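/- **Conventions.** Algorithms are programs for a probabilistic random access machine: it has finitely many natural-number variables and finitely many growable arrays of natural numbers with indirect addressing; its instructions are assignment of constants, addition, truncated subtraction, halving, array length, load, store, append, clear, fair coin flip, branching and loops; each instruction costs one plus the bit lengths of the numbers it handles (logarithmic cost). A running time is a bound that holds for every outcome of the coins. Let $\mathbb F_p$ be a finite field of order $p$ (a prime power). An element of $\mathbb F_p$ is represented by a number below $p$, via any fixed bijection, and a matrix by the list of its entries, row by row; an algorithm on $n\times n$ matrices is also given $n$. For $f,g:\mathbb N\to\mathbb N$ write $f=\tilde O(g)$ if there are constants $C,k$ with $f(n)\le C\,g(n)(\log n)^k$ for all sufficiently large $n$. A *trapdoored matrix family over $\mathbb F_p$ with two-sided multiplication* is a probabilistic algorithm (the sampler) that, given $n$, outputs in time $\tilde O(n^2)$ a triple $(R,C,C')$ such that: 1. (correctness and efficiency) for every possible output, $R\in\mathbb F_p^{n\times n}$, and $C$, $C'$ are arithmetic circuits over $\mathbb F_p$ of size $\tilde O(n)$ with $C(v)=Rv$ and $C'(v)=v^{t}R$ for every $v\in\mathbb F_p^n$; 2. (indistinguishability) for every probabilistic polynomial-time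 algorithm $\mathcal A$ with an advice string of polynomial length depending only on $n$, $$\Big|\Pr[\mathcal A(R)=1: R \text{ uniform in } \mathbb F_p^{n\times n}]-\Pr[\mathcal A(R)=1:(R,C,C')\text{ sampled}]\Big|$$ is smaller than $n^{-k}$ for every $k$ and all sufficiently large $n$. **Theorem.** Let $\mathbb F_p$ be a finite field of order $p$ and let $\varepsilon>0$. Assume that there is a trapdoored matrix family over $\mathbb F_p$ with two-sided multiplication. Let $\mathcal M$ be an algorithm, possibly randomized, that on every input $A\in\mathbb F_p^{n\times n}$ halts in time $T(n)$, such that for every sufficiently large $n$ $$\Pr_{A\sim GL_n(\mathbb F_p)}\big[\mathcal M(A)=A^{-1}\big]\ \ge\ \varepsilon ,$$ where $A$ is uniform in $GL_n(\mathbb F_p)$ and the probability is also over the coins of $\mathcal M$. Then for every $c\in\mathbb N$ there is a probabilistic algorithm that, on every input $A\in GL_n(\mathbb F_p)$, halts in time $\tilde O(T(n))$ and, for every sufficiently large $n$ and **every** $A\in GL_n(\mathbb F_p)$, outputs $A^{-1}$ with probability at least $1-n^{-c}$. -/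

import Mathlib

namespace TrapdooredMatrix

/-! ### Machine model: probabilistic random access machine with logarithmic cost

A program uses finitely many natural-number variables and finitely many growable arrays of natural
numbers, with indirect addressing into the arrays.  Every elementary instruction costs one plus the
bit lengths of the numbers (values, array indices, array lengths) that it handles. -/

/-- Programs.  Variables and arrays are named by natural numbers. -/
inductive Prog : Type
  /-- do nothing -/
  | skip : Prog
  /-- `x := c` -/
  | const (x c : ℕ) : Prog
  /-- `x := y + z` -/
  | plus (x y z : ℕ) : Prog
  /-- `x := max (y - z) 0` -/
  | minus (x y z : ℕ) : Prog
  /-- `x := ⌊y / 2⌋` -/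
  | half (x y : ℕ) : Prog
  /-- `x :=` length of the array `a` -/
  | len (x a : ℕ) : Prog
  /-- `x := a[y]`, which is `0` if `y` is out of range -/
  | load (x a y : ℕ) : Prog
  /-- `a[y] := z`, which does nothing if `y` is out of range -/
  | store (a y z : ℕ) : Prog
  /-- append the value of `y` at the end of the array `a` -/
  | push (a y : ℕ) : Prog
  /-- reset the array `a` to length `0` -/
  | clear (a : ℕ) : Prog
  /-- `x :=` a fair random bit, independent of all others -/
  | coin (x : ℕ) : Prog
  /-- sequential composition -/
  | seq (P Q : Prog) : Prog
  /-- run `P` if `x ≠ 0`, and `Q` otherwise -/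
  | ifNZ (x : ℕ) (P Q : Prog) : Prog
  /-- repeat `P` as long as `x ≠ 0` -/
  | whileNZ (x : ℕ) (P : Prog) : Prog

/-- A memory configuration, with the cost spent so far. -/
structure State : Type where
  var : ℕ → ℕ
  arr : ℕ → List ℕ
  time : ℕ

namespace State

/-- Charge `c` units of time. -/
def tick (s : State) (c : ℕ) : State := { s with time := s.time + c }

/-- Assign the value `v` to the variable `x`. -/
def setVar (s : State) (x v : ℕ) : State := { s with var := Function.update s.var x v }

/-- Replace the content of the array `a` by `l`. -/
def setArr (s : State) (a : ℕ) (l : List ℕ) : State :=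
  { s with arr := Function.update s.arr a l }

end State

/-- At most `k - 1` rounds of a loop guarded by `x ≠ 0`; `none` means that this did not suffice. -/
noncomputable def loopFor (x : ℕ) (body : State → PMF (Option State)) :
    ℕ → State → PMF (Option State)
  | 0, _ => PMF.pure none
  | k + 1, s =>
    if s.var x = 0 then PMF.pure (some (s.tick (1 + Nat.size (s.var x))))
    else (body (s.tick (1 + Nat.size (s.var x)))).bind
      fun o => o.elim (PMF.pure none) (loopFor x body k)

/-- The distribution of the final configuration of a program, where every loop is cut off after
`fuel` guard tests; `none` stands for a run that was cut off. -/
noncomputable def Prog.run (fuel : ℕ) : Prog → State → PMF (Option State)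
  | .skip, s => PMF.pure (some (s.tick 1))
  | .const x c, s => PMF.pure (some ((s.setVar x c).tick (1 + Nat.size c)))
  | .plus x y z, s =>
    PMF.pure (some ((s.setVar x (s.var y + s.var z)).tick
      (1 + Nat.size (s.var y) + Nat.size (s.var z))))
  | .minus x y z, s =>
    PMF.pure (some ((s.setVar x (s.var y - s.var z)).tick
      (1 + Nat.size (s.var y) + Nat.size (s.var z))))
  | .half x y, s => PMF.pure (some ((s.setVar x (s.var y / 2)).tick (1 + Nat.size (s.var y))))
  | .len x a, s =>
    PMF.pure (some ((s.setVar x (s.arr a).length).tick (1 + Nat.size (s.arr a).length)))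
  | .load x a y, s =>
    PMF.pure (some ((s.setVar x ((s.arr a).getD (s.var y) 0)).tick
      (1 + Nat.size (s.var y) + Nat.size ((s.arr a).getD (s.var y) 0))))
  | .store a y z, s =>
    PMF.pure (some ((s.setArr a ((s.arr a).set (s.var y) (s.var z))).tick
      (1 + Nat.size (s.var y) + Nat.size (s.var z))))
  | .push a y, s =>
    PMF.pure (some ((s.setArr a (s.arr a ++ [s.var y])).tick
      (1 + Nat.size (s.arr a).length + Nat.size (s.var y))))
  | .clear a, s => PMF.pure (some ((s.setArr a []).tick 1))
  | .coin x, s =>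
    (PMF.uniformOfFintype Bool).bind
      fun b => PMF.pure (some ((s.setVar x (if b then 1 else 0)).tick 1))
  | .seq P Q, s => (P.run fuel s).bind fun o => o.elim (PMF.pure none) (Q.run fuel)
  | .ifNZ x P Q, s =>
    if s.var x = 0 then Q.run fuel (s.tick (1 + Nat.size (s.var x)))
    else P.run fuel (s.tick (1 + Nat.size (s.var x)))
  | .whileNZ x P, s => loopFor x (P.run fuel) fuel s

/-- Started in `s`, the program halts for every outcome of its coins, and then the clock shows at
most `t`. -/
def HaltsWithin (P : Prog) (s : State) (t : ℕ) : Prop :=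
  ∃ fuel, ∀ o ∈ (P.run fuel s).support, ∃ s', o = some s' ∧ s'.time ≤ t

/-- The configuration `s'` is a possible final configuration of `P` started in `s`. -/
def Reaches (P : Prog) (s s' : State) : Prop := ∃ fuel, some s' ∈ (P.run fuel s).support

/-- The probability that `P`, started in `s`, halts in a configuration with the property `E`. -/
noncomputable def prob (P : Prog) (s : State) (E : State → Prop) : ℝ :=
  (⨆ fuel, (P.run fuel s).toOuterMeasure {o | ∃ s', o = some s' ∧ E s'}).toReal

/-- The initial configuration: variable `0` holds `n`, arrays `0` and `1` hold `l` and `l'`, every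
other variable is `0`, every other array is empty, and the clock shows `0`. -/
def input (n : ℕ) (l l' : List ℕ) : State where
  var := fun x => if x = 0 then n else 0
  arr := fun a => if a = 0 then l else if a = 1 then l' else []
  time := 0

/-- `f = Õ(g)`: up to a factor polylogarithmic in `n`, `f n` is at most `g n` for large `n`. -/
def SoftO (f g : ℕ → ℕ) : Prop :=
  ∃ C k : ℕ, ∀ᶠ n in Filter.atTop, f n ≤ C * g n * (Nat.log 2 n) ^ k

/-! ### Arithmetic circuits -/

/-- Gates of an arithmetic circuit; wires are numbered. -/
inductive Gate (F : Type*) : Type _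
  | const (a : F) : Gate F
  | plus (i j : ℕ) : Gate F
  | times (i j : ℕ) : Gate F

/-- All wires that the gate reads have a number below `b`. -/
def Gate.InRange {F : Type*} (b : ℕ) : Gate F → Prop
  | .const _ => True
  | .plus i j => i < b ∧ j < b
  | .times i j => i < b ∧ j < b

/-- The value of a gate, given the values on the earlier wires. -/
def Gate.eval {F : Type*} [Field F] (w : List F) : Gate F → F
  | .const a => a
  | .plus i j => w.getD i 0 + w.getD j 0
  | .times i j => w.getD i 0 * w.getD j 0

/-- An arithmetic circuit with `m` inputs and `k` outputs.  Wires `0, …, m - 1` are the inputs, and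
wire `m + i` is the output of the `i`-th gate, which reads earlier wires only. -/
structure Circuit (F : Type*) (m k : ℕ) where
  gates : List (Gate F)
  outputs : Fin k → Fin (m + gates.length)
  inRange : ∀ (i : ℕ) (h : i < gates.length), (gates[i]).InRange (m + i)

/-- The function that a circuit computes. -/
def Circuit.eval {F : Type*} [Field F] {m k : ℕ} (C : Circuit F m k) (v : Fin m → F) :
    Fin k → F :=
  fun i => (C.gates.foldl (fun w g => w ++ [g.eval w]) (List.ofFn v)).getD (C.outputs i) 0

/-- The number of gates. -/
def Circuit.size {F : Type*} {m k : ℕ} (C : Circuit F m k) : ℕ := C.gates.length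

/-! ### Encodings -/

section Encodings

variable {F : Type*} [Fintype F] (code : F ≃ Fin (Fintype.card F))

/-- A matrix as the list of the codes of its entries, row by row. -/
def encMatrix {n : ℕ} (A : Matrix (Fin n) (Fin n) F) : List ℕ :=
  (List.finRange n).flatMap fun i => (List.finRange n).map fun j => (code (A i j) : ℕ)

/-- A gate as three numbers. -/
def encGate : Gate F → List ℕ
  | .const a => [0, code a, 0]
  | .plus i j => [1, i, j]
  | .times i j => [2, i, j]

/-- A circuit as a list: the number of gates, then the gates, then the output wires. -/
def encCircuit {m k : ℕ} (C : Circuit F m k) : List ℕ :=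
  C.gates.length :: (C.gates.flatMap (encGate code) ++ List.ofFn fun i => (C.outputs i : ℕ))

end Encodings

/-! ### Trapdoored matrix families -/

section Families

variable {F : Type*} [Field F] [Fintype F] [DecidableEq F] (code : F ≃ Fin (Fintype.card F))

open BigOperators

/-- The probability that the distinguisher `D`, with advice `z`, outputs `1` on a uniformly random
`n × n` matrix. -/
noncomputable def acceptUniform (D : Prog) (z : List ℕ) (n : ℕ) : ℝ :=
  (∑ R : Matrix (Fin n) (Fin n) F,
    prob D (input n (encMatrix code R) z) fun s => s.var 0 = 1) /
      Fintype.card (Matrix (Fin n) (Fin n) F)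

/-- The probability that the distinguisher `D`, with advice `z`, outputs `1` on the matrix that the
sampler `S` produces (in its array `0`) for dimension `n`. -/
noncomputable def acceptSampled (S D : Prog) (z : List ℕ) (n : ℕ) : ℝ :=
  ∑ R : Matrix (Fin n) (Fin n) F,
    prob S (input n [] []) (fun s => s.arr 0 = encMatrix code R) *
      prob D (input n (encMatrix code R) z) fun s => s.var 0 = 1

/-- The matrices sampled by `S` are computationally indistinguishable from uniformly random ones:
every probabilistic polynomial-time algorithm with advice of polynomial length has negligible
advantage. -/
def Indistinguishable (S : Prog) : Prop :=
  ∀ (D : Prog) (z : ℕ → List ℕ),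
    (∃ d : ℕ, ∀ n, (z n).length ≤ n ^ d + d ∧
      ∀ R : Matrix (Fin n) (Fin n) F,
        HaltsWithin D (input n (encMatrix code R) (z n)) (n ^ d + d)) →
    ∀ k : ℕ, ∀ᶠ n : ℕ in Filter.atTop,
      |acceptUniform code D (z n) n - acceptSampled code S D (z n) n| ≤ 1 / (n : ℝ) ^ k

/-- `S` samples a trapdoored matrix family over `F` with two-sided multiplication: given `n`, it
outputs, in time `Õ(n²)`, a matrix `R` (array `0`), a circuit for `v ↦ R v` (array `1`) and a
circuit for `v ↦ vᵀ R` (array `2`), both of size `Õ(n)`, and `R` is indistinguishable from a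
uniformly random matrix. -/
structure IsTrapdooredFamily (S : Prog) : Prop where
  samplable : ∃ t : ℕ → ℕ, SoftO t (fun n => n ^ 2) ∧ ∀ n, HaltsWithin S (input n [] []) (t n)
  correct : ∃ b : ℕ → ℕ, SoftO b (fun n => n) ∧
    ∀ n s, Reaches S (input n [] []) s →
      ∃ (R : Matrix (Fin n) (Fin n) F) (C C' : Circuit F n n),
        s.arr 0 = encMatrix code R ∧ s.arr 1 = encCircuit code C ∧
        s.arr 2 = encCircuit code C' ∧
        (∀ v, C.eval v = R.mulVec v) ∧ (∀ v, C'.eval v = R.vecMul v) ∧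
        C.size ≤ b n ∧ C'.size ≤ b n
  indistinguishable : Indistinguishable code S

/-- The probability that the algorithm `P`, given `n` and the invertible matrix `A`, outputs (in
its array `1`) the inverse of `A`. -/
noncomputable def probInverts (P : Prog) {n : ℕ} (A : Matrix.GeneralLinearGroup (Fin n) F) : ℝ :=
  prob P (input n (encMatrix code (A : Matrix (Fin n) (Fin n) F)) []) fun s =>
    s.arr 1 = encMatrix code ((A⁻¹ : Matrix.GeneralLinearGroup (Fin n) F) :
      Matrix (Fin n) (Fin n) F)

end Families

end TrapdooredMatrix

open scoped ENNReal

set_option linter.unusedSectionVars false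
set_option linter.unusedSimpArgs false
set_option linter.unusedVariables false

namespace TrapdooredMatrix

/-! ### Expectation transformers -/

/-! The reduction randomizes the input. For a fixed invertible `A` and uniform `R`, the matrix `AᵀR`
is uniform, so an inverter that works on average also works on `AᵀR`. If `X` inverts `AᵀR`, then
`(RX)ᵀ` inverts `A`. With a truly random `R` both products would be too expensive. With `R` from the
trapdoored family they are cheap: the rows of `AᵀR` are the values of the circuit for `v ↦ vᵀR` on
the columns of `A`, and the rows of `(RX)ᵀ` are the values of the circuit for `v ↦ Rv` on the
columns of `X`. Each product is `n` evaluations of a circuit of size `Õ(n)`. A candidate `Z` is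
tested by comparing `A(Zr)` with `r` for random 0-1 vectors `r`; one test misses a wrong candidate
with probability at most 1/2 (`ex_freivStep`).

The success probability comes from indistinguishability. At least a quarter of all matrices are
invertible (`card_matrix_le`), so the inverter succeeds with probability at least `ε/4` on a uniform
matrix. A distinguisher that gets `R` and the advice `V = (Aᵀ)⁻¹` recovers `Aᵀ` from `V`, runs the
inverter on `AᵀR` and accepts if the result `X` satisfies `RX = V`. It accepts uniform `R` with
probability at least `ε/4`, hence sampled `R` with probability at least `ε/8` for large `n`. Taking
for each `n` the `A` with the smallest success probability as advice makes the bound hold for every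
`A` at once (`eventually_succProb`).

Nothing says that `T` is polynomial, but a distinguisher has to run in polynomial time. The inverter
is therefore run with a clock that starts at a polynomial `c₀` (`Prog.clk`), chosen to be at least
the cost of a deterministic polynomial-time inversion (`fallback`: powering with exponent one less
than the order of the general linear group). If the clock runs out, then `T ≥ c₀` (`ens_clk`), so
that inversion fits into the time budget and replaces the inverter. The clocked procedure takes
polynomial time whatever `T` is (`ens_clk_poly`), takes time `Õ(T)`, and succeeds at least as often
as the inverter (`ofReal_probInverts_le`).

Repetition finishes the proof: with `K * Nat.size n` attempts, and as many tests in each, the error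
is below `n⁻ᶜ` (`failBound_le`, `amplification`). The overhead of `Õ(n²)` is absorbed because an
inverter that ever succeeds has to write `n²` numbers (`eventually_sq_le`).

Programs are analysed with expectation transformers. `E P g s` is the expected value of `g` at the
end, where runs that are cut off count as `⊤`; `Ens` is the case of functions with values `0` and
`⊤`, and expresses total correctness. `Tr` and `Ex` are the versions with a time bound, for
assertions and for expected potentials. In `Ex` a potential has the value `⊤` wherever a required
assertion fails, so that one function carries both kinds of information. -/

/-- The effect of a deterministic elementary instruction. -/
def Prog.eff : Prog → State → State
  | .skip, s => s.tick 1
  | .const x c, s => (s.setVar x c).tick (1 + Nat.size c)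
  | .plus x y z, s =>
    (s.setVar x (s.var y + s.var z)).tick (1 + Nat.size (s.var y) + Nat.size (s.var z))
  | .minus x y z, s =>
    (s.setVar x (s.var y - s.var z)).tick (1 + Nat.size (s.var y) + Nat.size (s.var z))
  | .half x y, s => (s.setVar x (s.var y / 2)).tick (1 + Nat.size (s.var y))
  | .len x a, s => (s.setVar x (s.arr a).length).tick (1 + Nat.size (s.arr a).length)
  | .load x a y, s =>
    (s.setVar x ((s.arr a).getD (s.var y) 0)).tick
      (1 + Nat.size (s.var y) + Nat.size ((s.arr a).getD (s.var y) 0))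
  | .store a y z, s =>
    (s.setArr a ((s.arr a).set (s.var y) (s.var z))).tick
      (1 + Nat.size (s.var y) + Nat.size (s.var z))
  | .push a y, s =>
    (s.setArr a (s.arr a ++ [s.var y])).tick
      (1 + Nat.size (s.arr a).length + Nat.size (s.var y))
  | .clear a, s => (s.setArr a []).tick 1
  | _, s => s

/-- Deterministic elementary instructions. -/
def Prog.IsBasic : Prog → Prop
  | .coin _ | .seq _ _ | .ifNZ _ _ _ | .whileNZ _ _ => False
  | _ => True

/-- Ten of the fourteen constructors are deterministic elementary instructions and behave alike
through `eff`; grouping them leaves five cases for every induction below. -/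
theorem Prog.basicInduction {motive : Prog → Prop}
    (basic : ∀ P : Prog, P.IsBasic → motive P)
    (coin : ∀ x, motive (.coin x))
    (seq : ∀ P Q, motive P → motive Q → motive (.seq P Q))
    (ifNZ : ∀ x P Q, motive P → motive Q → motive (.ifNZ x P Q))
    (whileNZ : ∀ x P, motive P → motive (.whileNZ x P)) (P : Prog) : motive P := by
  induction P with
  | coin x => exact coin x
  | seq P Q hP hQ => exact seq P Q hP hQ
  | ifNZ x P Q hP hQ => exact ifNZ x P Q hP hQ
  | whileNZ x P hP => exact whileNZ x P hP
  | _ => exact basic _ trivial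

/-- The expectation transformer of a loop, from that of its body; running out of fuel counts
as `bot`. -/
noncomputable def wpLoop (x : ℕ) (bot : ℝ≥0∞) (body : (State → ℝ≥0∞) → State → ℝ≥0∞)
    (g : State → ℝ≥0∞) : ℕ → State → ℝ≥0∞
  | 0, _ => bot
  | k + 1, s =>
    if s.var x = 0 then g (s.tick (1 + Nat.size (s.var x)))
    else body (wpLoop x bot body g k) (s.tick (1 + Nat.size (s.var x)))

/-- The expected value of `g` in the final configuration, where running out of fuel counts as
`bot`. -/
noncomputable def Prog.wp (bot : ℝ≥0∞) (fuel : ℕ) : Prog → (State → ℝ≥0∞) → State → ℝ≥0∞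
  | .coin x, g, s => 2⁻¹ * g ((s.setVar x 1).tick 1) + 2⁻¹ * g ((s.setVar x 0).tick 1)
  | .seq P Q, g, s => P.wp bot fuel (Q.wp bot fuel g) s
  | .ifNZ x P Q, g, s =>
    if s.var x = 0 then Q.wp bot fuel g (s.tick (1 + Nat.size (s.var x)))
    else P.wp bot fuel g (s.tick (1 + Nat.size (s.var x)))
  | .whileNZ x P, g, s => wpLoop x bot (P.wp bot fuel) g fuel s
  | .skip, g, s => g (Prog.skip.eff s)
  | .const x c, g, s => g ((Prog.const x c).eff s)
  | .plus x y z, g, s => g ((Prog.plus x y z).eff s)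
  | .minus x y z, g, s => g ((Prog.minus x y z).eff s)
  | .half x y, g, s => g ((Prog.half x y).eff s)
  | .len x a, g, s => g ((Prog.len x a).eff s)
  | .load x a y, g, s => g ((Prog.load x a y).eff s)
  | .store a y z, g, s => g ((Prog.store a y z).eff s)
  | .push a y, g, s => g ((Prog.push a y).eff s)
  | .clear a, g, s => g ((Prog.clear a).eff s)

section wp

variable {bot : ℝ≥0∞} {fuel : ℕ} {g g' : State → ℝ≥0∞} {s : State}

theorem Prog.wp_basic {P : Prog} (h : P.IsBasic) : P.wp bot fuel g s = g (P.eff s) := by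
  cases P <;> first | rfl | exact h.elim

theorem Prog.run_basic {P : Prog} (h : P.IsBasic) :
    P.run fuel s = PMF.pure (some (P.eff s)) := by
  cases P <;> first | rfl | exact h.elim

theorem wp_seq (P Q : Prog) :
    (Prog.seq P Q).wp bot fuel g s = P.wp bot fuel (Q.wp bot fuel g) s := rfl

theorem wp_ifNZ (x : ℕ) (P Q : Prog) :
    (Prog.ifNZ x P Q).wp bot fuel g s =
      if s.var x = 0 then Q.wp bot fuel g (s.tick (1 + Nat.size (s.var x)))
      else P.wp bot fuel g (s.tick (1 + Nat.size (s.var x))) := rfl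

theorem wp_whileNZ (x : ℕ) (P : Prog) :
    (Prog.whileNZ x P).wp bot fuel g s = wpLoop x bot (P.wp bot fuel) g fuel s := rfl

theorem wp_coin (x : ℕ) : (Prog.coin x).wp bot fuel g s =
    2⁻¹ * g ((s.setVar x 1).tick 1) + 2⁻¹ * g ((s.setVar x 0).tick 1) := rfl

/-- The expectation of `f` under `μ`. -/
noncomputable def expect {α : Type*} (μ : PMF α) (f : α → ℝ≥0∞) : ℝ≥0∞ := ∑' a, μ a * f a

theorem expect_pure {α : Type*} (a : α) (f : α → ℝ≥0∞) : expect (PMF.pure a) f = f a := by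
  classical
  rw [expect, tsum_eq_single a]
  · simp
  · intro b hb; simp [PMF.pure_apply, hb]

theorem expect_bind {α β : Type*} (μ : PMF α) (ν : α → PMF β) (f : β → ℝ≥0∞) :
    expect (μ.bind ν) f = expect μ fun a => expect (ν a) f := by
  simp only [expect, PMF.bind_apply, ← ENNReal.tsum_mul_right, ← ENNReal.tsum_mul_left]
  rw [ENNReal.tsum_comm]
  simp only [mul_assoc]

theorem wpLoop_eq_expect {x : ℕ} {body : State → PMF (Option State)}
    {wbody : (State → ℝ≥0∞) → State → ℝ≥0∞}
    (h : ∀ g s, wbody g s = expect (body s) fun o => o.elim bot g) (g : State → ℝ≥0∞) (k : ℕ) :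
    ∀ s, wpLoop x bot wbody g k s = expect (loopFor x body k s) fun o => o.elim bot g := by
  induction k with
  | zero => intro s; simp [wpLoop, loopFor, expect_pure]
  | succ k ih =>
    intro s
    simp only [wpLoop, loopFor]
    split_ifs
    · simp [expect_pure]
    · rw [h, expect_bind]
      congr 1; funext o
      cases o with
      | none => simp [expect_pure]
      | some s' => simp [ih]

/-- This is the bridge from the distributions of `Prog.run` to backward reasoning. Linearity and
statements about supports are obtained through it. -/
theorem wp_eq_expect (P : Prog) : ∀ (g : State → ℝ≥0∞) (s : State),
    P.wp bot fuel g s = expect (P.run fuel s) fun o => o.elim bot g := by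
  induction P using Prog.basicInduction with
  | basic P hP => intro g s; rw [P.wp_basic hP, P.run_basic hP, expect_pure]; rfl
  | coin x =>
    intro g s
    simp only [Prog.run, expect_bind, expect_pure, wp_coin]
    simp [expect, tsum_fintype]
  | seq P Q hP hQ =>
    intro g s
    rw [wp_seq, hP, Prog.run, expect_bind]
    congr 1; funext o
    cases o with
    | none => simp [expect_pure]
    | some s' => simp [hQ]
  | ifNZ x P Q hP hQ =>
    intro g s
    rw [wp_ifNZ, Prog.run]
    split_ifs <;> simp [hP, hQ]
  | whileNZ x P hP => intro g s; exact wpLoop_eq_expect hP g fuel s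

/-- The relation `r` is preserved under composition and contains every elementary step that `P`
can make. -/
def Sound (r : State → State → Prop) : Prog → Prop
  | .seq P Q => Sound r P ∧ Sound r Q
  | .ifNZ _ P Q => Sound r P ∧ Sound r Q
  | .whileNZ _ P => Sound r P
  | .coin x => ∀ s b, b ≤ 1 → r s ((s.setVar x b).tick 1)
  | P => ∀ s, r s (P.eff s)

theorem Sound.basic {r : State → State → Prop} {P : Prog} (h : Sound r P) (hP : P.IsBasic) :
    ∀ s, r s (P.eff s) := by
  cases P <;> first | exact h | exact hP.elim

/-- Every final configuration is related to the initial one by a chain of elementary steps, so the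
comparison matters only there. The trivial relation gives monotonicity; other relations give frames,
growth of arrays and monotonicity of time. -/
theorem wp_le_of_sound {r : State → State → Prop} (htrans : ∀ s t u, r s t → r t u → r s u)
    (htick : ∀ s c, r s (s.tick c)) (P : Prog) (hP : Sound r P) :
    ∀ (g g' : State → ℝ≥0∞) (s : State), (∀ s', r s s' → g s' ≤ g' s') →
      P.wp bot fuel g s ≤ P.wp bot fuel g' s := by
  induction P using Prog.basicInduction with
  | basic P hb =>
    intro g g' s h
    rw [P.wp_basic hb, P.wp_basic hb]
    exact h _ (hP.basic hb s)
  | coin x =>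
    intro g g' s h
    rw [wp_coin, wp_coin]
    gcongr
    · exact h _ (hP s 1 le_rfl)
    · exact h _ (hP s 0 zero_le_one)
  | seq P Q ihP ihQ =>
    intro g g' s h
    exact ihP hP.1 _ _ s fun s' hs' => ihQ hP.2 _ _ s' fun s'' hs'' => h _ (htrans _ _ _ hs' hs'')
  | ifNZ x P Q ihP ihQ =>
    intro g g' s h
    rw [wp_ifNZ, wp_ifNZ]
    split_ifs
    · exact ihQ hP.2 _ _ _ fun s' hs' => h _ (htrans _ _ _ (htick _ _) hs')
    · exact ihP hP.1 _ _ _ fun s' hs' => h _ (htrans _ _ _ (htick _ _) hs')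
  | whileNZ x P ih =>
    intro g g' s h
    rw [wp_whileNZ, wp_whileNZ]
    -- The round budget `k` of the loop is separated from the fuel of its body, which stays fixed
    -- during this inner induction.
    suffices H : ∀ k s, (∀ s', r s s' → g s' ≤ g' s') →
        wpLoop x bot (P.wp bot fuel) g k s ≤ wpLoop x bot (P.wp bot fuel) g' k s from H _ _ h
    intro k
    induction k with
    | zero => intro s _; exact le_rfl
    | succ k ihk =>
      intro s h
      simp only [wpLoop]
      split_ifs
      · exact h _ (htick _ _)
      · exact ih hP _ _ _ fun s' hs' => ihk s' fun s'' hs'' =>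
          h _ (htrans _ _ _ (htrans _ _ _ (htick _ _) hs') hs'')

theorem sound_true (P : Prog) : Sound (fun _ _ => True) P := by
  induction P using Prog.basicInduction with
  | basic P h => cases P <;> first | exact fun _ => trivial | exact h.elim
  | coin x => exact fun _ _ _ => trivial
  | seq P Q hP hQ => exact ⟨hP, hQ⟩
  | ifNZ x P Q hP hQ => exact ⟨hP, hQ⟩
  | whileNZ x P hP => exact hP

theorem wp_mono (P : Prog) (h : ∀ s, g s ≤ g' s) :
    P.wp bot fuel g s ≤ P.wp bot fuel g' s :=
  wp_le_of_sound (r := fun _ _ => True) (fun _ _ _ _ _ => trivial) (fun _ _ => trivial) P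
    (sound_true P) g g' s fun s' _ => h s'

theorem wpLoop_antitone {x : ℕ} {P : Prog} {f f' : ℕ}
    (hP : ∀ g s, P.wp ⊤ f' g s ≤ P.wp ⊤ f g s) (g : State → ℝ≥0∞) :
    ∀ {k k' : ℕ}, k ≤ k' → ∀ s, wpLoop x ⊤ (P.wp ⊤ f') g k' s ≤ wpLoop x ⊤ (P.wp ⊤ f) g k s := by
  intro k
  induction k with
  | zero => intro k' _ s; exact le_top
  | succ k ih =>
    intro k' hk s
    obtain ⟨k', rfl⟩ : ∃ j, k' = j + 1 := ⟨k' - 1, by omega⟩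
    simp only [wpLoop]
    split_ifs
    · exact le_rfl
    · exact (hP _ _).trans (wp_mono P fun s => ih (by omega) s)

/-- More fuel only replaces the penalty `⊤` of a cut-off run by an actual value. With penalty `0`
the order is reversed, see `wp_zero_monotone`. -/
theorem wp_top_antitone (P : Prog) {f f' : ℕ} (hf : f ≤ f') :
    ∀ g s, P.wp ⊤ f' g s ≤ P.wp ⊤ f g s := by
  induction P using Prog.basicInduction with
  | basic P hP => intro g s; rw [P.wp_basic hP, P.wp_basic hP]
  | coin x => intro g s; rfl
  | seq P Q hP hQ => intro g s; exact (hP _ _).trans (wp_mono P fun s => hQ g s)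
  | ifNZ x P Q hP hQ =>
    intro g s
    rw [wp_ifNZ, wp_ifNZ]
    split_ifs
    · exact hQ _ _
    · exact hP _ _
  | whileNZ x P hP => intro g s; exact wpLoop_antitone hP g hf s

theorem wpLoop_monotone {x : ℕ} {P : Prog} {f f' : ℕ}
    (hP : ∀ g s, P.wp 0 f g s ≤ P.wp 0 f' g s) (g : State → ℝ≥0∞) :
    ∀ {k k' : ℕ}, k ≤ k' → ∀ s, wpLoop x 0 (P.wp 0 f) g k s ≤ wpLoop x 0 (P.wp 0 f') g k' s := by
  intro k
  induction k with
  | zero => intro k' _ s; exact zero_le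
  | succ k ih =>
    intro k' hk s
    obtain ⟨k', rfl⟩ : ∃ j, k' = j + 1 := ⟨k' - 1, by omega⟩
    simp only [wpLoop]
    split_ifs
    · exact le_rfl
    · exact (hP _ _).trans (wp_mono P fun s => ih (by omega) s)

theorem wp_zero_monotone (P : Prog) {f f' : ℕ} (hf : f ≤ f') :
    ∀ g s, P.wp 0 f g s ≤ P.wp 0 f' g s := by
  induction P using Prog.basicInduction with
  | basic P hP => intro g s; rw [P.wp_basic hP, P.wp_basic hP]
  | coin x => intro g s; rfl
  | seq P Q hP hQ => intro g s; exact (hP _ _).trans (wp_mono P fun s => hQ g s)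
  | ifNZ x P Q hP hQ =>
    intro g s
    rw [wp_ifNZ, wp_ifNZ]
    split_ifs
    · exact hQ _ _
    · exact hP _ _
  | whileNZ x P hP => intro g s; exact wpLoop_monotone hP g hf s

theorem wpLoop_mono {x : ℕ} {P : Prog} (h : ∀ s, g s ≤ g' s) (k : ℕ) :
    ∀ s, wpLoop x bot (P.wp bot fuel) g k s ≤ wpLoop x bot (P.wp bot fuel) g' k s := by
  induction k with
  | zero => intro s; exact le_rfl
  | succ k ih =>
    intro s
    simp only [wpLoop]
    split_ifs
    · exact h _
    · exact wp_mono P ih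

theorem wpLoop_iInf {x : ℕ} {P : Prog} {f : ℕ}
    (hP : ∀ g : ℕ → State → ℝ≥0∞, Antitone g → ∀ s,
      P.wp ⊤ f (fun s => ⨅ i, g i s) s = ⨅ i, P.wp ⊤ f (g i) s)
    (g : ℕ → State → ℝ≥0∞) (hg : Antitone g) (k : ℕ) :
    ∀ s, wpLoop x ⊤ (P.wp ⊤ f) (fun s => ⨅ i, g i s) k s
      = ⨅ i, wpLoop x ⊤ (P.wp ⊤ f) (g i) k s := by
  induction k with
  | zero => intro s; simp [wpLoop]
  | succ k ih =>
    intro s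
    simp only [wpLoop]
    split_ifs
    · rfl
    · rw [← hP (fun i => wpLoop x ⊤ (P.wp ⊤ f) (g i) k)]
      · congr 1; funext s'; exact ih s'
      · intro i j hij s
        exact wpLoop_mono (hg hij) k s

/-- For fixed fuel a program is a finite tree of coin flips, and finite sums commute with infima of
antitone sequences. This is the continuity needed to merge the fuel of two composed programs. -/
theorem wp_iInf (P : Prog) {f : ℕ} : ∀ g : ℕ → State → ℝ≥0∞, Antitone g → ∀ s,
    P.wp ⊤ f (fun s => ⨅ i, g i s) s = ⨅ i, P.wp ⊤ f (g i) s := by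
  induction P using Prog.basicInduction with
  | basic P hP => intro g hg s; simp only [P.wp_basic hP]
  | coin x =>
    intro g hg s
    simp only [wp_coin]
    rw [ENNReal.mul_iInf_of_ne (by simp) (by simp), ENNReal.mul_iInf_of_ne (by simp) (by simp),
      ENNReal.iInf_add_iInf]
    intro i j
    -- The two branches may approach their infima at different indices; by antitonicity the larger
    -- index serves both.
    refine ⟨max i j, ?_⟩
    gcongr
    · exact hg (le_max_left i j) _
    · exact hg (le_max_right i j) _
  | seq P Q hP hQ =>
    intro g hg s
    simp only [wp_seq]
    rw [← hP]
    · congr 1; funext s'; exact hQ g hg s'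
    · intro i j hij s; exact wp_mono Q (hg hij)
  | ifNZ x P Q hP hQ =>
    intro g hg s
    simp only [wp_ifNZ]
    split_ifs
    · exact hQ g hg _
    · exact hP g hg _
  | whileNZ x P hP =>
    intro g hg s
    simp only [wp_whileNZ]
    exact wpLoop_iInf hP g hg f s

end wp

/-- The expected value of `g` in the final configuration of `P`, where not halting counts
as `⊤`. -/
noncomputable def E (P : Prog) (g : State → ℝ≥0∞) (s : State) : ℝ≥0∞ := ⨅ f, P.wp ⊤ f g s

section E

variable {g g' : State → ℝ≥0∞} {s : State}

theorem E_le_wp (P : Prog) (f : ℕ) : E P g s ≤ P.wp ⊤ f g s := iInf_le _ f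

theorem E_mono (P : Prog) (h : ∀ s, g s ≤ g' s) : E P g s ≤ E P g' s :=
  iInf_mono fun _ => wp_mono P h

theorem E_le_of_sound {r : State → State → Prop} (htrans : ∀ s t u, r s t → r t u → r s u)
    (htick : ∀ s c, r s (s.tick c)) {P : Prog} (hP : Sound r P)
    (h : ∀ s', r s s' → g s' ≤ g' s') : E P g s ≤ E P g' s :=
  iInf_mono fun _ => wp_le_of_sound htrans htick P hP g g' s h

theorem E_basic {P : Prog} (h : P.IsBasic) : E P g s = g (P.eff s) := by
  simp [E, P.wp_basic h]

theorem E_coin (x : ℕ) : E (.coin x) g s =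
    2⁻¹ * g ((s.setVar x 1).tick 1) + 2⁻¹ * g ((s.setVar x 0).tick 1) := by
  simp [E, wp_coin]

theorem E_ifNZ (x : ℕ) (P Q : Prog) : E (.ifNZ x P Q) g s =
    if s.var x = 0 then E Q g (s.tick (1 + Nat.size (s.var x)))
    else E P g (s.tick (1 + Nat.size (s.var x))) := by
  simp only [E, wp_ifNZ]
  split_ifs <;> rfl

/-- The two programs may need different amounts of fuel. Continuity pulls the infimum for `Q` out of
`P`, and the maximum of both amounts suffices for the composition. -/
theorem E_seq (P Q : Prog) : E (.seq P Q) g s = E P (E Q g) s := by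
  apply le_antisymm
  · refine le_iInf fun f => ?_
    have : (fun s => ⨅ f, Q.wp ⊤ f g s) = E Q g := rfl
    rw [← this, wp_iInf P _ fun i j hij s => wp_top_antitone Q hij g s]
    refine le_iInf fun f' => ?_
    exact (E_le_wp _ (max f f')).trans ((wp_top_antitone P (le_max_left f f') _ _).trans
      (wp_mono P fun s => wp_top_antitone Q (le_max_right f f') g s))
  · refine le_iInf fun f => (E_le_wp P f).trans (wp_mono P fun s => E_le_wp Q f)

/-- Unrolling one round consumes one unit of fuel, and the infimum over all fuel is insensitive to
this shift. -/
theorem E_whileNZ (x : ℕ) (P : Prog) : E (.whileNZ x P) g s =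
    if s.var x = 0 then g (s.tick (1 + Nat.size (s.var x)))
    else E P (E (.whileNZ x P) g) (s.tick (1 + Nat.size (s.var x))) := by
  have key : ∀ f, (Prog.whileNZ x P).wp ⊤ (f + 1) g s =
      if s.var x = 0 then g (s.tick (1 + Nat.size (s.var x)))
      else P.wp ⊤ (f + 1) (wpLoop x ⊤ (P.wp ⊤ (f + 1)) g f) (s.tick (1 + Nat.size (s.var x))) :=
    fun f => rfl
  split_ifs with hx
  · simp only [if_pos hx] at key
    refine le_antisymm ((E_le_wp _ 1).trans_eq (key 0)) (le_iInf fun f => ?_)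
    exact (key f).ge.trans (wp_top_antitone _ (Nat.le_succ f) _ _)
  · simp only [hx, if_false] at key
    apply le_antisymm
    · refine le_iInf fun f => ?_
      have : (fun s => ⨅ f, (Prog.whileNZ x P).wp ⊤ f g s) = E (.whileNZ x P) g := rfl
      rw [← this, wp_iInf P _ fun i j hij s => wp_top_antitone _ hij g s]
      refine le_iInf fun k => ?_
      refine (E_le_wp _ (max f k + 1)).trans ((key _).le.trans ?_)
      refine (wp_top_antitone P (by omega : f ≤ max f k + 1) _ _).trans (wp_mono P fun s => ?_)
      exact wpLoop_antitone (fun g s => wp_top_antitone P (by omega) g s) g (le_max_right f k) s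
    · refine le_iInf fun f => ?_
      refine le_trans ?_ (wp_top_antitone _ (Nat.le_succ f) _ _)
      rw [Nat.succ_eq_add_one, key]
      refine (E_le_wp P (f + 1)).trans (wp_mono P fun s => (E_le_wp _ (f + 1)).trans ?_)
      exact wpLoop_antitone (fun g s => le_rfl) g (Nat.le_succ f) s

theorem E_add (P : Prog) (g g' : State → ℝ≥0∞) (s : State) :
    E P (fun s => g s + g' s) s = E P g s + E P g' s := by
  have h : ∀ f, P.wp ⊤ f (fun s => g s + g' s) s = P.wp ⊤ f g s + P.wp ⊤ f g' s := by
    intro f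
    simp only [wp_eq_expect, expect, ← ENNReal.tsum_add, ← mul_add]
    congr 1; funext o
    cases o <;> simp
  simp only [E, h]
  rw [ENNReal.iInf_add_iInf]
  intro i j
  refine ⟨max i j, ?_⟩
  gcongr
  · exact wp_top_antitone P (le_max_left i j) _ _
  · exact wp_top_antitone P (le_max_right i j) _ _

/-- The factor must not vanish because `0 * ⊤ = 0` would erase the penalty for cut-off runs; it must
be finite so that it commutes with the infimum over the fuel. -/
theorem E_mul_le (P : Prog) {a : ℝ≥0∞} (ha : a ≠ ⊤) (ha0 : a ≠ 0) (g : State → ℝ≥0∞) (s : State) :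
    E P (fun s => a * g s) s = a * E P g s := by
  have h : ∀ f, P.wp ⊤ f (fun s => a * g s) s = a * P.wp ⊤ f g s := by
    intro f
    simp only [wp_eq_expect, expect, ← ENNReal.tsum_mul_left]
    congr 1; funext o
    cases o with
    | none => simp only [Option.elim_none]; rw [mul_left_comm, ENNReal.mul_top ha0]
    | some s => simp only [Option.elim_some]; rw [mul_left_comm]
  simp only [E, h]
  rw [ENNReal.mul_iInf_of_ne ha0 ha]

end E

/-! ### Total correctness -/

open Classical in
/-- `0` where `Q` holds and `⊤` elsewhere. -/
noncomputable def topUnless (Q : State → Prop) (s : State) : ℝ≥0∞ := if Q s then 0 else ⊤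

/-- Started in `s`, the program `P` halts for every outcome of its coins, in a configuration with
the property `Q`. -/
def Ens (P : Prog) (Q : State → Prop) (s : State) : Prop := E P (topUnless Q) s = 0

section Ens

variable {P R : Prog} {Q Q' : State → Prop} {g : State → ℝ≥0∞} {s : State}

theorem topUnless_of {s : State} (h : Q s) : topUnless Q s = 0 := if_pos h

theorem topUnless_of_not {s : State} (h : ¬ Q s) : topUnless Q s = ⊤ := if_neg h

theorem topUnless_eq_zero {s : State} : topUnless Q s = 0 ↔ Q s := by
  by_cases h : Q s <;> simp [topUnless, h]

theorem topUnless_anti (h : ∀ s, Q s → Q' s) (s : State) : topUnless Q' s ≤ topUnless Q s := by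
  by_cases hq : Q s
  · simp [topUnless, h s hq]
  · simp [topUnless_of_not hq]

theorem topUnless_le_of {s s' : State} (h : Q s → Q' s') : topUnless Q' s' ≤ topUnless Q s := by
  by_cases hq : Q s
  · simp [topUnless, h hq]
  · simp [topUnless_of_not hq]

theorem Ens.mono (h : Ens P Q s) (hQ : ∀ s, Q s → Q' s) : Ens P Q' s :=
  le_antisymm ((E_mono P (topUnless_anti hQ)).trans h.le) zero_le

theorem Ens.mono_sound {r : State → State → Prop} (h : Ens P Q s)
    (htrans : ∀ s t u, r s t → r t u → r s u) (htick : ∀ s c, r s (s.tick c)) (hP : Sound r P)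
    (hQ : ∀ s', r s s' → Q s' → Q' s') : Ens P Q' s := by
  refine le_antisymm (le_trans ?_ h.le) zero_le
  refine E_le_of_sound htrans htick hP fun s' hs' => ?_
  by_cases hq : Q s'
  · simp [topUnless, hQ s' hs' hq]
  · simp [topUnless_of_not hq]

/-- Adding `topUnless Q` to `g'` makes the comparison hold everywhere, and the added term has
expectation zero by assumption. -/
theorem Ens.E_le_E {g' : State → ℝ≥0∞} (h : Ens P Q s) (hg : ∀ s, Q s → g s ≤ g' s) :
    E P g s ≤ E P g' s := by
  calc E P g s ≤ E P (fun s => g' s + topUnless Q s) s := by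
        refine E_mono P fun s => ?_
        by_cases hq : Q s
        · simpa [topUnless_of hq] using hg s hq
        · simp [topUnless_of_not hq]
    _ = E P g' s := by rw [E_add, h, add_zero]

/-- Total correctness yields one amount of fuel at which no run is cut off. From there on the
outcome is an honest probability distribution on configurations, under which constants average to
themselves. -/
theorem Ens.E_const (h : Ens P Q s) (r : ℝ≥0∞) : E P (fun _ => r) s = r := by
  have h0 : ∃ f, P.wp ⊤ f (topUnless Q) s ≠ ⊤ := by
    by_contra! hc
    have : E P (topUnless Q) s = ⊤ := by simp [E, hc]
    rw [h] at this; exact ENNReal.zero_ne_top this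
  obtain ⟨f, hf⟩ := h0
  have hnone : P.run f s none = 0 := by
    by_contra hne
    apply hf
    rw [wp_eq_expect, expect]
    exact ENNReal.tsum_eq_top_of_eq_top ⟨none, by simp [ENNReal.mul_top hne]⟩
  have hall : ∀ f', f ≤ f' → P.run f' s none = 0 := by
    intro f' hf'
    by_contra hne
    have h1 : P.wp ⊤ f' (topUnless Q) s = ⊤ := by
      rw [wp_eq_expect, expect]
      exact ENNReal.tsum_eq_top_of_eq_top ⟨none, by simp [ENNReal.mul_top hne]⟩
    have := wp_top_antitone P hf' (topUnless Q) s
    rw [h1, top_le_iff] at this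
    exact hf this
  have hval : ∀ f', f ≤ f' → P.wp ⊤ f' (fun _ => r) s = r := by
    intro f' hf'
    rw [wp_eq_expect, expect]
    have : ∀ o, P.run f' s o * (o.elim ⊤ fun _ => r) = P.run f' s o * r := by
      intro o
      cases o with
      | none => simp [hall f' hf']
      | some s => rfl
    simp only [this, ENNReal.tsum_mul_right, PMF.tsum_coe, one_mul]
  apply le_antisymm
  · exact (E_le_wp P f).trans (hval f le_rfl).le
  · refine le_iInf fun f' => ?_
    exact (hval _ (le_max_left f f')).ge.trans (wp_top_antitone P (le_max_right f f') _ _)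

theorem Ens.E_le (h : Ens P Q s) {r : ℝ≥0∞} (hg : ∀ s, Q s → g s ≤ r) : E P g s ≤ r :=
  (h.E_le_E hg).trans_eq (h.E_const r)

theorem Ens_basic (h : P.IsBasic) : Ens P Q s ↔ Q (P.eff s) := by
  rw [Ens, E_basic h, topUnless_eq_zero]

/-- The point is that `E R (topUnless Q)` again takes only the values `0` and `⊤`: doubling does not
change `topUnless Q`, hence does not change its expectation either. -/
theorem Ens_seq : Ens (.seq P R) Q s ↔ Ens P (Ens R Q) s := by
  have h01 : ∀ s, E R (topUnless Q) s = topUnless (Ens R Q) s := by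
    intro s
    by_cases h : Ens R Q s
    · rw [topUnless_of h]; exact h
    · rw [topUnless_of_not h]
      have hmul : E R (fun s => 2 * topUnless Q s) s = 2 * E R (topUnless Q) s :=
        E_mul_le R (by simp) (by simp) _ _
      have : (fun s => 2 * topUnless Q s) = topUnless Q := by
        funext s
        by_cases hq : Q s
        · simp [topUnless_of hq]
        · simp [topUnless_of_not hq]
      rw [this] at hmul
      -- A finite value that equals its own double is zero.
      by_contra hne
      apply h
      have h2 : E R (topUnless Q) s + E R (topUnless Q) s = E R (topUnless Q) s := by
        rw [← two_mul]; exact hmul.symm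
      have := ENNReal.add_right_inj hne (b := E R (topUnless Q) s) (c := 0)
      rw [add_zero] at this
      exact this.1 h2
  rw [Ens, E_seq, Ens]
  rw [show E R (topUnless Q) = topUnless (Ens R Q) from funext h01]

theorem Ens_ifNZ {x : ℕ} : Ens (.ifNZ x P R) Q s ↔
    if s.var x = 0 then Ens R Q (s.tick (1 + Nat.size (s.var x)))
    else Ens P Q (s.tick (1 + Nat.size (s.var x))) := by
  rw [Ens, E_ifNZ]
  split_ifs <;> rfl

theorem Ens_whileNZ {x : ℕ} : Ens (.whileNZ x P) Q s ↔
    if s.var x = 0 then Q (s.tick (1 + Nat.size (s.var x)))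
    else Ens P (Ens (.whileNZ x P) Q) (s.tick (1 + Nat.size (s.var x))) := by
  by_cases hx : s.var x = 0
  · rw [if_pos hx, Ens, E_whileNZ, if_pos hx, topUnless_eq_zero]
  · rw [if_neg hx, ← Ens_seq, Ens, E_whileNZ, if_neg hx, ← E_seq, Ens]

theorem Ens_coin {x : ℕ} : Ens (.coin x) Q s ↔
    Q ((s.setVar x 1).tick 1) ∧ Q ((s.setVar x 0).tick 1) := by
  rw [Ens, E_coin]
  simp [topUnless_eq_zero]

end Ens

/-! ### Halting, probabilities and reachable configurations -/

open Classical in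
/-- `1` where `Q` holds and `0` elsewhere. -/
noncomputable def ind (Q : State → Prop) (s : State) : ℝ≥0∞ := if Q s then 1 else 0

/-- Reachability is kept in the conclusion because the correctness of the sampler is stated for
reachable configurations. -/
theorem ens_of_haltsWithin {P : Prog} {s : State} {t : ℕ} (h : HaltsWithin P s t) :
    Ens P (fun s' => s'.time ≤ t ∧ Reaches P s s') s := by
  obtain ⟨f, hf⟩ := h
  refine le_antisymm ((E_le_wp P f).trans_eq ?_) zero_le
  rw [wp_eq_expect, expect, ENNReal.tsum_eq_zero]
  intro o
  by_cases ho : o ∈ (P.run f s).support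
  · obtain ⟨s', rfl, ht⟩ := hf o ho
    have : topUnless (fun s' => s'.time ≤ t ∧ Reaches P s s') s' = 0 :=
      topUnless_of ⟨ht, f, ho⟩
    simp [this]
  · rw [(PMF.apply_eq_zero_iff _ _).2 ho, zero_mul]

theorem haltsWithin_of_ens {P : Prog} {s : State} {t : ℕ} (h : Ens P (fun s' => s'.time ≤ t) s) :
    HaltsWithin P s t := by
  have h0 : ∃ f, P.wp ⊤ f (topUnless fun s' => s'.time ≤ t) s < ⊤ := by
    by_contra! hc
    have : E P (topUnless fun s' => s'.time ≤ t) s = ⊤ := by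
      simp only [top_le_iff] at hc
      simp [E, hc]
    rw [h] at this; exact ENNReal.zero_ne_top this
  obtain ⟨f, hf⟩ := h0
  refine ⟨f, fun o ho => ?_⟩
  rw [wp_eq_expect, expect] at hf
  have hne : P.run f s o ≠ 0 := (PMF.mem_support_iff _ _).1 ho
  have hterm := ENNReal.ne_top_of_tsum_ne_top hf.ne o
  cases o with
  | none => exact absurd (by simp [ENNReal.mul_top hne]) hterm
  | some s' =>
    refine ⟨s', rfl, ?_⟩
    by_contra hc
    apply hterm
    rw [Option.elim_some, topUnless_of_not hc, ENNReal.mul_top hne]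

/-- `prob` is a supremum in which unfinished runs count `0`, and `E` is an infimum in which they
count `⊤`. Once the fuel suffices for every run, the two sequences agree. -/
theorem prob_eq_E {P : Prog} {s : State} {Q : State → Prop} (h : Ens P Q s) (A : State → Prop) :
    prob P s A = (E P (ind A) s).toReal := by
  classical
  have hpf : ∀ f, (P.run f s).toOuterMeasure {o | ∃ s', o = some s' ∧ A s'} =
      P.wp 0 f (ind A) s := by
    intro f
    rw [wp_eq_expect, expect, PMF.toOuterMeasure_apply]
    congr 1; funext o
    cases o with
    | none => simp
    | some s' => by_cases hA : A s' <;> simp [ind, hA]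
  simp only [prob, hpf]
  congr 1
  have h0 : ∃ f, P.wp ⊤ f (topUnless Q) s ≠ ⊤ := by
    by_contra! hc
    have : E P (topUnless Q) s = ⊤ := by simp [E, hc]
    rw [h] at this; exact ENNReal.zero_ne_top this
  obtain ⟨f, hf⟩ := h0
  have hnone : ∀ f', f ≤ f' → P.run f' s none = 0 := by
    intro f' hf'
    by_contra hne
    have h1 : P.wp ⊤ f' (topUnless Q) s = ⊤ := by
      rw [wp_eq_expect, expect]
      exact ENNReal.tsum_eq_top_of_eq_top ⟨none, by simp [ENNReal.mul_top hne]⟩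
    have := wp_top_antitone P hf' (topUnless Q) s
    rw [h1, top_le_iff] at this
    exact hf this
  have heq : ∀ f', f ≤ f' → P.wp 0 f' (ind A) s = P.wp ⊤ f' (ind A) s := by
    intro f' hf'
    rw [wp_eq_expect, wp_eq_expect, expect, expect]
    congr 1; funext o
    cases o with
    | none => simp [hnone f' hf']
    | some s => rfl
  apply le_antisymm
  · refine iSup_le fun i => le_iInf fun j => ?_
    calc P.wp 0 i (ind A) s ≤ P.wp 0 (max f (max i j)) (ind A) s :=
          wp_zero_monotone P (by omega) _ _
      _ = P.wp ⊤ (max f (max i j)) (ind A) s := heq _ (by omega)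
      _ ≤ P.wp ⊤ j (ind A) s := wp_top_antitone P (by omega) _ _
  · exact (E_le_wp P f).trans ((heq f le_rfl).ge.trans (le_iSup (fun f => P.wp 0 f (ind A) s) f))

theorem ind_add_ind_not (A : State → Prop) (s : State) : ind A s + ind (fun s => ¬ A s) s = 1 := by
  by_cases h : A s <;> simp [ind, h]

theorem Ens.E_ind_add {P : Prog} {s : State} {Q : State → Prop} (h : Ens P Q s)
    (A : State → Prop) : E P (ind A) s + E P (ind fun s => ¬ A s) s = 1 := by
  rw [← E_add]
  simp only [ind_add_ind_not]
  exact h.E_const 1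

theorem Ens.E_ind_le_one {P : Prog} {s : State} {Q : State → Prop} (h : Ens P Q s)
    (A : State → Prop) : E P (ind A) s ≤ 1 := by
  rw [← h.E_ind_add A]; exact le_self_add

attribute [irreducible] Ens E

/-! ### Names, frames and renaming -/

/-- Every variable and array that occurs in the program has a name below `N`. -/
def NamesBelow (N : ℕ) : Prog → Prop
  | .skip => True
  | .const x _ => x < N
  | .plus x y z => x < N ∧ y < N ∧ z < N
  | .minus x y z => x < N ∧ y < N ∧ z < N
  | .half x y => x < N ∧ y < N
  | .len x a => x < N ∧ a < N
  | .load x a y => x < N ∧ a < N ∧ y < N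
  | .store a y z => a < N ∧ y < N ∧ z < N
  | .push a y => a < N ∧ y < N
  | .clear a => a < N
  | .coin x => x < N
  | .seq P Q => NamesBelow N P ∧ NamesBelow N Q
  | .ifNZ x P Q => x < N ∧ NamesBelow N P ∧ NamesBelow N Q
  | .whileNZ x P => x < N ∧ NamesBelow N P

theorem NamesBelow.mono {N N' : ℕ} (h : N ≤ N') {P : Prog} (hP : NamesBelow N P) :
    NamesBelow N' P := by
  induction P with
  | seq P Q ihP ihQ => exact ⟨ihP hP.1, ihQ hP.2⟩
  | ifNZ x P Q ihP ihQ => exact ⟨hP.1.trans_le h, ihP hP.2.1, ihQ hP.2.2⟩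
  | whileNZ x P ih => exact ⟨hP.1.trans_le h, ih hP.2⟩
  | skip => trivial
  | _ => simp only [NamesBelow] at hP ⊢; omega

theorem exists_namesBelow (P : Prog) : ∃ N, NamesBelow N P := by
  induction P with
  | seq P Q hP hQ =>
    obtain ⟨N, hN⟩ := hP
    obtain ⟨N', hN'⟩ := hQ
    exact ⟨max N N', hN.mono (le_max_left _ _), hN'.mono (le_max_right _ _)⟩
  | ifNZ x P Q hP hQ =>
    obtain ⟨N, hN⟩ := hP
    obtain ⟨N', hN'⟩ := hQ
    exact ⟨max (x + 1) (max N N'), by omega, hN.mono (by omega), hN'.mono (by omega)⟩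
  | whileNZ x P hP =>
    obtain ⟨N, hN⟩ := hP
    exact ⟨max (x + 1) N, by omega, hN.mono (by omega)⟩
  | skip => exact ⟨0, trivial⟩
  | const x c => exact ⟨x + 1, by simp [NamesBelow]⟩
  | plus x y z => exact ⟨x + y + z + 1, by simp only [NamesBelow]; omega⟩
  | minus x y z => exact ⟨x + y + z + 1, by simp only [NamesBelow]; omega⟩
  | half x y => exact ⟨x + y + 1, by simp only [NamesBelow]; omega⟩
  | len x a => exact ⟨x + a + 1, by simp only [NamesBelow]; omega⟩
  | load x a y => exact ⟨x + a + y + 1, by simp only [NamesBelow]; omega⟩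
  | store a y z => exact ⟨a + y + z + 1, by simp only [NamesBelow]; omega⟩
  | push a y => exact ⟨a + y + 1, by simp only [NamesBelow]; omega⟩
  | clear a => exact ⟨a + 1, by simp [NamesBelow]⟩
  | coin x => exact ⟨x + 1, by simp [NamesBelow]⟩

/-- The program changes only variables in `vs` and arrays in `as`. -/
def WritesIn (vs as : Set ℕ) : Prog → Prop
  | .skip => True
  | .const x _ => x ∈ vs
  | .plus x _ _ => x ∈ vs
  | .minus x _ _ => x ∈ vs
  | .half x _ => x ∈ vs
  | .len x _ => x ∈ vs
  | .load x _ _ => x ∈ vs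
  | .store a _ _ => a ∈ as
  | .push a _ => a ∈ as
  | .clear a => a ∈ as
  | .coin x => x ∈ vs
  | .seq P Q => WritesIn vs as P ∧ WritesIn vs as Q
  | .ifNZ _ P Q => WritesIn vs as P ∧ WritesIn vs as Q
  | .whileNZ _ P => WritesIn vs as P

theorem WritesIn.mono {vs vs' as as' : Set ℕ} (hv : vs ⊆ vs') (ha : as ⊆ as') {P : Prog}
    (h : WritesIn vs as P) : WritesIn vs' as' P := by
  induction P with
  | seq P Q ihP ihQ => exact ⟨ihP h.1, ihQ h.2⟩
  | ifNZ x P Q ihP ihQ => exact ⟨ihP h.1, ihQ h.2⟩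
  | whileNZ x P ih => exact ih h
  | _ => first | trivial | exact hv h | exact ha h

theorem NamesBelow.writesIn {N : ℕ} {P : Prog} (h : NamesBelow N P) :
    WritesIn (Set.Iio N) (Set.Iio N) P := by
  induction P with
  | seq P Q ihP ihQ => exact ⟨ihP h.1, ihQ h.2⟩
  | ifNZ x P Q ihP ihQ => exact ⟨ihP h.2.1, ihQ h.2.2⟩
  | whileNZ x P ih => exact ih h.2
  | _ => first | trivial | exact h | exact h.1

/-- The memory `(v', a')` agrees with `(v, a)` outside the variables `vs` and the arrays `as`. -/
def Fr (vs as : Set ℕ) (v : ℕ → ℕ) (a : ℕ → List ℕ) (v' : ℕ → ℕ) (a' : ℕ → List ℕ) : Prop :=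
  (∀ x, x ∉ vs → v' x = v x) ∧ ∀ r, r ∉ as → a' r = a r

theorem Fr.refl {vs as : Set ℕ} (v : ℕ → ℕ) (a : ℕ → List ℕ) : Fr vs as v a v a :=
  ⟨fun _ _ => rfl, fun _ _ => rfl⟩

theorem Fr.trans {vs as : Set ℕ} {v v' v'' : ℕ → ℕ} {a a' a'' : ℕ → List ℕ}
    (h : Fr vs as v a v' a') (h' : Fr vs as v' a' v'' a'') : Fr vs as v a v'' a'' :=
  ⟨fun x hx => (h'.1 x hx).trans (h.1 x hx), fun x hx => (h'.2 x hx).trans (h.2 x hx)⟩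

theorem sound_frame {vs as : Set ℕ} {P : Prog} (h : WritesIn vs as P) :
    Sound (fun s s' => Fr vs as s.var s.arr s'.var s'.arr) P := by
  induction P with
  | seq P Q ihP ihQ => exact ⟨ihP h.1, ihQ h.2⟩
  | ifNZ x P Q ihP ihQ => exact ⟨ihP h.1, ihQ h.2⟩
  | whileNZ x P ih => exact ih h
  | coin x =>
    exact fun s b _ => ⟨fun y hy => Function.update_of_ne (by rintro rfl; exact hy h) _ _,
      fun _ _ => rfl⟩
  | skip => exact fun s => Fr.refl _ _
  | store b y z =>
    exact fun s => ⟨fun _ _ => rfl,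
      fun y hy => Function.update_of_ne (by rintro rfl; exact hy h) _ _⟩
  | push b y =>
    exact fun s => ⟨fun _ _ => rfl,
      fun y hy => Function.update_of_ne (by rintro rfl; exact hy h) _ _⟩
  | clear b =>
    exact fun s => ⟨fun _ _ => rfl,
      fun y hy => Function.update_of_ne (by rintro rfl; exact hy h) _ _⟩
  | _ =>
    exact fun s => ⟨fun y hy => Function.update_of_ne (by rintro rfl; exact hy h) _ _,
      fun _ _ => rfl⟩

theorem Ens.frame {vs as : Set ℕ} {P : Prog} {Q : State → Prop} {s : State}
    (hP : WritesIn vs as P) (h : Ens P Q s) :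
    Ens P (fun s' => Q s' ∧ Fr vs as s.var s.arr s'.var s'.arr) s :=
  h.mono_sound (fun _ _ _ h h' => h.trans h') (fun _ _ => Fr.refl _ _) (sound_frame hP)
    fun _ hr hq => ⟨hq, hr⟩

/-- Rename the variables and arrays of a program. -/
def Prog.rename (ρ : ℕ → ℕ) : Prog → Prog
  | .skip => .skip
  | .const x c => .const (ρ x) c
  | .plus x y z => .plus (ρ x) (ρ y) (ρ z)
  | .minus x y z => .minus (ρ x) (ρ y) (ρ z)
  | .half x y => .half (ρ x) (ρ y)
  | .len x a => .len (ρ x) (ρ a)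
  | .load x a y => .load (ρ x) (ρ a) (ρ y)
  | .store a y z => .store (ρ a) (ρ y) (ρ z)
  | .push a y => .push (ρ a) (ρ y)
  | .clear a => .clear (ρ a)
  | .coin x => .coin (ρ x)
  | .seq P Q => .seq (P.rename ρ) (Q.rename ρ)
  | .ifNZ x P Q => .ifNZ (ρ x) (P.rename ρ) (Q.rename ρ)
  | .whileNZ x P => .whileNZ (ρ x) (P.rename ρ)

/-- The configuration `s` with the memory of `u` put at the names in the range of `ρ`. -/
noncomputable def embed (ρ : ℕ → ℕ) (s u : State) : State where
  var := Function.extend ρ u.var s.var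
  arr := Function.extend ρ u.arr s.arr
  time := s.time + u.time

theorem extend_update {α β : Type*} [DecidableEq α] {f : α → α} (hf : Function.Injective f)
    (g e : α → β) (x : α) (c : β) :
    Function.extend f (Function.update g x c) e = Function.update (Function.extend f g e) (f x) c := by
  funext y
  by_cases hy : ∃ z, f z = y
  · obtain ⟨z, rfl⟩ := hy
    rw [hf.extend_apply]
    by_cases hz : z = x
    · subst hz; simp
    · rw [Function.update_of_ne hz, Function.update_of_ne (fun h => hz (hf h)), hf.extend_apply]
  · rw [Function.extend_apply' _ _ _ hy, Function.update_of_ne, Function.extend_apply' _ _ _ hy]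
    rintro rfl; exact hy ⟨x, rfl⟩

section rename

variable {ρ : ℕ → ℕ}

theorem embed_var (hρ : Function.Injective ρ) (s u : State) (x : ℕ) : (embed ρ s u).var (ρ x) = u.var x :=
  hρ.extend_apply _ _ _

theorem embed_arr (hρ : Function.Injective ρ) (s u : State) (x : ℕ) : (embed ρ s u).arr (ρ x) = u.arr x :=
  hρ.extend_apply _ _ _

theorem embed_setVar (hρ : Function.Injective ρ) (s u : State) (x c : ℕ) :
    embed ρ s (u.setVar x c) = (embed ρ s u).setVar (ρ x) c := by
  simp only [embed, State.setVar, extend_update hρ]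

theorem embed_setArr (hρ : Function.Injective ρ) (s u : State) (x : ℕ) (l : List ℕ) :
    embed ρ s (u.setArr x l) = (embed ρ s u).setArr (ρ x) l := by
  simp only [embed, State.setArr, extend_update hρ]

theorem embed_tick (s u : State) (c : ℕ) : embed ρ s (u.tick c) = (embed ρ s u).tick c := by
  simp only [embed, State.tick, add_assoc]

theorem rename_isBasic {P : Prog} (h : P.IsBasic) : (P.rename ρ).IsBasic := by
  cases P <;> trivial

theorem eff_rename (hρ : Function.Injective ρ) {P : Prog} (h : P.IsBasic) (s u : State) :
    (P.rename ρ).eff (embed ρ s u) = embed ρ s (P.eff u) := by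
  cases P <;> first
    | exact h.elim
    | simp only [Prog.rename, Prog.eff, embed_tick, embed_setVar hρ, embed_setArr hρ, embed_var hρ,
        embed_arr hρ]

/-- Every step commutes with `embed`. This allows the sampler and the inverter to run unchanged
inside a larger memory, each among names of its own. -/
theorem wp_rename (hρ : Function.Injective ρ) {bot : ℝ≥0∞} {fuel : ℕ} (s : State) (P : Prog) :
    ∀ (g : State → ℝ≥0∞) (u : State), (P.rename ρ).wp bot fuel g (embed ρ s u) =
      P.wp bot fuel (fun u => g (embed ρ s u)) u := by
  induction P using Prog.basicInduction with
  | basic P hP =>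
    intro g u
    rw [Prog.wp_basic (rename_isBasic hP), P.wp_basic hP, eff_rename hρ hP]
  | coin x =>
    intro g u
    simp only [Prog.rename, wp_coin, embed_tick, embed_setVar hρ]
  | seq P Q hP hQ =>
    intro g u
    simp only [Prog.rename, wp_seq, hP, hQ]
  | ifNZ x P Q hP hQ =>
    intro g u
    simp only [Prog.rename, wp_ifNZ, embed_var hρ, ← embed_tick, hP, hQ]
  | whileNZ x P hP =>
    intro g u
    simp only [Prog.rename, wp_whileNZ]
    suffices H : ∀ k u, wpLoop (ρ x) bot ((P.rename ρ).wp bot fuel) g k (embed ρ s u) =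
        wpLoop x bot (P.wp bot fuel) (fun u => g (embed ρ s u)) k u from H _ _
    intro k
    induction k with
    | zero => intro u; rfl
    | succ k ih =>
      intro u
      simp only [wpLoop, embed_var hρ, ← embed_tick, hP]
      simp only [ih]

theorem E_rename (hρ : Function.Injective ρ) (s : State) (P : Prog) (g : State → ℝ≥0∞) (u : State) :
    E (P.rename ρ) g (embed ρ s u) = E P (fun u => g (embed ρ s u)) u := by
  simp only [E, wp_rename hρ]

end rename

/-! ### Time bounds the growth of arrays -/

/-- The total number of cells and bits in a list of numbers. -/
def weight (l : List ℕ) : ℕ := (l.map fun v => 1 + Nat.size v).sum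

theorem weight_append (l l' : List ℕ) : weight (l ++ l') = weight l + weight l' := by
  simp [weight]

theorem length_le_weight (l : List ℕ) : l.length ≤ weight l := by
  induction l with
  | nil => simp [weight]
  | cons v l ih => simp only [weight, List.map_cons, List.sum_cons, List.length_cons] at ih ⊢; omega

theorem weight_set_le (l : List ℕ) (i v : ℕ) : weight (l.set i v) ≤ weight l + Nat.size v := by
  induction l generalizing i with
  | nil => simp [weight]
  | cons w l ih =>
    cases i with
    | zero => simp only [List.set_cons_zero, weight, List.map_cons, List.sum_cons]; omega
    | succ i =>
      have := ih i
      simp only [List.set_cons_succ, weight, List.map_cons, List.sum_cons] at this ⊢; omega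

/-- Writing a number costs at least the weight that it adds to an array. Hence running time bounds
output size. This is used twice: to bound the cost of copying an arbitrary output, and to show that
inversion takes time at least `n²`. -/
theorem sound_weight (r : ℕ) (P : Prog) :
    Sound (fun s s' => weight (s'.arr r) + s.time ≤ weight (s.arr r) + s'.time) P := by
  have key : ∀ (s : State) (b : ℕ) (l : List ℕ) (c : ℕ), weight l ≤ weight (s.arr b) + c →
      weight (((s.setArr b l).tick c).arr r) + s.time ≤
        weight (s.arr r) + ((s.setArr b l).tick c).time := by
    intro s b l c h
    simp only [State.setArr, State.tick]
    by_cases hb : r = b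
    · subst hb; rw [Function.update_self]; omega
    · rw [Function.update_of_ne hb]; omega
  induction P with
  | seq P Q ihP ihQ => exact ⟨ihP, ihQ⟩
  | ifNZ x P Q ihP ihQ => exact ⟨ihP, ihQ⟩
  | whileNZ x P ih => exact ih
  | store b y z =>
    intro s
    refine key s b _ _ ((weight_set_le _ _ _).trans ?_)
    omega
  | push b y =>
    intro s
    refine key s b _ _ ?_
    rw [weight_append]
    simp only [weight, List.map_cons, List.map_nil, List.sum_cons, List.sum_nil]
    omega
  | clear b => exact fun s => key s b _ _ (by simp [weight])
  | coin x => intro _ _ _; simp only [State.setVar, State.tick]; omega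
  | _ => intro s; simp only [Prog.eff, State.setVar, State.tick]; omega

theorem Ens.weight {P : Prog} {Q : State → Prop} {s : State} (h : Ens P Q s) :
    Ens P (fun s' => Q s' ∧ ∀ r, TrapdooredMatrix.weight (s'.arr r) + s.time ≤
      TrapdooredMatrix.weight (s.arr r) + s'.time) s := by
  have hs : Sound (fun s s' => ∀ r, TrapdooredMatrix.weight (s'.arr r) + s.time ≤
      TrapdooredMatrix.weight (s.arr r) + s'.time) P := by
    have h := fun r => sound_weight r P
    clear * - h
    induction P with
    | seq P Q ihP ihQ => exact ⟨ihP fun r => (h r).1, ihQ fun r => (h r).2⟩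
    | ifNZ x P Q ihP ihQ => exact ⟨ihP fun r => (h r).1, ihQ fun r => (h r).2⟩
    | whileNZ x P ih => exact ih h
    | coin x => exact fun s b hb r => h r s b hb
    | _ => exact fun s r => h r s
  refine h.mono_sound (fun s t u h h' r => ?_) (fun s c r => ?_) hs fun _ hr hq => ⟨hq, hr⟩
  · have := h r; have := h' r; omega
  · simp only [State.tick]; omega

/-! ### Time-bounded triples -/

/-- Started in the memory `(v, a)`, the program halts for every outcome of its coins within time
`c`, in a memory with the property `Q`. -/
def Tr (P : Prog) (c : ℕ) (v : ℕ → ℕ) (a : ℕ → List ℕ)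
    (Q : (ℕ → ℕ) → (ℕ → List ℕ) → Prop) : Prop :=
  ∀ τ, Ens P (fun s => s.time ≤ τ + c ∧ Q s.var s.arr) ⟨v, a, τ⟩

infixr:60 " ;; " => Prog.seq

/-- Run `body` as often as the variable `k` says, counting `k` down; variable `1` is overwritten. -/
def Prog.forN (k : ℕ) (body : Prog) : Prog :=
  .whileNZ k (body ;; .const 1 1 ;; .minus k k 1)

section Tr

variable {P R : Prog} {c c' c₁ c₂ : ℕ} {v : ℕ → ℕ} {a : ℕ → List ℕ}
  {Q Q' Q₁ : (ℕ → ℕ) → (ℕ → List ℕ) → Prop}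

theorem Tr.mono (h : Tr P c v a Q) (hc : c ≤ c') (hQ : ∀ v a, Q v a → Q' v a) :
    Tr P c' v a Q' := fun τ => (h τ).mono fun s hs => ⟨by omega, hQ _ _ hs.2⟩

theorem Tr.seq (h : Tr P c₁ v a Q₁) (h' : ∀ v' a', Q₁ v' a' → Tr R c₂ v' a' Q) :
    Tr (P ;; R) (c₁ + c₂) v a Q := by
  intro τ
  rw [Ens_seq]
  refine (h τ).mono fun s hs => ?_
  refine (h' _ _ hs.2 s.time).mono fun s' hs' => ⟨by omega, hs'.2⟩

theorem Tr.step {Q : State → Prop} {t : ℕ} (h : Tr P c v a Q₁)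
    (h' : ∀ v' a' t', t' ≤ t + c → Q₁ v' a' → Q ⟨v', a', t'⟩) : Ens P Q ⟨v, a, t⟩ :=
  (h t).mono fun _ hs => h' _ _ _ hs.1 hs.2

theorem Tr.seqStep {Q : State → Prop} {t : ℕ} (h : Tr P c v a Q₁)
    (h' : ∀ v' a' t', t' ≤ t + c → Q₁ v' a' → Ens R Q ⟨v', a', t'⟩) :
    Ens (P ;; R) Q ⟨v, a, t⟩ :=
  Ens_seq.2 (h.step h')

theorem Tr.frame {vs as : Set ℕ} (h : Tr P c v a Q) (hP : WritesIn vs as P) :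
    Tr P c v a fun v' a' => Q v' a' ∧ Fr vs as v a v' a' :=
  fun τ => ((h τ).frame hP).mono fun s hs => ⟨hs.1.1, hs.1.2, hs.2⟩

theorem Tr.const {x k : ℕ} (h : Q (Function.update v x k) a) :
    Tr (.const x k) (1 + Nat.size k) v a Q := by
  intro τ
  rw [Ens_basic (by trivial)]
  exact ⟨le_rfl, h⟩

/-- The summand `2 * l + 5` pays for testing and decrementing the counter in one round; the last `1`
pays for the final test at counter zero. The body has to establish the next invariant for the memory
after the counter and variable `1` have been overwritten. -/
theorem Tr.forN {k N l : ℕ} {c : ℕ → ℕ} {I : ℕ → (ℕ → ℕ) → (ℕ → List ℕ) → Prop}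
    (hl : Nat.size N ≤ l) (hk : v k = N) (h0 : I 0 v a)
    (hb : ∀ j < N, ∀ v a, v k = N - j → I j v a → Tr P (c j) v a fun v' a' => v' k = N - j ∧
      I (j + 1) (Function.update (Function.update v' 1 1) k (N - (j + 1))) a')
    (hk1 : k ≠ 1) :
    Tr (.forN k P) (∑ j ∈ Finset.range N, c j + N * (2 * l + 5) + 1) v a
      fun v' a' => v' k = 0 ∧ I N v' a' := by
  suffices H : ∀ m j, j + m = N → ∀ v a, v k = N - j → I j v a →
      Tr (.forN k P) (∑ i ∈ Finset.range m, c (j + i) + m * (2 * l + 5) + 1) v a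
        fun v' a' => v' k = 0 ∧ I N v' a' by
    have := H N 0 (by omega) v a (by omega) h0
    simpa using this
  intro m
  induction m with
  | zero =>
    intro j hj v a hv hI τ
    have hj : j = N := by omega
    subst hj
    rw [Prog.forN, Ens_whileNZ]
    simp only [hv, Nat.sub_self, if_true, State.tick, Nat.size_zero]
    exact ⟨by omega, trivial, hI⟩
  | succ m ih =>
    intro j hj v a hv hI τ
    rw [Prog.forN, Ens_whileNZ]
    have hne : v k ≠ 0 := by omega
    simp only [hne, if_false, State.tick]
    have hsz : Nat.size (v k) ≤ l := (Nat.size_le_size (by omega)).trans hl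
    have hstep : Tr (P ;; .const 1 1 ;; .minus k k 1) (c j + (l + 4)) v a fun v' a' =>
        v' k = N - (j + 1) ∧ I (j + 1) v' a' := by
      refine (hb j (by omega) v a hv hI).seq fun v' a' h => ?_
      intro τ
      rw [Ens_seq, Ens_basic (by trivial), Ens_basic (by trivial)]
      simp only [Prog.eff, State.setVar, State.tick, Function.update_self,
        Function.update_of_ne hk1, h.1]
      have h2 : Nat.size (N - j) ≤ l := (Nat.size_le_size (by omega)).trans hl
      refine ⟨by have := Nat.size_one; omega, by omega, ?_⟩
      have : N - j - 1 = N - (j + 1) := by omega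
      rw [this]; exact h.2
    refine (hstep (τ + (1 + Nat.size (v k)))).mono fun s hs => ?_
    refine (ih (j + 1) (by omega) s.var s.arr hs.2.1 hs.2.2 s.time).mono fun s' hs' => ⟨?_, hs'.2⟩
    have e1 := hs.1
    have e2 := hs'.1
    have e3 : (m + 1) * (2 * l + 5) = m * (2 * l + 5) + (2 * l + 5) := by ring
    rw [Finset.sum_range_succ', add_zero]
    have e4 : ∀ i, j + 1 + i = j + (i + 1) := fun i => by omega
    simp only [e4] at e2
    omega

/-- The loop rule with a frame for the body. -/
theorem Tr.forN_frame_sum {k N l : ℕ} {c : ℕ → ℕ} {vs as : Set ℕ}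
    {I : ℕ → (ℕ → ℕ) → (ℕ → List ℕ) → Prop}
    (hP : WritesIn vs as P) (h1 : 1 ∈ vs) (hkv : k ∈ vs) (hk1 : k ≠ 1) (hl : Nat.size N ≤ l)
    (hk : v k = N) (h0 : I 0 v a)
    (hb : ∀ j < N, ∀ v' a', Fr vs as v a v' a' → v' k = N - j → I j v' a' →
      Tr P (c j) v' a' fun v'' a'' => v'' k = N - j ∧
      I (j + 1) (Function.update (Function.update v'' 1 1) k (N - (j + 1))) a'') :
    Tr (.forN k P) (∑ j ∈ Finset.range N, c j + N * (2 * l + 5) + 1) v a fun v' a' =>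
      v' k = 0 ∧ I N v' a' ∧ Fr vs as v a v' a' := by
  refine (Tr.forN (I := fun j v' a' => I j v' a' ∧ Fr vs as v a v' a') hl hk ⟨h0, Fr.refl _ _⟩ ?_
    hk1)
  intro j hj v' a' hv' ⟨hI, hF⟩
  refine ((hb j hj v' a' hF hv' hI).frame hP).mono le_rfl fun v'' a'' h => ⟨h.1.1, h.1.2, ?_⟩
  refine hF.trans (h.2.trans ⟨fun x hx => ?_, fun _ _ => rfl⟩)
  rw [Function.update_of_ne (by rintro rfl; exact hx hkv),
    Function.update_of_ne (by rintro rfl; exact hx h1)]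

theorem Tr.forN_frame {k N l : ℕ} {vs as : Set ℕ} {I : ℕ → (ℕ → ℕ) → (ℕ → List ℕ) → Prop}
    (hP : WritesIn vs as P) (h1 : 1 ∈ vs) (hkv : k ∈ vs) (hk1 : k ≠ 1) (hl : Nat.size N ≤ l)
    (hk : v k = N) (h0 : I 0 v a)
    (hb : ∀ j < N, ∀ v' a', Fr vs as v a v' a' → v' k = N - j → I j v' a' →
      Tr P c v' a' fun v'' a'' => v'' k = N - j ∧
      I (j + 1) (Function.update (Function.update v'' 1 1) k (N - (j + 1))) a'') :
    Tr (.forN k P) (N * (c + 2 * l + 5) + 1) v a fun v' a' =>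
      v' k = 0 ∧ I N v' a' ∧ Fr vs as v a v' a' := by
  refine (Tr.forN_frame_sum (c := fun _ => c) hP h1 hkv hk1 hl hk h0 hb).mono (le_of_eq ?_)
    fun _ _ h => h
  rw [Finset.sum_const, Finset.card_range, smul_eq_mul]
  ring

theorem WritesIn.forN {vs as : Set ℕ} {k : ℕ} (h1 : 1 ∈ vs) (hk : k ∈ vs)
    (hP : WritesIn vs as P) : WritesIn vs as (.forN k P) := ⟨hP, h1, hk⟩

end Tr

/-! ### Programs with a clock -/

/-- Set variable `N + 1` to `1` if the variables `x` and `N` are nonzero, and to `0` otherwise. -/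
def clkGuard (N x : ℕ) : Prog :=
  .ifNZ N (.ifNZ x (.const (N + 1) 1) (.const (N + 1) 0)) (.const (N + 1) 0)

/-- Run a program with names below `N` as long as the clock, variable `N`, is nonzero.  The clock
is decremented in every round of every loop. -/
def Prog.clk (N : ℕ) : Prog → Prog
  | .seq P Q => P.clk N ;; Q.clk N
  | .ifNZ x P Q => .ifNZ N (.ifNZ x (P.clk N) (Q.clk N)) .skip
  | .whileNZ x P => clkGuard N x ;;
      .whileNZ (N + 1) (P.clk N ;; .const (N + 2) 1 ;; .minus N N (N + 2) ;; clkGuard N x)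
  | P => .ifNZ N P .skip

theorem Prog.clk_basic {N : ℕ} {P : Prog} (h : P.IsBasic) : P.clk N = .ifNZ N P .skip := by
  cases P <;> first | rfl | exact h.elim

/-- The configuration `s'` of a clocked program corresponds to the configuration `s` of the
program itself. -/
structure ClkRel (N K τ c₀ δ e : ℕ) (s s' : State) : Prop where
  agree : s'.var N ≠ 0 → ∀ x < N, s'.var x = s.var x ∧ s'.arr x = s.arr x
  time_le : s'.time + δ ≤ τ + K * s.time
  le_clock : c₀ + e ≤ s'.var N + s.time
  clock_le : s'.var N ≤ c₀

theorem eff_agree {N : ℕ} {P : Prog} (hb : P.IsBasic) (hN : NamesBelow N P) {s s' : State}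
    (h : ∀ x < N, s'.var x = s.var x ∧ s'.arr x = s.arr x) :
    (∀ x < N, (P.eff s').var x = (P.eff s).var x ∧ (P.eff s').arr x = (P.eff s).arr x) ∧
      (P.eff s').var N = s'.var N ∧
      ∃ d, 1 ≤ d ∧ (P.eff s').time = s'.time + d ∧ (P.eff s).time = s.time + d := by
  have hv : ∀ x < N, s'.var x = s.var x := fun x hx => (h x hx).1
  have ha : ∀ x < N, s'.arr x = s.arr x := fun x hx => (h x hx).2
  have upd : ∀ (x c : ℕ), ∀ y < N,
      Function.update s'.var x c y = Function.update s.var x c y := fun x c y hy => by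
    by_cases hxy : y = x
    · subst hxy; simp
    · simp [Function.update_of_ne hxy, hv y hy]
  have upda : ∀ (x : ℕ) (c : List ℕ), ∀ y < N,
      Function.update s'.arr x c y = Function.update s.arr x c y := fun x c y hy => by
    by_cases hxy : y = x
    · subst hxy; simp
    · simp [Function.update_of_ne hxy, ha y hy]
  have updN : ∀ (x c : ℕ), x < N → Function.update s'.var x c N = s'.var N := fun x c hx =>
    Function.update_of_ne hx.ne' _ _
  cases P with
  | skip => exact ⟨h, rfl, 1, le_rfl, rfl, rfl⟩
  | const x c => exact ⟨fun y hy => ⟨upd _ _ y hy, ha y hy⟩, updN _ _ hN, _, by omega, rfl, rfl⟩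
  | plus x y z =>
    simp only [Prog.eff, State.tick, State.setVar, hv y hN.2.1, hv z hN.2.2]
    exact ⟨fun y hy => ⟨upd _ _ y hy, ha y hy⟩, updN _ _ hN.1, _, by omega, rfl, rfl⟩
  | minus x y z =>
    simp only [Prog.eff, State.tick, State.setVar, hv y hN.2.1, hv z hN.2.2]
    exact ⟨fun y hy => ⟨upd _ _ y hy, ha y hy⟩, updN _ _ hN.1, _, by omega, rfl, rfl⟩
  | half x y =>
    simp only [Prog.eff, State.tick, State.setVar, hv y hN.2]
    exact ⟨fun y hy => ⟨upd _ _ y hy, ha y hy⟩, updN _ _ hN.1, _, by omega, rfl, rfl⟩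
  | len x b =>
    simp only [Prog.eff, State.tick, State.setVar, ha b hN.2]
    exact ⟨fun y hy => ⟨upd _ _ y hy, ha y hy⟩, updN _ _ hN.1, _, by omega, rfl, rfl⟩
  | load x b y =>
    simp only [Prog.eff, State.tick, State.setVar, ha b hN.2.1, hv y hN.2.2]
    exact ⟨fun y hy => ⟨upd _ _ y hy, ha y hy⟩, updN _ _ hN.1, _, by omega, rfl, rfl⟩
  | store b y z =>
    simp only [Prog.eff, State.tick, State.setArr, ha b hN.1, hv y hN.2.1, hv z hN.2.2]
    exact ⟨fun y hy => ⟨hv y hy, upda _ _ y hy⟩, trivial, _, by omega, rfl, rfl⟩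
  | push b y =>
    simp only [Prog.eff, State.tick, State.setArr, ha b hN.1, hv y hN.2]
    exact ⟨fun y hy => ⟨hv y hy, upda _ _ y hy⟩, trivial, _, by omega, rfl, rfl⟩
  | clear b =>
    exact ⟨fun y hy => ⟨hv y hy, upda _ _ y hy⟩, rfl, 1, le_rfl, rfl, rfl⟩
  | _ => exact hb.elim

theorem sound_time (P : Prog) : Sound (fun s s' => s.time ≤ s'.time) P := by
  induction P with
  | seq P Q ihP ihQ => exact ⟨ihP, ihQ⟩
  | ifNZ x P Q ihP ihQ => exact ⟨ihP, ihQ⟩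
  | whileNZ x P ih => exact ih
  | coin x => exact fun s _ _ => Nat.le_add_right _ _
  | _ => exact fun s => Nat.le_add_right _ _

/-- Time never decreases, so a bound that holds at all later times survives any run, and cut-off
runs count as `⊤`. This is applied when the clocked program has stopped and the original one
continues alone. -/
theorem le_wp_of_time {P : Prog} {f : ℕ} {g : State → ℝ≥0∞} {s : State} {r : ℝ≥0∞}
    (h : ∀ s', s.time ≤ s'.time → r ≤ g s') : r ≤ P.wp ⊤ f g s := by
  refine le_trans ?_ (wp_le_of_sound (r := fun s s' => s.time ≤ s'.time)
    (fun _ _ _ h h' => h.trans h') (fun s c => Nat.le_add_right _ _) P (sound_time P)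
    (fun _ => r) g s h)
  rw [wp_eq_expect, expect]
  calc r = ∑' o, P.run f s o * r := by rw [ENNReal.tsum_mul_right, PMF.tsum_coe, one_mul]
    _ ≤ _ := ENNReal.tsum_le_tsum fun o => by
      cases o with
      | none => exact mul_le_mul_right le_top _
      | some _ => exact le_rfl

theorem le_wpLoop_of_time {x : ℕ} {P : Prog} {f : ℕ} {g : State → ℝ≥0∞} {r : ℝ≥0∞} (k : ℕ) :
    ∀ s : State, (∀ s', s.time + 1 ≤ s'.time → r ≤ g s') →
      r ≤ wpLoop x ⊤ (P.wp ⊤ f) g k s := by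
  induction k with
  | zero => intro s _; exact le_top
  | succ k ih =>
    intro s h
    simp only [wpLoop]
    split_ifs
    · exact h _ (by simp only [State.tick]; omega)
    · refine le_wp_of_time fun s' hs' => ih s' fun s'' hs'' => h s'' ?_
      simp only [State.tick] at hs'; omega

section clk

variable {N K τ c₀ δ e : ℕ}

theorem ClkRel.size_clock {s s' : State} (h : ClkRel N K τ c₀ δ e s s') :
    Nat.size (s'.var N) ≤ Nat.size c₀ := Nat.size_le_size h.clock_le

/-- With the clock at zero the clocked program only skips. One unit of time in the original pays for
`K` units here, agreement of the memories is no longer demanded, and the bound on the clock only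
becomes weaker as the original continues. -/
theorem ClkRel.of_zero {s s' u u' : State} (h : ClkRel N K τ c₀ δ e s s') (h0 : s'.var N = 0)
    (hu : u'.var N = 0) {d : ℕ} (ht : u'.time ≤ s'.time + d) (hd : d ≤ K) (h1 : s.time + 1 ≤ u.time) :
    ClkRel N K τ c₀ δ e u u' := by
  have h2 : K * (s.time + 1) ≤ K * u.time := Nat.mul_le_mul_left _ h1
  have h3 := h.time_le
  have h4 := h.le_clock
  rw [mul_add, mul_one] at h2
  exact ⟨fun hne => absurd hu hne, by omega, by omega, by omega⟩

theorem E_clkGuard {x : ℕ} (g : State → ℝ≥0∞) (s : State) :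
    ∃ (b d : ℕ), (b = if s.var N ≠ 0 ∧ s.var x ≠ 0 then 1 else 0) ∧
      d ≤ (if s.var N ≠ 0 then 4 + Nat.size (s.var N) + Nat.size (s.var x) else 2) ∧
      E (clkGuard N x) g s = g ((s.setVar (N + 1) b).tick d) := by
  rw [clkGuard, E_ifNZ]
  by_cases hN : s.var N = 0
  · rw [if_pos hN, E_basic (by trivial)]
    exact ⟨0, 2, by simp [hN], by simp [hN], by
      simp [Prog.eff, State.tick, State.setVar, hN, Nat.size_zero, add_assoc]⟩
  · rw [if_neg hN, E_ifNZ]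
    by_cases hx : s.var x = 0
    · simp only [State.tick, hx, if_true]
      rw [E_basic (by trivial)]
      exact ⟨0, 1 + Nat.size (s.var N) + (1 + 0) + (1 + 0), by simp [hx], by
        rw [if_pos hN]; omega, by
        simp only [Prog.eff, State.tick, State.setVar, Nat.size_zero, add_assoc]⟩
    · simp only [State.tick, hx, if_false]
      rw [E_basic (by trivial)]
      refine ⟨1, 1 + Nat.size (s.var N) + (1 + Nat.size (s.var x)) + (1 + 1), by simp [hx, hN], by
        rw [if_pos hN]; omega, by
        simp only [Prog.eff, State.tick, State.setVar, Nat.size_one, add_assoc]⟩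

/-- The two runs are coupled through identical coins, and the coupling is expressed as an inequality
between expectations. The parameters `δ` and `e` are reserves: `δ` units of time and `e` units of
clock are set aside on entering a loop body, to be spent on the decrement after it. Since each round
of the original costs at least one unit of time, the clock cannot fall faster than the original time
grows. -/
theorem E_clk_le_wp (hK : 2 * Nat.size c₀ + 10 ≤ K) {f : ℕ} {P : Prog} (hP : NamesBelow N P) :
    ∀ {δ e : ℕ} {g g' : State → ℝ≥0∞},
      (∀ s s', ClkRel N K τ c₀ δ e s s' → g' s' ≤ g s) →
      ∀ {s s' : State}, ClkRel N K τ c₀ δ e s s' → E (P.clk N) g' s' ≤ P.wp ⊤ f g s := by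
  induction P using Prog.basicInduction with
  | basic P hb =>
    intro δ e g g' hg s s' h
    rw [Prog.clk_basic hb, P.wp_basic hb, E_ifNZ, E_basic hb, E_basic (by trivial)]
    apply le_trans ?_ (hg (P.eff s) (if s'.var N = 0 then s'.tick 2 else
      P.eff (s'.tick (1 + Nat.size (s'.var N)))) ?_)
    · split_ifs with h0
      · rw [h0]; rfl
      · rfl
    · split_ifs with h0
      · obtain ⟨-, -, d, hd, -, hd2⟩ := eff_agree hb hP (s := s) (s' := s) fun _ _ => ⟨rfl, rfl⟩
        exact h.of_zero h0 h0 (d := 2) le_rfl (by omega) (by omega)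
      · obtain ⟨h1, h2, d, hd, hd1, hd2⟩ := eff_agree hb hP (s := s)
          (s' := s'.tick (1 + Nat.size (s'.var N))) (h.agree h0)
        refine ⟨fun _ => h1, ?_, ?_, ?_⟩
        · rw [hd1, hd2]
          simp only [State.tick]
          have h3 := h.time_le
          have h4 := h.size_clock
          -- An instruction of cost `d ≥ 1` buys `K * d` units, enough for itself and for the
          -- preceding test of the clock.
          have : (Nat.size c₀ + 1 + 1) * d ≤ K * d := Nat.mul_le_mul_right _ (by omega)
          have h5 : (Nat.size c₀ + 1) * 1 ≤ (Nat.size c₀ + 1) * d := Nat.mul_le_mul_left _ hd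
          rw [mul_add]
          rw [add_mul] at this
          omega
        · rw [h2, hd2]; have := h.le_clock; simp only [State.tick]; omega
        · rw [h2]; exact h.clock_le
  | coin x =>
    intro δ e g g' hg s s' h
    simp only [Prog.clk]
    rw [E_ifNZ, wp_coin]
    by_cases h0 : s'.var N = 0
    · rw [if_pos h0, E_basic (by trivial)]
      have hr : ∀ b, ClkRel N K τ c₀ δ e ((s.setVar x b).tick 1)
          (Prog.skip.eff (s'.tick (1 + Nat.size (s'.var N)))) := fun b =>
        h.of_zero h0 h0 (d := 2) (by simp [Prog.eff, State.tick, h0]) (by omega) le_rfl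
      refine le_of_eq_of_le ?_ (add_le_add (mul_le_mul_right (hg _ _ (hr 1)) _)
        (mul_le_mul_right (hg _ _ (hr 0)) _))
      rw [← add_mul, ENNReal.inv_two_add_inv_two, one_mul]
    · rw [if_neg h0, E_coin]
      have hr : ∀ b, ClkRel N K τ c₀ δ e ((s.setVar x b).tick 1)
          (((s'.tick (1 + Nat.size (s'.var N))).setVar x b).tick 1) := by
        intro b
        have hxN : N ≠ x := (show x < N from hP).ne'
        refine ⟨fun _ y hy => ?_, ?_, ?_, ?_⟩
        · have := h.agree h0 y hy
          simp only [State.setVar, State.tick]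
          by_cases hxy : y = x
          · subst hxy; simp [this.2]
          · simp [Function.update_of_ne hxy, this]
        · simp only [State.setVar, State.tick]
          have h3 := h.time_le
          have h4 := h.size_clock
          rw [mul_add]; omega
        · have := h.le_clock
          simp only [State.setVar, State.tick, Function.update_of_ne hxN]
          omega
        · simp only [State.setVar, State.tick, Function.update_of_ne hxN]
          exact h.clock_le
      gcongr
      · exact hg _ _ (hr 1)
      · exact hg _ _ (hr 0)
  | seq P Q ihP ihQ =>
    intro δ e g g' hg s s' h
    simp only [Prog.clk]
    rw [E_seq, wp_seq]
    exact ihP hP.1 (fun s s' h => ihQ hP.2 hg h) h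
  | ifNZ x P Q ihP ihQ =>
    intro δ e g g' hg s s' h
    simp only [Prog.clk]
    rw [E_ifNZ]
    by_cases h0 : s'.var N = 0
    · rw [if_pos h0, E_basic (by trivial), wp_ifNZ]
      have hr : ∀ u : State, (s.tick (1 + Nat.size (s.var x))).time ≤ u.time →
          g' (Prog.skip.eff (s'.tick (1 + Nat.size (s'.var N)))) ≤ g u := fun u hu =>
        hg _ _ (h.of_zero h0 h0 (d := 2) (by simp [Prog.eff, State.tick, h0]) (by omega)
          (by simp only [State.tick] at hu; omega))
      split_ifs
      · exact le_wp_of_time hr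
      · exact le_wp_of_time hr
    · rw [if_neg h0, E_ifNZ, wp_ifNZ]
      have hx : s'.var x = s.var x := (h.agree h0 x hP.1).1
      have hr : ClkRel N K τ c₀ δ e (s.tick (1 + Nat.size (s.var x)))
          ((s'.tick (1 + Nat.size (s'.var N))).tick (1 + Nat.size (s.var x))) := by
        refine ⟨fun _ => h.agree h0, ?_, ?_, h.clock_le⟩
        · simp only [State.tick]
          have h3 := h.time_le
          have h4 := h.size_clock
          have h5 : (Nat.size c₀ + 1 + 1) * (1 + Nat.size (s.var x)) ≤ K * (1 + Nat.size (s.var x)) :=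
            Nat.mul_le_mul_right _ (by omega)
          have h6 : (Nat.size c₀ + 1) * 1 ≤ (Nat.size c₀ + 1) * (1 + Nat.size (s.var x)) :=
            Nat.mul_le_mul_left _ (by omega)
          rw [mul_add]
          rw [add_mul] at h5
          omega
        · have := h.le_clock; simp only [State.tick]; omega
      simp only [State.tick, hx] at hr ⊢
      split_ifs
      · exact ihQ hP.2.2 hg hr
      · exact ihP hP.2.1 hg hr
  | whileNZ x P ih =>
    intro δ e g g' hg s s' h
    rw [wp_whileNZ]
    simp only [Prog.clk]
    obtain ⟨hxN, hPN⟩ := hP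
    generalize hB : (P.clk N ;; .const (N + 2) 1 ;; .minus N N (N + 2) ;; clkGuard N x) = B
    -- The body of the clocked loop ends with the guard computation, so the guard followed by the
    -- loop is what recurs. The induction is on the round budget of the original loop.
    suffices H : ∀ k s s', ClkRel N K τ c₀ δ e s s' →
        E (clkGuard N x ;; .whileNZ (N + 1) B) g' s' ≤ wpLoop x ⊤ (P.wp ⊤ f) g k s from H f s s' h
    clear h s s'
    intro k
    induction k with
    | zero => intro s s' _; exact le_top
    | succ k ihk =>
      intro s s' h
      rw [E_seq]
      obtain ⟨b, d, hb, hd, he⟩ := E_clkGuard (N := N) (x := x) (E (.whileNZ (N + 1) B) g') s'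
      rw [he, E_whileNZ]
      have hvar : ((s'.setVar (N + 1) b).tick d).var (N + 1) = b := by
        simp [State.setVar, State.tick]
      have hvarN : Function.update s'.var (N + 1) b N = s'.var N :=
        Function.update_of_ne (by omega) _ _
      rw [hvar]
      by_cases h0 : s'.var N = 0
      · have hb0 : b = 0 := by simpa [h0] using hb
        simp only [h0, ne_eq, not_true_eq_false, if_false] at hd
        rw [if_pos hb0]
        refine le_wpLoop_of_time _ _ fun u hu => hg _ _ (h.of_zero h0 (d := 3) ?_ ?_ ?_ hu)
        · simp only [State.setVar, State.tick]; rw [hvarN, h0]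
        · simp only [State.setVar, State.tick, hb0, Nat.size_zero]; omega
        · omega
      have hx : s'.var x = s.var x := (h.agree h0 x hxN).1
      have hag : ∀ y < N, Function.update s'.var (N + 1) b y = s.var y ∧ s'.arr y = s.arr y := by
        intro y hy
        rw [Function.update_of_ne (by omega)]
        exact h.agree h0 y hy
      rw [if_pos h0] at hd
      have h4 := h.size_clock
      have h3 := h.time_le
      have h7 := h.le_clock
      simp only [wpLoop]
      by_cases hx0 : s.var x = 0
      · have hb0 : b = 0 := by simpa [hx, hx0] using hb
        rw [if_pos hb0, if_pos hx0]
        refine hg _ _ ⟨fun _ => hag, ?_, ?_, ?_⟩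
        · simp only [State.setVar, State.tick, hb0, Nat.size_zero, hx0] at *
          rw [mul_add]; rw [hx, Nat.size_zero] at hd; omega
        · simp only [State.setVar, State.tick, hvarN]; omega
        · simp only [State.setVar, State.tick, hvarN]; exact h.clock_le
      · have hb1 : b = 1 := by simpa [hx, hx0, h0] using hb
        rw [if_neg (by omega), if_neg hx0, ← hB, E_seq]
        -- The original has just paid for its test of `x`. From this the body inherits a reserve of
        -- `4 + Nat.size c₀` units of time and one unit of clock, exactly what the decrement
        -- consumes afterwards.
        refine ih hPN (δ := δ + (4 + Nat.size c₀)) (e := e + 1) ?_ ?_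
        · intro u u' hu
          rw [E_seq, E_basic (by trivial), E_seq, E_basic (by trivial)]
          rw [← E_seq, hB]
          refine ihk _ _ ?_
          have e1 := hu.agree
          have e2 := hu.time_le
          have e3 := hu.le_clock
          have e4 := hu.clock_le
          have e5 := hu.size_clock
          have e6 : Function.update u'.var (N + 2) 1 N = u'.var N :=
            Function.update_of_ne (by omega) _ _
          refine ⟨fun hne y hy => ?_, ?_, ?_, ?_⟩
          · simp only [Prog.eff, State.setVar, State.tick, Function.update_self, e6] at hne ⊢
            rw [Function.update_of_ne (by omega), Function.update_of_ne (by omega)]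
            exact e1 (by omega) y hy
          · simp only [Prog.eff, State.setVar, State.tick, Function.update_self, e6, Nat.size_one]
            omega
          · simp only [Prog.eff, State.setVar, State.tick, Function.update_self, e6]; omega
          · simp only [Prog.eff, State.setVar, State.tick, Function.update_self, e6]; omega
        · refine ⟨fun _ => hag, ?_, ?_, ?_⟩
          · simp only [State.setVar, State.tick, hb1, Nat.size_one]
            have h5 : (2 * Nat.size c₀ + 9 + 1) * (1 + Nat.size (s.var x)) ≤
              K * (1 + Nat.size (s.var x)) := Nat.mul_le_mul_right _ (by omega)
            have h6 : (2 * Nat.size c₀ + 9) * 1 ≤ (2 * Nat.size c₀ + 9) * (1 + Nat.size (s.var x)) :=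
              Nat.mul_le_mul_left _ (by omega)
            rw [mul_add]
            rw [add_mul] at h5
            rw [hx] at hd
            omega
          · simp only [State.setVar, State.tick, hvarN]; omega
          · simp only [State.setVar, State.tick, hvarN]; exact h.clock_le

/-- A clocked program simulates the program until the clock runs out. -/
theorem E_clk_le (hK : 2 * Nat.size c₀ + 10 ≤ K) {P : Prog} (hP : NamesBelow N P)
    {g g' : State → ℝ≥0∞} (hg : ∀ s s', ClkRel N K τ c₀ δ e s s' → g' s' ≤ g s)
    {s s' : State} (h : ClkRel N K τ c₀ δ e s s') : E (P.clk N) g' s' ≤ E P g s := by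
  rw [E.eq_1 P]
  exact le_iInf fun _ => E_clk_le_wp hK hP hg h

end clk

/-! ### Clocked programs take polynomial time -/

/-- All numbers in the memory have at most `B` bits. -/
def BitBound (B : ℕ) (s : State) : Prop :=
  (∀ x, Nat.size (s.var x) ≤ B) ∧ (∀ r, ∀ y ∈ s.arr r, Nat.size y ≤ B) ∧
    ∀ r, Nat.size (s.arr r).length ≤ B

/-- The configuration `s'` can be reached from `s` in `j` steps, as far as the growth of numbers and
the time are concerned. -/
def Grow (B₀ j : ℕ) (s s' : State) : Prop :=
  ∀ B, B₀ ≤ B → BitBound B s → BitBound (B + j) s' ∧ s'.time ≤ s.time + j * (3 * (B + j) + 3)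

theorem Grow.trans {B₀ j j' : ℕ} {s t u : State} (h : Grow B₀ j s t) (h' : Grow B₀ j' t u) :
    Grow B₀ (j + j') s u := by
  intro B hB hs
  obtain ⟨h1, h2⟩ := h B hB hs
  obtain ⟨h3, h4⟩ := h' (B + j) (by omega) h1
  refine ⟨by rwa [← add_assoc], h4.trans ?_⟩
  have : j * (3 * (B + j) + 3) ≤ j * (3 * (B + (j + j')) + 3) := Nat.mul_le_mul_left _ (by omega)
  have h5 : (j + j') * (3 * (B + (j + j')) + 3) =
    j * (3 * (B + (j + j')) + 3) + j' * (3 * (B + (j + j')) + 3) := by ring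
  rw [← add_assoc] at *
  omega

theorem Grow.mono {B₀ B₁ j j' : ℕ} {s t : State} (h : Grow B₀ j s t) (hB : B₀ ≤ B₁) (hj : j ≤ j') :
    Grow B₁ j' s t := by
  intro B hB' hs
  obtain ⟨h1, h2⟩ := h B (hB.trans hB') hs
  refine ⟨⟨fun x => (h1.1 x).trans (by omega), fun r y hy => (h1.2.1 r y hy).trans (by omega),
    fun r => (h1.2.2 r).trans (by omega)⟩, h2.trans ?_⟩
  have : j * (3 * (B + j) + 3) ≤ j' * (3 * (B + j') + 3) := Nat.mul_le_mul hj (by omega)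
  omega

theorem size_add_le {x y B : ℕ} (hx : Nat.size x ≤ B) (hy : Nat.size y ≤ B) :
    Nat.size (x + y) ≤ B + 1 := by
  rw [Nat.size_le] at *
  rw [pow_succ]; omega

theorem grow_tick {B₀ : ℕ} (s : State) (x : ℕ) : Grow B₀ 1 s (s.tick (1 + Nat.size (s.var x))) := by
  intro B _ hs
  refine ⟨⟨fun x => (hs.1 x).trans (by simp), fun r y hy => (hs.2.1 r y hy).trans (by simp),
    fun r => (hs.2.2 r).trans (by simp)⟩, ?_⟩
  have := hs.1 x
  simp only [State.tick]; omega

theorem grow_setVar {B₀ : ℕ} (s : State) (x c d : ℕ)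
    (h : ∀ B, B₀ ≤ B → BitBound B s → Nat.size c ≤ B + 1 ∧ d ≤ 3 * B + 3) :
    Grow B₀ 1 s ((s.setVar x c).tick d) := by
  intro B hB hs
  obtain ⟨h1, h2⟩ := h B hB hs
  refine ⟨⟨fun y => ?_, fun r y hy => (hs.2.1 r y hy).trans (by simp),
    fun r => (hs.2.2 r).trans (by simp)⟩, ?_⟩
  · simp only [State.setVar, State.tick]
    by_cases hxy : y = x
    · subst hxy; rwa [Function.update_self]
    · rw [Function.update_of_ne hxy]; exact (hs.1 y).trans (by simp)
  · simp only [State.tick, State.setVar]; omega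

theorem grow_setArr {B₀ : ℕ} (s : State) (r : ℕ) (l : List ℕ) (d : ℕ)
    (h : ∀ B, B₀ ≤ B → BitBound B s → (∀ y ∈ l, Nat.size y ≤ B + 1) ∧
      Nat.size l.length ≤ B + 1 ∧ d ≤ 3 * B + 3) :
    Grow B₀ 1 s ((s.setArr r l).tick d) := by
  intro B hB hs
  obtain ⟨h1, h2, h3⟩ := h B hB hs
  refine ⟨⟨fun y => (hs.1 y).trans (by simp), fun q => ?_, fun q => ?_⟩, ?_⟩
  · simp only [State.setArr, State.tick]
    by_cases hxy : q = r
    · subst hxy; rwa [Function.update_self]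
    · rw [Function.update_of_ne hxy]; exact fun y hy => (hs.2.1 q y hy).trans (by simp)
  · simp only [State.setArr, State.tick]
    by_cases hxy : q = r
    · subst hxy; rwa [Function.update_self]
    · rw [Function.update_of_ne hxy]; exact (hs.2.2 q).trans (by simp)
  · simp only [State.tick, State.setArr]; omega

theorem size_getD_le {l : List ℕ} {B : ℕ} (h : ∀ y ∈ l, Nat.size y ≤ B) (i : ℕ) :
    Nat.size (l.getD i 0) ≤ B := by
  rw [List.getD_eq_getElem?_getD]
  by_cases hi : i < l.length
  · simpa [hi] using h _ (List.getElem_mem hi)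
  · simp [hi, Nat.size_zero]

/-- One instruction adds at most one bit, since the only arithmetic that increases numbers is
addition. The threshold `B₀` absorbs the constant of an assignment; an append needs `B₀ = 1`. -/
theorem grow_eff {P : Prog} (hP : P.IsBasic) : ∃ B₀, ∀ s, Grow B₀ 1 s (P.eff s) := by
  cases P with
  | skip =>
    refine ⟨0, fun s B _ hs => ⟨⟨fun x => (hs.1 x).trans (by simp), fun r y hy =>
      (hs.2.1 r y hy).trans (by simp), fun r => (hs.2.2 r).trans (by simp)⟩, ?_⟩⟩
    simp only [Prog.eff, State.tick]; omega
  | const x c =>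
    exact ⟨Nat.size c, fun s => grow_setVar _ _ _ _ fun B hB hs => ⟨by omega, by omega⟩⟩
  | plus x y z =>
    refine ⟨0, fun s => grow_setVar _ _ _ _ fun B hB hs => ⟨size_add_le (hs.1 y) (hs.1 z), ?_⟩⟩
    have := hs.1 y; have := hs.1 z; omega
  | minus x y z =>
    refine ⟨0, fun s => grow_setVar _ _ _ _ fun B hB hs => ⟨?_, ?_⟩⟩
    · exact (Nat.size_le_size (Nat.sub_le _ _)).trans ((hs.1 y).trans (by simp))
    · have := hs.1 y; have := hs.1 z; omega
  | half x y =>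
    refine ⟨0, fun s => grow_setVar _ _ _ _ fun B hB hs => ⟨?_, ?_⟩⟩
    · exact (Nat.size_le_size (Nat.div_le_self _ _)).trans ((hs.1 y).trans (by simp))
    · have := hs.1 y; omega
  | len x r =>
    refine ⟨0, fun s => grow_setVar _ _ _ _ fun B hB hs => ⟨?_, ?_⟩⟩
    · exact (hs.2.2 r).trans (by simp)
    · have := hs.2.2 r; omega
  | load x r y =>
    refine ⟨0, fun s => grow_setVar _ _ _ _ fun B hB hs => ?_⟩
    have h1 := size_getD_le (hs.2.1 r) (s.var y)
    have := hs.1 y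
    exact ⟨by omega, by omega⟩
  | store r y z =>
    refine ⟨0, fun s => grow_setArr _ _ _ _ fun B hB hs => ⟨?_, ?_, ?_⟩⟩
    · intro w hw
      rcases List.mem_or_eq_of_mem_set hw with hw | rfl
      · exact (hs.2.1 r w hw).trans (by simp)
      · exact (hs.1 z).trans (by simp)
    · rw [List.length_set]; exact (hs.2.2 r).trans (by simp)
    · have := hs.1 y; have := hs.1 z; omega
  | push r y =>
    refine ⟨1, fun s => grow_setArr _ _ _ _ fun B hB hs => ⟨?_, ?_, ?_⟩⟩
    · intro w hw
      rw [List.mem_append, List.mem_singleton] at hw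
      rcases hw with hw | rfl
      · exact (hs.2.1 r w hw).trans (by simp)
      · exact (hs.1 y).trans (by simp)
    · rw [List.length_append]; exact size_add_le (hs.2.2 r) (by simpa [Nat.size_one] using hB)
    · have := hs.1 y; have := hs.2.2 r; omega
  | clear r =>
    refine ⟨0, fun s => grow_setArr _ _ _ _ fun B hB hs => ⟨by simp, by simp [Nat.size_zero], by omega⟩⟩
  | _ => exact hP.elim

/-- The clocked program `P` makes at most `A` steps per tick of its clock. -/
def ClkSteps (N A B₀ : ℕ) (P : Prog) : Prop :=
  ∀ s, Ens P (fun s' => s'.var N ≤ s.var N ∧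
    ∃ j ≤ A * (s.var N - s'.var N + 1), Grow B₀ j s s') s

theorem ens_clkGuard {N x : ℕ} (s : State) :
    Ens (clkGuard N x) (fun s' => s'.var N = s.var N ∧
      (s'.var (N + 1) ≠ 0 → s.var N ≠ 0) ∧ Grow 1 3 s s') s := by
  have h0 : ∀ b u d, b ≤ 1 → d ≤ 2 →
      Grow 1 1 u ((u.setVar (N + 1) b).tick d) := fun b u d hb hd =>
    grow_setVar _ _ _ _ fun B hB _ => ⟨(Nat.size_le_size hb).trans (by rw [Nat.size_one]; omega),
      by omega⟩
  have hN : ∀ b (v : ℕ → ℕ), Function.update v (N + 1) b N = v N :=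
    fun b v => Function.update_of_ne (by omega) _ _
  rw [clkGuard, Ens_ifNZ]
  split_ifs with hc
  · rw [Ens_basic (by trivial)]
    exact ⟨hN _ _, by simp [Prog.eff, State.tick, State.setVar],
      ((grow_tick s N).trans (h0 0 _ _ (by simp) (by simp))).mono le_rfl (by simp)⟩
  · rw [Ens_ifNZ]
    split_ifs
    · rw [Ens_basic (by trivial)]
      exact ⟨hN _ _, fun _ => hc,
        (((grow_tick s N).trans (grow_tick _ x)).trans (h0 0 _ _ (by simp) (by simp))).mono le_rfl
          (by simp)⟩
    · rw [Ens_basic (by trivial)]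
      exact ⟨hN _ _, fun _ => hc,
        (((grow_tick s N).trans (grow_tick _ x)).trans (h0 1 _ _ (by simp)
          (by simp [Nat.size_one]))).mono le_rfl (by simp)⟩

/-- Between two ticks of the clock there is only loop-free code, whose length depends on the program
alone, not on how long the unclocked program would run. This makes the distinguisher polynomial even
if `T` is not. -/
theorem exists_clkSteps {N : ℕ} {P : Prog} (hP : NamesBelow N P) :
    ∃ A B₀, ClkSteps N A B₀ (P.clk N) := by
  induction P using Prog.basicInduction with
  | basic P hb =>
    obtain ⟨B₀, hB⟩ := grow_eff hb
    obtain ⟨B₁, hB₁⟩ := grow_eff (P := .skip) trivial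
    refine ⟨2, B₀ + B₁, fun s => ?_⟩
    rw [Prog.clk_basic hb, Ens_ifNZ]
    split_ifs
    · rw [Ens_basic (by trivial)]
      exact ⟨le_rfl, 2, by omega, ((grow_tick s N).trans (hB₁ _)).mono (by omega) le_rfl⟩
    · rw [Ens_basic hb]
      have := (eff_agree hb hP (s := s.tick (1 + Nat.size (s.var N)))
        (s' := s.tick (1 + Nat.size (s.var N))) fun _ _ => ⟨rfl, rfl⟩).2.1
      exact ⟨this.le, 2, by omega, ((grow_tick s N).trans (hB _)).mono (by omega) le_rfl⟩
  | coin x =>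
    obtain ⟨B₁, hB₁⟩ := grow_eff (P := .skip) trivial
    refine ⟨2, 1 + B₁, fun s => ?_⟩
    simp only [Prog.clk]
    rw [Ens_ifNZ]
    split_ifs
    · rw [Ens_basic (by trivial)]
      exact ⟨le_rfl, 2, by omega, ((grow_tick s N).trans (hB₁ _)).mono (by omega) le_rfl⟩
    · rw [Ens_coin]
      have hxN : N ≠ x := (show x < N from hP).ne'
      have : ∀ b ≤ 1, Grow 1 1 (s.tick (1 + Nat.size (s.var N)))
          (((s.tick (1 + Nat.size (s.var N))).setVar x b).tick 1) := fun b hb =>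
        grow_setVar _ _ _ _ fun B hB _ => ⟨(Nat.size_le_size hb).trans (by rw [Nat.size_one]; omega),
          by omega⟩
      constructor
      · exact ⟨(Function.update_of_ne hxN _ _).le, 2, by omega,
          ((grow_tick s N).trans (this 1 le_rfl)).mono (by omega) le_rfl⟩
      · exact ⟨(Function.update_of_ne hxN _ _).le, 2, by omega,
          ((grow_tick s N).trans (this 0 zero_le_one)).mono (by omega) le_rfl⟩
  | seq P Q ihP ihQ =>
    obtain ⟨A, B, h⟩ := ihP hP.1
    obtain ⟨A', B', h'⟩ := ihQ hP.2
    refine ⟨A + A', B + B', fun s => ?_⟩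
    simp only [Prog.clk]
    rw [Ens_seq]
    refine (h s).mono fun t ht => (h' t).mono fun u hu => ?_
    obtain ⟨h1, j, hj, hg⟩ := ht
    obtain ⟨h2, j', hj', hg'⟩ := hu
    refine ⟨h2.trans h1, j + j', ?_,
      (hg.mono (by omega) le_rfl).trans (hg'.mono (by omega) le_rfl)⟩
    rw [add_mul]
    exact Nat.add_le_add (hj.trans (Nat.mul_le_mul_left _ (by omega)))
      (hj'.trans (Nat.mul_le_mul_left _ (by omega)))
  | ifNZ x P Q ihP ihQ =>
    obtain ⟨A, B, h⟩ := ihP hP.2.1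
    obtain ⟨A', B', h'⟩ := ihQ hP.2.2
    obtain ⟨B₁, hB₁⟩ := grow_eff (P := .skip) trivial
    refine ⟨A + A' + 2, B + B' + B₁, fun s => ?_⟩
    simp only [Prog.clk]
    rw [Ens_ifNZ]
    split_ifs
    · rw [Ens_basic (by trivial)]
      refine ⟨le_rfl, 2, ?_, ((grow_tick s N).trans (hB₁ _)).mono (by omega) le_rfl⟩
      exact le_trans (by omega) (Nat.le_mul_of_pos_right _ (by omega))
    · rw [Ens_ifNZ]
      split_ifs
      · refine (h' _).mono fun u hu => ?_
        obtain ⟨h2, j', hj', hg'⟩ := hu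
        refine ⟨h2, 1 + 1 + j', ?_, (((grow_tick s N).trans (grow_tick _ x)).trans hg').mono
          (by omega) le_rfl⟩
        have h3 : 2 * 1 ≤ 2 * (s.var N - u.var N + 1) := Nat.mul_le_mul_left _ (by omega)
        simp only [State.tick] at hj'
        rw [add_mul, add_mul]
        omega
      · refine (h _).mono fun u hu => ?_
        obtain ⟨h2, j', hj', hg'⟩ := hu
        refine ⟨h2, 1 + 1 + j', ?_, (((grow_tick s N).trans (grow_tick _ x)).trans hg').mono
          (by omega) le_rfl⟩
        have h3 : 2 * 1 ≤ 2 * (s.var N - u.var N + 1) := Nat.mul_le_mul_left _ (by omega)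
        simp only [State.tick] at hj'
        rw [add_mul, add_mul]
        omega
  | whileNZ x P ih =>
    obtain ⟨A, B, h⟩ := ih hP.2
    refine ⟨2 * A + 12, B + 1, fun s => ?_⟩
    simp only [Prog.clk]
    generalize hR : (P.clk N ;; .const (N + 2) 1 ;; .minus N N (N + 2) ;; clkGuard N x) = R
    -- A round that starts with a nonzero clock strictly lowers it, and a nonzero guard afterwards
    -- certifies that the clock is still nonzero for the next round.
    have hbody : ∀ s, s.var N ≠ 0 → Ens R (fun s' => s'.var N < s.var N ∧
        (s'.var (N + 1) ≠ 0 → s'.var N ≠ 0) ∧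
        ∃ j ≤ (2 * A + 6) * (s.var N - s'.var N), Grow (B + 1) j s s') s := by
      intro s hs
      rw [← hR, Ens_seq]
      refine (h s).mono fun t ht => ?_
      rw [Ens_seq, Ens_basic (by trivial), Ens_seq, Ens_basic (by trivial)]
      obtain ⟨h1, j, hj, hg⟩ := ht
      obtain ⟨B₁, hB₁⟩ := grow_eff (P := .const (N + 2) 1) trivial
      have e1 : Grow 1 1 t ((Prog.const (N + 2) 1).eff t) :=
        grow_setVar _ _ _ _ fun B hB _ => ⟨by rw [Nat.size_one]; omega, by rw [Nat.size_one]; omega⟩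
      have e2 : ∀ u, Grow 1 1 u ((Prog.minus N N (N + 2)).eff u) := fun u =>
        grow_setVar _ _ _ _ fun B hB hu => by
          have e3 := hu.1 N
          have e4 := hu.1 (N + 2)
          have e5 := Nat.size_le_size (Nat.sub_le (u.var N) (u.var (N + 2)))
          exact ⟨by omega, by omega⟩
      have e3 := (e1.trans (e2 _))
      have e4 : ((Prog.minus N N (N + 2)).eff ((Prog.const (N + 2) 1).eff t)).var N =
          t.var N - 1 := by
        simp only [Prog.eff, State.tick, State.setVar, Function.update_self]
        rw [Function.update_of_ne (by omega)]
      refine (ens_clkGuard _).mono fun u hu => ?_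
      obtain ⟨h2, h3, h4⟩ := hu
      rw [e4] at h2 h3
      refine ⟨by omega, by omega, j + (1 + 1) + 3, ?_, ?_⟩
      -- The factor `2` covers the case where the body has already exhausted the clock, so that the
      -- truncated decrement has no effect.
      · have h5 : A * (s.var N - t.var N + 1) ≤ A * (2 * (s.var N - u.var N)) :=
          Nat.mul_le_mul_left _ (by omega)
        have h6 : (2 * A + 6) * (s.var N - u.var N) =
          A * (2 * (s.var N - u.var N)) + 6 * (s.var N - u.var N) := by ring
        omega
      · exact ((hg.mono (by omega) le_rfl).trans (e3.mono (by omega) le_rfl)).trans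
          (h4.mono (by omega) le_rfl)
    -- The value of the clock is the termination measure, whatever the loop itself computes.
    have hloop : ∀ m s, s.var N = m → (s.var (N + 1) ≠ 0 → s.var N ≠ 0) →
        Ens (.whileNZ (N + 1) R) (fun s' => s'.var N ≤ s.var N ∧
          ∃ j ≤ (2 * A + 7) * (s.var N - s'.var N) + 1, Grow (B + 1) j s s') s := by
      intro m
      induction m using Nat.strong_induction_on with
      | _ m ihm =>
        intro s hs hs1
        rw [Ens_whileNZ]
        split_ifs with hg
        · exact ⟨le_rfl, 1, by omega, grow_tick _ _⟩
        · refine (hbody (s.tick (1 + Nat.size (s.var (N + 1)))) (hs1 hg)).mono fun t ht => ?_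
          obtain ⟨h1, h2, j, hj, hgr⟩ := ht
          simp only [State.tick] at h1 hj
          refine (ihm (t.var N) (by omega) t rfl h2).mono fun u hu => ?_
          obtain ⟨h3, j', hj', hgr'⟩ := hu
          refine ⟨by omega, 1 + j + j', ?_, ((grow_tick _ _).trans hgr).trans hgr'⟩
          have e1 : (2 * A + 6) * (s.var N - t.var N) + (s.var N - t.var N) =
            (2 * A + 7) * (s.var N - t.var N) := by ring
          have e2 : (2 * A + 7) * (s.var N - t.var N) + (2 * A + 7) * (t.var N - u.var N) =
              (2 * A + 7) * (s.var N - u.var N) := by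
            rw [← mul_add]; congr 1; omega
          omega
    rw [Ens_seq]
    refine (ens_clkGuard s).mono fun t ht => ?_
    obtain ⟨h1, h2, h3⟩ := ht
    refine (hloop _ t rfl (by rwa [h1])).mono fun u hu => ?_
    obtain ⟨h4, j, hj, hg⟩ := hu
    rw [h1] at h4 hj
    refine ⟨h4, 3 + j, ?_, (h3.mono (by omega) le_rfl).trans hg⟩
    have e1 : (2 * A + 7) * (s.var N - u.var N) + (5 * (s.var N - u.var N) + (2 * A + 12)) =
      (2 * A + 12) * (s.var N - u.var N + 1) := by ring
    omega

/-! ### Symbolic execution -/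

section rules

variable {P R : Prog} {Q : State → Prop} {v : ℕ → ℕ} {r : ℕ → List ℕ} {t : ℕ}

theorem Ens_skip : Ens .skip Q ⟨v, r, t⟩ ↔ Q ⟨v, r, t + 1⟩ := Ens_basic trivial

theorem Ens_const {x c : ℕ} : Ens (.const x c) Q ⟨v, r, t⟩ ↔
    Q ⟨Function.update v x c, r, t + (1 + Nat.size c)⟩ := Ens_basic trivial

theorem Ens_plus {x y z : ℕ} : Ens (.plus x y z) Q ⟨v, r, t⟩ ↔
    Q ⟨Function.update v x (v y + v z), r, t + (1 + Nat.size (v y) + Nat.size (v z))⟩ :=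
  Ens_basic trivial

theorem Ens_minus {x y z : ℕ} : Ens (.minus x y z) Q ⟨v, r, t⟩ ↔
    Q ⟨Function.update v x (v y - v z), r, t + (1 + Nat.size (v y) + Nat.size (v z))⟩ :=
  Ens_basic trivial

theorem Ens_half {x y : ℕ} : Ens (.half x y) Q ⟨v, r, t⟩ ↔
    Q ⟨Function.update v x (v y / 2), r, t + (1 + Nat.size (v y))⟩ := Ens_basic trivial

theorem Ens_load {x b y : ℕ} : Ens (.load x b y) Q ⟨v, r, t⟩ ↔
    Q ⟨Function.update v x ((r b).getD (v y) 0), r,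
      t + (1 + Nat.size (v y) + Nat.size ((r b).getD (v y) 0))⟩ := Ens_basic trivial

theorem Ens_push {b y : ℕ} : Ens (.push b y) Q ⟨v, r, t⟩ ↔
    Q ⟨v, Function.update r b (r b ++ [v y]),
      t + (1 + Nat.size (r b).length + Nat.size (v y))⟩ := Ens_basic trivial

theorem Ens_clear {b : ℕ} : Ens (.clear b) Q ⟨v, r, t⟩ ↔
    Q ⟨v, Function.update r b [], t + 1⟩ := Ens_basic trivial

theorem Ens_ite {x : ℕ} : Ens (.ifNZ x P R) Q ⟨v, r, t⟩ ↔
    if v x = 0 then Ens R Q ⟨v, r, t + (1 + Nat.size (v x))⟩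
    else Ens P Q ⟨v, r, t + (1 + Nat.size (v x))⟩ := Ens_ifNZ

end rules

theorem size_le_of_le {m W l : ℕ} (hW : Nat.size W ≤ l) (h : m ≤ W) : Nat.size m ≤ l :=
  (Nat.size_le_size h).trans hW

theorem size_le_self (m : ℕ) : Nat.size m ≤ m := Nat.size_le.2 Nat.lt_two_pow_self

/-! ### Case distinction and field operations -/

/-- Run the program whose position in the list is the value of the variable `t`. -/
def caseOf (t : ℕ) : List Prog → Prog
  | [] => .skip
  | P :: Ps => .ifNZ t (.const 1 1 ;; .minus t t 1 ;; caseOf t Ps) P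

theorem WritesIn.caseOf {vs as : Set ℕ} {t : ℕ} {Ps : List Prog} (h1 : 1 ∈ vs) (ht : t ∈ vs)
    (h : ∀ P ∈ Ps, WritesIn vs as P) : WritesIn vs as (caseOf t Ps) := by
  induction Ps with
  | nil => trivial
  | cons P Ps ih =>
    exact ⟨⟨h1, ht, ih fun P hP => h P (List.mem_cons_of_mem _ hP)⟩, h P List.mem_cons_self⟩

theorem tr_caseOf {t : ℕ} (ht : t ≠ 1) {Q : (ℕ → ℕ) → (ℕ → List ℕ) → Prop} {c : ℕ}
    {a : ℕ → List ℕ} (Ps : List Prog) : ∀ (v : ℕ → ℕ) (h : v t < Ps.length),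
      (∀ v', Fr {1, t} ∅ v a v' a → Tr (Ps[v t]) c v' a Q) →
      Tr (caseOf t Ps) (c + Ps.length * (2 * Ps.length + 5)) v a Q := by
  -- The bound `L` on the tested value stays fixed while the list shrinks, so every level has the
  -- same cost.
  suffices H : ∀ L, Ps.length ≤ L → ∀ (v : ℕ → ℕ) (h : v t < Ps.length),
      (∀ v', Fr {1, t} ∅ v a v' a → Tr (Ps[v t]) c v' a Q) →
      Tr (caseOf t Ps) (c + Ps.length * (2 * L + 5)) v a Q from H _ le_rfl
  intro L
  induction Ps with
  | nil => intro _ v h; simp at h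
  | cons P Ps ih =>
    intro hL v h hQ τ
    rw [caseOf, Ens_ite]
    have hsz := size_le_self (v t)
    simp only [List.length_cons] at h hL
    rw [List.length_cons, add_mul]
    split_ifs with h0
    · have h1 := hQ v (Fr.refl _ _)
      simp only [h0, List.getElem_cons_zero] at h1
      refine (h1 _).mono fun s hs => ⟨by omega, hs.2⟩
    · simp only [Ens_seq, Ens_const, Ens_minus, Function.update_of_ne ht, Function.update_self]
      have hv : Function.update (Function.update v 1 1) t (v t - 1) t = v t - 1 :=
        Function.update_self ..
      have h2 := ih (by omega) (Function.update (Function.update v 1 1) t (v t - 1))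
        (by rw [hv]; omega) fun v' hv' => by
          have h3 := hQ v' ⟨fun x hx => ?_, fun _ _ => rfl⟩
          · have : (P :: Ps)[v t] = Ps[v t - 1] := by
              rw [List.getElem_cons, dif_neg h0]
            simp only [hv]
            rw [this] at h3; exact h3
          · simp only [Set.mem_insert_iff, Set.mem_singleton_iff, not_or] at hx
            rw [hv'.1 x (by simp [hx]), Function.update_of_ne hx.2, Function.update_of_ne hx.1]
      refine (h2 _).mono fun s hs => ⟨?_, hs.2⟩
      have := hs.1
      have := Nat.size_one
      omega

/-- `z := f x y`, for values of the variables `x` and `y` below `q`. -/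
def fop (q : ℕ) (f : ℕ → ℕ → ℕ) (z x y : ℕ) : Prog :=
  .const 1 0 ;; .plus 2 x 1 ;; caseOf 2 ((List.range q).map fun i =>
    .const 1 0 ;; .plus 3 y 1 ;; caseOf 3 ((List.range q).map fun j => .const z (f i j)))

/-- A bound for the running time of `fop q`. -/
def fopCost (q : ℕ) : ℕ := 2 * (q * (2 * q + 5)) + 3 * q + 5

theorem writesIn_fop (q : ℕ) (f : ℕ → ℕ → ℕ) (z x y : ℕ) : WritesIn {1, 2, 3, z} ∅ (fop q f z x y) := by
  refine ⟨by simp [WritesIn], by simp [WritesIn], WritesIn.caseOf (by simp) (by simp) ?_⟩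
  intro P hP
  obtain ⟨i, -, rfl⟩ := List.mem_map.1 hP
  refine ⟨by simp [WritesIn], by simp [WritesIn], WritesIn.caseOf (by simp) (by simp) ?_⟩
  intro P hP
  obtain ⟨j, -, rfl⟩ := List.mem_map.1 hP
  simp [WritesIn]

/-- The operation table is hard-wired into the program, so the cost depends on `q` only and is
constant as `n` grows. No structure of the coding of the field is needed. -/
theorem tr_fop {q : ℕ} {f : ℕ → ℕ → ℕ} (hf : ∀ i j, f i j < q) {z x y : ℕ} {v : ℕ → ℕ}
    {a : ℕ → List ℕ} (hx : v x < q) (hy : v y < q) (hx1 : x ≠ 1) (hy1 : y ≠ 1) (hy2 : y ≠ 2) :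
    Tr (fop q f z x y) (fopCost q) v a fun v' a' => v' z = f (v x) (v y) ∧
      Fr {1, 2, 3, z} ∅ v a v' a' := by
  refine Tr.frame ?_ (writesIn_fop q f z x y)
  intro τ
  have hsx := size_le_self (v x)
  have hsy := size_le_self (v y)
  simp only [fop, Ens_seq, Ens_const, Ens_plus, Function.update_self, Function.update_of_ne hx1,
    add_zero]
  refine (tr_caseOf (by simp) _ (Q := fun v' _ => v' z = f (v x) (v y))
    (c := q * (2 * q + 5) + 2 * q + 3) _
    (by simpa using hx) ?_ _).mono
    fun s hs => ⟨?_, hs.2⟩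
  · intro v' hv' τ'
    simp only [Function.update_self, List.getElem_map, List.getElem_range, Ens_seq, Ens_const,
      Ens_plus, Function.update_of_ne hy1, add_zero]
    have hvy : v' y = v y := by
      rw [hv'.1 y (by simp [hy1, hy2]), Function.update_of_ne hy2, Function.update_of_ne hy1]
    refine (tr_caseOf (by simp) _ (Q := fun v' _ => v' z = f (v x) (v y)) (c := 1 + q) _
      (by simpa [hvy] using hy) ?_ _).mono
      fun s hs => ⟨?_, hs.2⟩
    · intro v'' hv'' τ''
      simp only [Function.update_self, List.getElem_map, List.getElem_range, Ens_const, hvy]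
      refine ⟨?_, trivial⟩
      have h1 := size_le_self (f (v x) (v y))
      have h2 := hf (v x) (v y)
      omega
    · have := hs.1
      simp only [List.length_map, List.length_range, hvy, Nat.size_zero] at this ⊢
      omega
  · have := hs.1
    simp only [List.length_map, List.length_range, Nat.size_zero, fopCost] at this ⊢
    omega

/-! ### Lists of field elements -/

section field

variable {F : Type*} [Field F] [Fintype F] (code : F ≃ Fin (Fintype.card F))

/-- The field element with a given code. -/
def dec (m : ℕ) : F := if h : m < Fintype.card F then code.symm ⟨m, h⟩ else 0

theorem dec_code (x : F) : dec code (code x) = x := by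
  simp [dec]

theorem code_dec {m : ℕ} (h : m < Fintype.card F) : (code (dec code m) : ℕ) = m := by
  simp [dec, h]

/-- Addition of codes. -/
def addc (i j : ℕ) : ℕ := code (dec code i + dec code j)

/-- Multiplication of codes. -/
def mulc (i j : ℕ) : ℕ := code (dec code i * dec code j)

/-- The list of the codes of the first `N` values of `φ`. -/
def lst (N : ℕ) (φ : ℕ → F) : List ℕ := (List.range N).map fun k => (code (φ k) : ℕ)

theorem length_lst (N : ℕ) (φ : ℕ → F) : (lst code N φ).length = N := by simp [lst]

theorem lst_zero (φ : ℕ → F) : lst code 0 φ = [] := rfl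

theorem lst_succ (N : ℕ) (φ : ℕ → F) : lst code (N + 1) φ = lst code N φ ++ [(code (φ N) : ℕ)] := by
  simp [lst, List.range_succ]

theorem getD_lst {N k : ℕ} (φ : ℕ → F) (h : k < N) : (lst code N φ).getD k 0 = code (φ k) := by
  simp [lst, h]

theorem lst_congr {N : ℕ} {φ ψ : ℕ → F} (h : ∀ k < N, φ k = ψ k) : lst code N φ = lst code N ψ :=
  List.map_congr_left fun k hk => by rw [h k (List.mem_range.1 hk)]

theorem lst_injective {N : ℕ} {φ ψ : ℕ → F} (h : lst code N φ = lst code N ψ) {k : ℕ} (hk : k < N) :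
    φ k = ψ k := by
  have := getD_lst code φ hk
  rw [h, getD_lst code ψ hk] at this
  exact code.injective (Fin.ext this.symm)

/-- The entries of a matrix with `c` columns, row by row. -/
def flat (c : ℕ) (f : ℕ → ℕ → F) (k : ℕ) : F := f (k / c) (k % c)

theorem flat_apply {c j : ℕ} (f : ℕ → ℕ → F) (i : ℕ) (hj : j < c) : flat c f (i * c + j) = f i j := by
  rw [flat, mul_comm, Nat.mul_add_div (by omega), Nat.mul_add_mod, Nat.div_eq_of_lt hj,
    Nat.mod_eq_of_lt hj, add_zero]

theorem index_lt {m c i j : ℕ} (hi : i < m) (hj : j < c) : i * c + j < m * c := by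
  have : (i + 1) * c ≤ m * c := Nat.mul_le_mul_right _ hi
  rw [add_mul] at this; omega

theorem getD_lst_flat {m c i j : ℕ} (f : ℕ → ℕ → F) (hi : i < m) (hj : j < c) :
    (lst code (m * c) (flat c f)).getD (i * c + j) 0 = code (f i j) := by
  rw [getD_lst code _ (index_lt hi hj), flat_apply f i hj]

/-! ### Dot products and matrix products -/

/-- One step of a dot product. -/
def dotStep (A B : ℕ) : Prog :=
  .load 15 A 11 ;; .load 16 B 12 ;; fop (Fintype.card F) (mulc code) 17 15 16 ;;
    fop (Fintype.card F) (addc code) 10 10 17 ;; .const 1 1 ;; .plus 11 11 1 ;; .plus 12 12 13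

/-- `v₁₀ := ∑ₖ A[v₁₁ + k] B[v₁₂ + k v₁₃]`, for `k < v₀`. -/
def dot (A B : ℕ) : Prog :=
  .const 10 (code 0) ;; .const 1 0 ;; .plus 14 0 1 ;; .forN 14 (dotStep code A B)

/-- A bound for the running time of `dot`. -/
def dotCost (q n l : ℕ) : ℕ := n * (2 * fopCost q + 2 * q + 8 * l + 20) + l + q + 10

theorem writesIn_dotStep (A B : ℕ) :
    WritesIn {1, 2, 3, 10, 11, 12, 14, 15, 16, 17} ∅ (dotStep code A B) :=
  ⟨by simp [WritesIn], by simp [WritesIn],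
    (writesIn_fop _ _ _ _ _).mono (by intro x; simp; omega) le_rfl,
    (writesIn_fop _ _ _ _ _).mono (by intro x; simp; omega) le_rfl, by simp [WritesIn]⟩

theorem writesIn_dot (A B : ℕ) : WritesIn {1, 2, 3, 10, 11, 12, 14, 15, 16, 17} ∅ (dot code A B) :=
  ⟨by simp [WritesIn], by simp [WritesIn], by simp [WritesIn],
    WritesIn.forN (by simp) (by simp) (writesIn_dotStep code A B)⟩

/-- The stride in variable `13` makes the second factor a column of a matrix with `c` columns stored
by rows. Here and below, `W` majorizes the indices and counters that occur and `l` bounds its bit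
length, so handling such a number costs at most `l`. -/
theorem tr_dot {A B n c i j W l : ℕ} {v : ℕ → ℕ} {a : ℕ → List ℕ} {f g : ℕ → F}
    (hW : Nat.size W ≤ l) (hn : v 0 = n) (hi : v 11 = i) (hj : v 12 = j) (hc : v 13 = c)
    (hiW : i + n ≤ W) (hjW : j + n * c ≤ W)
    (hcW : c ≤ W) (hf : ∀ k < n, (a A).getD (i + k) 0 = code (f k))
    (hg : ∀ k < n, (a B).getD (j + k * c) 0 = code (g k)) :
    Tr (dot code A B) (dotCost (Fintype.card F) n l) v a fun v' a' =>
      v' 10 = code (∑ k ∈ Finset.range n, f k * g k) ∧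
      Fr {1, 2, 3, 10, 11, 12, 14, 15, 16, 17} ∅ v a v' a' := by
  refine Tr.frame ?_ (writesIn_dot code A B)
  intro τ
  have hq : ∀ x : F, Nat.size (code x) ≤ Fintype.card F := fun x =>
    (size_le_self _).trans (code x).2.le
  simp only [dot, Ens_seq, Ens_const, Ens_plus]
  simp only [Function.update_apply, Nat.reduceEqDiff, if_true, if_false, add_zero, hn]
  refine (Tr.forN_frame (N := n) (l := l) (vs := {1, 2, 3, 10, 11, 12, 14, 15, 16, 17}) (as := ∅)
    (c := 2 * fopCost (Fintype.card F) + 2 * Fintype.card F + 6 * l + 15)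
    (I := fun k v' _ => v' 10 = code (∑ k ∈ Finset.range k, f k * g k) ∧ v' 11 = i + k ∧
      v' 12 = j + k * c) (writesIn_dotStep code A B)
      (by simp) (by simp) (by simp) (size_le_of_le hW (by omega)) ?_ ?_ ?_ _).mono fun s hs => ?_
  · simp
  · simp [hi, hj]
  · rintro k hk v' a' hF hv' ⟨h10, h11, h12⟩ τ
    have ha' : a' = a := funext fun r => hF.2 r (by simp)
    have h13 : v' 13 = c := by rw [hF.1 13 (by simp)]; simp [hc]
    subst ha'
    simp only [dotStep, Ens_seq, Ens_load, h11, h12, Function.update_apply, Nat.reduceEqDiff, if_true, if_false,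
      hf k hk, hg k hk]
    refine (tr_fop (f := mulc code) (fun i j => (code _).2) (by simp) (by simp) (by simp) (by simp)
      (by simp)).step fun v1 a1 t1 ht1 ⟨h1, hF1⟩ => ?_
    have e10 := hF1.1 10 (by simp)
    have e11 := hF1.1 11 (by simp)
    have e12 := hF1.1 12 (by simp)
    have e13 := hF1.1 13 (by simp)
    have e14 := hF1.1 14 (by simp)
    simp only [Function.update_apply, Nat.reduceEqDiff, if_true, if_false] at h1 e10 e11 e12 e13 e14
    simp only [mulc, dec_code] at h1
    refine (tr_fop (f := addc code) (fun i j => (code _).2) (by simp [e10, h10]) (by simp [h1]) (by simp) (by simp)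
      (by simp)).seqStep fun v2 a2 t2 ht2 ⟨h2, hF2⟩ => ?_
    have d11 := hF2.1 11 (by simp)
    have d12 := hF2.1 12 (by simp)
    have d13 := hF2.1 13 (by simp)
    have d14 := hF2.1 14 (by simp)
    simp only [addc, h1, e10, h10, dec_code] at h2 ht2 ⊢
    simp only [Ens_seq, Ens_const, Ens_plus, Function.update_apply, Nat.reduceEqDiff, if_true, if_false, d11,
      d12, d13, d14, e11, e12, e13, e14, h11, h12, h13, hv', h2, Nat.size_one]
    have hkc : (k + 1) * c ≤ n * c := Nat.mul_le_mul_right _ hk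
    rw [add_mul] at hkc
    have s1 : Nat.size (i + k) ≤ l := size_le_of_le hW (by omega)
    have s2 : Nat.size (j + k * c) ≤ l := size_le_of_le hW (by omega)
    have s3 : Nat.size c ≤ l := size_le_of_le hW hcW
    have s4 := hq (f k)
    have s5 := hq (g k)
    refine ⟨by omega, trivial, ?_, by ring, by ring⟩
    rw [Finset.sum_range_succ]
  · refine ⟨?_, hs.2.2.1.1⟩
    have := hs.1
    have := hq 0
    have : Nat.size n ≤ l := size_le_of_le hW (by omega)
    simp only [dotCost, Nat.size_zero] at *
    have e : n * (2 * fopCost (Fintype.card F) + 2 * Fintype.card F + 6 * l + 15 + 2 * l + 5) =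
      n * (2 * fopCost (Fintype.card F) + 2 * Fintype.card F + 8 * l + 20) := by ring
    omega

end field

/-- The variables `1, …, b - 1`, except for `13`. -/
def regs (b : ℕ) : Set ℕ := {x | 1 ≤ x ∧ x < b ∧ x ≠ 13}

theorem regs_mono {b b' : ℕ} (h : b ≤ b') : regs b ⊆ regs b' :=
  fun _ hx => ⟨hx.1, hx.2.1.trans_le h, hx.2.2⟩

section field

variable {F : Type*} [Field F] [Fintype F] (code : F ≃ Fin (Fintype.card F))

theorem writesIn_dot_regs (A B : ℕ) : WritesIn (regs 18) ∅ (dot code A B) :=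
  (writesIn_dot code A B).mono (by intro x hx; simp at hx; simp [regs]; omega) le_rfl

theorem size_code_le (x : F) : Nat.size (code x) ≤ Fintype.card F :=
  (size_le_self _).trans (code x).2.le

/-- One entry of a matrix product. -/
def matmulEntry (A B out : ℕ) : Prog :=
  .const 1 0 ;; .plus 11 20 1 ;; .plus 12 23 1 ;; dot code A B ;; .push out 10 ;; .const 1 1 ;;
    .plus 23 23 1

/-- One row of a matrix product. -/
def matmulRow (A B out : ℕ) : Prog :=
  .const 23 0 ;; .const 1 0 ;; .plus 22 13 1 ;; .forN 22 (matmulEntry code A B out) ;;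
    .plus 20 20 0

/-- The product of a matrix with `v₀` rows and columns and one with `v₁₃` columns. -/
def matmul (A B out : ℕ) : Prog :=
  .clear out ;; .const 20 0 ;; .const 1 0 ;; .plus 21 0 1 ;; .forN 21 (matmulRow code A B out)

theorem writesIn_matmulEntry (A B out : ℕ) :
    WritesIn (regs 30) {out} (matmulEntry code A B out) :=
  ⟨by simp [WritesIn, regs], by simp [WritesIn, regs], by simp [WritesIn, regs],
    (writesIn_dot_regs code A B).mono (regs_mono (by simp)) (by simp), by simp [WritesIn, regs]⟩

theorem writesIn_matmulRow (A B out : ℕ) :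
    WritesIn (regs 30) {out} (matmulRow code A B out) :=
  ⟨by simp [WritesIn, regs], by simp [WritesIn, regs], by simp [WritesIn, regs],
    WritesIn.forN (by simp [regs]) (by simp [regs]) (writesIn_matmulEntry code A B out),
    by simp [WritesIn, regs]⟩

theorem writesIn_matmul (A B out : ℕ) : WritesIn (regs 30) {out} (matmul code A B out) :=
  ⟨by simp [WritesIn, regs], by simp [WritesIn, regs], by simp [WritesIn, regs],
    by simp [WritesIn, regs],
    WritesIn.forN (by simp [regs]) (by simp [regs]) (writesIn_matmulRow code A B out)⟩

/-- A bound for the running time of `matmulRow`. -/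
def matmulRowCost (q n c l : ℕ) : ℕ := c * (dotCost q n l + 10 * l + q + 20) + 5 * l + 10

/-- A bound for the running time of `matmul`. -/
def matmulCost (q n c l : ℕ) : ℕ := n * (matmulRowCost q n c l + 2 * l + 5) + l + 10

theorem tr_matmulRow {A B out n c W l i : ℕ} {v : ℕ → ℕ} {a : ℕ → List ℕ} {f g : ℕ → ℕ → F}
    (hAo : A ≠ out) (hBo : B ≠ out) (hi : i < n)
    (hW : Nat.size W ≤ l) (hn : v 0 = n) (hc : v 13 = c) (h20 : v 20 = i * n)
    (hnW : n * n + n * c + n + c ≤ W)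
    (hf : a A = lst code (n * n) (flat n f)) (hg : a B = lst code (n * c) (flat c g))
    (hout : a out = lst code (i * c) (flat c fun i j => ∑ k ∈ Finset.range n, f i k * g k j)) :
    Tr (matmulRow code A B out) (matmulRowCost (Fintype.card F) n c l) v a fun v' a' =>
      v' 20 = (i + 1) * n ∧ v' 21 = v 21 ∧
      a' out = lst code ((i + 1) * c)
        (flat c fun i j => ∑ k ∈ Finset.range n, f i k * g k j) := by
  set φ : ℕ → F := flat c fun i j => ∑ k ∈ Finset.range n, f i k * g k j with hφ
  have hin : (i + 1) * n ≤ n * n := Nat.mul_le_mul_right _ hi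
  have hic : (i + 1) * c ≤ n * c := Nat.mul_le_mul_right _ hi
  rw [add_mul, one_mul] at hin hic
  intro τ
  simp only [matmulRow, Ens_seq, Ens_const, Ens_plus]
  simp only [Function.update_apply, Nat.reduceEqDiff, if_true, if_false, add_zero, hc]
  refine (Tr.forN_frame (N := c) (l := l) (c := dotCost (Fintype.card F) n l + 8 * l +
      Fintype.card F + 15)
    (I := fun j v' a' => v' 20 = i * n ∧ v' 23 = j ∧ v' 21 = v 21 ∧ a' out = lst code (i * c + j) φ)
    (writesIn_matmulEntry code A B out) (by simp [regs]) (by simp [regs]) (by simp)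
    (size_le_of_le hW (by omega)) ?_ ?_ ?_).step fun v1 a1 t1 ht1 ⟨_, ⟨h20', h23, h21, ho⟩, hF⟩ => ?_
  · simp
  · simp [h20, hout]
  · rintro j hj v' a' hF hv' ⟨h20', h23, h21, ho⟩ τ
    have h13 : v' 13 = c := by rw [hF.1 13 (by simp [regs])]; simp [hc]
    have h0 : v' 0 = n := by rw [hF.1 0 (by simp [regs])]; simp [hn]
    have hA' : a' A = lst code (n * n) (flat n f) := by rw [hF.2 A (by simp [hAo]), hf]
    have hB' : a' B = lst code (n * c) (flat c g) := by rw [hF.2 B (by simp [hBo]), hg]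
    simp only [matmulEntry, Ens_seq, Ens_const, Ens_plus]
    simp only [Function.update_apply, Nat.reduceEqDiff, if_true, if_false, add_zero, h20', h23]
    refine (tr_dot (n := n) (c := c) (i := i * n) (j := j) (l := l) (f := fun k => f i k)
      (g := fun k => g k j) code hW
      (by simp [h0]) (by simp) (by simp) (by simp [h13]) (by omega) ?_ (by omega) ?_ ?_).step
      fun v1 a1 t1 ht1 ⟨h1, hF1⟩ => ?_
    · have : j + n * c ≤ n * c + c := by omega
      omega
    · intro k hk
      rw [hA']; exact getD_lst_flat code f hi hk
    · intro k hk
      rw [hB', add_comm]; exact getD_lst_flat code g hk hj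
    have e20 := hF1.1 20 (by simp)
    have e21 := hF1.1 21 (by simp)
    have e22 := hF1.1 22 (by simp)
    have e23 := hF1.1 23 (by simp)
    simp only [Function.update_apply, Nat.reduceEqDiff, if_true, if_false] at e20 e21 e22 e23
    have ha1 : a1 out = lst code (i * c + j) φ := by rw [hF1.2 out (by simp), ho]
    simp only [Ens_seq, Ens_push, Ens_const, Ens_plus, Function.update_apply, Nat.reduceEqDiff, if_true,
      if_false, h1, e20, e21, e22, e23, h20', h21, h23, ha1, length_lst, hv', Nat.size_one,
      Nat.size_zero] at ht1 ⊢
    have s1 : Nat.size (i * n) ≤ l := size_le_of_le hW (by omega)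
    have s2 : Nat.size (i * c + j) ≤ l := size_le_of_le hW (by omega)
    have s3 : Nat.size j ≤ l := size_le_of_le hW (by omega)
    have s4 := size_code_le code (∑ k ∈ Finset.range n, f i k * g k j)
    refine ⟨by omega, trivial, trivial, trivial, trivial, ?_⟩
    rw [← add_assoc, lst_succ, hφ, flat_apply _ i hj]
  · have e0 : v1 0 = n := by rw [hF.1 0 (by simp [regs])]; simp [hn]
    simp only [Ens_plus, Function.update_apply, Nat.reduceEqDiff, if_true, if_false, e0, h20', h21, ho]
    have s1 : Nat.size (i * n) ≤ l := size_le_of_le hW (by omega)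
    have s2 : Nat.size n ≤ l := size_le_of_le hW (by omega)
    have s3 : Nat.size c ≤ l := size_le_of_le hW (by omega)
    simp only [Nat.size_zero] at ht1
    refine ⟨?_, by ring, trivial, by rw [add_mul, one_mul]⟩
    rw [matmulRowCost]
    have e : c * (dotCost (Fintype.card F) n l + 8 * l + Fintype.card F + 15 + 2 * l + 5) =
      c * (dotCost (Fintype.card F) n l + 10 * l + Fintype.card F + 20) := by ring
    omega

/-- Two cases are used: `c = n` in the distinguisher and in matrix powering, where cubic time is
affordable, and `c = 1` for the random test, where the cost is `Õ(n²)`. -/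
theorem tr_matmul {A B out n c W l : ℕ} {v : ℕ → ℕ} {a : ℕ → List ℕ} {f g : ℕ → ℕ → F}
    (hAo : A ≠ out) (hBo : B ≠ out)
    (hW : Nat.size W ≤ l) (hn : v 0 = n) (hc : v 13 = c) (hnW : n * n + n * c + n + c ≤ W)
    (hf : a A = lst code (n * n) (flat n f)) (hg : a B = lst code (n * c) (flat c g)) :
    Tr (matmul code A B out) (matmulCost (Fintype.card F) n c l) v a fun v' a' =>
      a' out = lst code (n * c) (flat c fun i j => ∑ k ∈ Finset.range n, f i k * g k j) ∧
      Fr (regs 30) {out} v a v' a' := by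
  refine Tr.frame ?_ (writesIn_matmul code A B out)
  set φ : ℕ → F := flat c fun i j => ∑ k ∈ Finset.range n, f i k * g k j with hφ
  intro τ
  simp only [matmul, Ens_seq, Ens_const, Ens_plus, Ens_clear]
  simp only [Function.update_apply, Nat.reduceEqDiff, if_true, if_false, add_zero, hn]
  refine (Tr.forN_frame (N := n) (l := l) (c := matmulRowCost (Fintype.card F) n c l)
    (I := fun i v' a' => v' 20 = i * n ∧ a' out = lst code (i * c) φ)
    (writesIn_matmulRow code A B out) (by simp [regs]) (by simp [regs]) (by simp)
    (size_le_of_le hW (by omega)) ?_ ?_ ?_).step fun v1 a1 t1 ht1 ⟨_, ⟨h20, ho⟩, hF⟩ => ?_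
  · simp
  · simp [lst_zero]
  · rintro i hi v' a' hF hv' ⟨h20', ho⟩
    refine (tr_matmulRow code (f := f) (g := g) hAo hBo hi hW ?_ ?_ h20' hnW ?_ ?_ ho).mono le_rfl ?_
    · rw [hF.1 0 (by simp [regs])]; simp [hn]
    · rw [hF.1 13 (by simp [regs])]; simp [hc]
    · rw [hF.2 A (by simp [hAo]), Function.update_of_ne hAo, hf]
    · rw [hF.2 B (by simp [hBo]), Function.update_of_ne hBo, hg]
    · rintro v'' a'' ⟨h1, h2, h3⟩
      simp [h1, h2, h3, hv', hφ]
  · have s2 : Nat.size n ≤ l := size_le_of_le hW (by omega)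
    simp only [Nat.size_zero] at ht1
    exact ⟨by rw [matmulCost]; show t1 ≤ _; omega, ho⟩

/-! ### Copying and comparing -/

/-- The field element with code `m`, or some field element if there is none. -/
def san (m : ℕ) : F := dec code (if m < Fintype.card F then m else 0)

theorem code_san (m : ℕ) : (code (san code m) : ℕ) = if m < Fintype.card F then m else 0 := by
  rw [san, code_dec]
  split_ifs with h
  · exact h
  · exact Fintype.card_pos

theorem san_code (x : F) : san code (code x) = x := by simp [san, dec_code]

/-- One step of `copy`. -/
def copyStep (A out : ℕ) : Prog :=
  .load 15 A 11 ;; .const 16 (Fintype.card F) ;; .minus 16 16 15 ;;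
    .ifNZ 16 (.push out 15) (.const 15 0 ;; .push out 15) ;; .const 1 1 ;; .plus 11 11 1

/-- Copy the first `v₁₄` entries of the array `A` to `out`, replacing those that are not codes. -/
def copy (F : Type*) [Fintype F] (A out : ℕ) : Prog :=
  .clear out ;; .const 11 0 ;; .forN 14 (copyStep (F := F) A out)

theorem writesIn_copyStep (A out : ℕ) : WritesIn (regs 18) {out} (copyStep (F := F) A out) := by
  simp [copyStep, WritesIn, regs]

theorem writesIn_copy (A out : ℕ) : WritesIn (regs 18) {out} (copy F A out) :=
  ⟨by simp [WritesIn], by simp [WritesIn, regs],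
    WritesIn.forN (by simp [regs]) (by simp [regs]) (writesIn_copyStep A out)⟩

/-- An array produced by the given inverter may hold huge numbers. Reading them costs at most the
weight of the array in total, which the running time of the inverter bounds. -/
theorem sum_size_le_weight (L : List ℕ) (N : ℕ) :
    ∑ k ∈ Finset.range N, Nat.size (L.getD k 0) ≤ weight L := by
  induction N generalizing L with
  | zero => simp
  | succ N ih =>
    rw [Finset.sum_range_succ']
    cases L with
    | nil => simp [weight, Nat.size_zero]
    | cons x L =>
      have := ih L
      simp only [List.getD_cons_succ, List.getD_cons_zero, weight, List.map_cons, List.sum_cons] at *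
      omega

/-- A bound for the running time of `copy`. -/
def copyCost (q N l w : ℕ) : ℕ := 2 * w + N * (4 * q + 5 * l + 25) + 10

theorem tr_copy {A out N W l : ℕ} {v : ℕ → ℕ} {a : ℕ → List ℕ} (hAo : A ≠ out)
    (hW : Nat.size W ≤ l) (hN : v 14 = N) (hNW : N ≤ W) :
    Tr (copy F A out) (copyCost (Fintype.card F) N l (weight (a A))) v a fun v' a' =>
      a' out = lst code N (fun k => san code ((a A).getD k 0)) ∧ Fr (regs 18) {out} v a v' a' := by
  refine Tr.frame ?_ (writesIn_copy A out)
  intro τ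
  simp only [copy, Ens_seq, Ens_const, Ens_clear]
  -- Single entries have no useful size bound, so the cost is summed over the rounds instead of
  -- using a uniform bound for a round.
  refine (Tr.forN_frame_sum (N := N) (l := l)
    (c := fun k => 2 * Nat.size ((a A).getD k 0) + (4 * Fintype.card F + 3 * l + 20))
    (I := fun k v' a' => v' 11 = k ∧ a' out = lst code k (fun k => san code ((a A).getD k 0)))
    (writesIn_copyStep A out) (by simp [regs]) (by simp [regs]) (by simp)
    (size_le_of_le hW (by omega)) ?_ ?_ ?_).step fun v1 a1 t1 ht1 ⟨_, ⟨h20, ho⟩, hF⟩ => ?_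
  · simp [hN]
  · simp [lst_zero]
  · rintro k hk v' a' hF hv' ⟨h11, ho⟩ τ
    have hA' : a' A = a A := by rw [hF.2 A (by simp [hAo]), Function.update_of_ne hAo]
    have hq := size_le_self (Fintype.card F)
    have hq' := size_le_self (Fintype.card F - (a A).getD k 0)
    have s1 : Nat.size k ≤ l := size_le_of_le hW (by omega)
    simp only [copyStep, Ens_seq, Ens_const, Ens_load, Ens_minus, Ens_ite, Ens_push, Ens_plus]
    simp only [Function.update_apply, Nat.reduceEqDiff, if_true, if_false, add_zero, hA', h11, ho,
      length_lst, hv', Nat.size_one, Nat.size_zero]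
    have hcode := code_san code ((a A).getD k 0)
    have hq'' := size_le_self ((a A).getD k 0)
    split_ifs with h
    · rw [if_neg (by omega)] at hcode
      refine ⟨by omega, trivial, trivial, ?_⟩
      rw [lst_succ, hcode]
    · rw [if_pos (by omega)] at hcode
      refine ⟨by omega, trivial, trivial, ?_⟩
      rw [lst_succ, hcode]
  · refine ⟨?_, ho⟩
    simp only [Nat.size_zero, Finset.sum_add_distrib, ← Finset.mul_sum, Finset.sum_const,
      Finset.card_range, smul_eq_mul] at ht1
    have := sum_size_le_weight (a A) N
    have e : N * (4 * Fintype.card F + 5 * l + 25) =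
      4 * (N * Fintype.card F) + 5 * (N * l) + 25 * N := by ring
    have e' : N * (2 * l + 5) = 2 * (N * l) + 5 * N := by ring
    have e'' : N * (4 * Fintype.card F) = 4 * (N * Fintype.card F) := by ring
    have e₃ : N * (3 * l) = 3 * (N * l) := by ring
    rw [copyCost]
    show t1 ≤ _
    omega

theorem weight_lst_le (N : ℕ) (φ : ℕ → F) : weight (lst code N φ) ≤ N * (Fintype.card F + 1) := by
  induction N with
  | zero => simp [lst_zero, weight]
  | succ N ih =>
    rw [lst_succ, weight_append, add_mul]
    have := size_code_le code (φ N)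
    have h : weight [(code (φ N) : ℕ)] = 1 + Nat.size (code (φ N)) := by simp [weight]
    omega

/-- One step of `eqCheck`. -/
def eqStep (A B : ℕ) : Prog :=
  .load 15 A 11 ;; .load 16 B 11 ;; .minus 17 15 16 ;; .minus 10 16 15 ;; .plus 17 17 10 ;;
    .ifNZ 17 (.const 18 1) .skip ;; .const 1 1 ;; .plus 11 11 1

/-- Set `v₁₈` to `1` if the arrays `A` and `B` differ in their first `v₁₄` entries. -/
def eqCheck (A B : ℕ) : Prog := .const 11 0 ;; .forN 14 (eqStep A B)

theorem writesIn_eqStep (A B : ℕ) : WritesIn (regs 19) ∅ (eqStep A B) := by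
  simp [eqStep, WritesIn, regs]

theorem writesIn_eqCheck (A B : ℕ) : WritesIn (regs 19) ∅ (eqCheck A B) :=
  ⟨by simp [WritesIn, regs], WritesIn.forN (by simp [regs]) (by simp [regs]) (writesIn_eqStep A B)⟩

/-- A bound for the running time of `eqCheck`. -/
def eqCost (q N l : ℕ) : ℕ := N * (12 * q + 6 * l + 35) + 10

theorem tr_eqCheck {A B N W l : ℕ} {v : ℕ → ℕ} {a : ℕ → List ℕ} {φ ψ : ℕ → F}
    (hW : Nat.size W ≤ l) (hN : v 14 = N) (hNW : N ≤ W)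
    (hA : a A = lst code N φ) (hB : a B = lst code N ψ) :
    Tr (eqCheck A B) (eqCost (Fintype.card F) N l) v a fun v' a' =>
      ((v' 18 = 0 ↔ v 18 = 0 ∧ ∀ k < N, φ k = ψ k) ∧ v' 18 ≤ max (v 18) 1) ∧ Fr (regs 19) ∅ v a v' a' := by
  refine Tr.frame ?_ (writesIn_eqCheck A B)
  intro τ
  simp only [eqCheck, Ens_seq, Ens_const]
  refine (Tr.forN_frame (N := N) (l := l) (c := 12 * Fintype.card F + 4 * l + 30)
    (I := fun k v' _ => v' 11 = k ∧ (v' 18 = 0 ↔ v 18 = 0 ∧ ∀ i < k, φ i = ψ i) ∧ v' 18 ≤ max (v 18) 1)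
    (writesIn_eqStep A B) (by simp [regs]) (by simp [regs]) (by simp)
    (size_le_of_le hW (by omega)) ?_ ?_ ?_).step fun v1 a1 t1 ht1 ⟨_, ⟨h20, ho⟩, hF⟩ => ?_
  · simp [hN]
  · simp
  · rintro k hk v' a' hF hv' ⟨h11, ho, hmax⟩ τ
    have ha' : a' = a := funext fun r => hF.2 r (by simp)
    have s1 : Nat.size k ≤ l := size_le_of_le hW (by omega)
    have s2 := size_code_le code (φ k)
    have s3 := size_code_le code (ψ k)
    have s4 := Nat.size_le_size (Nat.sub_le (code (φ k) : ℕ) (code (ψ k)))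
    have s5 := Nat.size_le_size (Nat.sub_le (code (ψ k) : ℕ) (code (φ k)))
    have s6 := size_add_le (s4.trans s2) (s5.trans s3)
    have hq : 1 ≤ Fintype.card F := Fintype.card_pos
    simp only [eqStep, Ens_seq, Ens_const, Ens_load, Ens_minus, Ens_ite, Ens_skip, Ens_plus]
    simp only [Function.update_apply, Nat.reduceEqDiff, if_true, if_false, add_zero, ha', h11, hA, hB,
      getD_lst code _ hk, length_lst, hv', Nat.size_one, Nat.size_zero]
    have hall : (∀ i < k + 1, φ i = ψ i) ↔ (∀ i < k, φ i = ψ i) ∧ φ k = ψ k :=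
      Nat.forall_lt_succ_right
    -- Subtraction is truncated, so equality requires both differences to vanish.
    have heq : (code (φ k) : ℕ) - code (ψ k) + ((code (ψ k) : ℕ) - code (φ k)) = 0 ↔ φ k = ψ k := by
      constructor
      · intro h; exact code.injective (Fin.ext (by omega))
      · intro h; rw [h]; omega
    split_ifs with h
    · refine ⟨by omega, trivial, trivial, ?_, hmax⟩
      rw [ho, hall, heq.1 h]; simp
    · refine ⟨by omega, trivial, trivial, ?_, by simp⟩
      rw [hall]
      rw [heq] at h
      simp [h]
  · refine ⟨?_, ho⟩
    simp only [Nat.size_zero] at ht1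
    have e : N * (12 * Fintype.card F + 4 * l + 30 + 2 * l + 5) =
      N * (12 * Fintype.card F + 6 * l + 35) := by ring
    rw [eqCost]
    show t1 ≤ _
    omega

end field

/-! ### Evaluation of circuits -/

theorem getD_flatMap {α : Type*} {f : α → List ℕ} {d : ℕ} (hf : ∀ x, (f x).length = d)
    (L : List α) : ∀ (g : ℕ) (hg : g < L.length) (r : ℕ), r < d →
      (L.flatMap f).getD (d * g + r) 0 = (f L[g]).getD r 0 := by
  induction L with
  | nil => intro g hg; simp at hg
  | cons x L ih =>
    intro g hg r hr
    rw [List.flatMap_cons]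
    cases g with
    | zero =>
      rw [List.getD_append _ _ _ _ (by rw [hf]; omega)]
      simp
    | succ g =>
      rw [List.getD_append_right _ _ _ _ (by rw [hf, mul_add]; omega), hf]
      have : d * (g + 1) + r - d = d * g + r := by rw [mul_add]; omega
      rw [this, ih g (by simpa using hg) r hr]
      simp

theorem length_flatMap_const {α : Type*} {f : α → List ℕ} {d : ℕ} (hf : ∀ x, (f x).length = d)
    (L : List α) : (L.flatMap f).length = d * L.length := by
  induction L with
  | nil => simp
  | cons x L ih => rw [List.flatMap_cons, List.length_append, ih, hf, List.length_cons]; ring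

section field

variable {F : Type*} [Field F] [Fintype F] (code : F ≃ Fin (Fintype.card F))

theorem length_encGate (g : Gate F) : (encGate code g).length = 3 := by cases g <;> rfl

variable {n : ℕ} (C : Circuit F n n)

theorem encCircuit_zero : (encCircuit code C).getD 0 0 = C.gates.length := rfl

theorem encCircuit_gate {g r : ℕ} (hg : g < C.gates.length) (hr : r < 3) :
    (encCircuit code C).getD (1 + 3 * g + r) 0 = (encGate code C.gates[g]).getD r 0 := by
  have : 1 + 3 * g + r = (3 * g + r) + 1 := by ring
  rw [encCircuit, this, List.getD_cons_succ, List.getD_append, getD_flatMap (length_encGate code) _ g hg r hr]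
  rw [length_flatMap_const (length_encGate code)]; omega

theorem encCircuit_output (i : Fin n) :
    (encCircuit code C).getD (1 + 3 * C.gates.length + i) 0 = C.outputs i := by
  have : 1 + 3 * C.gates.length + i = (3 * C.gates.length + i) + 1 := by ring
  rw [encCircuit, this, List.getD_cons_succ, List.getD_append_right,
    length_flatMap_const (length_encGate code)]
  · simp
  · rw [length_flatMap_const (length_encGate code)]; omega

/-- The values on the inputs and the first `g` gates. -/
def wires (v : Fin n → F) (g : ℕ) : List F :=
  (C.gates.take g).foldl (fun w g => w ++ [g.eval w]) (List.ofFn v)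

theorem wires_zero (v : Fin n → F) : wires C v 0 = List.ofFn v := by simp [wires]

theorem wires_succ (v : Fin n → F) {g : ℕ} (hg : g < C.gates.length) :
    wires C v (g + 1) = wires C v g ++ [(C.gates[g]).eval (wires C v g)] := by
  rw [wires, List.take_succ_eq_append_getElem hg, List.foldl_append]
  rfl

theorem length_wires (v : Fin n → F) {g : ℕ} (hg : g ≤ C.gates.length) :
    (wires C v g).length = n + g := by
  induction g with
  | zero => simp [wires_zero]
  | succ g ih => rw [wires_succ C v hg, List.length_append, ih (by omega)]; simp; omega

theorem getD_map_code {L : List F} {i : ℕ} (h : i < L.length) :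
    (L.map fun x => (code x : ℕ)).getD i 0 = code (L.getD i 0) := by
  simp [h]

/-- Load one wire of the inputs; array `9` holds the wires. -/
def inputStep (src : ℕ) : Prog := .load 15 src 11 ;; .push 9 15 ;; .plus 11 11 0

/-- Evaluate one gate. -/
def gateStep (cir : ℕ) : Prog :=
  .load 15 cir 12 ;; .const 1 1 ;; .plus 12 12 1 ;; .load 16 cir 12 ;; .plus 12 12 1 ;;
    .load 17 cir 12 ;; .plus 12 12 1 ;; caseOf 15 [.push 9 16,
      .load 10 9 16 ;; .load 11 9 17 ;; fop (Fintype.card F) (addc code) 18 10 11 ;; .push 9 18,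
      .load 10 9 16 ;; .load 11 9 17 ;; fop (Fintype.card F) (mulc code) 18 10 11 ;; .push 9 18]

/-- Output one wire. -/
def outputStep (cir out : ℕ) : Prog :=
  .load 15 cir 12 ;; .load 16 9 15 ;; .push out 16 ;; .const 1 1 ;; .plus 12 12 1

/-- Evaluate the circuit `cir` at column `v₃₀` of the matrix `src` and append the result to
`out`. -/
def colEval (cir src out : ℕ) : Prog :=
  .clear 9 ;; .const 1 0 ;; .plus 11 30 1 ;; .plus 14 0 1 ;; .forN 14 (inputStep src) ;;
    .const 12 0 ;; .load 20 cir 12 ;; .const 12 1 ;; .forN 20 (gateStep code cir) ;;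
    .const 1 0 ;; .plus 21 0 1 ;; .forN 21 (outputStep cir out)

theorem writesIn_inputStep (src : ℕ) : WritesIn (regs 30) {9} (inputStep src) := by
  simp [inputStep, WritesIn, regs]

theorem writesIn_gateStep (cir : ℕ) : WritesIn (regs 30) {9} (gateStep code cir) := by
  have h : ∀ f, WritesIn (regs 30) {9} (fop (Fintype.card F) f 18 10 11) := fun f =>
    (writesIn_fop _ f 18 10 11).mono (by intro x hx; simp at hx; simp [regs]; omega) (by simp)
  refine ⟨by simp [WritesIn, regs], by simp [WritesIn, regs], by simp [WritesIn, regs],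
    by simp [WritesIn, regs], by simp [WritesIn, regs], by simp [WritesIn, regs],
    by simp [WritesIn, regs], WritesIn.caseOf (by simp [regs]) (by simp [regs]) ?_⟩
  intro P hP
  simp only [List.mem_cons, List.not_mem_nil, or_false] at hP
  rcases hP with rfl | rfl | rfl
  · simp [WritesIn]
  · exact ⟨by simp [WritesIn, regs], by simp [WritesIn, regs], h _, by simp [WritesIn, regs]⟩
  · exact ⟨by simp [WritesIn, regs], by simp [WritesIn, regs], h _, by simp [WritesIn, regs]⟩

theorem writesIn_outputStep (cir out : ℕ) : WritesIn (regs 30) {out} (outputStep cir out) := by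
  simp [outputStep, WritesIn, regs]

theorem writesIn_colEval (cir src out : ℕ) :
    WritesIn (regs 30) {9, out} (colEval code cir src out) :=
  ⟨by simp [WritesIn, regs], by simp [WritesIn, regs], by simp [WritesIn, regs],
    by simp [WritesIn, regs],
    WritesIn.forN (by simp [regs]) (by simp [regs]) ((writesIn_inputStep src).mono le_rfl (by simp)),
    by simp [WritesIn, regs], by simp [WritesIn, regs], by simp [WritesIn, regs],
    WritesIn.forN (by simp [regs]) (by simp [regs])
      ((writesIn_gateStep code cir).mono le_rfl (by simp)),
    by simp [WritesIn, regs], by simp [WritesIn, regs],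
    WritesIn.forN (by simp [regs]) (by simp [regs])
      ((writesIn_outputStep cir out).mono le_rfl (by simp))⟩

/-- A bound for the running time of one step of a circuit evaluation. -/
def stepCost (q l : ℕ) : ℕ := fopCost q + 4 * q + 20 * l + 60

/-- A gate costs two array accesses and one table lookup, hence time linear in `l` for fixed `q`.
The circuit evaluation is therefore quasilinear in its size. -/
theorem tr_gateStep {cir W l g : ℕ} {v : ℕ → ℕ} {a : ℕ → List ℕ} {u : Fin n → F}
    (hW : Nat.size W ≤ l) (hcir : a cir = encCircuit code C) (hg : g < C.gates.length)
    (hmW : n + 3 * C.gates.length + Fintype.card F + 10 ≤ W) (h12 : v 12 = 1 + 3 * g)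
    (h9 : a 9 = (wires C u g).map fun x => (code x : ℕ)) :
    Tr (gateStep code cir) (stepCost (Fintype.card F) l) v a fun v' a' =>
      v' 12 = 1 + 3 * (g + 1) ∧ v' 20 = v 20 ∧
      a' 9 = (wires C u (g + 1)).map fun x => (code x : ℕ) := by
  intro τ
  have hlen := length_wires C u hg.le
  have hlen9 : (a 9).length = n + g := by rw [h9, List.length_map, hlen]
  have g0 := encCircuit_gate code C hg (r := 0) (by omega)
  have g1 := encCircuit_gate code C hg (r := 1) (by omega)
  have g2 := encCircuit_gate code C hg (r := 2) (by omega)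
  have hin := C.inRange g hg
  have s1 : Nat.size (1 + 3 * g) ≤ l := size_le_of_le hW (by omega)
  have s2 : Nat.size (1 + 3 * g + 1) ≤ l := size_le_of_le hW (by omega)
  have s3 : Nat.size (1 + 3 * g + 1 + 1) ≤ l := size_le_of_le hW (by omega)
  have s4 : Nat.size (n + g) ≤ l := size_le_of_le hW (by omega)
  rw [wires_succ C u hg]
  simp only [add_zero] at g0
  -- Addition and multiplication gates are handled together. The range condition of the circuit
  -- guarantees that both operands are already in array `9`.
  have hop : ∀ (f : ℕ → ℕ → ℕ) (op : F → F → F) (i j : ℕ), i < n + g → j < n + g →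
      (∀ x y, f (code x) (code y) = code (op x y)) → (∀ x y, f x y < Fintype.card F) →
      ∀ v' : ℕ → ℕ, v' 16 = i → v' 17 = j →
      Tr (.load 10 9 16 ;; .load 11 9 17 ;; fop (Fintype.card F) f 18 10 11 ;; .push 9 18)
        (fopCost (Fintype.card F) + 4 * l + 3 * Fintype.card F + 6) v' a fun v'' a'' =>
        v'' 12 = v' 12 ∧ v'' 20 = v' 20 ∧ a'' 9 = ((wires C u g) ++ [op ((wires C u g).getD i 0)
          ((wires C u g).getD j 0)]).map fun x => (code x : ℕ) := by
    intro f op i j hi hj hf hfq v' h16 h17 τ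
    have e1 : (a 9).getD i 0 = code ((wires C u g).getD i 0) := by
      rw [h9]; exact getD_map_code code (by omega)
    have e2 : (a 9).getD j 0 = code ((wires C u g).getD j 0) := by
      rw [h9]; exact getD_map_code code (by omega)
    simp only [Ens_seq, Ens_load]
    simp only [Function.update_apply, Nat.reduceEqDiff, if_true, if_false, h16, h17, e1, e2]
    refine (tr_fop (f := f) hfq (by simp) (by simp) (by simp) (by simp) (by simp)).step
      fun v1 a1 t1 ht1 ⟨h1, hF1⟩ => ?_
    have e12 := hF1.1 12 (by simp)
    have e20 := hF1.1 20 (by simp)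
    have ha1 : a1 9 = a 9 := hF1.2 9 (by simp)
    simp only [Function.update_apply, Nat.reduceEqDiff, if_true, if_false, hf] at h1 e12 e20
    simp only [Ens_push, h1, e12, e20, ha1, Function.update_self, hlen9]
    have s5 : Nat.size i ≤ l := size_le_of_le hW (by omega)
    have s6 : Nat.size j ≤ l := size_le_of_le hW (by omega)
    have s7 := size_code_le code ((wires C u g).getD i 0)
    have s8 := size_code_le code ((wires C u g).getD j 0)
    have s9 := size_code_le code (op ((wires C u g).getD i 0) ((wires C u g).getD j 0))
    refine ⟨by omega, trivial, trivial, ?_⟩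
    rw [h9, List.map_append]; rfl
  simp only [gateStep, Ens_seq, Ens_load, Ens_const, Ens_plus]
  simp only [Function.update_apply, Nat.reduceEqDiff, if_true, if_false, h12, hcir, Nat.size_one]
  have hpos : 1 + 3 * g + 1 + 1 + 1 = 1 + 3 * (g + 1) := by ring
  have hpos2 : 1 + 3 * g + 1 + 1 = 1 + 3 * g + 2 := by ring
  rcases hgate : C.gates[g] with x | ⟨i, j⟩ | ⟨i, j⟩
  · rw [hgate] at g0 g1 g2 hin
    simp only [encGate, List.getD_cons_zero, List.getD_cons_succ] at g0 g1 g2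
    rw [hpos2] at *
    simp only [g0, g1, g2]
    have s5 := size_code_le code x
    refine (tr_caseOf (t := 15) (by simp) _ (c := l + Fintype.card F + 1)
      (Q := fun v'' a'' => v'' 12 = 1 + 3 * (g + 1) ∧ v'' 20 = v 20 ∧
        a'' 9 = ((wires C u g) ++ [x]).map fun x => (code x : ℕ)) _ (by simp) ?_).step
      fun v1 a1 t1 ht1 hQ => ?_
    · intro v' hv'
      simp only [Function.update_apply, Nat.reduceEqDiff, if_true, if_false, List.getElem_cons_zero]
      intro τ'
      have e12 := hv'.1 12 (by simp)
      have e16 := hv'.1 16 (by simp)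
      have e20 := hv'.1 20 (by simp)
      simp only [Function.update_apply, Nat.reduceEqDiff, if_true, if_false] at e12 e16 e20
      simp only [Ens_push, e12, e16, e20, Function.update_self, hlen9]
      refine ⟨by omega, by omega, trivial, ?_⟩
      rw [h9, List.map_append]; rfl
    · simp only [List.length_cons, List.length_nil, Nat.size_zero] at ht1
      refine ⟨?_, hQ⟩
      show t1 ≤ _
      rw [stepCost]
      omega
  · rw [hgate] at g0 g1 g2 hin
    simp only [encGate, List.getD_cons_zero, List.getD_cons_succ] at g0 g1 g2
    obtain ⟨hi, hj⟩ := hin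
    rw [hpos2] at *
    simp only [g0, g1, g2]
    have s5 : Nat.size i ≤ l := size_le_of_le hW (by omega)
    have s6 : Nat.size j ≤ l := size_le_of_le hW (by omega)
    refine (tr_caseOf (t := 15) (by simp) _
      (c := fopCost (Fintype.card F) + 4 * l + 3 * Fintype.card F + 6)
      (Q := fun v'' a'' => v'' 12 = 1 + 3 * (g + 1) ∧ v'' 20 = v 20 ∧
        a'' 9 = ((wires C u g) ++ [(wires C u g).getD i 0 + (wires C u g).getD j 0]).map
          fun x => (code x : ℕ)) _ (by simp) ?_).step
      fun v1 a1 t1 ht1 hQ => ?_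
    · intro v' hv'
      simp only [Function.update_apply, Nat.reduceEqDiff, if_true, if_false, List.getElem_cons_zero,
        List.getElem_cons_succ]
      have e12 := hv'.1 12 (by simp)
      have e16 := hv'.1 16 (by simp)
      have e17 := hv'.1 17 (by simp)
      have e20 := hv'.1 20 (by simp)
      simp only [Function.update_apply, Nat.reduceEqDiff, if_true, if_false] at e12 e16 e17 e20
      refine (hop (addc code) (· + ·) i j hi hj (fun x y => by simp [addc, dec_code])
        (fun x y => (code _).2) v' e16 e17).mono le_rfl ?_
      rintro v'' a'' ⟨h1, h2, h3⟩
      exact ⟨by omega, by omega, h3⟩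
    · simp only [List.length_cons, List.length_nil, Nat.size_one] at ht1
      refine ⟨?_, hQ⟩
      show t1 ≤ _
      rw [stepCost]
      omega
  · rw [hgate] at g0 g1 g2 hin
    simp only [encGate, List.getD_cons_zero, List.getD_cons_succ] at g0 g1 g2
    obtain ⟨hi, hj⟩ := hin
    rw [hpos2] at *
    simp only [g0, g1, g2]
    have s5 : Nat.size i ≤ l := size_le_of_le hW (by omega)
    have s6 : Nat.size j ≤ l := size_le_of_le hW (by omega)
    refine (tr_caseOf (t := 15) (by simp) _
      (c := fopCost (Fintype.card F) + 4 * l + 3 * Fintype.card F + 6)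
      (Q := fun v'' a'' => v'' 12 = 1 + 3 * (g + 1) ∧ v'' 20 = v 20 ∧
        a'' 9 = ((wires C u g) ++ [(wires C u g).getD i 0 * (wires C u g).getD j 0]).map
          fun x => (code x : ℕ)) _ (by simp) ?_).step
      fun v1 a1 t1 ht1 hQ => ?_
    · intro v' hv'
      simp only [Function.update_apply, Nat.reduceEqDiff, if_true, if_false, List.getElem_cons_zero,
        List.getElem_cons_succ]
      have e12 := hv'.1 12 (by simp)
      have e16 := hv'.1 16 (by simp)
      have e17 := hv'.1 17 (by simp)
      have e20 := hv'.1 20 (by simp)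
      simp only [Function.update_apply, Nat.reduceEqDiff, if_true, if_false] at e12 e16 e17 e20
      refine (hop (mulc code) (· * ·) i j hi hj (fun x y => by simp [mulc, dec_code])
        (fun x y => (code _).2) v' e16 e17).mono le_rfl ?_
      rintro v'' a'' ⟨h1, h2, h3⟩
      exact ⟨by omega, by omega, h3⟩
    · have s7 : Nat.size 2 ≤ 2 := size_le_self 2
      simp only [List.length_cons, List.length_nil] at ht1
      refine ⟨?_, hQ⟩
      show t1 ≤ _
      rw [stepCost]
      omega

/-- The values of the circuit on the columns of `f`. -/
def colValues (f : ℕ → ℕ → F) (i k : ℕ) : F :=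
  if h : k < n then C.eval (fun t : Fin n => f t i) ⟨k, h⟩ else 0

/-- A bound for the running time of `colEval` for a circuit with `m` gates. -/
def colCost (q n m l : ℕ) : ℕ := (2 * n + m + 1) * (stepCost q l + 2 * l + 5)

/-- A column is read with stride `n`, while the result is appended as a row. The implicit
transposition is what the algorithm needs on both sides. -/
theorem tr_colEval {cir src out i W l : ℕ} {v : ℕ → ℕ} {a : ℕ → List ℕ} {f : ℕ → ℕ → F}
    (hco : cir ≠ out) (hc9 : cir ≠ 9) (hs9 : src ≠ 9) (ho9 : out ≠ 9) (hi : i < n)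
    (hW : Nat.size W ≤ l) (hn : v 0 = n) (h30 : v 30 = i)
    (hmW : n * n + 2 * n + 3 * C.gates.length + Fintype.card F + 10 ≤ W)
    (hcir : a cir = encCircuit code C)
    (hf : a src = lst code (n * n) (flat n f))
    (hout : a out = lst code (i * n) (flat n (colValues C f))) :
    Tr (colEval code cir src out) (colCost (Fintype.card F) n C.gates.length l) v a fun v' a' =>
      a' out = lst code ((i + 1) * n) (flat n (colValues C f)) ∧ Fr (regs 30) {9, out} v a v' a' := by
  refine Tr.frame ?_ (writesIn_colEval code cir src out)
  set u : Fin n → F := fun t => f t i with hu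
  have hin : (i + 1) * n ≤ n * n := Nat.mul_le_mul_right _ hi
  rw [add_mul, one_mul] at hin
  have sn : Nat.size n ≤ l := size_le_of_le hW (by omega)
  have si : Nat.size i ≤ l := size_le_of_le hW (by omega)
  intro τ
  simp only [colEval, Ens_seq, Ens_const, Ens_plus, Ens_clear]
  simp only [Function.update_apply, Nat.reduceEqDiff, if_true, if_false, add_zero, hn, h30]
  refine (Tr.forN_frame (N := n) (l := l) (c := 5 * l + 2 * Fintype.card F + 10)
    (I := fun k v' a' => v' 11 = i + k * n ∧ a' 9 = lst code k (fun k => f k i))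
    (writesIn_inputStep src) (by simp [regs]) (by simp [regs]) (by simp) sn ?_ ?_ ?_).step
    fun v1 a1 t1 ht1 ⟨_, ⟨_, h9⟩, hF1⟩ => ?_
  · simp
  · simp [lst_zero]
  · rintro k hk v' a' hF hv' ⟨h11, h9⟩ τ
    have h0 : v' 0 = n := by rw [hF.1 0 (by simp [regs])]; simp [hn]
    have hsrc : a' src = lst code (n * n) (flat n f) := by
      rw [hF.2 src (by simp [hs9]), Function.update_of_ne hs9, hf]
    have hk1 : (k + 1) * n ≤ n * n := Nat.mul_le_mul_right _ hk
    rw [add_mul, one_mul] at hk1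
    have hget : (a' src).getD (i + k * n) 0 = code (f k i) := by
      rw [hsrc, add_comm]; exact getD_lst_flat code f hk hi
    simp only [inputStep, Ens_seq, Ens_load, Ens_push, Ens_plus]
    simp only [Function.update_apply, Nat.reduceEqDiff, if_true, if_false, h11, hget, h9, length_lst, h0,
      hv']
    have s1 : Nat.size (i + k * n) ≤ l := size_le_of_le hW (by omega)
    have s2 : Nat.size k ≤ l := size_le_of_le hW (by omega)
    have s3 := size_code_le code (f k i)
    refine ⟨by omega, trivial, by ring, ?_⟩
    rw [lst_succ]
  have hcir1 : a1 cir = encCircuit code C := by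
    rw [hF1.2 cir (by simp [hc9]), Function.update_of_ne hc9, hcir]
  have hout1 : a1 out = a out := by
    rw [hF1.2 out (by simp [ho9]), Function.update_of_ne ho9]
  have h01 : v1 0 = n := by rw [hF1.1 0 (by simp [regs])]; simp [hn]
  have h9' : a1 9 = (wires C u 0).map fun x => (code x : ℕ) := by
    rw [h9, wires_zero]
    apply List.ext_getElem
    · simp [length_lst]
    · intro k h1 h2
      simp [lst, hu]
  have sm : Nat.size C.gates.length ≤ l := size_le_of_le hW (by omega)
  simp only [Ens_seq, Ens_const, Ens_load, Function.update_apply, Nat.reduceEqDiff, if_true, if_false,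
    hcir1, encCircuit_zero, Nat.size_one]
  refine Tr.step (Tr.forN_frame (N := C.gates.length) (l := l) (c := stepCost (Fintype.card F) l)
    (I := fun g v' a' => v' 12 = 1 + 3 * g ∧ a' 9 = (wires C u g).map fun x => (code x : ℕ))
    (writesIn_gateStep code cir) (by simp [regs]) (by simp [regs]) (by simp) sm ?_ ?_ ?_)
    fun v2 a2 t2 ht2 ⟨_, ⟨h12, h9''⟩, hF2⟩ => ?_
  · simp
  · simp [h9']
  · rintro g hg v' a' hF hv' ⟨h12, h9⟩
    have hcir' : a' cir = encCircuit code C := by rw [hF.2 cir (by simp [hc9]), hcir1]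
    refine (tr_gateStep code C hW hcir' hg (by omega) h12 h9).mono le_rfl ?_
    rintro v'' a'' ⟨h1, h2, h3⟩
    simp [h1, h2, h3, hv']
  have hcir2 : a2 cir = encCircuit code C := by
    rw [hF2.2 cir (by simp [hc9]), hcir1]
  have hout2 : a2 out = lst code (i * n) (flat n (colValues C f)) := by
    rw [hF2.2 out (by simp [ho9]), hout1, hout]
  have h02 : v2 0 = n := by rw [hF2.1 0 (by simp [regs])]; simp [h01]
  simp only [Ens_seq, Ens_const, Ens_plus, Function.update_apply, Nat.reduceEqDiff, if_true, if_false,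
    h02, add_zero]
  refine Tr.step (Tr.forN_frame (N := n) (l := l) (c := 8 * l + 2 * Fintype.card F + 20)
    (I := fun k v' a' => v' 12 = 1 + 3 * C.gates.length + k ∧
      a' out = lst code (i * n + k) (flat n (colValues C f)))
    (writesIn_outputStep cir out) (by simp [regs]) (by simp [regs]) (by simp) sn ?_ ?_ ?_)
    fun v3 a3 t3 ht3 ⟨_, ⟨_, ho⟩, hF3⟩ => ?_
  · simp
  · simp [h12, hout2]
  · rintro k hk v' a' hF hv' ⟨h12', ho⟩ τ
    have hcir' : a' cir = encCircuit code C := by rw [hF.2 cir (by simp [hco]), hcir2]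
    have h9₃ : a' 9 = (wires C u C.gates.length).map fun x => (code x : ℕ) := by
      rw [hF.2 9 (by simp [ho9.symm]), h9'']
    have hlen := length_wires C u le_rfl
    have hlt := (C.outputs ⟨k, hk⟩).2
    have hget := encCircuit_output code C ⟨k, hk⟩
    have hval : (wires C u C.gates.length).getD (C.outputs ⟨k, hk⟩) 0 = colValues C f i k := by
      rw [colValues, dif_pos hk, Circuit.eval, wires, List.take_length]
    have hget2 : (a' 9).getD (C.outputs ⟨k, hk⟩) 0 = code (colValues C f i k) := by
      rw [h9₃, getD_map_code code (by omega), hval]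
    simp only at hget
    have hik : i * n + k < n * n := by omega
    simp only [outputStep, Ens_seq, Ens_const, Ens_load, Ens_push, Ens_plus]
    simp only [Function.update_apply, Nat.reduceEqDiff, if_true, if_false, h12', hcir', hget, hget2, ho,
      length_lst, hv', Nat.size_one]
    have s1 : Nat.size (1 + 3 * C.gates.length + k) ≤ l := size_le_of_le hW (by omega)
    have s2 : Nat.size (C.outputs ⟨k, hk⟩ : ℕ) ≤ l := size_le_of_le hW (by omega)
    have s3 := size_code_le code (colValues C f i k)
    have s4 : Nat.size (i * n + k) ≤ l := size_le_of_le hW (by omega)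
    by_cases h9o : 9 = out
    · exact absurd h9o.symm ho9
    simp only [h9o, if_false, hget2] at *
    refine ⟨by omega, trivial, by omega, ?_⟩
    rw [← add_assoc, lst_succ, flat_apply _ i hk]
  · refine ⟨?_, by rw [add_mul, one_mul]; exact ho⟩
    show t3 ≤ _
    simp only [Nat.size_zero] at ht1 ht2 ht3
    have e : (2 * n + C.gates.length + 1) * (stepCost (Fintype.card F) l + 2 * l + 5) =
      n * (stepCost (Fintype.card F) l + 2 * l + 5) + n * (stepCost (Fintype.card F) l + 2 * l + 5) +
      C.gates.length * (stepCost (Fintype.card F) l + 2 * l + 5) +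
      (stepCost (Fintype.card F) l + 2 * l + 5) := by ring
    have e1 : n * (5 * l + 2 * Fintype.card F + 10 + 2 * l + 5) ≤
        n * (stepCost (Fintype.card F) l + 2 * l + 5) :=
      Nat.mul_le_mul_left _ (by rw [stepCost]; omega)
    have e2 : n * (8 * l + 2 * Fintype.card F + 20 + 2 * l + 5) ≤
        n * (stepCost (Fintype.card F) l + 2 * l + 5) :=
      Nat.mul_le_mul_left _ (by rw [stepCost]; omega)
    rw [colCost, e]
    have e3 : stepCost (Fintype.card F) l = fopCost (Fintype.card F) + 4 * Fintype.card F +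
      20 * l + 60 := rfl
    omega

/-- The matrix `out` whose rows are the values of the circuit `cir` on the columns of `src`. -/
def applyCols (cir src out : ℕ) : Prog :=
  .clear out ;; .const 30 0 ;; .const 1 0 ;; .plus 31 0 1 ;;
    .forN 31 (colEval code cir src out ;; .const 1 1 ;; .plus 30 30 1)

theorem writesIn_applyStep (cir src out : ℕ) :
    WritesIn (regs 40) {9, out} (colEval code cir src out ;; .const 1 1 ;; .plus 30 30 1) :=
  ⟨(writesIn_colEval code cir src out).mono (regs_mono (by simp)) le_rfl,
    by simp [WritesIn, regs], by simp [WritesIn, regs]⟩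

theorem writesIn_applyCols (cir src out : ℕ) :
    WritesIn (regs 40) {9, out} (applyCols code cir src out) :=
  ⟨by simp [WritesIn, regs], by simp [WritesIn, regs], by simp [WritesIn, regs],
    by simp [WritesIn, regs],
    WritesIn.forN (by simp [regs]) (by simp [regs]) (writesIn_applyStep code cir src out)⟩

/-- A bound for the running time of `applyCols` for a circuit with `m` gates. -/
def applyCost (q n m l : ℕ) : ℕ := n * (colCost q n m l + 4 * l + 15) + l + 10

/-- Applied to `A` with the circuit for `v ↦ vᵀR` this yields `AᵀR`, and applied to `X` with the
circuit for `v ↦ Rv` it yields `(RX)ᵀ`. Neither use multiplies two matrices explicitly. -/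
theorem tr_applyCols {cir src out W l : ℕ} {v : ℕ → ℕ} {a : ℕ → List ℕ} {f : ℕ → ℕ → F}
    (hco : cir ≠ out) (hso : src ≠ out) (hc9 : cir ≠ 9) (hs9 : src ≠ 9) (ho9 : out ≠ 9)
    (hW : Nat.size W ≤ l) (hn : v 0 = n)
    (hmW : n * n + 2 * n + 3 * C.gates.length + Fintype.card F + 10 ≤ W)
    (hcir : a cir = encCircuit code C)
    (hf : a src = lst code (n * n) (flat n f)) :
    Tr (applyCols code cir src out) (applyCost (Fintype.card F) n C.gates.length l) v a
      fun v' a' => a' out = lst code (n * n) (flat n (colValues C f)) ∧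
        Fr (regs 40) {9, out} v a v' a' := by
  refine Tr.frame ?_ (writesIn_applyCols code cir src out)
  have sn : Nat.size n ≤ l := size_le_of_le hW (by omega)
  intro τ
  simp only [applyCols, Ens_seq, Ens_const, Ens_plus, Ens_clear]
  simp only [Function.update_apply, Nat.reduceEqDiff, if_true, if_false, add_zero, hn]
  refine (Tr.forN_frame (N := n) (l := l) (c := colCost (Fintype.card F) n C.gates.length l + 2 * l + 10)
    (I := fun i v' a' => v' 30 = i ∧ a' out = lst code (i * n) (flat n (colValues C f)))
    (writesIn_applyStep code cir src out) (by simp [regs]) (by simp [regs]) (by simp) sn ?_ ?_ ?_).step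
    fun v1 a1 t1 ht1 ⟨_, ⟨_, ho⟩, hF1⟩ => ?_
  · simp
  · simp [lst_zero]
  · rintro i hi v' a' hF hv' ⟨h30, ho⟩ τ
    have h0 : v' 0 = n := by rw [hF.1 0 (by simp [regs])]; simp [hn]
    have hcir' : a' cir = encCircuit code C := by
      rw [hF.2 cir (by simp [hc9, hco]), Function.update_of_ne hco, hcir]
    have hsrc' : a' src = lst code (n * n) (flat n f) := by
      rw [hF.2 src (by simp [hs9, hso]), Function.update_of_ne hso, hf]
    refine (tr_colEval code C hco hc9 hs9 ho9 hi hW h0 h30 hmW hcir' hsrc' ho).seqStep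
      fun v2 a2 t2 ht2 ⟨h1, hF2⟩ => ?_
    have e30 := hF2.1 30 (by simp [regs])
    have e31 := hF2.1 31 (by simp [regs])
    have si : Nat.size i ≤ l := size_le_of_le hW (by omega)
    simp only [Ens_seq, Ens_const, Ens_plus]
    simp only [Function.update_apply, Nat.reduceEqDiff, if_true, if_false, e30, e31, h30, hv', h1,
      Nat.size_one]
    refine ⟨by omega, trivial, trivial, trivial⟩
  · refine ⟨?_, ho⟩
    show t1 ≤ _
    simp only [Nat.size_zero] at ht1
    have e : n * (colCost (Fintype.card F) n C.gates.length l + 2 * l + 10 + 2 * l + 5) =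
      n * (colCost (Fintype.card F) n C.gates.length l + 4 * l + 15) := by ring
    rw [applyCost]
    omega

end field

/-- The variables `1, …, b - 1`. -/
def low (b : ℕ) : Set ℕ := {x | 1 ≤ x ∧ x < b}

theorem low_mono {b b' : ℕ} (h : b ≤ b') : low b ⊆ low b' := fun _ hx => ⟨hx.1, hx.2.trans_le h⟩

theorem regs_subset_low {b b' : ℕ} (h : b ≤ b') : regs b ⊆ low b' :=
  fun _ hx => ⟨hx.1, hx.2.1.trans_le h⟩

/-! ### Matrices as arrays of codes, and polynomial-time inversion -/

section field

variable {F : Type*} [Field F] [Fintype F] (code : F ≃ Fin (Fintype.card F)) {n : ℕ}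

/-- The entries of a matrix, extended by `0`. -/
def ext (A : Matrix (Fin n) (Fin n) F) (i j : ℕ) : F :=
  if h : i < n ∧ j < n then A ⟨i, h.1⟩ ⟨j, h.2⟩ else 0

theorem ext_apply (A : Matrix (Fin n) (Fin n) F) (i j : Fin n) : ext A i j = A i j := by
  simp [ext]

theorem flatMap_range (f : ℕ → ℕ → ℕ) (m c : ℕ) :
    ((List.range m).flatMap fun i => (List.range c).map fun j => f i j) =
      (List.range (m * c)).map fun k => f (k / c) (k % c) := by
  induction m with
  | zero => simp
  | succ m ih =>
    rw [List.range_succ, List.flatMap_append, ih, add_mul, one_mul, List.range_add, List.map_append]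
    congr 1
    simp only [List.flatMap_cons, List.flatMap_nil, List.append_nil, List.map_map]
    apply List.map_congr_left
    intro j hj
    have hj := List.mem_range.1 hj
    simp only [Function.comp]
    rw [mul_comm m c, Nat.mul_add_div (by omega), Nat.mul_add_mod, Nat.div_eq_of_lt hj,
      Nat.mod_eq_of_lt hj, add_zero]

theorem encMatrix_eq (A : Matrix (Fin n) (Fin n) F) :
    encMatrix code A = lst code (n * n) (flat n (ext A)) := by
  have h := flatMap_range (fun i j => (code (ext A i j) : ℕ)) n n
  rw [lst]
  refine Eq.trans ?_ h
  rw [encMatrix, ← List.map_coe_finRange_eq_range, List.flatMap_map]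
  congr 1; funext i
  rw [List.map_map]
  apply List.map_congr_left
  intro j _
  simp [ext_apply]

theorem encMatrix_congr {A : Matrix (Fin n) (Fin n) F} {f : ℕ → ℕ → F}
    (h : ∀ i j : Fin n, f i j = A i j) : lst code (n * n) (flat n f) = encMatrix code A := by
  rw [encMatrix_eq]
  apply lst_congr
  intro k hk
  have h1 : k / n < n := Nat.div_lt_of_lt_mul hk
  have hn : 0 < n := Nat.pos_of_ne_zero (by rintro rfl; simp at hk)
  have h2 : k % n < n := Nat.mod_lt _ hn
  rw [flat, flat, ext, dif_pos ⟨h1, h2⟩]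
  exact h ⟨_, h1⟩ ⟨_, h2⟩

theorem encMatrix_injective : Function.Injective (encMatrix code (n := n)) := by
  intro A B h
  rw [encMatrix_eq, encMatrix_eq] at h
  ext i j
  have := lst_injective code h (index_lt i.2 j.2)
  rwa [flat_apply _ _ j.2, flat_apply _ _ j.2, ext_apply, ext_apply] at this

theorem length_encMatrix (A : Matrix (Fin n) (Fin n) F) : (encMatrix code A).length = n * n := by
  rw [encMatrix_eq, length_lst]

theorem weight_encMatrix_le (A : Matrix (Fin n) (Fin n) F) :
    weight (encMatrix code A) ≤ n * n * (Fintype.card F + 1) := by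
  rw [encMatrix_eq]; exact weight_lst_le code _ _

theorem tr_matmul_enc {A B out W l : ℕ} {v : ℕ → ℕ} {a : ℕ → List ℕ}
    {X Y : Matrix (Fin n) (Fin n) F} (hAo : A ≠ out) (hBo : B ≠ out)
    (hW : Nat.size W ≤ l) (hn : v 0 = n) (hc : v 13 = n) (hnW : n * n + n * n + n + n ≤ W)
    (hf : a A = encMatrix code X) (hg : a B = encMatrix code Y) :
    Tr (matmul code A B out) (matmulCost (Fintype.card F) n n l) v a fun v' a' =>
      a' out = encMatrix code (X * Y) ∧ Fr (regs 30) {out} v a v' a' := by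
  rw [encMatrix_eq] at hf hg
  refine (tr_matmul code hAo hBo hW hn hc hnW hf hg).mono le_rfl ?_
  rintro v' a' ⟨h1, h2⟩
  refine ⟨?_, h2⟩
  rw [h1]
  apply encMatrix_congr
  intro i j
  rw [Matrix.mul_apply, ← Fin.sum_univ_eq_sum_range fun k => ext X i k * ext Y k j]
  simp only [ext_apply]

/-- Compute the square of the value of variable `0` in variable `14`. -/
def squareDim : Prog := .const 14 0 ;; .const 1 0 ;; .plus 24 0 1 ;; .forN 24 (.plus 14 14 0)

theorem writesIn_squareDim : WritesIn {1, 14, 24} ∅ squareDim :=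
  ⟨by simp [WritesIn], by simp [WritesIn], by simp [WritesIn],
    WritesIn.forN (by simp) (by simp) (by simp [WritesIn])⟩

/-- A bound for the running time of `squareDim`. -/
def squareCost (n l : ℕ) : ℕ := n * (4 * l + 6) + l + 8

theorem tr_squareDim {n W l : ℕ} {v : ℕ → ℕ} {a : ℕ → List ℕ}
    (hW : Nat.size W ≤ l) (hn : v 0 = n) (hNW : n * n + n ≤ W) :
    Tr squareDim (squareCost n l) v a fun v' a' => v' 14 = n * n ∧ Fr {1, 14, 24} ∅ v a v' a' := by
  refine Tr.frame ?_ writesIn_squareDim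
  intro τ
  simp only [squareDim, Ens_seq, Ens_const, Ens_plus]
  simp only [Function.update_apply, Nat.reduceEqDiff, if_true, if_false, add_zero, hn]
  have sn : Nat.size n ≤ l := size_le_of_le hW (by omega)
  refine Tr.step (Tr.forN_frame (N := n) (l := l) (c := 1 + 2 * l) (vs := {1, 14, 24}) (as := ∅)
    (I := fun k v' a' => v' 14 = k * n)
    (by simp [WritesIn]) (by simp) (by simp) (by simp) sn ?_ ?_ ?_)
    fun v1 a1 t1 ht1 ⟨_, h14, hF1⟩ => ⟨?_, h14⟩
  · simp
  · simp
  · intro k hk v' a' hF hv' h14 τ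
    have h0 : v' 0 = n := by rw [hF.1 0 (by simp)]; simp [hn]
    have hkn : (k + 1) * n ≤ n * n := Nat.mul_le_mul_right _ hk
    rw [add_mul, one_mul] at hkn
    have s1 : Nat.size (k * n) ≤ l := size_le_of_le hW (by omega)
    simp only [Ens_plus, Function.update_apply, Nat.reduceEqDiff, if_true, if_false, h0, h14, hv']
    exact ⟨by omega, trivial, by ring⟩
  · show t1 ≤ _
    simp only [Nat.size_zero] at ht1
    have e : n * (1 + 2 * l + 2 * l + 5) = n * (4 * l + 6) := by ring
    rw [squareCost]
    omega

/-- Copy the first `v₀²` entries of the array `A` to `out`, replacing those that are not codes. -/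
def copySq (F : Type*) [Fintype F] (A out : ℕ) : Prog := squareDim ;; copy F A out

theorem writesIn_copySq (A out : ℕ) : WritesIn (regs 30) {out} (copySq F A out) :=
  ⟨writesIn_squareDim.mono (by intro x; simp [regs]; omega) (by simp),
    (writesIn_copy A out).mono (regs_mono (by simp)) le_rfl⟩

/-- A bound for the running time of `copySq`. -/
def copySqCost (q n l w : ℕ) : ℕ := copyCost q (n * n) l w + squareCost n l

/-- The matrix at the beginning of a list of numbers, where numbers that are not codes are
replaced. -/
def sanMatrix (n : ℕ) (L : List ℕ) : Matrix (Fin n) (Fin n) F :=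
  fun i j => san code (L.getD (i * n + j) 0)

theorem sanMatrix_encMatrix (A : Matrix (Fin n) (Fin n) F) :
    sanMatrix code n (encMatrix code A) = A := by
  ext i j
  rw [sanMatrix, encMatrix_eq, getD_lst_flat code _ i.2 j.2, san_code, ext_apply]

theorem tr_copySq {A out W l : ℕ} {v : ℕ → ℕ} {a : ℕ → List ℕ} (hAo : A ≠ out)
    (hW : Nat.size W ≤ l) (hn : v 0 = n) (hNW : n * n + n ≤ W) :
    Tr (copySq F A out) (copySqCost (Fintype.card F) n l (weight (a A))) v a fun v' a' =>
      a' out = encMatrix code (sanMatrix code n (a A)) ∧ Fr (regs 30) {out} v a v' a' := by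
  refine Tr.frame ?_ (writesIn_copySq A out)
  intro τ
  refine (tr_squareDim hW hn hNW).seqStep fun v1 a1 t1 ht1 ⟨h14, hF1⟩ => ?_
  have ha1 : a1 = a := funext fun r => hF1.2 r (by simp)
  subst ha1
  refine (tr_copy code hAo hW h14 (by omega)).step fun v2 a2 t2 ht2 ⟨h, _⟩ => ⟨?_, ?_⟩
  · show t2 ≤ _
    rw [copySqCost]
    omega
  · show a2 out = _
    rw [h, encMatrix_eq]
    apply lst_congr
    intro k hk
    have h1 : k / n < n := Nat.div_lt_of_lt_mul hk
    have hn : 0 < n := Nat.pos_of_ne_zero (by rintro rfl; simp at hk)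
    have h2 : k % n < n := Nat.mod_lt _ hn
    rw [flat, ext, dif_pos ⟨h1, h2⟩, sanMatrix]
    simp only
    rw [Nat.div_add_mod']

/-! ### Inversion in polynomial time -/

/-- The order of the general linear group over a field with `q` elements. -/
def glOrder (q n i : ℕ) : ℕ := ∏ t ∈ Finset.range i, (q ^ n - q ^ t)

/-- A power of a matrix that is the inverse if there is one. -/
def powInv (B : Matrix (Fin n) (Fin n) F) : Matrix (Fin n) (Fin n) F :=
  B ^ (glOrder (Fintype.card F) n n - 2 + 1)

/-- By Lagrange's theorem the order of the general linear group annihilates `B`, so the preceding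
power is the inverse. Powering needs neither pivots nor divisions, and the exponent has `O(n²)` bits
for fixed `q`. -/
theorem mul_powInv {B X : Matrix (Fin n) (Fin n) F} (h : B * X = 1) : B * powInv B = 1 := by
  classical
  let U : Matrix.GeneralLinearGroup (Fin n) F := ⟨B, X, h, mul_eq_one_comm.1 h⟩
  have hcard : Nat.card (Matrix.GeneralLinearGroup (Fin n) F) = glOrder (Fintype.card F) n n := by
    rw [Matrix.card_GL_field, glOrder,
      ← Fin.prod_univ_eq_prod_range fun t => Fintype.card F ^ n - Fintype.card F ^ t]
  have hU : U ^ glOrder (Fintype.card F) n n = 1 := by rw [← hcard]; exact pow_card_eq_one'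
  have hB : B ^ glOrder (Fintype.card F) n n = 1 := by
    have := congrArg (fun u : Matrix.GeneralLinearGroup (Fin n) F => (u : Matrix (Fin n) (Fin n) F)) hU
    simpa using this
  have hpos : 0 < glOrder (Fintype.card F) n n := by rw [← hcard]; exact Nat.card_pos
  rw [powInv]
  -- Truncated subtraction gives the exponent `1` instead of `0` if the group is trivial; then `B =
  -- 1` and the power is still correct.
  by_cases h1 : glOrder (Fintype.card F) n n = 1
  · rw [h1, pow_one] at hB
    simp [hB]
  · rw [← pow_succ']
    have : glOrder (Fintype.card F) n n - 2 + 1 + 1 = glOrder (Fintype.card F) n n := by omega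
    rw [this, hB]

theorem glOrder_le (q n i : ℕ) : glOrder q n i ≤ q ^ (n * i) := by
  rw [glOrder, pow_mul]
  calc _ ≤ ∏ t ∈ Finset.range i, q ^ n := Finset.prod_le_prod' fun t _ => Nat.sub_le _ _
    _ = _ := by rw [Finset.prod_const, Finset.card_range]

/-- Multiply the variable `x` by the constant `q`. -/
def mulConst (q x : ℕ) : Prog :=
  .const 46 0 ;; .const 47 q ;; .forN 47 (.plus 46 46 x) ;; .const 1 0 ;; .plus x 46 1

theorem writesIn_mulConst (q x : ℕ) : WritesIn {1, 46, 47, x} ∅ (mulConst q x) := by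
  simp [mulConst, WritesIn, Prog.forN]

/-- A bound for the running time of `mulConst`. -/
def mulConstCost (q l : ℕ) : ℕ := q * (4 * l + 6) + 2 * l + 10

theorem tr_mulConst {q x W l : ℕ} {v : ℕ → ℕ} {a : ℕ → List ℕ} (hW : Nat.size W ≤ l)
    (hx : x ≠ 1 ∧ x ≠ 46 ∧ x ≠ 47) (hxW : q * v x + v x + q ≤ W) :
    Tr (mulConst q x) (mulConstCost q l) v a fun v' a' => v' x = q * v x ∧
      Fr {1, 46, 47, x} ∅ v a v' a' := by
  refine Tr.frame ?_ (writesIn_mulConst q x)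
  intro τ
  have sq : Nat.size q ≤ l := size_le_of_le hW (by omega)
  simp only [mulConst, Ens_seq, Ens_const]
  refine Tr.step (Tr.forN_frame (N := q) (l := l) (c := 1 + 2 * l) (vs := {1, 46, 47}) (as := ∅)
    (I := fun k v' a' => v' 46 = k * v x)
    (by simp [WritesIn]) (by simp) (by simp) (by simp) sq ?_ ?_ ?_)
    fun v1 a1 t1 ht1 ⟨_, h46, hF1⟩ => ?_
  · simp
  · simp
  · intro k hk v' a' hF hv' h46 τ
    have h0 : v' x = v x := by rw [hF.1 x (by simp [hx])]; simp [Function.update_apply, hx]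
    have hkn : (k + 1) * v x ≤ q * v x := Nat.mul_le_mul_right _ hk
    rw [add_mul, one_mul] at hkn
    have s1 : Nat.size (k * v x) ≤ l := size_le_of_le hW (by omega)
    have s2 : Nat.size (v x) ≤ l := size_le_of_le hW (by omega)
    simp only [Ens_plus, Function.update_apply, Nat.reduceEqDiff, if_true, if_false, h0, h46, hv']
    exact ⟨by omega, trivial, by ring⟩
  · have s1 : Nat.size (q * v x) ≤ l := size_le_of_le hW (by omega)
    simp only [Ens_seq, Ens_const, Ens_plus, Function.update_apply, Nat.reduceEqDiff, if_true, if_false,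
      h46, Nat.size_zero, add_zero] at ht1 ⊢
    refine ⟨?_, trivial⟩
    have e : q * (1 + 2 * l + 2 * l + 5) = q * (4 * l + 6) := by ring
    rw [mulConstCost]
    omega

/-- Multiply the variable `x` by `q` as often as the variable `45` says. -/
def mulPow (q x : ℕ) : Prog := .forN 45 (mulConst q x)

theorem tr_mulPow {q x W l N m : ℕ} {v : ℕ → ℕ} {a : ℕ → List ℕ} (hW : Nat.size W ≤ l)
    (hq : 1 ≤ q) (hx : x ≠ 1 ∧ x ≠ 46 ∧ x ≠ 47 ∧ x ≠ 45) (hm : v x = m) (hN : v 45 = N)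
    (hxW : q ^ N * m + q ^ N * m + q + N ≤ W) :
    Tr (mulPow q x) (N * (mulConstCost q l + 2 * l + 5) + 1) v a fun v' a' => v' x = q ^ N * m ∧
      Fr {1, 45, 46, 47, x} ∅ v a v' a' := by
  have hw : WritesIn {1, 45, 46, 47, x} ∅ (mulConst q x) :=
    (writesIn_mulConst q x).mono (by intro y; simp; tauto) le_rfl
  refine (Tr.forN_frame (N := N) (l := l) (I := fun k v' a' => v' x = q ^ k * m)
    hw (by simp) (by simp) (by simp) (size_le_of_le hW (by omega)) hN ?_ ?_).mono le_rfl
    fun v' a' h => ⟨h.2.1, h.2.2⟩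
  · simp [hm]
  · intro k hk v' a' hF hv' hvx
    have h1 : q * (q ^ k * m) ≤ q ^ N * m := by
      rw [← mul_assoc, ← pow_succ']
      exact Nat.mul_le_mul_right _ (Nat.pow_le_pow_right hq hk)
    have h2 : 1 * (q ^ k * m) ≤ q * (q ^ k * m) := Nat.mul_le_mul_right _ hq
    refine (tr_mulConst (q := q) hW ⟨hx.1, hx.2.1, hx.2.2.1⟩ (by rw [hvx]; omega)).mono le_rfl ?_
    rintro v'' a'' ⟨h3, h4⟩
    have e45 := h4.1 45 (by simp [hx.2.2.2.symm])
    refine ⟨by rw [e45, hv'], ?_⟩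
    simp only [Function.update_apply, hx.1, hx.2.2.2, if_false, h3, hvx]
    ring

/-- Multiply the variable `40` by `q ^ n - q ^ i`, where `i` is the value of the variable `41`,
and increment the latter. -/
def orderStep (q : ℕ) : Prog :=
  .const 1 0 ;; .plus 43 40 1 ;; .plus 44 40 1 ;; .plus 45 0 1 ;; mulPow q 43 ;; .const 1 0 ;;
    .plus 45 41 1 ;; mulPow q 44 ;; .minus 40 43 44 ;; .const 1 1 ;; .plus 41 41 1

/-- Compute the order of the general linear group in the variable `40`. -/
def order (q : ℕ) : Prog :=
  .const 40 1 ;; .const 41 0 ;; .const 1 0 ;; .plus 42 0 1 ;; .forN 42 (orderStep q)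

theorem writesIn_mulPow (q x : ℕ) : WritesIn {1, 45, 46, 47, x} ∅ (mulPow q x) :=
  WritesIn.forN (by simp) (by simp) ((writesIn_mulConst q x).mono (by intro y; simp; tauto) le_rfl)

theorem writesIn_orderStep (q : ℕ) : WritesIn {1, 40, 41, 43, 44, 45, 46, 47} ∅ (orderStep q) :=
  ⟨by simp [WritesIn], by simp [WritesIn], by simp [WritesIn], by simp [WritesIn],
    (writesIn_mulPow q 43).mono (by intro y; simp; omega) le_rfl, by simp [WritesIn],
    by simp [WritesIn], (writesIn_mulPow q 44).mono (by intro y; simp; omega) le_rfl,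
    by simp [WritesIn], by simp [WritesIn], by simp [WritesIn]⟩

theorem writesIn_order (q : ℕ) : WritesIn {1, 40, 41, 42, 43, 44, 45, 46, 47} ∅ (order q) :=
  ⟨by simp [WritesIn], by simp [WritesIn], by simp [WritesIn], by simp [WritesIn],
    WritesIn.forN (by simp) (by simp)
      ((writesIn_orderStep q).mono (by intro y; simp; omega) le_rfl)⟩

/-- A bound for the running time of `order`. -/
def orderCost (q n l : ℕ) : ℕ := n * (2 * (n * (mulConstCost q l + 2 * l + 5)) + 12 * l + 25) + 2 * l + 10

/-- Each factor `qⁿ - qⁱ` is applied to the current product `p` as the difference of `qⁿ p` and `qⁱ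
p`. Only multiplication by the constant `q`, by repeated addition, is required. -/
theorem tr_order {q W l : ℕ} {v : ℕ → ℕ} {a : ℕ → List ℕ} (hq : 1 ≤ q) (hW : Nat.size W ≤ l)
    (hn : v 0 = n) (hqW : 2 * q ^ (n * n) + q + n + 1 ≤ W) :
    Tr (order q) (orderCost q n l) v a fun v' a' => v' 40 = glOrder q n n ∧
      Fr {1, 40, 41, 42, 43, 44, 45, 46, 47} ∅ v a v' a' := by
  refine Tr.frame ?_ (writesIn_order q)
  intro τ
  have sn : Nat.size n ≤ l := size_le_of_le hW (by omega)
  simp only [order, Ens_seq, Ens_const, Ens_plus]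
  simp only [Function.update_apply, Nat.reduceEqDiff, if_true, if_false, add_zero, hn]
  refine Tr.step (Tr.forN_frame (N := n) (l := l)
    (c := 2 * (n * (mulConstCost q l + 2 * l + 5)) + 10 * l + 20)
    (vs := {1, 40, 41, 42, 43, 44, 45, 46, 47}) (as := ∅)
    (I := fun k v' a' => v' 40 = glOrder q n k ∧ v' 41 = k)
    ((writesIn_orderStep q).mono (by intro y; simp; omega) le_rfl) (by simp) (by simp) (by simp)
    sn ?_ ?_ ?_)
    fun v1 a1 t1 ht1 ⟨_, ⟨h40, _⟩, hF1⟩ => ⟨?_, h40⟩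
  · simp
  · simp [glOrder]
  · rintro k hk v' a' hF hv' ⟨h40, h41⟩ τ
    have h0 : v' 0 = n := by rw [hF.1 0 (by simp)]; simp [hn]
    have hle : q ^ n * glOrder q n k ≤ q ^ (n * n) := by
      calc q ^ n * glOrder q n k ≤ q ^ n * q ^ (n * k) := Nat.mul_le_mul_left _ (glOrder_le q n k)
        _ = q ^ (n * (k + 1)) := by rw [← pow_add]; congr 1; ring
        _ ≤ _ := Nat.pow_le_pow_right hq (Nat.mul_le_mul_left _ hk)
    have hle0 : 1 * glOrder q n k ≤ q ^ n * glOrder q n k :=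
      Nat.mul_le_mul_right _ (Nat.one_le_pow _ _ hq)
    have hle2 : q ^ k * glOrder q n k ≤ q ^ n * glOrder q n k :=
      Nat.mul_le_mul_right _ (Nat.pow_le_pow_right hq hk.le)
    simp only [orderStep, Ens_seq, Ens_const, Ens_plus]
    simp only [Function.update_apply, Nat.reduceEqDiff, if_true, if_false, add_zero, h0, h40]
    refine (tr_mulPow (q := q) (x := 43) (N := n) (m := glOrder q n k) hW hq (by simp) (by simp)
      (by simp) (by omega)).step fun v2 a2 t2 ht2 ⟨h43, hF2⟩ => ?_
    have e40 := hF2.1 40 (by simp)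
    have e41 := hF2.1 41 (by simp)
    have e42 := hF2.1 42 (by simp)
    have e44 := hF2.1 44 (by simp)
    simp only [Function.update_apply, Nat.reduceEqDiff, if_true, if_false] at e40 e41 e42 e44
    simp only [Ens_seq, Ens_const, Ens_plus]
    simp only [Function.update_apply, Nat.reduceEqDiff, if_true, if_false, add_zero, e41, h41]
    refine (tr_mulPow (q := q) (x := 44) (N := k) (m := glOrder q n k) hW hq (by simp) (by simp [e44])
      (by simp) (by omega)).step fun v3 a3 t3 ht3 ⟨h44, hF3⟩ => ?_
    have d41 := hF3.1 41 (by simp)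
    have d42 := hF3.1 42 (by simp)
    have d43 := hF3.1 43 (by simp)
    simp only [Function.update_apply, Nat.reduceEqDiff, if_true, if_false] at d41 d42 d43
    have s1 : Nat.size (glOrder q n k) ≤ l := size_le_of_le hW (by omega)
    have s2 : Nat.size k ≤ l := size_le_of_le hW (by omega)
    have s3 : Nat.size (q ^ n * glOrder q n k) ≤ l := size_le_of_le hW (by omega)
    have s4 : Nat.size (q ^ k * glOrder q n k) ≤ l := size_le_of_le hW (by omega)
    simp only [Ens_seq, Ens_minus, Ens_const, Ens_plus, Function.update_apply, Nat.reduceEqDiff, if_true,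
      if_false, d41, d42, d43, e41, e42, h41, h43, h44, hv', Nat.size_one, Nat.size_zero] at ht2 ht3 ⊢
    have hk2 : k * (mulConstCost q l + 2 * l + 5) ≤ n * (mulConstCost q l + 2 * l + 5) :=
      Nat.mul_le_mul_right _ hk.le
    refine ⟨by omega, trivial, ?_, trivial⟩
    rw [show glOrder q n (k + 1) = glOrder q n k * (q ^ n - q ^ k) from
      Finset.prod_range_succ _ _, ← Nat.sub_mul, mul_comm]
  · show t1 ≤ _
    simp only [Nat.size_zero, Nat.size_one] at ht1
    have e : n * (2 * (n * (mulConstCost q l + 2 * l + 5)) + 10 * l + 20 + 2 * l + 5) =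
      n * (2 * (n * (mulConstCost q l + 2 * l + 5)) + 12 * l + 25) := by ring
    rw [orderCost]
    omega

/-- One step of binary powering. -/
def powStep (out : ℕ) : Prog :=
  .half 41 40 ;; .minus 42 40 41 ;; .minus 42 42 41 ;;
    .ifNZ 42 (matmul code out 20 21 ;; copySq F 21 out) .skip ;; matmul code 20 20 21 ;;
    copySq F 21 20 ;; .const 1 0 ;; .plus 40 41 1

/-- Compute the power of the matrix `src` that is its inverse if there is one. -/
def fallback (src out : ℕ) : Prog :=
  order (Fintype.card F) ;; .const 1 0 ;; .plus 13 0 1 ;; .const 1 2 ;; .minus 40 40 1 ;;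
    copySq F src out ;; copySq F src 20 ;; .whileNZ 40 (powStep code out)

theorem writesIn_powStep (out : ℕ) : WritesIn (low 50) {out, 20, 21} (powStep code out) := by
  have h1 : ∀ A B, WritesIn (low 50) {out, 20, 21} (matmul code A B 21) := fun A B =>
    (writesIn_matmul code A B 21).mono (regs_subset_low (by simp)) (by simp)
  have h2 : ∀ A B, B = out ∨ B = 20 → WritesIn (low 50) {out, 20, 21} (copySq F A B) :=
    fun A B hB => (writesIn_copySq A B).mono (regs_subset_low (by simp)) (by simp; tauto)
  exact ⟨by simp [WritesIn, low], by simp [WritesIn, low], by simp [WritesIn, low],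
    ⟨⟨h1 _ _, h2 _ _ (Or.inl rfl)⟩, trivial⟩, h1 _ _, h2 _ _ (Or.inr rfl), by simp [WritesIn, low],
    by simp [WritesIn, low]⟩

theorem writesIn_fallback (src out : ℕ) :
    WritesIn (low 50) {out, 20, 21} (fallback code src out) := by
  have h2 : ∀ A B, B = out ∨ B = 20 → WritesIn (low 50) {out, 20, 21} (copySq F A B) :=
    fun A B hB => (writesIn_copySq A B).mono (regs_subset_low (by simp)) (by simp; tauto)
  exact ⟨(writesIn_order _).mono (by intro y; simp [low]; omega) (by simp), by simp [WritesIn, low],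
    by simp [WritesIn, low], by simp [WritesIn, low], by simp [WritesIn, low], h2 _ _ (Or.inl rfl),
    h2 _ _ (Or.inr rfl), writesIn_powStep code out⟩

/-- A bound for the time to copy the code of a matrix. -/
def copyEncCost (q n l : ℕ) : ℕ := copySqCost q n l (n * n * (q + 1))

theorem tr_copySq_enc {A out W l : ℕ} {v : ℕ → ℕ} {a : ℕ → List ℕ} {X : Matrix (Fin n) (Fin n) F}
    (hAo : A ≠ out) (hW : Nat.size W ≤ l) (hn : v 0 = n) (hNW : n * n + n ≤ W)
    (hA : a A = encMatrix code X) :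
    Tr (copySq F A out) (copyEncCost (Fintype.card F) n l) v a fun v' a' =>
      a' out = encMatrix code X ∧ Fr (regs 30) {out} v a v' a' := by
  refine (tr_copySq code hAo hW hn hNW).mono ?_ ?_
  · have := weight_encMatrix_le code X
    rw [hA, copyEncCost, copySqCost, copySqCost, copyCost, copyCost]
    omega
  · rw [hA, sanMatrix_encMatrix]; exact fun _ _ h => h

/-- A bound for the running time of `powStep`. -/
def powStepCost (q n l : ℕ) : ℕ := 2 * (matmulCost q n n l + copyEncCost q n l) + 8 * l + 20

theorem tr_powStep {out W l m : ℕ} {v : ℕ → ℕ} {a : ℕ → List ℕ} {X Y : Matrix (Fin n) (Fin n) F}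
    (ho : out ≠ 20 ∧ out ≠ 21) (hW : Nat.size W ≤ l) (hn : v 0 = n) (h13 : v 13 = n)
    (hnW : n * n + n * n + n + n ≤ W) (hm : v 40 = m) (hmW : m ≤ W)
    (hY : a out = encMatrix code Y) (hX : a 20 = encMatrix code X) :
    Tr (powStep code out) (powStepCost (Fintype.card F) n l) v a fun v' a' =>
      v' 0 = n ∧ v' 13 = n ∧ v' 40 = m / 2 ∧ a' 20 = encMatrix code (X * X) ∧
      a' out = encMatrix code (if m % 2 = 0 then Y else Y * X) := by
  intro τ
  have s1 : Nat.size m ≤ l := size_le_of_le hW hmW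
  have s2 : Nat.size (m / 2) ≤ l := size_le_of_le hW (by omega)
  have s3 : Nat.size (m - m / 2) ≤ l := size_le_of_le hW (by omega)
  simp only [powStep, Ens_seq, Ens_half, Ens_minus, Ens_ite]
  simp only [Function.update_apply, Nat.reduceEqDiff, if_true, if_false, hm]
  have hsz : Nat.size (m - m / 2 - m / 2) ≤ 1 :=
    (Nat.size_le_size (by omega : _ ≤ 1)).trans Nat.size_one.le
  have hrest : ∀ v1 a1 t1, t1 ≤ τ + matmulCost (Fintype.card F) n n l +
      copyEncCost (Fintype.card F) n l + 5 * l + 10 → v1 0 = n → v1 13 = n → v1 41 = m / 2 →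
      a1 20 = encMatrix code X → a1 out = encMatrix code (if m % 2 = 0 then Y else Y * X) →
      Ens (matmul code 20 20 21 ;; copySq F 21 20 ;; .const 1 0 ;; .plus 40 41 1) (fun s =>
        s.time ≤ τ + powStepCost (Fintype.card F) n l ∧ s.var 0 = n ∧ s.var 13 = n ∧
        s.var 40 = m / 2 ∧ s.arr 20 = encMatrix code (X * X) ∧
        s.arr out = encMatrix code (if m % 2 = 0 then Y else Y * X)) ⟨v1, a1, t1⟩ := by
    intro v1 a1 t1 ht1 h0 h13 h41 h20 hout
    refine (tr_matmul_enc code (by simp) (by simp) hW h0 h13 hnW h20 h20).seqStep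
      fun v2 a2 t2 ht2 ⟨h2, hF2⟩ => ?_
    refine (tr_copySq_enc code (by simp) hW (by rw [hF2.1 0 (by simp [regs]), h0]) (by omega) h2).seqStep
      fun v3 a3 t3 ht3 ⟨h3, hF3⟩ => ?_
    have e41 : v3 41 = m / 2 := by
      rw [hF3.1 41 (by simp [regs]), hF2.1 41 (by simp [regs]), h41]
    have e13 : v3 13 = n := by rw [hF3.1 13 (by simp [regs]), hF2.1 13 (by simp [regs]), h13]
    have e0 : v3 0 = n := by rw [hF3.1 0 (by simp [regs]), hF2.1 0 (by simp [regs]), h0]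
    have eo : a3 out = a1 out := by rw [hF3.2 out (by simp [ho]), hF2.2 out (by simp [ho])]
    simp only [Ens_seq, Ens_const, Ens_plus, Function.update_apply, Nat.reduceEqDiff, if_true, if_false, e0, e13,
      e41, eo, h3, hout, OfNat.zero_ne_ofNat, OfNat.ofNat_ne_one, Nat.size_zero, zero_ne_one, add_zero]
    refine ⟨by rw [powStepCost]; omega, trivial, trivial, trivial, trivial, trivial⟩
  by_cases hpar : m - m / 2 - m / 2 = 0
  · rw [if_pos hpar, Ens_skip]
    refine hrest _ _ _ ?_ ?_ ?_ ?_ hX (by rw [if_pos (by omega)]; exact hY)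
    · omega
    · simp [hn]
    · simp [h13]
    · simp
  · rw [if_neg hpar]
    refine (tr_matmul_enc code ho.2 (by simp) hW (by simp [hn]) (by simp [h13]) hnW hY hX).step
      fun v2 a2 t2 ht2 ⟨h2, hF2⟩ => ?_
    refine (tr_copySq_enc code ho.2.symm hW (by rw [hF2.1 0 (by simp [regs])]; simp [hn])
      (by omega) h2).step fun v3 a3 t3 ht3 ⟨h3, hF3⟩ => ?_
    refine hrest _ _ _ ?_ ?_ ?_ ?_ ?_ (by rw [if_neg (by omega)]; exact h3)
    · omega
    · rw [hF3.1 0 (by simp [regs]), hF2.1 0 (by simp [regs])]; simp [hn]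
    · rw [hF3.1 13 (by simp [regs]), hF2.1 13 (by simp [regs])]; simp [h13]
    · rw [hF3.1 41 (by simp [regs]), hF2.1 41 (by simp [regs])]; simp
    · rw [hF3.2 20 (by simp [ho.1.symm]), hF2.2 20 (by simp), hX]

/-- Binary powering preserves `Y * X ^ m` while `m` is halved. The parameter `k` bounds the number
of binary digits of `m`, hence the number of rounds. -/
theorem tr_powLoop {out W l : ℕ} (ho : out ≠ 20 ∧ out ≠ 21) (hW : Nat.size W ≤ l)
    (hnW : n * n + n * n + n + n ≤ W) (k : ℕ) : ∀ {m : ℕ} {v : ℕ → ℕ} {a : ℕ → List ℕ}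
    {X Y : Matrix (Fin n) (Fin n) F}, m < 2 ^ k → m ≤ W → v 0 = n → v 13 = n → v 40 = m →
    Commute X Y →
    a out = encMatrix code Y → a 20 = encMatrix code X →
    Tr (.whileNZ 40 (powStep code out)) (k * (powStepCost (Fintype.card F) n l + l + 1) + 1) v a
      fun v' a' => a' out = encMatrix code (Y * X ^ m) := by
  induction k with
  | zero =>
    intro m v a X Y hm hmW h0 h13 h40 hc hY hX τ
    have hm0 : m = 0 := by omega
    subst hm0
    rw [Ens_whileNZ, if_pos h40]
    simp [State.tick, h40, Nat.size_zero, hY]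
  | succ k ih =>
    intro m v a X Y hm hmW h0 h13 h40 hc hY hX τ
    have s1 : Nat.size m ≤ l := size_le_of_le hW hmW
    have e : (k + 1) * (powStepCost (Fintype.card F) n l + l + 1) =
      k * (powStepCost (Fintype.card F) n l + l + 1) + (powStepCost (Fintype.card F) n l + l + 1) := by
      ring
    rw [Ens_whileNZ]
    split_ifs with h
    · have hm0 : m = 0 := h40.symm.trans h
      subst hm0
      simp [State.tick, h40, Nat.size_zero, hY]
    · simp only [State.tick, h40]
      refine (tr_powStep code ho hW h0 h13 hnW h40 hmW hY hX).step
        fun v1 a1 t1 ht1 ⟨e0, e13, e40, e20, eo⟩ => ?_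
      refine (ih (m := m / 2) (by rw [pow_succ] at hm; omega) (by omega) e0 e13 e40 ?_ eo e20).step
        fun v2 a2 t2 ht2 h2 => ⟨?_, ?_⟩
      · split_ifs
        · exact hc.mul_left hc
        · exact (hc.mul_left hc).mul_right ((Commute.refl X).mul_left (Commute.refl X))
      · show t2 ≤ _; omega
      · show a2 out = _
        rw [h2, ← pow_two, ← pow_mul]
        congr 1
        split_ifs with hp
        · have : 2 * (m / 2) = m := by omega
          rw [this]
        · have : 2 * (m / 2) + 1 = m := by omega
          rw [mul_assoc, ← pow_succ', this]

/-- A bound for the running time of `fallback`. -/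
def fallbackCost (q n l : ℕ) : ℕ := orderCost q n l + 2 * copyEncCost q n l +
  l * (powStepCost q n l + l + 1) + 3 * l + 20

theorem tr_fallback {src out W l : ℕ} {v : ℕ → ℕ} {a : ℕ → List ℕ} {B : Matrix (Fin n) (Fin n) F}
    (ho : out ≠ 20 ∧ out ≠ 21) (hso : src ≠ out) (hs20 : src ≠ 20) (hW : Nat.size W ≤ l) (hn : v 0 = n)
    (hnW : n * n + n * n + n + n ≤ W)
    (hqW : 2 * Fintype.card F ^ (n * n) + Fintype.card F + n + 2 ≤ W)
    (hB : a src = encMatrix code B) :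
    Tr (fallback code src out) (fallbackCost (Fintype.card F) n l) v a fun v' a' =>
      a' out = encMatrix code (powInv B) ∧ Fr (low 50) {out, 20, 21} v a v' a' := by
  refine Tr.frame ?_ (writesIn_fallback code src out)
  intro τ
  have sn : Nat.size n ≤ l := size_le_of_le hW (by omega)
  have hq : 1 ≤ Fintype.card F := Fintype.card_pos
  have hle := glOrder_le (Fintype.card F) n n
  rw [fallback]
  refine (tr_order hq hW hn (by omega)).seqStep fun v1 a1 t1 ht1 ⟨h40, hF1⟩ => ?_
  have ha1 : a1 = a := funext fun r => hF1.2 r (by simp)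
  subst ha1
  have h0 := hF1.1 0 (by simp)
  simp only [Ens_seq, Ens_const, Ens_plus, Ens_minus]
  simp only [Function.update_apply, Nat.reduceEqDiff, if_true, if_false, add_zero, h0, hn, h40]
  refine (tr_copySq_enc code hso hW (by simp [h0, hn]) (by omega) hB).step
    fun v2 a2 t2 ht2 ⟨h2, hF2⟩ => ?_
  have bs : a2 src = encMatrix code B := by rw [hF2.2 src (by simp [hso]), hB]
  have b0 : v2 0 = n := by rw [hF2.1 0 (by simp [regs])]; simp [h0, hn]
  refine (tr_copySq_enc code (A := src) (out := 20) (X := B) hs20 hW b0 (by omega) bs).seqStep fun v3 a3 t3 ht3 ⟨h3, hF3⟩ => ?_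
  have e0 : v3 0 = n := by
    rw [hF3.1 0 (by simp [regs]), hF2.1 0 (by simp [regs])]; simp [h0, hn]
  have e13 : v3 13 = n := by
    rw [hF3.1 13 (by simp [regs]), hF2.1 13 (by simp [regs])]; simp [h0, hn]
  have e40 : v3 40 = glOrder (Fintype.card F) n n - 2 := by
    rw [hF3.1 40 (by simp [regs]), hF2.1 40 (by simp [regs])]; simp [h40]
  have eo : a3 out = encMatrix code B := by rw [hF3.2 out (by simp [ho.1]), h2]
  have sg : Nat.size (glOrder (Fintype.card F) n n) ≤ l := size_le_of_le hW (by omega)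
  -- The accumulator starts with `B` rather than with the identity, so no identity matrix has to be
  -- built; this accounts for the exponent `glOrder - 2`. The bound `l` on its bit length serves as
  -- the number of rounds.
  refine (tr_powLoop code ho hW hnW l (m := glOrder (Fintype.card F) n n - 2) ?_ (by omega) e0 e13 e40
    (Commute.refl B) eo h3).step fun v4 a4 t4 ht4 h4 => ⟨?_, ?_⟩
  · rw [← Nat.size_le]; exact size_le_of_le hW (by omega)
  · show t4 ≤ _
    have s2 : Nat.size 2 ≤ 2 := size_le_self 2
    simp only [Nat.size_zero] at ht2
    rw [fallbackCost]
    omega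
  · show a4 out = _
    rw [h4, powInv, pow_succ']

end field

/-! ### Time-bounded expectations -/

/-- Started in the memory `(v, a)`, the program halts for every outcome of its coins within time
`c`, and the expected value of `Φ` in its final memory is at most `r`. -/
def Ex (P : Prog) (c : ℕ) (v : ℕ → ℕ) (a : ℕ → List ℕ)
    (Φ : (ℕ → ℕ) → (ℕ → List ℕ) → ℝ≥0∞) (r : ℝ≥0∞) : Prop :=
  ∀ (τ : ℕ) (g : State → ℝ≥0∞), (∀ v' a' t', t' ≤ τ + c → g ⟨v', a', t'⟩ ≤ Φ v' a') →
    E P g ⟨v, a, τ⟩ ≤ r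

section Ex

variable {P R : Prog} {c c' c₁ c₂ : ℕ} {v : ℕ → ℕ} {a : ℕ → List ℕ} {r r' : ℝ≥0∞}
  {Φ Φ' Φ₁ : (ℕ → ℕ) → (ℕ → List ℕ) → ℝ≥0∞} {Q : (ℕ → ℕ) → (ℕ → List ℕ) → Prop}

theorem Ex.mono (h : Ex P c v a Φ r) (hc : c ≤ c') (hΦ : ∀ v a, Φ' v a ≤ Φ v a) (hr : r ≤ r') :
    Ex P c' v a Φ' r' := fun τ g hg =>
  (h τ g fun v' a' t' ht' => (hg v' a' t' (by omega)).trans (hΦ v' a')).trans hr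

theorem Tr.ex (h : Tr P c v a Q) (hr : ∀ v' a', Q v' a' → Φ v' a' ≤ r) : Ex P c v a Φ r :=
  fun τ g hg => (h τ).E_le fun s hs => (hg _ _ _ hs.1).trans (hr _ _ hs.2)

/-- The intermediate potential also serves as an assertion: where it is `⊤` there is nothing to
prove about the second program. Typically it is a bound guarded by the facts that the second program
relies on. -/
theorem Ex.seq (h : Ex P c₁ v a Φ₁ r) (h' : ∀ v' a', Φ₁ v' a' ≠ ⊤ → Ex R c₂ v' a' Φ (Φ₁ v' a')) :
    Ex (P ;; R) (c₁ + c₂) v a Φ r := by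
  intro τ g hg
  rw [E_seq]
  refine h τ _ fun v' a' t' ht' => ?_
  by_cases ht : Φ₁ v' a' = ⊤
  · rw [ht]; exact le_top
  · exact h' v' a' ht t' g fun v'' a'' t'' ht'' => hg _ _ _ (by omega)

theorem Tr.exSeq (h : Tr P c₁ v a Q) (h' : ∀ v' a', Q v' a' → Ex R c₂ v' a' Φ r) :
    Ex (P ;; R) (c₁ + c₂) v a Φ r := by
  intro τ g hg
  rw [E_seq]
  refine (h τ).E_le fun s hs => ?_
  exact h' _ _ hs.2 s.time g fun v'' a'' t'' ht'' => hg _ _ _ (by have := hs.1; omega)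

theorem Ex.frame {vs as : Set ℕ} (h : Ex P c v a Φ r) (hP : WritesIn vs as P)
    (hΦ : ∀ v' a', Fr vs as v a v' a' → Φ' v' a' ≤ Φ v' a') : Ex P c v a Φ' r := by
  classical
  intro τ g hg
  refine le_trans ?_ (h τ (fun s => if Fr vs as v a s.var s.arr then g s else 0) ?_)
  · refine E_le_of_sound (fun _ _ _ h h' => h.trans h') (fun _ _ => Fr.refl _ _) (sound_frame hP)
      fun s' hs' => ?_
    rw [if_pos hs']
  · intro v' a' t' ht'
    simp only
    split_ifs with hf
    · exact (hg _ _ _ ht').trans (hΦ _ _ hf)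
    · exact zero_le

theorem Ex.coin {x : ℕ} (h : 2⁻¹ * Φ (Function.update v x 1) a + 2⁻¹ * Φ (Function.update v x 0) a ≤ r) :
    Ex (.coin x) 1 v a Φ r := by
  intro τ g hg
  rw [E_coin]
  refine le_trans ?_ h
  gcongr <;> exact hg _ _ _ le_rfl

theorem Ex.ifNZ {x : ℕ} (h : v x ≠ 0 → Ex P c v a Φ r) (h' : v x = 0 → Ex R c v a Φ r) :
    Ex (.ifNZ x P R) (c + 1 + Nat.size (v x)) v a Φ r := by
  intro τ g hg
  rw [E_ifNZ]
  split_ifs with hx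
  · exact h' hx _ g fun v' a' t' ht' => hg _ _ _ (by simp only at ht' ⊢; omega)
  · exact h hx _ g fun v' a' t' ht' => hg _ _ _ (by simp only at ht' ⊢; omega)

/-- A finite expectation excludes the value `⊤` on every run, so the assertion encoded by `Φ` holds
surely. The passage from finite to zero is again invariance under doubling. -/
theorem Ex.tr (h : Ex P c v a Φ r) (hr : r ≠ ⊤) (hQ : ∀ v' a', Φ v' a' ≠ ⊤ → Q v' a') :
    Tr P c v a Q := by
  intro τ
  rw [Ens.eq_1]
  set g := topUnless fun s => s.time ≤ τ + c ∧ Q s.var s.arr with hg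
  have h1 : E P g ⟨v, a, τ⟩ ≤ r := by
    refine h τ g fun v' a' t' ht' => ?_
    by_cases ht : Φ v' a' = ⊤
    · rw [ht]; exact le_top
    · rw [hg, topUnless_of ⟨ht', hQ _ _ ht⟩]; exact zero_le
  have h2 : (fun s => 2 * g s) = g := by
    funext s
    rw [hg]
    by_cases hs : s.time ≤ τ + c ∧ Q s.var s.arr
    · rw [topUnless_of hs, mul_zero]
    · rw [topUnless_of_not hs, ENNReal.mul_top (by simp)]
  have h3 := E_mul_le P (a := 2) (by simp) (by simp) g ⟨v, a, τ⟩
  rw [h2, two_mul] at h3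
  have h4 : E P g ⟨v, a, τ⟩ ≠ ⊤ := (h1.trans_lt (lt_top_iff_ne_top.2 hr)).ne
  exact ((ENNReal.add_right_inj h4).1 (by rw [add_zero]; exact h3)).symm

-- The potential `Φ j` must not increase in expectation during round `j`, as for a supermartingale.
-- It then bounds the expected final potential by the initial one.
open Classical in
theorem Ex.forN {k N l : ℕ} {Φ : ℕ → (ℕ → ℕ) → (ℕ → List ℕ) → ℝ≥0∞}
    (hl : Nat.size N ≤ l) (hk : v k = N) (hk1 : k ≠ 1)
    (hb : ∀ j < N, ∀ v a, v k = N - j → Φ j v a ≠ ⊤ → Ex P c v a (fun v' a' => if v' k = N - j then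
      Φ (j + 1) (Function.update (Function.update v' 1 1) k (N - (j + 1))) a' else ⊤) (Φ j v a)) :
    Ex (.forN k P) (N * (c + 2 * l + 5) + 1) v a
      (fun v' a' => if v' k = 0 then Φ N v' a' else ⊤) (Φ 0 v a) := by
  suffices H : ∀ m j, j + m = N → ∀ v a, v k = N - j →
      Ex (.forN k P) (m * (c + 2 * l + 5) + 1) v a
        (fun v' a' => if v' k = 0 then Φ N v' a' else ⊤) (Φ j v a) by
    have := H N 0 (by omega) v a (by omega)
    simpa using this
  intro m
  induction m with
  | zero =>
    intro j hj v a hv τ g hg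
    have hj : j = N := by omega
    subst hj
    have hv0 : v k = 0 := by omega
    rw [Prog.forN, E_whileNZ, if_pos hv0]
    have := hg v a (τ + (1 + Nat.size (v k))) (by simp only [hv0, Nat.size_zero]; omega)
    simpa only [if_pos hv0, State.tick] using this
  | succ m ih =>
    intro j hj v a hv τ g hg
    have hne : v k ≠ 0 := by omega
    by_cases htop : Φ j v a = ⊤
    · rw [htop]; exact le_top
    rw [Prog.forN, E_whileNZ, if_neg hne]
    simp only [State.tick]
    have hsz : Nat.size (v k) ≤ l := (Nat.size_le_size (by omega)).trans hl
    rw [E_seq]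
    refine hb j (by omega) v a hv htop _ _ fun v' a' t' ht' => ?_
    simp only
    split_ifs with hvk
    · rw [E_seq, E_basic (by trivial), E_basic (by trivial)]
      simp only [Prog.eff, State.setVar, State.tick, Function.update_self, Function.update_of_ne hk1, hvk]
      have e : N - j - 1 = N - (j + 1) := by omega
      rw [e]
      have h2 : Nat.size (N - j) ≤ l := (Nat.size_le_size (by omega)).trans hl
      refine ih (j + 1) (by omega) _ _ (by simp) _ g fun v'' a'' t'' ht'' => hg _ _ _ ?_
      have e3 : (m + 1) * (c + 2 * l + 5) = m * (c + 2 * l + 5) + (c + 2 * l + 5) := by ring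
      have := Nat.size_one
      omega
    · exact le_top

/-- A program that runs in its own part of the memory. -/
theorem Ex.region {ρ : ℕ → ℕ} (hρ : Function.Injective ρ) {N : ℕ} {u : State} {h : State → ℝ≥0∞}
    {Q : State → Prop} (hP : NamesBelow N P) (hu : u.time = 0) (hv : ∀ x, v (ρ x) = u.var x)
    (ha : ∀ x, a (ρ x) = u.arr x) (hE : Ens P (fun u' => u'.time ≤ c ∧ Q u') u)
    (hΦ : ∀ u' v' a', Q u' → (∀ x, v' (ρ x) = u'.var x) → (∀ x, a' (ρ x) = u'.arr x) →
      Fr (ρ '' Set.Iio N) (ρ '' Set.Iio N) v a v' a' → Φ v' a' ≤ h u') :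
    Ex (P.rename ρ) c v a Φ (E P h u) := by
  intro τ g hg
  have he : (⟨v, a, τ⟩ : State) = embed ρ ⟨v, a, τ⟩ u := by
    have : ∀ {α : Type} (f : ℕ → α) (f' : ℕ → α), (∀ x, f (ρ x) = f' x) →
        Function.extend ρ f' f = f := by
      intro α f f' hf
      funext y
      by_cases hy : ∃ x, ρ x = y
      · obtain ⟨x, rfl⟩ := hy; rw [hρ.extend_apply, hf]
      · rw [Function.extend_apply' _ _ _ hy]
    rw [embed, this v u.var hv, this a u.arr ha, hu, add_zero]
  rw [he, E_rename hρ]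
  refine (hE.frame hP.writesIn).E_le_E fun u' hu' => ?_
  have hfr : ∀ {α : Type} (f f₀ f' : ℕ → α), (∀ x, f (ρ x) = f₀ x) → (∀ x, x ∉ Set.Iio N → f' x = f₀ x) →
      ∀ y, y ∉ ρ '' Set.Iio N → Function.extend ρ f' f y = f y := by
    intro α f f₀ f' h1 h2 y hy
    by_cases hy' : ∃ x, ρ x = y
    · obtain ⟨x, rfl⟩ := hy'
      rw [hρ.extend_apply, h1, h2 x fun hx => hy ⟨x, hx, rfl⟩]
    · rw [Function.extend_apply' _ _ _ hy']
  refine (hg _ _ _ ?_).trans (hΦ u' _ _ hu'.1.2 (fun x => embed_var hρ ⟨v, a, τ⟩ u' x)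
    (fun x => embed_arr hρ ⟨v, a, τ⟩ u' x) ⟨hfr _ _ _ hv hu'.2.1, hfr _ _ _ ha hu'.2.2⟩)
  have := hu'.1.1
  simp only; omega

end Ex

/-! ### Preparing a memory region and the initial value of the clock -/

/-- Reset the variables and arrays `ρ 0, …, ρ (N - 1)`. -/
def resetRegion (ρ : ℕ → ℕ) : ℕ → Prog
  | 0 => .skip
  | N + 1 => resetRegion ρ N ;; .const (ρ N) 0 ;; .clear (ρ N)

theorem writesIn_resetRegion (ρ : ℕ → ℕ) (N : ℕ) :
    WritesIn (ρ '' Set.Iio N) (ρ '' Set.Iio N) (resetRegion ρ N) := by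
  induction N with
  | zero => trivial
  | succ N ih =>
    have h : ρ '' Set.Iio N ⊆ ρ '' Set.Iio (N + 1) :=
      Set.image_mono (Set.Iio_subset_Iio (Nat.le_succ N))
    exact ⟨ih.mono h h, ⟨N, by simp, rfl⟩, ⟨N, by simp, rfl⟩⟩

theorem tr_resetRegion (ρ : ℕ → ℕ) (hρ : Function.Injective ρ) (N : ℕ) (v : ℕ → ℕ) (a : ℕ → List ℕ) :
    Tr (resetRegion ρ N) (2 * N + 1) v a fun v' a' => (∀ x < N, v' (ρ x) = 0 ∧ a' (ρ x) = []) ∧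
      Fr (ρ '' Set.Iio N) (ρ '' Set.Iio N) v a v' a' := by
  refine Tr.frame ?_ (writesIn_resetRegion ρ N)
  induction N with
  | zero => intro τ; rw [resetRegion, Ens_skip]; exact ⟨by simp, by simp⟩
  | succ N ih =>
    intro τ
    refine ih.seqStep fun v1 a1 t1 ht1 h1 => ?_
    simp only [Ens_seq, Ens_const, Ens_clear, Nat.size_zero]
    refine ⟨by omega, fun x hx => ?_⟩
    by_cases hxN : x = N
    · subst hxN; simp
    · rw [Function.update_of_ne (hρ.ne hxN), Function.update_of_ne (hρ.ne hxN)]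
      exact h1 x (by omega)

/-- Multiply the variable `x` by the value of variable `0` plus `2`. -/
def mulDim (x : ℕ) : Prog :=
  .const 46 0 ;; .const 1 2 ;; .plus 47 0 1 ;; .forN 47 (.plus 46 46 x) ;; .const 1 0 ;; .plus x 46 1

/-- Compute a power of the value of variable `0` plus `2`. -/
def powDim (x : ℕ) : ℕ → Prog
  | 0 => .const x 1
  | d + 1 => powDim x d ;; mulDim x

theorem writesIn_mulDim (x : ℕ) : WritesIn {1, 46, 47, x} ∅ (mulDim x) := by
  simp [mulDim, WritesIn, Prog.forN]

theorem writesIn_powDim (x d : ℕ) : WritesIn {1, 46, 47, x} ∅ (powDim x d) := by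
  induction d with
  | zero => simp [powDim, WritesIn]
  | succ d ih => exact ⟨ih, writesIn_mulDim x⟩

/-- A bound for the running time of `mulDim`. -/
def mulDimCost (n l : ℕ) : ℕ := (n + 2) * (4 * l + 6) + 2 * l + 12

theorem tr_mulDim {x W l n m : ℕ} {v : ℕ → ℕ} {a : ℕ → List ℕ} (hW : Nat.size W ≤ l)
    (hx : x ≠ 0 ∧ x ≠ 1 ∧ x ≠ 46 ∧ x ≠ 47) (hn : v 0 = n) (hm : v x = m)
    (hxW : (n + 2) * m + m + n + 2 ≤ W) :
    Tr (mulDim x) (mulDimCost n l) v a fun v' a' => v' x = (n + 2) * m ∧ v' 0 = n := by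
  subst hm
  intro τ
  have sn : Nat.size n ≤ l := size_le_of_le hW (by omega)
  have sn2 : Nat.size (n + 2) ≤ l := size_le_of_le hW (by omega)
  simp only [mulDim, Ens_seq, Ens_const, Ens_plus]
  simp only [Function.update_apply, Nat.reduceEqDiff, if_true, if_false, add_zero, hn,
    OfNat.zero_ne_ofNat, zero_ne_one]
  refine Tr.step (Tr.forN_frame (N := n + 2) (l := l) (c := 1 + 2 * l) (vs := {1, 46, 47}) (as := ∅)
    (I := fun k v' a' => v' 46 = k * v x)
    (by simp [WritesIn]) (by simp) (by simp) (by simp) sn2 ?_ ?_ ?_)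
    fun v1 a1 t1 ht1 ⟨_, h46, hF1⟩ => ?_
  · simp
  · simp
  · intro k hk v' a' hF hv' h46 τ
    have h0 : v' x = v x := by rw [hF.1 x (by simp [hx])]; simp [Function.update_apply, hx]
    have hkn : (k + 1) * v x ≤ (n + 2) * v x := Nat.mul_le_mul_right _ hk
    rw [add_mul, one_mul] at hkn
    have s1 : Nat.size (k * v x) ≤ l := size_le_of_le hW (by omega)
    have s2 : Nat.size (v x) ≤ l := size_le_of_le hW (by omega)
    simp only [Ens_plus, Function.update_apply, Nat.reduceEqDiff, if_true, if_false, h0, h46, hv']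
    exact ⟨by omega, trivial, by ring⟩
  · have s1 : Nat.size ((n + 2) * v x) ≤ l := size_le_of_le hW (by omega)
    have s2 : Nat.size 2 ≤ 2 := size_le_self 2
    have h0 : v1 0 = n := by rw [hF1.1 0 (by simp)]; simp [hn]
    simp only [Ens_seq, Ens_const, Ens_plus, Function.update_apply, Nat.reduceEqDiff, if_true, if_false,
      h46, Nat.size_zero, add_zero, hx.1.symm, zero_ne_one, h0] at ht1 ⊢
    refine ⟨?_, trivial, trivial⟩
    have e : (n + 2) * (1 + 2 * l + 2 * l + 5) = (n + 2) * (4 * l + 6) := by ring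
    rw [mulDimCost]
    omega

/-- This supplies the initial clock value. The exponent is fixed, so the program is a fixed sequence
of `d` multiplications and costs only `Õ(n)`. -/
theorem tr_powDim {x W l n d : ℕ} {v : ℕ → ℕ} {a : ℕ → List ℕ} (hW : Nat.size W ≤ l)
    (hx : x ≠ 0 ∧ x ≠ 1 ∧ x ≠ 46 ∧ x ≠ 47) (hn : v 0 = n)
    (hxW : (n + 2) ^ d + (n + 2) ^ d + n + 2 ≤ W) :
    Tr (powDim x d) (d * mulDimCost n l + 2) v a fun v' a' => v' x = (n + 2) ^ d ∧
      Fr {1, 46, 47, x} ∅ v a v' a' := by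
  refine Tr.mono (Tr.frame (Q := fun v' a' => v' x = (n + 2) ^ d ∧ v' 0 = n) ?_ (writesIn_powDim x d)) le_rfl
    fun v' a' h => ⟨h.1.1, h.2⟩
  induction d with
  | zero =>
    intro τ
    rw [powDim, Ens_const]
    exact ⟨by simp only [Nat.size_one]; omega, by simp, by simp [Function.update_apply, hx.1.symm, hn]⟩
  | succ d ih =>
    have h1 : (n + 2) ^ d ≤ (n + 2) ^ (d + 1) := Nat.pow_le_pow_right (by omega) (Nat.le_succ d)
    refine Tr.mono ((ih (by omega)).seq fun v' a' h => tr_mulDim hW hx h.2 h.1 (by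
      rw [← pow_succ']; omega)) (by rw [add_mul]; omega) ?_
    intro v'' a'' h
    rw [pow_succ']
    exact h

theorem Tr.plus {x y z l : ℕ} {v : ℕ → ℕ} {a : ℕ → List ℕ} {Q : (ℕ → ℕ) → (ℕ → List ℕ) → Prop}
    (hy : Nat.size (v y) ≤ l) (hz : Nat.size (v z) ≤ l) (h : Q (Function.update v x (v y + v z)) a) :
    Tr (.plus x y z) (1 + 2 * l) v a Q := by
  intro τ
  rw [Ens_plus]
  exact ⟨by simp only; omega, h⟩

theorem Tr.skip {v : ℕ → ℕ} {a : ℕ → List ℕ} {Q : (ℕ → ℕ) → (ℕ → List ℕ) → Prop} (h : Q v a) :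
    Tr .skip 1 v a Q := by
  intro τ
  rw [Ens_skip]
  exact ⟨by simp only; omega, h⟩

theorem WritesIn.rename {vs as : Set ℕ} (ρ : ℕ → ℕ) {P : Prog} (h : WritesIn vs as P) :
    WritesIn (ρ '' vs) (ρ '' as) (P.rename ρ) := by
  induction P with
  | seq P Q ihP ihQ => exact ⟨ihP h.1, ihQ h.2⟩
  | ifNZ x P Q ihP ihQ => exact ⟨ihP h.1, ihQ h.2⟩
  | whileNZ x P ih => exact ih h
  | skip => trivial
  | _ => exact ⟨_, h, rfl⟩

/-! ### Calling the given inverter -/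

/-- The names that the given inverter uses. -/
def regM (x : ℕ) : ℕ := 101 + 2 * x

/-- The names that the sampler uses. -/
def regS (x : ℕ) : ℕ := 100 + 2 * x

theorem regM_injective : Function.Injective regM := fun x y h => by simp only [regM] at h; omega

theorem regS_injective : Function.Injective regS := fun x y h => by simp only [regS] at h; omega

section field

variable {F : Type*} [Field F] [Fintype F] (code : F ≃ Fin (Fintype.card F)) {n : ℕ}

/-- A number that is large enough for `fallback`. -/
def fbBound (q n : ℕ) : ℕ := 2 * (n * n) + 2 * n + 2 * q ^ (n * n) + q + 2

/-- The running time of `fallback`. -/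
def fbCost (q n : ℕ) : ℕ := fallbackCost q n (Nat.size (fbBound q n))

/-- The initial configuration of the clocked inverter. -/
def clkInput (N n : ℕ) (L : List ℕ) (c₀ : ℕ) : State := (input n L []).setVar N c₀

open Classical in
/-- The inverse of the matrix `B` that is obtained from the final configuration of the clocked
inverter. -/
noncomputable def result (N : ℕ) (B : Matrix (Fin n) (Fin n) F) (u : State) : Matrix (Fin n) (Fin n) F :=
  if u.var N = 0 then powInv B else sanMatrix code n (u.arr 1)

/-- Try to invert the matrix in array `2` with the given inverter; the result goes to array `3`. If
the inverter takes too long, then the matrix is inverted by powering. -/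
def callM (M : Prog) (N N' d : ℕ) : Prog :=
  resetRegion regM N' ;; copySq F 2 101 ;; .const 1 0 ;; .plus 101 0 1 ;; powDim (regM N) d ;;
    (M.clk N).rename regM ;; copySq F 103 3 ;; .ifNZ (regM N) .skip (fallback code 2 3)

/-- The variables that `callM` changes. -/
def callVars (N' : ℕ) : Set ℕ := low 50 ∪ regM '' Set.Iio N'

/-- The arrays that `callM` changes. -/
def callArrs (N' : ℕ) : Set ℕ := {3, 20, 21} ∪ regM '' Set.Iio N'

theorem writesIn_callM {M : Prog} {N N' d : ℕ} (hM : NamesBelow N' (M.clk N)) (hN0 : 1 ≤ N) (hN : N < N') :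
    WritesIn (callVars N') (callArrs N') (callM code M N N' d) := by
  have h101 : 101 ∈ regM '' Set.Iio N' := ⟨0, by simp; omega, rfl⟩
  have h103 : 103 ∈ regM '' Set.Iio N' := ⟨1, by simp; omega, rfl⟩
  have hl : low 50 ⊆ callVars N' := Set.subset_union_left
  have hr : regs 30 ⊆ callVars N' := (regs_subset_low (by simp)).trans Set.subset_union_left
  refine ⟨(writesIn_resetRegion _ _).mono Set.subset_union_right Set.subset_union_right,
    (writesIn_copySq _ _).mono hr (by simp [callArrs, h101]), Or.inl (by simp [low]), Or.inr h101,
    (writesIn_powDim _ _).mono ?_ (by simp), (hM.writesIn.rename regM).mono Set.subset_union_right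
      Set.subset_union_right, (writesIn_copySq _ _).mono hr (by simp [callArrs]), trivial,
    (writesIn_fallback code _ _).mono hl Set.subset_union_left⟩
  intro x hx
  simp only [Set.mem_insert_iff, Set.mem_singleton_iff] at hx
  rcases hx with rfl | rfl | rfl | rfl
  · exact Or.inl (by simp [low])
  · exact Or.inl (by simp [low])
  · exact Or.inl (by simp [low])
  · exact Or.inr ⟨N, hN, rfl⟩

/-- A bound for the running time of `callM`, where `τ` is a bound for the clocked inverter. -/
def callCost (q N' d n l τ : ℕ) : ℕ :=
  2 * N' + copyEncCost q n l + d * mulDimCost n l + τ + copySqCost q n l τ + τ + 3 * l + 20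

theorem notMem_regM {x : ℕ} (hx : x < 101) (s : Set ℕ) : x ∉ regM '' s := by
  rintro ⟨y, _, rfl⟩; simp only [regM] at hx; omega

-- The inverter sees its initial configuration exactly, because its names are reset and the names
-- from `N'` on are clean by `hclean`. The hypothesis `hclk` contains the decisive alternative:
-- either the clock is positive at the end, or `τ` is large enough to pay for inversion by powering.
-- The bound is the expectation of `φ` at the resulting matrix, with the randomness of the inverter
-- kept intact.
open Classical in
theorem ex_callM {M : Prog} {N N' d W l τ : ℕ} {v : ℕ → ℕ} {a : ℕ → List ℕ}
    {B : Matrix (Fin n) (Fin n) F} {Φ : (ℕ → ℕ) → (ℕ → List ℕ) → ℝ≥0∞}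
    {φ : Matrix (Fin n) (Fin n) F → ℝ≥0∞} (hM : NamesBelow N' (M.clk N)) (hN0 : 1 ≤ N) (hN : N < N')
    (hW : Nat.size W ≤ l) (hnW : n * n + n ≤ W) (hdW : (n + 2) ^ d + (n + 2) ^ d + n + 2 ≤ W)
    (hn : v 0 = n) (hB : a 2 = encMatrix code B)
    (hclean : ∀ x, N' ≤ x → v (regM x) = 0 ∧ a (regM x) = [])
    (hclk : Ens (M.clk N) (fun u => u.time ≤ τ ∧ u.var N ≤ (n + 2) ^ d ∧
      (u.var N = 0 → fbCost (Fintype.card F) n ≤ τ)) (clkInput N n (encMatrix code B) ((n + 2) ^ d)))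
    (hΦ : ∀ X v' a', a' 3 = encMatrix code X → Fr (callVars N') (callArrs N') v a v' a' →
      Φ v' a' ≤ φ X) :
    Ex (callM code M N N' d) (callCost (Fintype.card F) N' d n l τ) v a Φ
      (E (M.clk N) (fun u => φ (result code N B u))
        (clkInput N n (encMatrix code B) ((n + 2) ^ d))) := by
  set c₀ := (n + 2) ^ d with hc₀
  refine Ex.frame (Φ := fun v' a' => if Fr (callVars N') (callArrs N') v a v' a' then Φ v' a' else 0) ?_
    (writesIn_callM code hM hN0 hN) fun v' a' hF => by rw [if_pos hF]
  obtain ⟨Φ₀, hΦ₀⟩ : ∃ Φ₀, Φ₀ = fun v' a' =>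
      if Fr (callVars N') (callArrs N') v a v' a' then Φ v' a' else 0 := ⟨_, rfl⟩
  have hΦ' : ∀ X v' a', a' 3 = encMatrix code X → Φ₀ v' a' ≤ φ X := by
    intro X v' a' h
    rw [hΦ₀]
    simp only
    split_ifs with hF
    · exact hΦ X v' a' h hF
    · exact zero_le
  rw [← hΦ₀]
  have sn : Nat.size n ≤ l := size_le_of_le hW (by omega)
  have nr : ∀ x < 101, ∀ s : Set ℕ, x ∉ regM '' s := fun x hx s => notMem_regM hx s
  have rne : ∀ x y, y < 101 → regM x ≠ y := fun x y hy => by simp only [regM]; omega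
  refine Ex.mono ((tr_resetRegion regM regM_injective N' v a).exSeq (c₂ := copyEncCost (Fintype.card F) n l
    + (1 + 0 + (1 + 2 * l + (d * mulDimCost n l + 2 + (τ + (copySqCost (Fintype.card F) n l τ +
      (τ + 1 + 1 + l)))))))
    fun v1 a1 ⟨h1, hF1⟩ => ?_) (by rw [callCost]; omega) (fun _ _ => le_rfl) le_rfl
  have e1 : v1 0 = n := by rw [hF1.1 0 (nr 0 (by simp) _), hn]
  have b1 : a1 2 = encMatrix code B := by rw [hF1.2 2 (nr 2 (by simp) _), hB]
  have c1 : ∀ x, v1 (regM x) = 0 ∧ a1 (regM x) = [] := by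
    intro x
    by_cases hx : x < N'
    · exact h1 x hx
    · have : regM x ∉ regM '' Set.Iio N' := by
        rintro ⟨y, hy, hxy⟩
        rw [regM_injective hxy] at hy
        exact hx hy
      rw [hF1.1 _ this, hF1.2 _ this]
      exact hclean x (by omega)
  refine (tr_copySq_enc code (A := 2) (out := 101) (by simp) hW e1 hnW b1).exSeq fun v2 a2 ⟨h2, hF2⟩ => ?_
  have hr : ∀ x, regM x ∉ regs 30 := by intro x; simp [regM, regs]; omega
  refine (Tr.const (x := 1) (k := 0) (Q := fun v' a' => v' = Function.update v2 1 0 ∧ a' = a2)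
    ⟨rfl, rfl⟩).exSeq ?_
  rintro v3 a3 ⟨rfl, rfl⟩
  have e2 : v2 0 = n := by rw [hF2.1 0 (by simp [regs]), e1]
  refine (Tr.plus (x := 101) (y := 0) (z := 1) (l := l) (Q := fun v' a' => v' = Function.update
    (Function.update v2 1 0) 101 n ∧ a' = a3) (by simp [e2, sn]) (by simp) ⟨by simp [e2], rfl⟩).exSeq ?_
  rintro v4 a4 ⟨rfl, rfl⟩
  refine (tr_powDim (x := regM N) hW ⟨rne _ _ (by simp), rne _ _ (by simp), rne _ _ (by simp),
    rne _ _ (by simp)⟩ (by simp [e2]) (by rw [← hc₀]; omega)).exSeq fun v5 a5 ⟨h5, hF5⟩ => ?_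
  have ha5 : a5 = a4 := funext fun r => hF5.2 r (by simp)
  subst ha5
  have hv5 : ∀ x, v5 (regM x) = (clkInput N n (encMatrix code B) c₀).var x := by
    intro x
    simp only [clkInput, State.setVar, input, Function.update_apply]
    split_ifs with hx hx
    · rw [hx, h5]
    · subst hx
      rw [hF5.1 _ (by simp [regM]; omega)]
      simp [regM]
    · rw [hF5.1 _ (by simp [regM]; omega), Function.update_of_ne (by simp [regM]; omega),
        Function.update_of_ne (by simp [regM]; omega), hF2.1 _ (hr x)]
      exact (c1 x).1
  have ha5 : ∀ x, a5 (regM x) = (clkInput N n (encMatrix code B) c₀).arr x := by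
    intro x
    simp only [clkInput, State.setVar, input]
    split_ifs with hx hx
    · subst hx; exact h2
    · rw [hF2.2 _ (by simp [regM]; omega), (c1 x).2]
    · rw [hF2.2 _ (by simp [regM]; omega), (c1 x).2]
  have e5 : v5 0 = n := by
    rw [hF5.1 0 (by simp; exact (rne N 0 (by simp)).symm)]; simp [e2]
  have b5 : a5 2 = encMatrix code B := by rw [hF2.2 2 (by simp), b1]
  -- Array `103` is array `1` of the inverter. Its content is arbitrary, but its weight is at most
  -- the running time because that array starts empty.
  refine Ex.seq (Φ₁ := fun v' a' => if v' 0 = n ∧ a' 2 = encMatrix code B ∧ weight (a' 103) ≤ τ ∧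
      v' (regM N) ≤ c₀ ∧ (v' (regM N) = 0 → fbCost (Fintype.card F) n ≤ τ) then
      φ (if v' (regM N) = 0 then powInv B else sanMatrix code n (a' 103)) else ⊤)
    (Ex.region regM_injective (Q := fun u => (u.time ≤ τ ∧ u.var N ≤ c₀ ∧
      (u.var N = 0 → fbCost (Fintype.card F) n ≤ τ)) ∧ weight (u.arr 1) ≤ τ) hM rfl hv5 ha5
      (hclk.weight.mono fun u hu => ⟨hu.1.1, hu.1, ?_⟩) ?_) ?_
  · have := hu.2 1
    have h0 : weight ((clkInput N n (encMatrix code B) c₀).arr 1) = 0 := by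
      simp [clkInput, State.setVar, input, weight]
    have h0' : (clkInput N n (encMatrix code B) c₀).time = 0 := rfl
    have := hu.1.1
    omega
  · rintro u v' a' ⟨⟨_, hu2, hu3⟩, hu4⟩ hv' ha' hF
    have e103 : a' 103 = u.arr 1 := ha' 1
    rw [if_pos]
    · rw [hv', e103, result]
    · rw [hv', e103]
      exact ⟨by rw [hF.1 0 (nr 0 (by simp) _), e5], by rw [hF.2 2 (nr 2 (by simp) _), b5], hu4, hu2, hu3⟩
  · intro v6 a6 hne
    have hc : v6 0 = n ∧ a6 2 = encMatrix code B ∧ weight (a6 103) ≤ τ ∧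
        v6 (regM N) ≤ c₀ ∧ (v6 (regM N) = 0 → fbCost (Fintype.card F) n ≤ τ) := by
      by_contra hc; exact hne (if_neg hc)
    rw [if_pos hc]
    obtain ⟨e6, b6, w6, cl6, fb6⟩ := hc
    refine Ex.mono ((tr_copySq code (A := 103) (out := 3) (by simp) hW e6 hnW).exSeq (c₂ := τ + 1 + 1 + l)
      (Φ := Φ₀) fun v7 a7 ⟨h7, hF7⟩ => ?_) (by rw [copySqCost, copySqCost, copyCost, copyCost]; omega)
      (fun _ _ => le_rfl) le_rfl
    have e7 : v7 (regM N) = v6 (regM N) := hF7.1 _ (hr N)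
    have s7 : Nat.size (v7 (regM N)) ≤ l := size_le_of_le hW (by omega)
    refine Ex.mono (Ex.ifNZ (c := τ + 1) (fun hx => ?_) (fun hx => ?_)) (by omega)
      (fun _ _ => le_rfl) le_rfl
    · refine ((Tr.skip (Q := fun v' a' => a' = a7) rfl).mono (by omega) fun _ _ h => h).ex ?_
      rintro v' a' rfl
      rw [if_neg (e7 ▸ hx)]
      exact hΦ' _ _ _ h7
    · rw [if_pos (e7 ▸ hx)]
      -- Powering handles numbers of about `n²` bits, so it uses its own bound `fbBound` instead of
      -- `W`. Its cost is covered by `τ` because the clock has run out.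
      refine ((tr_fallback code (src := 2) (out := 3) (W := fbBound (Fintype.card F) n) (by simp) (by simp)
        (by simp) le_rfl (by rw [hF7.1 0 (by simp [regs]), e6]) (by rw [fbBound]; omega)
        (by rw [fbBound]; omega) (by rw [hF7.2 2 (by simp), b6])).mono (c' := τ + 1) ?_ fun _ _ h => h).ex ?_
      · have := fb6 (e7 ▸ hx)
        rw [fbCost] at this
        omega
      · rintro v' a' ⟨h8, _⟩
        exact hΦ' _ _ _ h8

end field

/-! ### The clocked inverter -/

section clkInput

variable {M : Prog} {N n c₀ : ℕ} {L : List ℕ}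

theorem clkRel_init (K : ℕ) : ClkRel N K 0 c₀ 0 0 (input n L []) (clkInput N n L c₀) where
  agree := fun _ x hx => ⟨Function.update_of_ne hx.ne _ _, rfl⟩
  time_le := by simp [clkInput, input, State.setVar]
  le_clock := by simp [clkInput, State.setVar]
  clock_le := by simp [clkInput, State.setVar]

/-- The simulation loses only the factor for testing and decrementing the clock. An exhausted clock
forces the simulated run to have lasted `c₀` units of time, so the bound `T` must be at least `c₀`.
-/
theorem ens_clk {T : ℕ} (hM : NamesBelow N M) (hT : HaltsWithin M (input n L []) T) :
    Ens (M.clk N) (fun u => u.time ≤ (2 * Nat.size c₀ + 10) * T ∧ u.var N ≤ c₀ ∧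
      (u.var N = 0 → c₀ ≤ T)) (clkInput N n L c₀) := by
  have h := (ens_of_haltsWithin hT).mono (Q' := fun s => s.time ≤ T) fun _ h => h.1
  rw [Ens.eq_1] at h ⊢
  refine le_antisymm (le_trans ?_ h.le) zero_le
  refine E_clk_le le_rfl hM (fun s s' hr => ?_) (clkRel_init (2 * Nat.size c₀ + 10))
  refine topUnless_le_of fun hs => ⟨?_, hr.clock_le, fun h0 => ?_⟩
  · have h1 := hr.time_le
    have h2 : (2 * Nat.size c₀ + 10) * s.time ≤ (2 * Nat.size c₀ + 10) * T := Nat.mul_le_mul_left _ hs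
    omega
  · have := hr.le_clock
    omega

/-- This bound does not involve `T`: at most `A * (c₀ + 1)` steps are made, and each lengthens the
numbers by at most one bit. It is used for the distinguisher, whereas `ens_clk` is used for the
algorithm. -/
theorem ens_clk_poly {A B₀ b : ℕ} (hA : ClkSteps N A B₀ (M.clk N)) (hb : B₀ ≤ b)
    (hn : Nat.size n ≤ b) (hc : Nat.size c₀ ≤ b) (hL : ∀ y ∈ L, Nat.size y ≤ b)
    (hL' : Nat.size L.length ≤ b) :
    Ens (M.clk N) (fun u => u.time ≤ A * (c₀ + 1) * (3 * (b + A * (c₀ + 1)) + 3) ∧ u.var N ≤ c₀)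
      (clkInput N n L c₀) := by
  have h0 : (clkInput N n L c₀).var N = c₀ := by simp [clkInput, State.setVar]
  refine (hA (clkInput N n L c₀)).mono fun u ⟨hu, j, hj, hg⟩ => ?_
  rw [h0] at hu hj
  refine ⟨?_, hu⟩
  have hj' : j ≤ A * (c₀ + 1) := hj.trans (Nat.mul_le_mul_left _ (by omega))
  have hB : BitBound b (clkInput N n L c₀) := by
    refine ⟨fun x => ?_, fun r y hy => ?_, fun r => ?_⟩
    · simp only [clkInput, State.setVar, input, Function.update_apply]
      split_ifs
      · exact hc
      · exact hn
      · simp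
    · simp only [clkInput, State.setVar, input] at hy
      split_ifs at hy
      · exact hL y hy
      · simp at hy
      · simp at hy
    · simp only [clkInput, State.setVar, input]
      split_ifs
      · exact hL'
      · simp
      · simp
  have ht := (hg b hb hB).2
  have ht0 : (clkInput N n L c₀).time = 0 := rfl
  calc u.time ≤ j * (3 * (b + j) + 3) := by omega
    _ ≤ _ := by gcongr

end clkInput

section field

variable {F : Type*} [Field F] [Fintype F] (code : F ≃ Fin (Fintype.card F)) {n : ℕ}

/-- The probability that the clocked inverter inverts `B`. -/
noncomputable def succProb (M : Prog) (N c₀ : ℕ) (B : Matrix (Fin n) (Fin n) F) : ℝ≥0∞ :=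
  E (M.clk N) (ind fun u => B * result code N B u = 1) (clkInput N n (encMatrix code B) c₀)

/-- The probability that the clocked inverter does not invert `B`. -/
noncomputable def failProb (M : Prog) (N c₀ : ℕ) (B : Matrix (Fin n) (Fin n) F) : ℝ≥0∞ :=
  E (M.clk N) (ind fun u => ¬ B * result code N B u = 1) (clkInput N n (encMatrix code B) c₀)

variable {M : Prog} {N c₀ : ℕ}

theorem succProb_add_failProb {T : ℕ} {B : Matrix (Fin n) (Fin n) F} (hM : NamesBelow N M)
    (hT : HaltsWithin M (input n (encMatrix code B) []) T) :
    succProb code M N c₀ B + failProb code M N c₀ B = 1 :=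
  (ens_clk hM hT).E_ind_add _

/-- A coupled run can fail only where the original fails: a positive final clock means that the
outputs agree, and an exhausted clock means that the inverse is computed by powering. -/
theorem failProb_le {B : Matrix.GeneralLinearGroup (Fin n) F} (hM : NamesBelow N M) (hN : 1 < N) :
    failProb code M N c₀ B.1 ≤ E M (ind fun s => ¬ s.arr 1 = encMatrix code B⁻¹.1)
      (input n (encMatrix code B.1) []) := by
  refine E_clk_le le_rfl hM (fun s s' hr => ?_) (clkRel_init (2 * Nat.size c₀ + 10))
  by_cases hs : s.arr 1 = encMatrix code B⁻¹.1
  · have : B.1 * result code N B.1 s' = 1 := by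
      rw [result]
      split_ifs with h0
      · exact mul_powInv B.mul_inv
      · rw [(hr.agree h0 1 hN).2, hs, sanMatrix_encMatrix]
        exact B.mul_inv
    simp [ind, this]
  · rw [ind, ind, if_pos hs]
    split_ifs <;> simp

/-- The simulation provides only upper bounds for expectations, so the lower bound for success is
obtained by complementing the bound for failure. -/
theorem ofReal_probInverts_le {T : ℕ} [DecidableEq F] {B : Matrix.GeneralLinearGroup (Fin n) F}
    (hM : NamesBelow N M) (hN : 1 < N) (hT : HaltsWithin M (input n (encMatrix code B.1) []) T) :
    ENNReal.ofReal (probInverts code M B) ≤ succProb code M N c₀ B.1 := by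
  have h := ens_of_haltsWithin hT
  rw [probInverts, prob_eq_E h, ENNReal.ofReal_toReal
    ((h.E_ind_le_one _).trans_lt ENNReal.one_lt_top).ne]
  have h1 := h.E_ind_add fun s => s.arr 1 = encMatrix code B⁻¹.1
  have h2 := succProb_add_failProb code (c₀ := c₀) hM hT
  have h3 : failProb code M N c₀ B.1 ≠ ⊤ := by
    intro h; rw [h] at h2; simp at h2
  rw [← h2] at h1
  have h4 := failProb_le code (c₀ := c₀) (B := B) hM hN
  refine (ENNReal.add_le_add_iff_right h3).1 ?_
  rw [← h1]
  gcongr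

/-! ### The distinguisher -/

/-- Copy the variable `0` to the variable `x`. -/
def getDim (x : ℕ) : Prog := .const 1 0 ;; .plus x 0 1

theorem tr_getDim {x l : ℕ} {v : ℕ → ℕ} {a : ℕ → List ℕ} (hn : v 0 = n) (hl : Nat.size n ≤ l)
    (hx : x ≠ 0 ∧ x ≠ 1) :
    Tr (getDim x) (l + 3) v a fun v' a' => v' x = n ∧ Fr {1, x} ∅ v a v' a' := by
  refine Tr.frame ?_ (by simp [getDim, WritesIn])
  intro τ
  simp only [getDim, Ens_seq, Ens_const, Ens_plus]
  simp only [Function.update_apply, Nat.reduceEqDiff, if_true, if_false, add_zero, hn, zero_ne_one, Nat.size_zero]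
  exact ⟨by omega, trivial⟩

/-- The distinguisher: the matrix is in array `0`, and the inverse of the transpose of the matrix to
be inverted is in array `1`. -/
def distinguisher (M : Prog) (N N' d : ℕ) : Prog :=
  fallback code 1 4 ;; getDim 13 ;; matmul code 4 0 2 ;; callM code M N N' d ;; getDim 13 ;;
    matmul code 0 3 5 ;; squareDim ;; .const 18 0 ;; eqCheck 5 1 ;;
    .ifNZ 18 (.const 0 0) (.const 0 1)

/-- A bound for the running time of `distinguisher`. -/
def distCost (q N' d n l τ : ℕ) : ℕ :=
  fbCost q n + 2 * matmulCost q n n l + callCost q N' d n l τ + squareCost n l + eqCost q (n * n) l +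
    4 * l + 20

-- The values `p` and `q` for acceptance and rejection are free because an upper bound is needed for
-- both events: together they determine the acceptance probability exactly. The advice is `V = Y⁻¹`
-- rather than `Y`, since then success can be tested as `R * X = V`, against a matrix that is
-- already in memory.
open Classical in
theorem ex_distinguisher {N' d W l τ : ℕ} {R V Y : Matrix (Fin n) (Fin n) F} (p q : ℝ≥0∞)
    (hM : NamesBelow N' (M.clk N)) (hN0 : 1 ≤ N) (hN : N < N')
    (hW : Nat.size W ≤ l) (hnW : n * n + n * n + n + n + 1 ≤ W)
    (hdW : (n + 2) ^ d + (n + 2) ^ d + n + 2 ≤ W) (hV : Y * V = 1)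
    (hclk : Ens (M.clk N) (fun u => u.time ≤ τ ∧ u.var N ≤ (n + 2) ^ d ∧
      (u.var N = 0 → fbCost (Fintype.card F) n ≤ τ))
      (clkInput N n (encMatrix code (Y * R)) ((n + 2) ^ d))) :
    Ex (distinguisher code M N N' d) (distCost (Fintype.card F) N' d n l τ)
      (input n (encMatrix code R) (encMatrix code V)).var
      (input n (encMatrix code R) (encMatrix code V)).arr
      (fun v' _ => if v' 0 = 1 then p else q)
      (E (M.clk N) (fun u => (fun X => if Y * R * X = 1 then p else q) (result code N (Y * R) u))
        (clkInput N n (encMatrix code (Y * R)) ((n + 2) ^ d))) := by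
  have hVY : V * Y = 1 := mul_eq_one_comm.1 hV
  -- Here the deterministic inversion by powering recovers `Y` from the advice.
  have hY : powInv V = Y := by
    have h := mul_powInv hVY
    calc powInv V = Y * V * powInv V := by rw [hV, one_mul]
      _ = Y := by rw [mul_assoc, h, mul_one]
  generalize hv : (input n (encMatrix code R) (encMatrix code V)).var = v
  generalize ha : (input n (encMatrix code R) (encMatrix code V)).arr = a
  have h0 : v 0 = n := by rw [← hv]; rfl
  have a0 : a 0 = encMatrix code R := by rw [← ha]; rfl
  have a1 : a 1 = encMatrix code V := by rw [← ha]; rfl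
  have hclean : ∀ x, N' ≤ x → v (regM x) = 0 ∧ a (regM x) = [] := by
    intro x _
    rw [← hv, ← ha]
    simp [input, regM]
    omega
  have sn : Nat.size n ≤ l := size_le_of_le hW (by omega)
  refine Ex.mono ((tr_fallback code (src := 1) (out := 4) (W := fbBound (Fintype.card F) n) (by simp)
    (by simp) (by simp) le_rfl h0 (by rw [fbBound]; omega) (by rw [fbBound]; omega) a1).exSeq
    (c₂ := l + 3 + (matmulCost (Fintype.card F) n n l + (callCost (Fintype.card F) N' d n l τ + (l + 3 +
      (matmulCost (Fintype.card F) n n l + (squareCost n l + (1 + 0 + (eqCost (Fintype.card F) (n * n) l +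
      (2 + 1 + 1)))))))))
    fun v1 b1 ⟨f1, hF1⟩ => ?_) (by rw [distCost, fbCost]; omega) (fun _ _ => le_rfl) le_rfl
  refine (tr_getDim (n := n) (by rw [hF1.1 0 (by simp [low]), h0]) sn (by simp)).exSeq fun v2 b2 ⟨f2, hF2⟩ => ?_
  have e20 : v2 0 = n := by rw [hF2.1 0 (by simp), hF1.1 0 (by simp [low]), h0]
  have x24 : b2 4 = encMatrix code Y := by rw [hF2.2 4 (by simp), f1, hY]
  have x20 : b2 0 = encMatrix code R := by rw [hF2.2 0 (by simp), hF1.2 0 (by simp), a0]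
  refine (tr_matmul_enc code (A := 4) (B := 0) (out := 2) (by simp) (by simp) hW e20 f2 (by omega)
    x24 x20).exSeq fun v3 b3 ⟨f3, hF3⟩ => ?_
  have e30 : v3 0 = n := by rw [hF3.1 0 (by simp [regs]), e20]
  have x30 : b3 0 = encMatrix code R := by rw [hF3.2 0 (by simp), x20]
  have x31 : b3 1 = encMatrix code V := by
    rw [hF3.2 1 (by simp), hF2.2 1 (by simp), hF1.2 1 (by simp), a1]
  have clean3 : ∀ x, N' ≤ x → v3 (regM x) = 0 ∧ b3 (regM x) = [] := by
    intro x hx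
    rw [hF3.1 _ (by simp [regs, regM]; omega), hF2.1 _ (by simp [regM]; omega), hF1.1 _ (by simp [low, regM]; omega),
      hF3.2 _ (by simp [regM]; omega), hF2.2 _ (by simp), hF1.2 _ (by simp [regM]; omega)]
    exact hclean x hx
  obtain ⟨Φ₁, hΦ₁⟩ : ∃ Φ₁ : (ℕ → ℕ) → (ℕ → List ℕ) → ℝ≥0∞, Φ₁ = fun v' a' =>
      if ∃ X : Matrix (Fin n) (Fin n) F, a' 3 = encMatrix code X ∧ v' 0 = n ∧ a' 0 = encMatrix code R ∧ a' 1 = encMatrix code V then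
        (if ∃ X : Matrix (Fin n) (Fin n) F, a' 3 = encMatrix code X ∧ Y * R * X = 1 then p else q) else ⊤ := ⟨_, rfl⟩
  have hcall : Ex (callM code M N N' d) (callCost (Fintype.card F) N' d n l τ) v3 b3 Φ₁
      (E (M.clk N) (fun u => (fun X => if Y * R * X = 1 then p else q) (result code N (Y * R) u))
        (clkInput N n (encMatrix code (Y * R)) ((n + 2) ^ d))) := by
    refine ex_callM code (φ := fun X => if Y * R * X = 1 then p else q) hM hN0 hN hW (by omega) hdW e30 f3 clean3 hclk fun X v' a' hX hF => ?_
    rw [hΦ₁]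
    simp only
    rw [if_pos]
    · refine le_of_eq ?_
      congr 1
      refine propext ⟨?_, fun h => ⟨X, hX, h⟩⟩
      rintro ⟨X', hX', h⟩
      rwa [encMatrix_injective code (hX.symm.trans hX')]
    · refine ⟨X, hX, ?_, ?_, ?_⟩
      · rw [hF.1 0 (by rintro (h | h); exact absurd h (by simp [low]); exact notMem_regM (by simp) _ h), e30]
      · rw [hF.2 0 (by rintro (h | h); exact absurd h (by simp); exact notMem_regM (by simp) _ h), x30]
      · rw [hF.2 1 (by rintro (h | h); exact absurd h (by simp); exact notMem_regM (by simp) _ h), x31]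
  refine hcall.seq ?_
  · rw [hΦ₁]
    intro v4 b4 hne
    simp only at hne ⊢
    have hc : ∃ X : Matrix (Fin n) (Fin n) F, b4 3 = encMatrix code X ∧ v4 0 = n ∧ b4 0 = encMatrix code R ∧
        b4 1 = encMatrix code V := by
      by_contra hc; exact hne (if_neg hc)
    rw [if_pos hc]
    obtain ⟨X, x43, e40, x40, x41⟩ := hc
    have hiff : (∃ X : Matrix (Fin n) (Fin n) F, b4 3 = encMatrix code X ∧ Y * R * X = 1) ↔ R * X = V := by
      constructor
      · rintro ⟨X', hX', h⟩
        rw [← encMatrix_injective code (x43.symm.trans hX')] at h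
        calc R * X = V * Y * (R * X) := by rw [hVY, one_mul]
          _ = V * (Y * R * X) := by simp only [mul_assoc]
          _ = V := by rw [h, mul_one]
      · intro h
        exact ⟨X, x43, by rw [mul_assoc, h, hV]⟩
    simp only [hiff]
    refine (tr_getDim (n := n) e40 sn (by simp)).exSeq fun v5 b5 ⟨f5, hF5⟩ => ?_
    have e50 : v5 0 = n := by rw [hF5.1 0 (by simp), e40]
    have x50 : b5 0 = encMatrix code R := by rw [hF5.2 0 (by simp), x40]
    have x53 : b5 3 = encMatrix code X := by rw [hF5.2 3 (by simp), x43]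
    refine (tr_matmul_enc code (A := 0) (B := 3) (out := 5) (by simp) (by simp) hW e50 f5 (by omega)
      x50 x53).exSeq fun v6 b6 ⟨f6, hF6⟩ => ?_
    have e60 : v6 0 = n := by rw [hF6.1 0 (by simp [regs]), hF5.1 0 (by simp), e40]
    have x61 : b6 1 = encMatrix code V := by rw [hF6.2 1 (by simp), hF5.2 1 (by simp), x41]
    refine (tr_squareDim hW e60 (by omega)).exSeq fun v7 b7 ⟨f7, hF7⟩ => ?_
    refine (Tr.const (x := 18) (k := 0) (Q := fun v' a' => v' = Function.update v7 18 0 ∧ a' = b7)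
      ⟨rfl, rfl⟩).exSeq ?_
    rintro v8 b8 ⟨rfl, rfl⟩
    have x75 : b8 5 = lst code (n * n) (flat n (ext (R * X))) := by
      rw [hF7.2 5 (by simp), f6, encMatrix_eq]
    have x71 : b8 1 = lst code (n * n) (flat n (ext V)) := by rw [hF7.2 1 (by simp), x61, encMatrix_eq]
    refine (tr_eqCheck code (A := 5) (B := 1) (N := n * n) hW (by simp [f7]) (by omega) x75 x71).exSeq
      fun v9 b9 ⟨⟨f9, m9⟩, hF9⟩ => ?_
    have hacc : v9 18 = 0 ↔ R * X = V := by
      rw [f9]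
      constructor
      · rintro ⟨_, h⟩
        apply encMatrix_injective code
        rw [encMatrix_eq, encMatrix_eq]
        exact lst_congr code h
      · rintro h
        exact ⟨by simp, fun k _ => by rw [h]⟩
    have s9 : Nat.size (v9 18) ≤ 1 := by
      refine (Nat.size_le_size (m9.trans ?_)).trans Nat.size_one.le
      simp
    refine Ex.mono (Ex.ifNZ (c := 2) (fun hx => ?_) (fun hx => ?_)) (by omega)
      (fun _ _ => le_rfl) le_rfl
    · refine ((Tr.const (x := 0) (k := 0) (Q := fun v' _ => v' 0 = 0) (by simp)).mono (by simp)
        fun _ _ h => h).ex ?_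
      intro v' a' h
      rw [if_neg (by omega), if_neg fun h => hx (hacc.2 h)]
    · refine ((Tr.const (x := 0) (k := 1) (Q := fun v' _ => v' 0 = 1) (by simp)).mono (by simp [Nat.size_one])
        fun _ _ h => h).ex ?_
      intro v' a' h
      rw [if_pos h, if_pos (hacc.1 hx)]

end field

/-! ### Polynomial bounds -/

/-- A function that is bounded by a polynomial. -/
def PolyB (f : ℕ → ℕ) : Prop := ∃ d, ∀ n, f n ≤ (n + 2) ^ d

namespace PolyB

variable {f g : ℕ → ℕ}

theorem mono (hg : PolyB g) (h : ∀ n, f n ≤ g n) : PolyB f :=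
  let ⟨d, hd⟩ := hg; ⟨d, fun n => (h n).trans (hd n)⟩

theorem const (c : ℕ) : PolyB fun _ => c :=
  ⟨c, fun n => Nat.lt_two_pow_self.le.trans (Nat.pow_le_pow_left (by omega) c)⟩

theorem id : PolyB fun n => n := ⟨1, fun n => by rw [pow_one]; show n ≤ _; omega⟩

theorem mul (hf : PolyB f) (hg : PolyB g) : PolyB fun n => f n * g n := by
  obtain ⟨d, hd⟩ := hf
  obtain ⟨e, he⟩ := hg
  exact ⟨d + e, fun n => by rw [pow_add]; exact Nat.mul_le_mul (hd n) (he n)⟩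

theorem add (hf : PolyB f) (hg : PolyB g) : PolyB fun n => f n + g n := by
  obtain ⟨d, hd⟩ := hf
  obtain ⟨e, he⟩ := hg
  refine ⟨d + e + 1, fun n => ?_⟩
  have h1 : (n + 2) ^ d ≤ (n + 2) ^ (d + e) := Nat.pow_le_pow_right (by omega) (by omega)
  have h2 : (n + 2) ^ e ≤ (n + 2) ^ (d + e) := Nat.pow_le_pow_right (by omega) (by omega)
  have h3 : (n + 2) ^ (d + e) * 2 ≤ (n + 2) ^ (d + e) * (n + 2) := Nat.mul_le_mul_left _ (by omega)
  have := hd n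
  have := he n
  rw [pow_succ]
  show f n + g n ≤ _
  omega

theorem pow (hf : PolyB f) (k : ℕ) : PolyB fun n => f n ^ k := by
  obtain ⟨d, hd⟩ := hf
  exact ⟨d * k, fun n => by rw [pow_mul]; exact Nat.pow_le_pow_left (hd n) k⟩

theorem le_pow_add (hf : PolyB f) : ∃ d, ∀ n, f n ≤ n ^ d + d := by
  obtain ⟨d, hd⟩ := hf
  have h2 : 2 * d ≤ 3 ^ d := by
    clear hd
    induction d with
    | zero => simp
    | succ d ih =>
      have : 1 ≤ 3 ^ d := Nat.one_le_pow _ _ (by simp)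
      rw [pow_succ]; omega
  refine ⟨3 ^ d, fun n => (hd n).trans ?_⟩
  rcases Nat.lt_or_ge n 2 with hn | hn
  · have : (n + 2) ^ d ≤ 3 ^ d := Nat.pow_le_pow_left (by omega) d
    omega
  · have h1 : (n + 2) ^ d ≤ (n ^ 2) ^ d := Nat.pow_le_pow_left (by nlinarith) d
    rw [← pow_mul] at h1
    have h3 : n ^ (2 * d) ≤ n ^ 3 ^ d := Nat.pow_le_pow_right (by omega) h2
    omega

end PolyB

theorem size_pow_le (q k : ℕ) : Nat.size (q ^ k) ≤ k * Nat.size q + 1 := by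
  rw [Nat.size_le, pow_succ, mul_comm k, pow_mul]
  have h1 : q ^ k ≤ (2 ^ Nat.size q) ^ k := Nat.pow_le_pow_left (Nat.lt_size_self q).le k
  have h2 : 0 < (2 ^ Nat.size q) ^ k := by positivity
  omega

/-- The numbers in the computation of the group order are exponential in `n²`, but only their bit
length enters the cost, and that is quadratic in `n`. -/
theorem polyB_fbCost (q : ℕ) : PolyB (fbCost q) := by
  have hl : PolyB fun n => Nat.size (fbBound q n) := by
    refine PolyB.mono (g := fun n => 2 * (n * n) + 2 * n + (n * n * Nat.size q + 1) + q + 12) ?_ fun n => ?_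
    · exact ((((((PolyB.const 2).mul (PolyB.id.mul PolyB.id)).add ((PolyB.const 2).mul PolyB.id)).add
        (((PolyB.id.mul PolyB.id).mul (PolyB.const _)).add (PolyB.const 1))).add (PolyB.const q)).add
        (PolyB.const 12))
    · have h := size_pow_le q (n * n)
      set B := 2 * (n * n) + 2 * n + (n * n * Nat.size q + 1) + q + 2 with hB
      have h1 : Nat.size (q ^ (n * n)) ≤ B := by omega
      have h2 : Nat.size (2 * (n * n) + 2 * n + q + 2) ≤ B := (size_le_self _).trans (by omega)
      have h3 := size_add_le h1 h1
      have h4 := size_add_le h3 (h2.trans (Nat.le_succ _))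
      have : fbBound q n = q ^ (n * n) + q ^ (n * n) + (2 * (n * n) + 2 * n + q + 2) := by
        rw [fbBound]; ring
      rw [this]
      omega
  obtain ⟨l, hl'⟩ : ∃ l : ℕ → ℕ, l = fun n => Nat.size (fbBound q n) := ⟨_, rfl⟩
  rw [← hl'] at hl
  have : fbCost q = fun n => fallbackCost q n (l n) := by rw [hl']; rfl
  rw [this]
  unfold fallbackCost powStepCost orderCost copyEncCost copySqCost mulConstCost squareCost copyCost
    matmulCost matmulRowCost dotCost
  repeat' first
    | with_reducible exact PolyB.const _ | with_reducible exact PolyB.id | with_reducible exact hl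
    | with_reducible apply PolyB.add | with_reducible apply PolyB.mul

theorem polyB_distCost (q N' d : ℕ) {l τ : ℕ → ℕ} (hl : PolyB l) (hτ : PolyB τ) :
    PolyB fun n => distCost q N' d n (l n) (τ n) := by
  unfold distCost callCost copyEncCost copySqCost mulDimCost squareCost copyCost eqCost
    matmulCost matmulRowCost dotCost
  repeat' first
    | with_reducible exact PolyB.const _ | with_reducible exact PolyB.id | with_reducible exact hl
    | with_reducible exact hτ | with_reducible exact polyB_fbCost q
    | with_reducible apply PolyB.add | with_reducible apply PolyB.mul

/-! ### The density of invertible matrices -/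

/-- The bare bound `1 / 4` is not inductive, so a slack `y = 2⁻⁽ⁿ⁺²⁾` is carried along. The step is
`1 / 4 + y / 2 ≤ (1 / 4 + y) * (1 - y)`, which holds for `0 ≤ y ≤ 1 / 4`. -/
theorem quarter_le_prod {x : ℝ} (h0 : 0 ≤ x) (h : x ≤ 1 / 2) (n : ℕ) :
    1 / 4 + (1 / 2 : ℝ) ^ (n + 2) ≤ ∏ j ∈ Finset.range (n + 1), (1 - x ^ (j + 1)) := by
  induction n with
  | zero => simp; linarith
  | succ n ih =>
    rw [Finset.prod_range_succ]
    have hx : x ^ (n + 2) ≤ (1 / 2) ^ (n + 2) := pow_le_pow_left₀ h0 h _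
    set y : ℝ := (1 / 2) ^ (n + 2) with hy
    have hy0 : 0 < y := by positivity
    have hy1 : y ≤ 1 / 4 := by
      rw [hy, pow_add]
      have : (1 / 2 : ℝ) ^ n ≤ 1 := pow_le_one₀ (by norm_num) (by norm_num)
      linarith
    have hy2 : (1 / 2 : ℝ) ^ (n + 1 + 2) = y / 2 := by rw [hy]; ring
    rw [hy2]
    calc 1 / 4 + y / 2 ≤ (1 / 4 + y) * (1 - y) := by nlinarith
      _ ≤ (1 / 4 + y) * (1 - x ^ (n + 1 + 1)) := by gcongr
      _ ≤ _ := by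
        gcongr
        have : x ^ (n + 1 + 1) ≤ y := hx
        linarith

/-- The proportion of invertible matrices is the product of the factors `1 - q⁻ʲ` for `1 ≤ j ≤ n`,
and `q⁻¹ ≤ 1 / 2`. This transfers success on invertible matrices to success on all matrices at the
price of a factor `4`. -/
theorem card_matrix_le {F : Type*} [Field F] [Fintype F] [DecidableEq F] (n : ℕ) :
    (Fintype.card (Matrix (Fin n) (Fin n) F) : ℝ) ≤
      4 * Fintype.card (Matrix.GeneralLinearGroup (Fin n) F) := by
  rw [← Nat.card_eq_fintype_card (α := Matrix.GeneralLinearGroup (Fin n) F), Matrix.card_GL_field,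
    Fin.prod_univ_eq_prod_range fun i => Fintype.card F ^ n - Fintype.card F ^ i]
  have hcard : Fintype.card (Matrix (Fin n) (Fin n) F) = Fintype.card F ^ (n * n) := by
    rw [← Nat.card_eq_fintype_card, ← Nat.card_eq_fintype_card (α := F)]
    simp [Matrix, Nat.card_fun, pow_mul]
  rw [hcard]
  set q := Fintype.card F with hq
  have hq2 : 2 ≤ q := Fintype.one_lt_card
  have hq0 : (0 : ℝ) < q := by positivity
  rcases n with _ | n
  · norm_num
  have h := quarter_le_prod (x := (q : ℝ)⁻¹) (by positivity)
    (by rw [one_div]; exact inv_anti₀ (by norm_num) (by exact_mod_cast hq2)) n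
  have h1 : (1 / 4 : ℝ) ≤ ∏ j ∈ Finset.range (n + 1), (1 - (q : ℝ)⁻¹ ^ (j + 1)) := by
    have : (0 : ℝ) < (1 / 2) ^ (n + 2) := by positivity
    linarith
  rw [← Finset.prod_range_reflect] at h1
  have h2 : ((∏ i ∈ Finset.range (n + 1), (q ^ (n + 1) - q ^ i) : ℕ) : ℝ) = (q : ℝ) ^ ((n + 1) * (n + 1)) *
      ∏ j ∈ Finset.range (n + 1), (1 - (q : ℝ)⁻¹ ^ (n + 1 - 1 - j + 1)) := by
    have hc : (q : ℝ) ^ ((n + 1) * (n + 1)) = ∏ i ∈ Finset.range (n + 1), (q : ℝ) ^ (n + 1) := by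
      rw [Finset.prod_const, Finset.card_range, pow_mul]
    rw [hc, ← Finset.prod_mul_distrib]
    push_cast
    refine Finset.prod_congr rfl fun i hi => ?_
    have hi := Finset.mem_range.1 hi
    rw [Nat.cast_sub (Nat.pow_le_pow_right (by omega) hi.le)]
    push_cast
    rw [mul_sub, mul_one, inv_pow]
    congr 1
    rw [eq_mul_inv_iff_mul_eq₀ (by positivity), ← pow_add]
    congr 1
    omega
  rw [h2, Nat.cast_pow]
  have h3 := mul_le_mul_of_nonneg_left h1 (by positivity : (0 : ℝ) ≤ (q : ℝ) ^ ((n + 1) * (n + 1)))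
  linarith

/-! ### From indistinguishability to success on every invertible matrix -/

section field

variable {F : Type*} [Field F] [Fintype F] [DecidableEq F] (code : F ≃ Fin (Fintype.card F)) {n : ℕ}

/-- Upper bounds for an event and for its complement that sum to one must both be attained. -/
theorem prob_of_ex {P : Prog} {c : ℕ} {s : State} {A : State → Prop} {p q : ℝ≥0∞} (hpq : p + q = 1)
    (hs : s.time = 0)
    (hp : ∃ Φ, Ex P c s.var s.arr Φ p ∧ ∀ s', ind A s' ≤ Φ s'.var s'.arr)
    (hq : ∃ Φ, Ex P c s.var s.arr Φ q ∧ ∀ s', ind (fun s => ¬ A s) s' ≤ Φ s'.var s'.arr)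
    (hh : Tr P c s.var s.arr fun _ _ => True) : prob P s A = p.toReal := by
  have hs' : s = ⟨s.var, s.arr, 0⟩ := by rw [← hs]
  have h := hh 0
  rw [← hs'] at h
  rw [prob_eq_E h]
  congr 1
  obtain ⟨Φ, hΦ, hA⟩ := hp
  obtain ⟨Φ', hΦ', hA'⟩ := hq
  have h1 := hΦ 0 (ind A) fun v' a' t' _ => hA ⟨v', a', t'⟩
  have h2 := hΦ' 0 (ind fun s => ¬ A s) fun v' a' t' _ => hA' ⟨v', a', t'⟩
  rw [← hs'] at h1 h2
  have h3 := h.E_ind_add A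
  have h4 : E P (ind fun s => ¬ A s) s ≠ ⊤ := by
    intro ht; rw [ht] at h3; simp at h3
  refine le_antisymm h1 ?_
  refine (ENNReal.add_le_add_iff_right h4).1 ?_
  rw [h3, ← hpq]
  gcongr

/-- The acceptance probability is exactly the success probability of the clocked inverter on `Y *
R`. The bound `T` is used only to know that the inverter halts; the time `c` of the distinguisher
does not depend on it. -/
theorem exists_distinguisher {M : Prog} {T : ℕ → ℕ} {N N' d : ℕ} (hM : NamesBelow N M)
    (hM' : NamesBelow N' (M.clk N)) (hN0 : 1 < N) (hN : N < N')
    (hT : ∀ (n : ℕ) (A : Matrix (Fin n) (Fin n) F), HaltsWithin M (input n (encMatrix code A) []) (T n)) :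
    ∃ c : ℕ → ℕ, PolyB c ∧ ∀ (n : ℕ) (R V Y : Matrix (Fin n) (Fin n) F), Y * V = 1 →
      HaltsWithin (distinguisher code M N N' d) (input n (encMatrix code R) (encMatrix code V)) (c n) ∧
      prob (distinguisher code M N N' d) (input n (encMatrix code R) (encMatrix code V))
        (fun s => s.var 0 = 1) = (succProb code M N ((n + 2) ^ d) (Y * R)).toReal := by
  classical
  obtain ⟨A, B₀, hA⟩ := exists_clkSteps hM
  obtain ⟨b, hb⟩ : ∃ b : ℕ → ℕ, b = fun n => B₀ + n + (n + 2) ^ d + (Fintype.card F) + n * n := ⟨_, rfl⟩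
  -- The cost of powering is added outright, so the clause about an exhausted clock is satisfied
  -- trivially.
  obtain ⟨τ, hτ⟩ : ∃ τ : ℕ → ℕ, τ = fun n =>
    A * ((n + 2) ^ d + 1) * (3 * (b n + A * ((n + 2) ^ d + 1)) + 3) + fbCost (Fintype.card F) n := ⟨_, rfl⟩
  obtain ⟨W, hW⟩ : ∃ W : ℕ → ℕ, W = fun n => n * n + n * n + n + n + 2 + (n + 2) ^ d + (n + 2) ^ d :=
    ⟨_, rfl⟩
  have pd : PolyB fun n => (n + 2) ^ d := (PolyB.id.add (PolyB.const 2)).pow d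
  have pb : PolyB b := by
    rw [hb]
    exact ((((PolyB.const B₀).add PolyB.id).add pd).add (PolyB.const (Fintype.card F))).add (PolyB.id.mul PolyB.id)
  have pA : PolyB fun n => A * ((n + 2) ^ d + 1) := (PolyB.const A).mul (pd.add (PolyB.const 1))
  have pτ : PolyB τ := by
    rw [hτ]
    exact (pA.mul (((PolyB.const 3).mul (pb.add pA)).add (PolyB.const 3))).add (polyB_fbCost (Fintype.card F))
  have pW : PolyB W := by
    rw [hW]
    exact ((((((PolyB.id.mul PolyB.id).add (PolyB.id.mul PolyB.id)).add PolyB.id).add PolyB.id).add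
      (PolyB.const 2)).add pd).add pd
  refine ⟨fun n => distCost (Fintype.card F) N' d n (W n) (τ n), polyB_distCost (Fintype.card F) N' d pW pτ, fun n R V Y hV => ?_⟩
  have hclk : Ens (M.clk N) (fun u => u.time ≤ τ n ∧ u.var N ≤ (n + 2) ^ d ∧
      (u.var N = 0 → fbCost (Fintype.card F) n ≤ τ n))
      (clkInput N n (encMatrix code (Y * R)) ((n + 2) ^ d)) := by
    refine (ens_clk_poly (b := b n) hA (by rw [hb]; simp only; omega)
      ((size_le_self _).trans (by rw [hb]; simp only; omega))
      ((size_le_self _).trans (by rw [hb]; simp only; omega)) ?_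
      ((size_le_self _).trans (by rw [length_encMatrix, hb]; simp only; omega))).mono
      fun u hu => ⟨hu.1.trans (by rw [hτ]; simp only; omega), hu.2, fun _ => by rw [hτ]; simp only; omega⟩
    intro y hy
    simp only [encMatrix, List.mem_flatMap, List.mem_map] at hy
    obtain ⟨i, _, j, _, rfl⟩ := hy
    refine (size_le_self _).trans ?_
    have := (code ((Y * R) i j)).2
    rw [hb]
    simp only
    omega
  -- Only polynomial time matters here, so the bit length is bounded crudely by the number `W n`
  -- itself.
  have hex := fun p r => ex_distinguisher code (N' := N') (d := d) (W := W n) (l := W n) (τ := τ n)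
    (R := R) (V := V) (Y := Y) p r hM' hN0.le hN (size_le_self _) (by rw [hW]; simp only; omega)
    (by rw [hW]; simp only; omega) hV hclk
  have hsum := succProb_add_failProb code (c₀ := (n + 2) ^ d) hM (hT n (Y * R))
  have hs : Ex (distinguisher code M N N' d) (distCost (Fintype.card F) N' d n (W n) (τ n))
      (input n (encMatrix code R) (encMatrix code V)).var
      (input n (encMatrix code R) (encMatrix code V)).arr
      (fun v' _ => if v' 0 = 1 then 1 else 0) (succProb code M N ((n + 2) ^ d) (Y * R)) := by
    refine (hex 1 0).mono le_rfl (fun _ _ => le_rfl) (le_of_eq ?_)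
    rw [succProb]
    congr 1
    funext u
    by_cases h : Y * R * result code N (Y * R) u = 1 <;> simp [ind, h]
  have hf : Ex (distinguisher code M N N' d) (distCost (Fintype.card F) N' d n (W n) (τ n))
      (input n (encMatrix code R) (encMatrix code V)).var
      (input n (encMatrix code R) (encMatrix code V)).arr
      (fun v' _ => if v' 0 = 1 then 0 else 1) (failProb code M N ((n + 2) ^ d) (Y * R)) := by
    refine (hex 0 1).mono le_rfl (fun _ _ => le_rfl) (le_of_eq ?_)
    rw [failProb]
    congr 1
    funext u
    by_cases h : Y * R * result code N (Y * R) u = 1 <;> simp [ind, h]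
  have htr := hs.tr (Q := fun _ _ => True) (by intro h; rw [h] at hsum; simp at hsum) fun _ _ _ => trivial
  refine ⟨haltsWithin_of_ens ((htr 0).mono fun s hs => ?_), ?_⟩
  · simpa only [Nat.zero_add] using hs.1
  · refine prob_of_ex hsum rfl ⟨_, hs, fun s' => ?_⟩ ⟨_, hf, fun s' => ?_⟩ htr
    · by_cases h : s'.var 0 = 1 <;> simp [ind, h]
    · by_cases h : s'.var 0 = 1 <;> simp [ind, h]

/-- The transpose of an invertible matrix. -/
def transposeUnit (A : Matrix.GeneralLinearGroup (Fin n) F) : Matrix.GeneralLinearGroup (Fin n) F :=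
  ⟨A.1.transpose, A⁻¹.1.transpose, by
    rw [← Matrix.transpose_mul, ← Units.val_mul, inv_mul_cancel]; simp, by
    rw [← Matrix.transpose_mul, ← Units.val_mul, mul_inv_cancel]; simp⟩

/-- The given inverter succeeds with constant probability if a fixed invertible matrix is
randomized with the help of the trapdoored family. -/
theorem eventually_succProb {S M : Prog} {T : ℕ → ℕ} {N N' d : ℕ} {ε : ℝ} (hε : 0 < ε)
    (hS : Indistinguishable code S) (hM : NamesBelow N M)
    (hM' : NamesBelow N' (M.clk N)) (hN0 : 1 < N) (hN : N < N')
    (hT : ∀ (n : ℕ) (A : Matrix (Fin n) (Fin n) F), HaltsWithin M (input n (encMatrix code A) []) (T n))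
    (hinv : ∀ᶠ n : ℕ in Filter.atTop, ε ≤ (∑ A : Matrix.GeneralLinearGroup (Fin n) F, probInverts code M A) /
        Fintype.card (Matrix.GeneralLinearGroup (Fin n) F)) :
    ∀ᶠ n : ℕ in Filter.atTop, ∀ A : Matrix.GeneralLinearGroup (Fin n) F,
      ε / 8 ≤ ∑ R : Matrix (Fin n) (Fin n) F, prob S (input n [] []) (fun s => s.arr 0 = encMatrix code R) *
        (succProb code M N ((n + 2) ^ d) (A.1.transpose * R)).toReal := by
  obtain ⟨c, hc, hD⟩ := exists_distinguisher code (d := d) hM hM' hN0 hN hT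
  set s : ∀ n, Matrix (Fin n) (Fin n) F → ℝ := fun n B => (succProb code M N ((n + 2) ^ d) B).toReal with hs
  set G : ∀ n, Matrix.GeneralLinearGroup (Fin n) F → ℝ := fun n A =>
    ∑ R : Matrix (Fin n) (Fin n) F, prob S (input n [] []) (fun s => s.arr 0 = encMatrix code R) *
      s n (A.1.transpose * R) with hG
  -- For each dimension the matrix on which the randomized inverter does worst becomes the advice.
  -- It need not be computable, since the advice may depend on `n` arbitrarily; a bound for it is a
  -- bound for all matrices.
  have hmin : ∀ n, ∃ A, ∀ A', G n A ≤ G n A' := fun n => Finite.exists_min (G n)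
  choose A₀ hA₀ using hmin
  set V : ∀ n, Matrix (Fin n) (Fin n) F := fun n => (transposeUnit (A₀ n)).2 with hVdef
  have hYV : ∀ n, (A₀ n).1.transpose * V n = 1 := fun n => (transposeUnit (A₀ n)).3
  -- One exponent covers both the running time and the `n²` entries of the advice.
  obtain ⟨e, he⟩ := (hc.add (PolyB.id.mul PolyB.id)).le_pow_add
  have hind := hS (distinguisher code M N N' d) (fun n => encMatrix code (V n)) ⟨e, fun n => ⟨?_, fun R => ?_⟩⟩ 1
  · have hun : ∀ n, acceptUniform code (distinguisher code M N N' d) (encMatrix code (V n)) n =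
        (∑ B : Matrix (Fin n) (Fin n) F, s n B) / Fintype.card (Matrix (Fin n) (Fin n) F) := by
      intro n
      rw [acceptUniform]
      congr 1
      -- Left multiplication by an invertible matrix permutes all matrices; this is the
      -- randomization of the instance.
      rw [← Equiv.sum_comp (Units.mulLeft (transposeUnit (A₀ n))) (s n)]
      exact Finset.sum_congr rfl fun R _ => (hD n R _ _ (hYV n)).2
    have hsa : ∀ n, acceptSampled code S (distinguisher code M N N' d) (encMatrix code (V n)) n = G n (A₀ n) := by
      intro n
      rw [acceptSampled]
      exact Finset.sum_congr rfl fun R _ => by rw [(hD n R _ _ (hYV n)).2]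
    -- Indistinguishability is invoked with exponent `1`; from this size on the advantage `1 / n` is
    -- at most `ε / 8`.
    have hlarge : ∀ᶠ n : ℕ in Filter.atTop, 8 / ε ≤ (n : ℝ) :=
      tendsto_natCast_atTop_atTop.eventually_ge_atTop _
    filter_upwards [hind, hinv, hlarge] with n h1 h2 h3 A
    refine le_trans ?_ (hA₀ n A)
    rw [hun, hsa] at h1
    have hn0 : (0 : ℝ) < n := lt_of_lt_of_le (by positivity) h3
    have h4 : 1 / (n : ℝ) ^ 1 ≤ ε / 8 := by
      rw [pow_one, div_le_iff₀ hn0]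
      rw [div_le_iff₀ hε] at h3
      linarith
    have h5 : ∑ A : Matrix.GeneralLinearGroup (Fin n) F, probInverts code M A ≤
        ∑ B : Matrix (Fin n) (Fin n) F, s n B := by
      have hle : ∀ A : Matrix.GeneralLinearGroup (Fin n) F, probInverts code M A ≤ s n A.1 := by
        intro A
        have h := ofReal_probInverts_le code (c₀ := (n + 2) ^ d) (B := A) hM hN0 (hT n A.1)
        have h' := succProb_add_failProb code (c₀ := (n + 2) ^ d) hM (hT n A.1)
        rw [hs]
        exact (ENNReal.ofReal_le_iff_le_toReal (by intro ht; rw [ht] at h'; simp at h')).1 h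
      calc _ ≤ ∑ A : Matrix.GeneralLinearGroup (Fin n) F, s n A.1 := Finset.sum_le_sum fun A _ => hle A
        _ = ∑ B ∈ Finset.univ.map ⟨fun A : Matrix.GeneralLinearGroup (Fin n) F => A.1, Units.val_injective⟩, s n B := by
          rw [Finset.sum_map]; rfl
        _ ≤ _ := Finset.sum_le_sum_of_subset_of_nonneg (Finset.subset_univ _)
          fun B _ _ => ENNReal.toReal_nonneg
    have h6 := card_matrix_le (F := F) n
    have hg : (0 : ℝ) < Fintype.card (Matrix.GeneralLinearGroup (Fin n) F) := by
      exact_mod_cast Fintype.card_pos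
    have hm : (0 : ℝ) < Fintype.card (Matrix (Fin n) (Fin n) F) := by
      exact_mod_cast Fintype.card_pos
    rw [le_div_iff₀ hg] at h2
    -- Success on invertible matrices alone gives `ε`, and these are at least a quarter of all
    -- matrices.
    have h7 : ε / 4 ≤ (∑ B : Matrix (Fin n) (Fin n) F, s n B) / Fintype.card (Matrix (Fin n) (Fin n) F) := by
      rw [le_div_iff₀ hm]
      nlinarith
    have := (abs_le.1 h1).2
    linarith
  · rw [length_encMatrix]
    have : c n + n * n ≤ n ^ e + e := he n
    omega
  · have : c n + n * n ≤ n ^ e + e := he n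
    refine haltsWithin_of_ens ((ens_of_haltsWithin (hD n R _ _ (hYV n)).1).mono fun s hs => ?_)
    have := hs.1
    omega

end field

section field

variable {F : Type*} [Field F] [Fintype F] (code : F ≃ Fin (Fintype.card F)) {n : ℕ}

/-! ### Random vectors -/

/-- Append a random bit, as a field element, to the array `5`. -/
def randStep : Prog :=
  .coin 10 ;; .ifNZ 10 (.const 10 (code 1)) (.const 10 (code 0)) ;; .push 5 10

/-- Fill the array `5` with random bits. -/
def randVec : Prog := .clear 5 ;; getDim 11 ;; .forN 11 (randStep code)

theorem writesIn_randStep : WritesIn {10} {5} (randStep code) := by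
  simp [randStep, WritesIn]

theorem writesIn_randVec : WritesIn (regs 30) {5} (randVec code) :=
  ⟨by simp [WritesIn], ⟨by simp [regs, WritesIn], by simp [regs, WritesIn]⟩,
    WritesIn.forN (by simp [regs]) (by simp [regs])
      ((writesIn_randStep code).mono (by simp [regs]) le_rfl)⟩

open Classical in
theorem ex_randStep {l : ℕ} {v : ℕ → ℕ} {a : ℕ → List ℕ} {Φ : (ℕ → ℕ) → (ℕ → List ℕ) → ℝ≥0∞} {p₁ p₀ : ℝ≥0∞}
    (hl : Nat.size (a 5).length ≤ l)
    (h1 : ∀ v', Φ v' (Function.update a 5 (a 5 ++ [(code 1 : ℕ)])) ≤ p₁)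
    (h0 : ∀ v', Φ v' (Function.update a 5 (a 5 ++ [(code 0 : ℕ)])) ≤ p₀) :
    Ex (randStep code) (2 * Fintype.card F + l + 6) v a Φ (2⁻¹ * p₁ + 2⁻¹ * p₀) := by
  have s0 := size_code_le code (0 : F)
  have s1 := size_code_le code (1 : F)
  have hne : Function.update v 10 0 ≠ Function.update v 10 1 := fun h => by
    have := congrFun h 10; simp at this
  refine Ex.mono (Ex.seq (c₁ := 1) (c₂ := 2 * Fintype.card F + l + 5)
    (Φ₁ := fun v' a' => if v' = Function.update v 10 1 ∧ a' = a then p₁ else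
      if v' = Function.update v 10 0 ∧ a' = a then p₀ else ⊤) (Ex.coin (le_of_eq ?_)) ?_) (by omega)
      (fun _ _ => le_rfl) le_rfl
  · simp [hne]
  · intro v' a' hΦ
    by_cases e1 : v' = Function.update v 10 1 ∧ a' = a
    · rw [if_pos e1]
      obtain ⟨rfl, rfl⟩ := e1
      refine Tr.ex (Q := fun v' b => b = Function.update a' 5 (a' 5 ++ [(code 1 : ℕ)])) ?_
        fun v' b hb => hb ▸ h1 v'
      intro τ
      simp only [Ens_seq, Ens_ite, Ens_const, Ens_push, Function.update_self, one_ne_zero, if_false,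
        Nat.size_one]
      exact ⟨by omega, trivial⟩
    · rw [if_neg e1] at hΦ ⊢
      by_cases e0 : v' = Function.update v 10 0 ∧ a' = a
      · rw [if_pos e0]
        obtain ⟨rfl, rfl⟩ := e0
        refine Tr.ex (Q := fun v' b => b = Function.update a' 5 (a' 5 ++ [(code 0 : ℕ)])) ?_
          fun v' b hb => hb ▸ h0 v'
        intro τ
        simp only [Ens_seq, Ens_ite, Ens_const, Ens_push, Function.update_self, if_true,
          Nat.size_zero]
        exact ⟨by omega, trivial⟩
      · exact absurd (if_neg e0) hΦ

/-- The field element with index `t` in the array `5`. -/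
def entry (a : ℕ → List ℕ) (t : ℕ) : F := dec code ((a 5).getD t 0)

theorem entry_push {k : ℕ} {a : ℕ → List ℕ} {x : F} (h : a 5 = lst code k (entry code a)) :
    (∀ t < k, entry code (Function.update a 5 (a 5 ++ [(code x : ℕ)])) t = entry code a t) ∧
    entry code (Function.update a 5 (a 5 ++ [(code x : ℕ)])) k = x ∧
    Function.update a 5 (a 5 ++ [(code x : ℕ)]) 5 =
      lst code (k + 1) (entry code (Function.update a 5 (a 5 ++ [(code x : ℕ)]))) := by
  have hlen : (a 5).length = k := by rw [h, length_lst]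
  have h1 : ∀ t < k, entry code (Function.update a 5 (a 5 ++ [(code x : ℕ)])) t = entry code a t := by
    intro t ht
    rw [entry, entry, Function.update_self, List.getD_append _ _ _ _ (by omega)]
  have h2 : entry code (Function.update a 5 (a 5 ++ [(code x : ℕ)])) k = x := by
    rw [entry, Function.update_self, List.getD_append_right _ _ _ _ (by omega), hlen]
    simp [dec_code]
  refine ⟨h1, h2, ?_⟩
  rw [lst_succ, h2, Function.update_self]
  congr 1
  conv_lhs => rw [h]
  exact lst_congr code fun t ht => (h1 t ht).symm

open Classical in
/-- The conditional probability, given the first `k` entries of the random vector, that its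
product with the vector `w` vanishes, or an upper bound for it. -/
noncomputable def dotPotential (w : ℕ → F) (p : ℝ≥0∞) (n k : ℕ) (a : ℕ → List ℕ) : ℝ≥0∞ :=
  if a 5 = lst code k (entry code a) then
    if ∃ t, k ≤ t ∧ t < n ∧ w t ≠ 0 then 2⁻¹ * p
    else if ∑ t ∈ Finset.range k, w t * entry code a t = 0 then p else 0
  else ⊤

/-- As long as a nonzero coordinate of `w` is still to come, the potential stays at `p / 2`. When
the last one is drawn, at most one of the two bits makes the dot product vanish; afterwards nothing
changes. -/
theorem dotPotential_step (w : ℕ → F) (p : ℝ≥0∞) {k : ℕ} {a : ℕ → List ℕ} (hk : k < n)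
    (ha : a 5 = lst code k (entry code a)) :
    2⁻¹ * dotPotential code w p n (k + 1) (Function.update a 5 (a 5 ++ [(code 1 : ℕ)])) +
    2⁻¹ * dotPotential code w p n (k + 1) (Function.update a 5 (a 5 ++ [(code 0 : ℕ)])) ≤
      dotPotential code w p n k a := by
  classical
  have half : ∀ x : ℝ≥0∞, 2⁻¹ * x + 2⁻¹ * x = x := fun x => by
    rw [← add_mul, ENNReal.inv_two_add_inv_two, one_mul]
  obtain ⟨a1, a2, a3⟩ := entry_push code (x := 1) ha
  obtain ⟨b1, b2, b3⟩ := entry_push code (x := 0) ha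
  have sa : ∑ t ∈ Finset.range k, w t * entry code (Function.update a 5 (a 5 ++ [(code 1 : ℕ)])) t =
      ∑ t ∈ Finset.range k, w t * entry code a t :=
    Finset.sum_congr rfl fun t ht => by rw [a1 t (Finset.mem_range.1 ht)]
  have sb : ∑ t ∈ Finset.range k, w t * entry code (Function.update a 5 (a 5 ++ [(code 0 : ℕ)])) t =
      ∑ t ∈ Finset.range k, w t * entry code a t :=
    Finset.sum_congr rfl fun t ht => by rw [b1 t (Finset.mem_range.1 ht)]
  rw [dotPotential, dotPotential, dotPotential, if_pos a3, if_pos b3, if_pos ha]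
  by_cases hex : ∃ t, k + 1 ≤ t ∧ t < n ∧ w t ≠ 0
  · have hex' : ∃ t, k ≤ t ∧ t < n ∧ w t ≠ 0 := by
      obtain ⟨t, h1, h2⟩ := hex; exact ⟨t, by omega, h2⟩
    rw [if_pos hex, if_pos hex, if_pos hex', half]
  · rw [if_neg hex, if_neg hex, Finset.sum_range_succ, Finset.sum_range_succ, sa, sb, a2, b2, mul_one,
      mul_zero, add_zero]
    by_cases hw : w k = 0
    · have hex' : ¬ ∃ t, k ≤ t ∧ t < n ∧ w t ≠ 0 := by
        rintro ⟨t, h1, h2, h3⟩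
        rcases Nat.eq_or_lt_of_le h1 with rfl | h1
        · exact h3 hw
        · exact hex ⟨t, h1, h2, h3⟩
      rw [if_neg hex', hw, add_zero, half]
    · rw [if_pos (⟨k, le_rfl, hk, hw⟩ : ∃ t, k ≤ t ∧ t < n ∧ w t ≠ 0)]
      split_ifs with h1 h2 h2
      -- If both bits gave zero, then the coefficient `w k` would be zero.
      · rw [h2, zero_add] at h1; exact absurd h1 hw
      · simp
      · simp
      · simp

/-- A bound for the running time of `randVec`. -/
def randCost (q n l : ℕ) : ℕ := n * (2 * q + 3 * l + 11) + l + 5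

open Classical in
theorem ex_randVec {W l : ℕ} {v : ℕ → ℕ} {a : ℕ → List ℕ} (w : ℕ → F) (p : ℝ≥0∞)
    (hn : v 0 = n) (hW : Nat.size W ≤ l) (hnW : n ≤ W) :
    Ex (randVec code) (randCost (Fintype.card F) n l) v a (fun _ a' => dotPotential code w p n n a')
      (if ∃ t < n, w t ≠ 0 then 2⁻¹ * p else p) := by
  classical
  have sn : Nat.size n ≤ l := size_le_of_le hW hnW
  have h1 : Tr (Prog.clear 5) 1 v a fun v' a' => v' = v ∧ a' = Function.update a 5 [] := by
    intro τ; rw [Ens_clear]; exact ⟨le_rfl, rfl, rfl⟩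
  refine Ex.mono (h1.exSeq (c₂ := l + 3 + (n * (2 * Fintype.card F + l + 6 + 2 * l + 5) + 1)) ?_)
    (by rw [randCost]; have : n * (2 * Fintype.card F + l + 6 + 2 * l + 5) = n * (2 * Fintype.card F + 3 * l + 11) := by ring
        omega) (fun _ _ => le_rfl) le_rfl
  rintro v1 a1 ⟨rfl, rfl⟩
  refine (tr_getDim (n := n) hn sn (by simp)).exSeq fun v2 a2 ⟨f2, hF2⟩ => ?_
  have ha2 : a2 5 = [] := by rw [hF2.2 5 (by simp)]; simp
  refine Ex.mono (Ex.forN (k := 11) (N := n) (Φ := fun k _ a => dotPotential code w p n k a) sn f2 (by simp)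
    fun j hj v3 a3 h3 hΦ => ?_) le_rfl ?_ ?_
  · have ha3 : a3 5 = lst code j (entry code a3) := by
      by_contra hc
      exact hΦ (if_neg hc)
    refine Ex.frame (Φ := fun _ a' => dotPotential code w p n (j + 1) a') ?_ (writesIn_randStep code)
      fun v' a' hF => ?_
    · refine Ex.mono (ex_randStep code (l := l) ?_ (fun _ => le_rfl) fun _ => le_rfl) le_rfl
        (fun _ _ => le_rfl) (dotPotential_step code w p hj ha3)
      rw [ha3, length_lst]; exact size_le_of_le hW (by omega)
    · rw [if_pos (by rw [hF.1 11 (by simp), h3])]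
  · intro v' a'
    split_ifs
    · exact le_rfl
    · exact le_top
  · rw [dotPotential, if_pos (by rw [ha2, lst_zero])]
    simp

/-! ### Checking a matrix product -/

/-- Compare the product of the matrices in the arrays `0` and `4` with the identity matrix on a random
vector; variable `18` is set to `1` if there is a difference. -/
def freivStep : Prog :=
  randVec code ;; .const 13 1 ;; matmul code 4 5 6 ;; matmul code 0 6 7 ;; getDim 14 ;; eqCheck 7 5

theorem writesIn_freivStep : WritesIn (low 30) {5, 6, 7} (freivStep code) :=
  ⟨(writesIn_randVec code).mono (regs_subset_low le_rfl) (by simp), by simp [WritesIn, low],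
    (writesIn_matmul code _ _ _).mono (regs_subset_low le_rfl) (by simp),
    (writesIn_matmul code _ _ _).mono (regs_subset_low le_rfl) (by simp),
    ⟨by simp [WritesIn, low], by simp [WritesIn, low]⟩,
    (writesIn_eqCheck _ _).mono (regs_subset_low (by simp)) (by simp)⟩

/-- The general bound on the variables written by `matmul` includes `18`, but the flag of the test
has to survive the products, so a finer frame is needed. -/
theorem matmul_preserves_flag (A B out : ℕ) : WritesIn {18}ᶜ Set.univ (matmul code A B out) := by
  have h1 : WritesIn {18}ᶜ Set.univ (matmulEntry code A B out) :=
    ⟨by simp [WritesIn], by simp [WritesIn], by simp [WritesIn],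
      (writesIn_dot_regs code A B).mono (fun x hx => by
        have := hx.2.1
        simp only [Set.mem_compl_iff, Set.mem_singleton_iff]
        omega) (by simp),
      by simp [WritesIn], by simp [WritesIn], by simp [WritesIn]⟩
  have h2 : WritesIn {18}ᶜ Set.univ (matmulRow code A B out) :=
    ⟨by simp [WritesIn], by simp [WritesIn], by simp [WritesIn],
      WritesIn.forN (by simp) (by simp) h1, by simp [WritesIn]⟩
  exact ⟨by simp [WritesIn], by simp [WritesIn], by simp [WritesIn], by simp [WritesIn],
    WritesIn.forN (by simp) (by simp) h2⟩

theorem randVec_preserves_flag : WritesIn {18}ᶜ {5} (randVec code) :=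
  ⟨by simp [WritesIn], ⟨by simp [WritesIn], by simp [WritesIn]⟩,
    WritesIn.forN (by simp) (by simp) ((writesIn_randStep code).mono (by simp) le_rfl)⟩

/-- A bound for the running time of `freivStep`. -/
def freivCost (q n l : ℕ) : ℕ := randCost q n l + 2 * matmulCost q n 1 l + eqCost q n l + l + 10

-- If `A * Z ≠ 1`, then some row `w` of `A * Z - 1` is nonzero, and the test passes only if the
-- random vector is orthogonal to `w`, which has probability at most 1/2. If `A * Z = 1`, the test
-- always passes. Associativity replaces the product of two matrices by two products with a vector.
open Classical in
theorem ex_freivStep {W l : ℕ} {v : ℕ → ℕ} {a : ℕ → List ℕ} {A Z : Matrix (Fin n) (Fin n) F}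
    (p : ℝ≥0∞) (hn : v 0 = n) (hW : Nat.size W ≤ l) (hnW : n * n + n + n + 1 ≤ W)
    (hA : a 0 = encMatrix code A) (hZ : a 4 = encMatrix code Z) (h18 : v 18 ≤ 1) :
    Ex (freivStep code) (freivCost (Fintype.card F) n l) v a
      (fun v' _ => if v' 18 ≤ 1 ∧ (A * Z = 1 → v 18 = 0 → v' 18 = 0) then (if v' 18 = 0 then p else 0) else ⊤)
      (if v 18 = 0 then (if A * Z = 1 then p else 2⁻¹ * p) else 0) := by
  have sn : Nat.size n ≤ l := size_le_of_le hW (by omega)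
  -- The extra point stands for the case without a differing row, where `n` may even be `0`; then
  -- `w` is taken to be zero.
  obtain ⟨i, hi⟩ : ∃ i : Fin n ⊕ Unit, (A * Z ≠ 1 → ∃ i' j, i = Sum.inl i' ∧ (A * Z) i' j ≠ (1 : Matrix _ _ F) i' j) := by
    by_cases h : A * Z = 1
    · exact ⟨Sum.inr (), fun h' => absurd h h'⟩
    · obtain ⟨i, hi⟩ := Function.ne_iff.1 h
      obtain ⟨j, hj⟩ := Function.ne_iff.1 hi
      exact ⟨Sum.inl i, fun _ => ⟨i, j, rfl, hj⟩⟩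
  set w : ℕ → F := fun t => match i with
    | Sum.inl i => ext (A * Z - 1) i t
    | Sum.inr _ => 0 with hw
  have hprod : ∀ r : ℕ → F, (∀ k < n, ∑ x ∈ Finset.range n, ext A k x * ∑ y ∈ Finset.range n, ext Z x y * r y = r k) →
      ∑ t ∈ Finset.range n, w t * r t = 0 := by
    intro r hr
    rcases i with i | _
    · have h1 := hr i i.2
      simp only [hw]
      have h2 : ∑ x ∈ Finset.range n, ext A i x * ∑ y ∈ Finset.range n, ext Z x y * r y =
          ∑ y ∈ Finset.range n, ext (A * Z) i y * r y := by
        simp only [Finset.mul_sum, ← mul_assoc]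
        rw [Finset.sum_comm]
        refine Finset.sum_congr rfl fun y hy => ?_
        rw [← Finset.sum_mul]
        congr 1
        have hy' := Finset.mem_range.1 hy
        have := ext_apply (A * Z) i ⟨y, hy'⟩
        simp only at this
        rw [this, Matrix.mul_apply, ← Fin.sum_univ_eq_sum_range fun k => ext A i k * ext Z k y]
        refine Finset.sum_congr rfl fun x _ => ?_
        rw [ext_apply, ← ext_apply Z x ⟨y, hy'⟩]
      have h3 : r i = ∑ y ∈ Finset.range n, ext (1 : Matrix (Fin n) (Fin n) F) i y * r y := by
        rw [Finset.sum_eq_single (i : ℕ)]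
        · rw [ext_apply]; simp
        · intro b hb hne
          have hb' := Finset.mem_range.1 hb
          have := ext_apply (1 : Matrix (Fin n) (Fin n) F) i ⟨b, hb'⟩
          simp only at this
          rw [this, Matrix.one_apply_ne (fun h => hne (by rw [h])), zero_mul]
        · intro h; exact absurd (Finset.mem_range.2 i.2) h
      rw [h2, h3] at h1
      rw [← sub_eq_zero, ← Finset.sum_sub_distrib] at h1
      rw [← h1]
      refine Finset.sum_congr rfl fun y hy => ?_
      have hy' := Finset.mem_range.1 hy
      rw [← sub_mul]
      congr 1
      simp [ext, hy']
    · simp [hw]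
  have hexi : A * Z ≠ 1 → ∃ t < n, w t ≠ 0 := by
    intro h
    obtain ⟨i', j, rfl, hj⟩ := hi h
    refine ⟨j, j.2, ?_⟩
    simp only [hw]
    rw [ext_apply, Matrix.sub_apply]
    exact sub_ne_zero.2 hj
  have hone : A * Z = 1 → ∀ r : ℕ → F, ∀ k < n,
      ∑ x ∈ Finset.range n, ext A k x * ∑ y ∈ Finset.range n, ext Z x y * r y = r k := by
    intro h r k hk
    have h1 : A.mulVec (Z.mulVec fun t : Fin n => r t) = fun t : Fin n => r t := by
      rw [Matrix.mulVec_mulVec, h, Matrix.one_mulVec]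
    have h2 := congrFun h1 ⟨k, hk⟩
    simp only [Matrix.mulVec, dotProduct] at h2
    rw [← h2, ← Fin.sum_univ_eq_sum_range fun x => ext A k x * ∑ y ∈ Finset.range n, ext Z x y * r y]
    refine Finset.sum_congr rfl fun x _ => ?_
    rw [← Fin.sum_univ_eq_sum_range fun y => ext Z x y * r y]
    have := ext_apply A ⟨k, hk⟩ x
    simp only at this
    rw [this]
    congr 1
    exact Finset.sum_congr rfl fun y _ => by rw [ext_apply]
  -- A flag that has been raised is never lowered, so acceptance keeps positive weight only as long
  -- as it is down.
  set p' : ℝ≥0∞ := if v 18 = 0 then p else 0 with hp'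
  refine Ex.mono (Ex.seq (c₁ := randCost (Fintype.card F) n l) (c₂ := 1 + 1 + (matmulCost (Fintype.card F) n 1 l +
      (matmulCost (Fintype.card F) n 1 l + (l + 3 + eqCost (Fintype.card F) n l))))
    (Φ₁ := fun v' a' => if v' 0 = n ∧ v' 18 = v 18 ∧ a' 0 = encMatrix code A ∧ a' 4 = encMatrix code Z then
      dotPotential code w p' n n a' else ⊤)
    (((ex_randVec code w p' hn hW (by omega)).frame (Φ' := fun v' a' => if v' 18 = v 18 then
      dotPotential code w p' n n a' else ⊤) (randVec_preserves_flag code) fun v' a' hF => ?_).frame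
        (writesIn_randVec code) fun v' a' hF => ?_) ?_)
    (by rw [freivCost]; omega) (fun _ _ => le_rfl) ?_
  · rw [if_pos (hF.1 18 (by simp))]
  · by_cases h : v' 18 = v 18
    · rw [if_pos h, if_pos ⟨by rw [hF.1 0 (by simp [regs]), hn], h, by rw [hF.2 0 (by simp), hA],
        by rw [hF.2 4 (by simp), hZ]⟩]
    · rw [if_neg h]; exact le_top
  · intro v1 a1 hΦ
    have hc : v1 0 = n ∧ v1 18 = v 18 ∧ a1 0 = encMatrix code A ∧ a1 4 = encMatrix code Z := by
      by_contra hc; exact hΦ (if_neg hc)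
    rw [if_pos hc] at hΦ ⊢
    have h5 : a1 5 = lst code n (entry code a1) := by
      by_contra hc; exact hΦ (if_neg hc)
    obtain ⟨e0, e18, x0, x4⟩ := hc
    rw [encMatrix_eq] at x0 x4
    set r : ℕ → F := entry code a1 with hr
    have h5' : a1 5 = lst code (n * 1) (flat 1 fun i _ => r i) := by
      rw [h5, mul_one]; exact lst_congr code fun k _ => by rw [flat, Nat.div_one]
    refine (Tr.const (x := 13) (k := 1) (Q := fun v' a' => v' = Function.update v1 13 1 ∧ a' = a1)
      ⟨rfl, rfl⟩).mono (c' := 1 + 1) (by simp [Nat.size_one]) (fun _ _ h => h) |>.exSeq ?_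
    rintro v2 a2 ⟨rfl, rfl⟩
    refine ((tr_matmul code (A := 4) (B := 5) (out := 6) (n := n) (c := 1) (by simp) (by simp) hW
      (by simp [e0]) (by simp) (by omega) x4 h5').frame (matmul_preserves_flag code 4 5 6)).exSeq
      fun v3 a3 ⟨⟨f3, hF3⟩, hG3⟩ => ?_
    have x30 : a3 0 = lst code (n * n) (flat n (ext A)) := by rw [hF3.2 0 (by simp), x0]
    have e30 : v3 0 = n := by rw [hF3.1 0 (by simp [regs])]; simp [e0]
    refine ((tr_matmul code (A := 0) (B := 6) (out := 7) (n := n) (c := 1) (by simp) (by simp) hW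
      e30 (by rw [hF3.1 13 (by simp [regs])]; simp) (by omega) x30 f3).frame
        (matmul_preserves_flag code 0 6 7)).exSeq fun v4 a4 ⟨⟨f4, hF4⟩, hG4⟩ => ?_
    refine (tr_getDim (n := n) (x := 14) (by rw [hF4.1 0 (by simp [regs]), e30]) sn (by simp)).exSeq
      fun v5 a5 ⟨f5, hF5⟩ => ?_
    have x57 : a5 7 = lst code n fun k => ∑ x ∈ Finset.range n, ext A k x * ∑ y ∈ Finset.range n, ext Z x y * r y := by
      rw [hF5.2 7 (by simp), f4, mul_one]
      exact lst_congr code fun k _ => by rw [flat, Nat.div_one]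
    have x55 : a5 5 = lst code n r := by
      rw [hF5.2 5 (by simp), hF4.2 5 (by simp), hF3.2 5 (by simp), h5]
    have e5 : v5 18 = v 18 := by
      rw [hF5.1 18 (by simp), hG4.1 18 (by simp), hG3.1 18 (by simp)]
      simpa using e18
    refine (tr_eqCheck code (A := 7) (B := 5) hW f5 (by omega) x57 x55).ex ?_
    rintro v6 a6 ⟨⟨f6, m6⟩, _⟩
    rw [e5] at f6 m6
    rw [if_pos ⟨m6.trans (by omega), fun h h' => f6.2 ⟨h', hone h r⟩⟩]
    split_ifs with h6
    · rw [dotPotential, if_pos h5, if_neg (by rintro ⟨t, h1, h2, _⟩; omega), if_pos (hprod r (f6.1 h6).2), hp',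
        if_pos (f6.1 h6).1]
    · exact zero_le
  · rw [hp']
    have hle : 2⁻¹ * p ≤ p := by
      calc 2⁻¹ * p ≤ 1 * p := by gcongr; simp
        _ = p := one_mul p
    by_cases h : v 18 = 0
    · rw [if_pos h, if_pos h]
      by_cases h1 : A * Z = 1
      · rw [if_pos h1]; split_ifs
        · exact hle
        · exact le_rfl
      · rw [if_neg h1, if_pos (hexi h1)]
    · rw [if_neg h, if_neg h]; simp

/-- Compare the product of the matrices in the arrays `0` and `4` with the identity matrix on `v₆₃`
random vectors. -/
def freivalds : Prog := .const 18 0 ;; .const 1 0 ;; .plus 62 63 1 ;; .forN 62 (freivStep code)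

theorem writesIn_freivalds : WritesIn (low 30 ∪ {62}) {5, 6, 7} (freivalds code) :=
  ⟨by simp [WritesIn, low], by simp [WritesIn, low], by simp [WritesIn, low],
    WritesIn.forN (by simp [low]) (by simp) ((writesIn_freivStep code).mono (by simp) le_rfl)⟩

-- The coins of the rounds are independent, which appears here as the potential `x ^ (L - j)` with
-- `x = 2⁻¹` for a wrong candidate and `x = 1` for a correct one. The side condition in the result
-- records that a correct candidate is accepted surely.
open Classical in
theorem ex_freivalds {W l L : ℕ} {v : ℕ → ℕ} {a : ℕ → List ℕ} {A Z : Matrix (Fin n) (Fin n) F}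
    (hn : v 0 = n) (hW : Nat.size W ≤ l) (hnW : n * n + n + n + 1 ≤ W) (hLW : L ≤ W)
    (hA : a 0 = encMatrix code A) (hZ : a 4 = encMatrix code Z) (h63 : v 63 = L) :
    Ex (freivalds code) (L * (freivCost (Fintype.card F) n l + 2 * l + 5) + 2 * l + 10) v a
      (fun v' _ => if v' 18 ≤ 1 ∧ (A * Z = 1 → v' 18 = 0) then (if v' 18 = 0 then 1 else 0) else ⊤)
      (if A * Z = 1 then 1 else 2⁻¹ ^ L) := by
  have sL : Nat.size L ≤ l := size_le_of_le hW hLW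
  obtain ⟨C, hC⟩ : ∃ C : (ℕ → ℕ) → (ℕ → List ℕ) → Prop, C = fun v' a' => v' 0 = n ∧
    a' 0 = encMatrix code A ∧ a' 4 = encMatrix code Z ∧ v' 18 ≤ 1 ∧ (A * Z = 1 → v' 18 = 0) := ⟨_, rfl⟩
  set x : ℝ≥0∞ := if A * Z = 1 then 1 else 2⁻¹ with hx
  have hx1 : (if A * Z = 1 then 1 else 2⁻¹ ^ L : ℝ≥0∞) = x ^ L := by
    rw [hx]; split_ifs <;> simp
  rw [hx1]
  refine Ex.mono ((Tr.const (x := 18) (k := 0) (Q := fun v' a' => v' = Function.update v 18 0 ∧ a' = a)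
    ⟨rfl, rfl⟩).exSeq (c₂ := 1 + (1 + 2 * l + (L * (freivCost (Fintype.card F) n l + 2 * l + 5) + 1))) ?_)
      (by simp only [Nat.size_zero]; omega) (fun _ _ => le_rfl) le_rfl
  rintro v1 a1 ⟨rfl, rfl⟩
  refine (Tr.const (x := 1) (k := 0) (Q := fun v' a' => v' = Function.update (Function.update v 18 0) 1 0 ∧
    a' = a1) ⟨rfl, rfl⟩).exSeq ?_
  rintro v2 a2 ⟨rfl, rfl⟩
  refine (Tr.plus (x := 62) (y := 63) (z := 1) (l := l) (Q := fun v' a' => v' =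
    Function.update (Function.update (Function.update v 18 0) 1 0) 62 L ∧ a' = a2) (by simp [h63, sL])
    (by simp) ⟨by simp [h63], rfl⟩).exSeq ?_
  rintro v3 a3 ⟨rfl, rfl⟩
  refine Ex.mono (Ex.forN (k := 62) (N := L) (l := l)
    (Φ := fun j v a => if C v a then (if v 18 = 0 then x ^ (L - j) else 0) else ⊤) sL (by simp) (by simp)
    fun j hj v4 a4 h4 hΦ => ?_) le_rfl ?_ ?_
  · have hc : C v4 a4 := by
      by_contra hc; exact hΦ (if_neg hc)
    rw [if_pos hc]
    have hc' := hc
    rw [hC] at hc'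
    obtain ⟨c1, c2, c3, c4, c5⟩ := hc'
    refine ((ex_freivStep code (x ^ (L - (j + 1))) c1 hW hnW c2 c3 c4).frame (writesIn_freivStep code)
      fun v' a' hF => ?_).mono le_rfl (fun _ _ => le_rfl) (le_of_eq ?_)
    · rw [if_pos (by rw [hF.1 62 (by simp [low]), h4])]
      by_cases hp : v' 18 ≤ 1 ∧ (A * Z = 1 → v4 18 = 0 → v' 18 = 0)
      · rw [if_pos hp, if_pos]
        · exact le_rfl
        · rw [hC]
          exact ⟨by simp [hF.1 0 (by simp [low]), c1], by rw [hF.2 0 (by simp), c2],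
            by rw [hF.2 4 (by simp), c3], by simpa using hp.1, fun h => by simpa using hp.2 h (c5 h)⟩
      · rw [if_neg hp]; exact le_top
    · split_ifs with h18 hAZ
      · have : x = 1 := if_pos hAZ
        rw [this]; simp
      · have : x = 2⁻¹ := if_neg hAZ
        rw [this, ← pow_succ']
        congr 1
        omega
      · rfl
  · intro v' a'
    by_cases h0 : v' 62 = 0
    · rw [if_pos h0]
      by_cases hc : C v' a'
      · rw [if_pos hc]
        rw [hC] at hc
        rw [if_pos ⟨hc.2.2.2.1, hc.2.2.2.2⟩, Nat.sub_self, pow_zero]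
      · rw [if_neg hc]; exact le_top
    · rw [if_neg h0]; exact le_top
  · rw [hC]
    simp [hn, hA, hZ]

end field

theorem Ex.add_const {P : Prog} {c : ℕ} {v : ℕ → ℕ} {a : ℕ → List ℕ} {r : ℝ≥0∞}
    {Φ : (ℕ → ℕ) → (ℕ → List ℕ) → ℝ≥0∞} (h : Ex P c v a Φ r) (hr : r ≠ ⊤) (x : ℝ≥0∞) :
    Ex P c v a (fun v' a' => Φ v' a' + x) (r + x) := by
  classical
  intro τ g hg
  have htr := (h.tr hr (Q := fun _ _ => True) fun _ _ _ => trivial) τ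
  have h1 := h τ (fun s => if s.time ≤ τ + c then Φ s.var s.arr else 0) fun v' a' t' ht' => by
    simp [ht']
  calc E P g ⟨v, a, τ⟩ ≤ E P (fun s => (if s.time ≤ τ + c then Φ s.var s.arr else 0) + x) ⟨v, a, τ⟩ :=
        htr.E_le_E fun s hs => by rw [if_pos hs.1]; exact hg s.var s.arr s.time hs.1
    _ = E P (fun s => if s.time ≤ τ + c then Φ s.var s.arr else 0) ⟨v, a, τ⟩ + x := by
        rw [E_add, htr.E_const]
    _ ≤ r + x := by gcongr

section field

variable {F : Type*} [Field F] [Fintype F] (code : F ≃ Fin (Fintype.card F)) {n : ℕ}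

/-! ### The algorithm -/

/-- One attempt to invert the matrix in array `0`. -/
def attempt (S M : Prog) (NS N N' d : ℕ) : Prog :=
  resetRegion regS NS ;; getDim 100 ;; S.rename regS ;; applyCols code 104 0 2 ;; callM code M N N' d ;;
    applyCols code 102 3 4 ;; freivalds code ;; .ifNZ 18 .skip (.const 60 1 ;; copySq F 4 1)

/-- The variables that `attempt` changes. -/
def attemptVars (NS N' : ℕ) : Set ℕ := low 50 ∪ {60, 62} ∪ regS '' Set.Iio NS ∪ regM '' Set.Iio N'

/-- The arrays that `attempt` changes. -/
def attemptArrs (NS N' : ℕ) : Set ℕ :=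
  {1, 2, 3, 4, 5, 6, 7, 9, 20, 21} ∪ regS '' Set.Iio NS ∪ regM '' Set.Iio N'

theorem writesIn_attempt {S M : Prog} {NS N N' d : ℕ} (hS : NamesBelow NS S) (hS0 : 2 < NS)
    (hM : NamesBelow N' (M.clk N)) (hN0 : 1 ≤ N) (hN : N < N') :
    WritesIn (attemptVars NS N') (attemptArrs NS N') (attempt code S M NS N N' d) := by
  have h100 : 100 ∈ regS '' Set.Iio NS := ⟨0, by simp; omega, rfl⟩
  have hl : low 50 ⊆ attemptVars NS N' := fun x hx => Or.inl (Or.inl (Or.inl hx))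
  have hr : ∀ b ≤ 50, regs b ⊆ attemptVars NS N' := fun b hb => (regs_subset_low hb).trans hl
  have hs : regS '' Set.Iio NS ⊆ attemptVars NS N' := fun x hx => Or.inl (Or.inr hx)
  have hs' : regS '' Set.Iio NS ⊆ attemptArrs NS N' := fun x hx => Or.inl (Or.inr hx)
  have ha : {1, 2, 3, 4, 5, 6, 7, 9, 20, 21} ⊆ attemptArrs NS N' := fun x hx => Or.inl (Or.inl hx)
  refine ⟨(writesIn_resetRegion _ _).mono hs hs', ⟨hl (by simp [low]), hs h100⟩,
    (hS.writesIn.rename regS).mono hs hs',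
    (writesIn_applyCols code _ _ _).mono (hr 40 (by simp)) (Set.Subset.trans (by simp [Set.insert_subset_iff]) ha),
    (writesIn_callM code hM hN0 hN).mono ?_ ?_,
    (writesIn_applyCols code _ _ _).mono (hr 40 (by simp)) (Set.Subset.trans (by simp [Set.insert_subset_iff]) ha),
    (writesIn_freivalds code).mono ?_ (Set.Subset.trans (by simp [Set.insert_subset_iff]) ha), trivial,
    Or.inl (Or.inl (Or.inr (by simp))),
    (writesIn_copySq _ _).mono (hr 30 (by simp)) (Set.Subset.trans (by simp [Set.insert_subset_iff]) ha)⟩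
  · exact Set.union_subset hl fun x hx => Or.inr hx
  · exact Set.union_subset (Set.Subset.trans (by simp [Set.insert_subset_iff]) ha) fun x hx => Or.inr hx
  · exact Set.union_subset ((low_mono (by simp)).trans hl) fun x hx => Or.inl (Or.inl (Or.inr (by simp at hx; simp [hx])))

/-- The configurations in which the algorithm tries to invert `A`. -/
def Base (A : Matrix (Fin n) (Fin n) F) (L : ℕ) (v : ℕ → ℕ) (a : ℕ → List ℕ) : Prop :=
  v 0 = n ∧ a 0 = encMatrix code A ∧ v 63 = L ∧ v 60 = 0

theorem Base.fr {A : Matrix (Fin n) (Fin n) F} {L : ℕ} {v v' : ℕ → ℕ} {a a' : ℕ → List ℕ} {vs as : Set ℕ}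
    (h : Base code A L v a) (hF : Fr vs as v a v' a') (h0 : 0 ∉ vs) (h63 : 63 ∉ vs) (h60 : 60 ∉ vs)
    (ha : 0 ∉ as) : Base code A L v' a' :=
  ⟨by rw [hF.1 0 h0, h.1], by rw [hF.2 0 ha, h.2.1], by rw [hF.1 63 h63, h.2.2.1], by rw [hF.1 60 h60, h.2.2.2]⟩

/-- The final configurations of the sampler that are useful. -/
def GoodSample (n m : ℕ) (u : State) : Prop :=
  ∃ (R : Matrix (Fin n) (Fin n) F) (C C' : Circuit F n n),
    u.arr 0 = encMatrix code R ∧ u.arr 1 = encCircuit code C ∧ u.arr 2 = encCircuit code C' ∧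
    (∀ v, C.eval v = R.mulVec v) ∧ (∀ v, C'.eval v = R.vecMul v) ∧ C.size ≤ m ∧ C'.size ≤ m

theorem tr_applyCols_enc {cir src out W l m : ℕ} {v : ℕ → ℕ} {a : ℕ → List ℕ} {C : Circuit F n n}
    {X Y : Matrix (Fin n) (Fin n) F}
    (hco : cir ≠ out) (hso : src ≠ out) (hc9 : cir ≠ 9) (hs9 : src ≠ 9) (ho9 : out ≠ 9)
    (hW : Nat.size W ≤ l) (hn : v 0 = n) (hCm : C.size ≤ m)
    (hmW : n * n + 2 * n + 3 * m + Fintype.card F + 10 ≤ W)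
    (hcir : a cir = encCircuit code C) (hX : a src = encMatrix code X)
    (hY : ∀ i, C.eval (fun t => X t i) = Y i) :
    Tr (applyCols code cir src out) (applyCost (Fintype.card F) n m l) v a
      fun v' a' => a' out = encMatrix code Y ∧ Fr (regs 40) {9, out} v a v' a' := by
  rw [Circuit.size] at hCm
  rw [encMatrix_eq] at hX
  refine (tr_applyCols code (C := C) hco hso hc9 hs9 ho9 hW hn (by omega) hcir hX).mono ?_ fun v' a' h => ⟨?_, h.2⟩
  · rw [applyCost, applyCost, colCost, colCost]; gcongr
  · rw [h.1]
    apply encMatrix_congr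
    intro i j
    rw [colValues, dif_pos j.2, ← hY]
    congr 1
    funext t
    exact ext_apply X t i

/-- Transposition reverses the product, and for square matrices a one-sided inverse is two-sided. -/
theorem candidate_iff {A R X : Matrix (Fin n) (Fin n) F} :
    A * (R * X).transpose = 1 ↔ A.transpose * R * X = 1 := by
  rw [← Matrix.transpose_inj, Matrix.transpose_mul, Matrix.transpose_transpose, Matrix.transpose_one,
    mul_eq_one_comm, mul_assoc]

/-- The value of the result of a run: `0` if it is correct, `1` if it is wrong, and `x` if there is
none. -/
noncomputable def outcome (A : Matrix.GeneralLinearGroup (Fin n) F) (x : ℝ≥0∞) (v : ℕ → ℕ) (a : ℕ → List ℕ) :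
    ℝ≥0∞ :=
  if v 60 = 0 then x else if v 60 = 1 then (if a 1 = encMatrix code A⁻¹.1 then 0 else 1) else ⊤

/-- The last part of `attempt`. -/
theorem ex_verify {W l L m : ℕ} {v : ℕ → ℕ} {a : ℕ → List ℕ} {A : Matrix.GeneralLinearGroup (Fin n) F}
    {R X : Matrix (Fin n) (Fin n) F} {C : Circuit F n n} {x : ℝ≥0∞} (hx : x ≠ ⊤)
    (hB : Base code A.1 L v a) (hW : Nat.size W ≤ l) (hLW : L ≤ W)
    (hmW : 2 * (n * n) + 2 * n + 3 * m + Fintype.card F + 10 ≤ W)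
    (hC : a 102 = encCircuit code C) (hCR : ∀ v, C.eval v = R.mulVec v) (hCm : C.size ≤ m)
    (hX : a 3 = encMatrix code X) [Decidable (A.1.transpose * R * X = 1)] :
    Ex (applyCols code 102 3 4 ;; freivalds code ;; .ifNZ 18 .skip (.const 60 1 ;; copySq F 4 1))
      (applyCost (Fintype.card F) n m l + (L * (freivCost (Fintype.card F) n l + 2 * l + 5) + 2 * l + 10) +
        copyEncCost (Fintype.card F) n l + 10) v a (outcome code A x)
      (if A.1.transpose * R * X = 1 then 0 else 2⁻¹ ^ L + x) := by
  classical
  have hn : v 0 = n := hB.1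
  set Y : Matrix (Fin n) (Fin n) F := (R * X).transpose with hY
  have hAY : A.1 * Y = 1 ↔ A.1.transpose * R * X = 1 := candidate_iff
  have hYi : ∀ i, C.eval (fun t => X t i) = Y i := by
    intro i
    rw [hCR]
    rfl
  refine Ex.mono ((tr_applyCols_enc code (cir := 102) (src := 3) (out := 4) (by simp) (by simp) (by simp)
    (by simp) (by simp) hW hn hCm (by omega) hC hX hYi).exSeq (c₂ := L * (freivCost (Fintype.card F) n l + 2 * l + 5) +
      2 * l + 10 + (copyEncCost (Fintype.card F) n l + 5)) fun v1 a1 ⟨f1, hF1⟩ => ?_) (by omega) (fun _ _ => le_rfl) le_rfl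
  have hB1 : Base code A.1 L v1 a1 := hB.fr code hF1 (by simp [regs]) (by simp [regs]) (by simp [regs]) (by simp)
  obtain ⟨Φ₁, hΦ₁⟩ : ∃ Φ₁ : (ℕ → ℕ) → (ℕ → List ℕ) → ℝ≥0∞, Φ₁ = fun v' a' =>
    if (v' 18 ≤ 1 ∧ (A.1 * Y = 1 → v' 18 = 0)) ∧ Base code A.1 L v' a' ∧ a' 4 = encMatrix code Y then
      (if v' 18 = 0 then (if A.1 * Y = 1 then 0 else 1) else x) else ⊤ := ⟨_, rfl⟩
  have hfr : ∀ v' a', Fr (low 30 ∪ {62}) {5, 6, 7} v1 a1 v' a' → Base code A.1 L v' a' ∧ a' 4 = encMatrix code Y :=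
    fun v' a' hF => ⟨hB1.fr code hF (by simp [low]) (by simp [low]) (by simp [low]) (by simp),
      by rw [hF.2 4 (by simp), f1]⟩
  have hfv := ex_freivalds code (A := A.1) (Z := Y) hB1.1 hW (by omega) hLW hB1.2.1 f1 hB1.2.2.1
  have hΦ : Ex (freivalds code) (L * (freivCost (Fintype.card F) n l + 2 * l + 5) + 2 * l + 10) v1 a1 Φ₁
      (if A.1.transpose * R * X = 1 then 0 else 2⁻¹ ^ L + x) := by
    by_cases h1 : A.1 * Y = 1
    · rw [if_pos (hAY.1 h1)]
      rw [if_pos h1] at hfv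
      refine ((hfv.tr (Q := fun v' a' => v' 18 = 0) ENNReal.one_ne_top fun v' a' hne => ?_).frame
        (writesIn_freivalds code)).ex ?_
      · by_contra h18
        exact hne (if_neg fun h => h18 (h.2 h1))
      · rintro v' a' ⟨h18, hF⟩
        rw [hΦ₁]
        simp only
        rw [if_pos ⟨⟨by omega, fun _ => h18⟩, hfr v' a' hF⟩, if_pos h18, if_pos h1]
    · rw [if_neg fun h => h1 (hAY.2 h)]
      rw [if_neg h1] at hfv
      -- A wrong candidate costs `1` if it is accepted and `x` otherwise; this is at most the
      -- indicator of acceptance plus `x`.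
      refine (hfv.add_const (ENNReal.pow_ne_top (by simp)) x).frame (writesIn_freivalds code) fun v' a' hF => ?_
      rw [hΦ₁]
      simp only [h1, false_imp_iff, and_true, hfr v' a' hF, and_self, if_false]
      split_ifs <;> simp
  refine hΦ.seq fun v2 a2 hne => ?_
  have hc : (v2 18 ≤ 1 ∧ (A.1 * Y = 1 → v2 18 = 0)) ∧ Base code A.1 L v2 a2 ∧ a2 4 = encMatrix code Y := by
    by_contra hc
    exact hne (by rw [hΦ₁]; exact if_neg hc)
  rw [hΦ₁]
  simp only
  rw [if_pos hc]
  obtain ⟨⟨h18, hz⟩, hB2, x24⟩ := hc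
  have s18 : Nat.size (v2 18) ≤ 1 := (Nat.size_le_size h18).trans Nat.size_one.le
  refine Ex.mono (Ex.ifNZ (c := copyEncCost (Fintype.card F) n l + 3) (fun hx => ?_) (fun hx => ?_)) (by omega)
    (fun _ _ => le_rfl) le_rfl
  · refine Ex.mono ((Tr.skip (Q := fun v' a' => v' = v2 ∧ a' = a2) ⟨rfl, rfl⟩).ex ?_) (by omega)
      (fun _ _ => le_rfl) le_rfl
    rintro v' a' ⟨rfl, rfl⟩
    rw [outcome, if_pos hB2.2.2.2, if_neg hx]
  · rw [if_pos hx]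
    refine Ex.mono ((Tr.const (x := 60) (k := 1) (Q := fun v' a' => v' = Function.update v2 60 1 ∧ a' = a2)
      ⟨rfl, rfl⟩).exSeq (c₂ := copyEncCost (Fintype.card F) n l) ?_) (by rw [Nat.size_one]; omega)
      (fun _ _ => le_rfl) le_rfl
    rintro v3 a3 ⟨rfl, rfl⟩
    refine (tr_copySq_enc code (A := 4) (out := 1) (X := Y) (by simp) hW (by simp [hB2.1]) (by omega) x24).ex ?_
    rintro v' a' ⟨h, hF⟩
    have h60 : v' 60 = 1 := by rw [hF.1 60 (by simp [regs])]; simp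
    rw [outcome, h60, if_neg one_ne_zero, if_pos rfl, h]
    have : encMatrix code Y = encMatrix code A⁻¹.1 ↔ A.1 * Y = 1 := by
      rw [(encMatrix_injective code).eq_iff]
      constructor
      · rintro h; rw [h]; exact A.mul_inv
      · intro h
        exact (Units.inv_eq_of_mul_eq_one_right h).symm
    simp only [this, le_refl]

variable {S M : Prog} {NS N N' d : ℕ}

/-- A bound for the running time of the last parts of `attempt`. -/
def verifyCost (q n m l L : ℕ) : ℕ :=
  applyCost q n m l + (L * (freivCost q n l + 2 * l + 5) + 2 * l + 10) + copyEncCost q n l + 10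

/-- A bound for the running time of `attempt`. -/
def attemptCost (NS N' d q n m l L τ τS : ℕ) : ℕ :=
  2 * NS + 1 + (l + 3) + τS + applyCost q n m l + callCost q N' d n l τ + verifyCost q n m l L

open Classical in
/-- The middle part of `attempt`. -/
theorem ex_solve {W l L m τ : ℕ} {v : ℕ → ℕ} {a : ℕ → List ℕ} {A : Matrix.GeneralLinearGroup (Fin n) F}
    {R : Matrix (Fin n) (Fin n) F} {C C' : Circuit F n n} {x : ℝ≥0∞} (hx : x ≠ ⊤)
    (hM : NamesBelow N' (M.clk N)) (hN0 : 1 ≤ N) (hN : N < N')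
    (hB : Base code A.1 L v a) (hW : Nat.size W ≤ l) (hLW : L ≤ W)
    (hmW : 2 * (n * n) + 2 * n + 3 * m + Fintype.card F + 10 ≤ W)
    (hdW : (n + 2) ^ d + (n + 2) ^ d + n + 2 ≤ W)
    (hC : a 102 = encCircuit code C) (hC' : a 104 = encCircuit code C')
    (hCR : ∀ v, C.eval v = R.mulVec v) (hCR' : ∀ v, C'.eval v = R.vecMul v)
    (hCm : C.size ≤ m) (hCm' : C'.size ≤ m)
    (hclean : ∀ x, N' ≤ x → v (regM x) = 0 ∧ a (regM x) = [])
    (hclk : Ens (M.clk N) (fun u => u.time ≤ τ ∧ u.var N ≤ (n + 2) ^ d ∧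
      (u.var N = 0 → fbCost (Fintype.card F) n ≤ τ))
      (clkInput N n (encMatrix code (A.1.transpose * R)) ((n + 2) ^ d))) :
    Ex (applyCols code 104 0 2 ;; callM code M N N' d ;; applyCols code 102 3 4 ;; freivalds code ;;
        .ifNZ 18 .skip (.const 60 1 ;; copySq F 4 1))
      (applyCost (Fintype.card F) n m l + (callCost (Fintype.card F) N' d n l τ +
        verifyCost (Fintype.card F) n m l L)) v a (outcome code A x)
      ((2⁻¹ ^ L + x) * failProb code M N ((n + 2) ^ d) (A.1.transpose * R)) := by
  have hYi : ∀ i, C'.eval (fun t => A.1 t i) = (A.1.transpose * R) i := by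
    intro i
    rw [hCR']
    rfl
  refine (tr_applyCols_enc code (cir := 104) (src := 0) (out := 2) (by simp) (by simp) (by simp)
    (by simp) (by simp) hW hB.1 hCm' (by omega) hC' hB.2.1 hYi).exSeq fun v1 a1 ⟨f1, hF1⟩ => ?_
  have hB1 : Base code A.1 L v1 a1 := hB.fr code hF1 (by simp [regs]) (by simp [regs]) (by simp [regs]) (by simp)
  have clean1 : ∀ x, N' ≤ x → v1 (regM x) = 0 ∧ a1 (regM x) = [] := by
    intro x hx
    rw [hF1.1 _ (by simp [regs, regM]; omega), hF1.2 _ (by simp [regM]; omega)]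
    exact hclean x hx
  set p : ℝ≥0∞ := 2⁻¹ ^ L + x with hp
  have hpt : p ≠ ⊤ := ENNReal.add_ne_top.2 ⟨ENNReal.pow_ne_top (by simp), hx⟩
  -- The summand `2⁻¹ ^ L` keeps the factor positive even for `x = 0`, so it may be moved in and out
  -- of expectations.
  have hp0 : p ≠ 0 := by simp [hp]
  obtain ⟨Φ₁, hΦ₁⟩ : ∃ Φ₁ : (ℕ → ℕ) → (ℕ → List ℕ) → ℝ≥0∞, Φ₁ = fun v' a' =>
      if ∃ X : Matrix (Fin n) (Fin n) F, a' 3 = encMatrix code X ∧ Base code A.1 L v' a' ∧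
        a' 102 = encCircuit code C then
        (if ∃ X : Matrix (Fin n) (Fin n) F, a' 3 = encMatrix code X ∧ A.1.transpose * R * X = 1 then 0 else p)
      else ⊤ := ⟨_, rfl⟩
  have hcall : Ex (callM code M N N' d) (callCost (Fintype.card F) N' d n l τ) v1 a1 Φ₁
      (E (M.clk N) (fun u => (fun X => if A.1.transpose * R * X = 1 then 0 else p) (result code N (A.1.transpose * R) u))
        (clkInput N n (encMatrix code (A.1.transpose * R)) ((n + 2) ^ d))) := by
    refine ex_callM code (φ := fun X => if A.1.transpose * R * X = 1 then 0 else p) hM hN0 hN hW (by omega) hdW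
      hB1.1 f1 clean1 hclk fun X v' a' hX hF => ?_
    rw [hΦ₁]
    simp only
    rw [if_pos]
    · refine le_of_eq ?_
      congr 1
      refine propext ⟨?_, fun h => ⟨X, hX, h⟩⟩
      rintro ⟨X', hX', h⟩
      rwa [encMatrix_injective code (hX.symm.trans hX')]
    · have nv : ∀ x, 50 ≤ x ∧ x < 101 ∨ x = 0 → x ∉ callVars N' := by
        rintro x hx (h | h)
        · simp [low] at h; omega
        · exact notMem_regM (by omega) _ h
      refine ⟨X, hX, hB1.fr code hF (nv _ (by simp)) (nv _ (by simp)) (nv _ (by simp)) ?_, ?_⟩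
      · rintro (h | h)
        · exact absurd h (by simp)
        · exact notMem_regM (by simp) _ h
      · rw [hF.2 102 (by simp [callArrs, regM]; omega), hF1.2 102 (by simp), hC]
  have hfail : E (M.clk N) (fun u => (fun X => if A.1.transpose * R * X = 1 then 0 else p)
      (result code N (A.1.transpose * R) u)) (clkInput N n (encMatrix code (A.1.transpose * R)) ((n + 2) ^ d)) =
      p * failProb code M N ((n + 2) ^ d) (A.1.transpose * R) := by
    rw [failProb, ← E_mul_le _ hpt hp0]
    congr 1
    funext u
    rw [ind]
    split_ifs <;> simp_all
  rw [hfail] at hcall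
  refine hcall.seq fun v2 a2 hne => ?_
  have hc : ∃ X : Matrix (Fin n) (Fin n) F, a2 3 = encMatrix code X ∧ Base code A.1 L v2 a2 ∧
      a2 102 = encCircuit code C := by
    by_contra hc
    exact hne (by rw [hΦ₁]; exact if_neg hc)
  rw [hΦ₁]
  simp only
  rw [if_pos hc]
  obtain ⟨X, x3, hB2, x102⟩ := hc
  have hiff : (∃ X : Matrix (Fin n) (Fin n) F, a2 3 = encMatrix code X ∧ A.1.transpose * R * X = 1) ↔
      A.1.transpose * R * X = 1 := by
    constructor
    · rintro ⟨X', hX', h⟩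
      rwa [← encMatrix_injective code (x3.symm.trans hX')] at h
    · exact fun h => ⟨X, x3, h⟩
  simp only [hiff]
  exact ex_verify code hx hB2 hW hLW hmW x102 hCR hCm x3

/-- The probability that the inverter fails, given the final configuration of the sampler. -/
noncomputable def sampleFail (M : Prog) (N c₀ : ℕ) (A : Matrix.GeneralLinearGroup (Fin n) F) (u : State) : ℝ≥0∞ :=
  failProb code M N c₀ (A.1.transpose * sanMatrix code n (u.arr 0))

/-- The images under `ρ` of the names from `N` on hold the initial values. -/
def Clean (ρ : ℕ → ℕ) (N : ℕ) (v : ℕ → ℕ) (a : ℕ → List ℕ) : Prop :=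
  ∀ x, N ≤ x → v (ρ x) = 0 ∧ a (ρ x) = []

theorem Clean.fr {ρ : ℕ → ℕ} {v v' : ℕ → ℕ} {a a' : ℕ → List ℕ} {vs as : Set ℕ}
    (h : Clean ρ N v a) (hF : Fr vs as v a v' a') (hv : ∀ x, N ≤ x → ρ x ∉ vs)
    (ha : ∀ x, N ≤ x → ρ x ∉ as) : Clean ρ N v' a' := fun x hx => by
  rw [hF.1 _ (hv x hx), hF.2 _ (ha x hx)]
  exact h x hx

theorem regS_notMem_regM (x : ℕ) (s : Set ℕ) : regS x ∉ regM '' s := by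
  rintro ⟨y, _, h⟩; simp only [regM, regS] at h; omega

theorem regM_notMem_regS (x : ℕ) (s : Set ℕ) : regM x ∉ regS '' s := by
  rintro ⟨y, _, h⟩; simp only [regM, regS] at h; omega

theorem regS_notMem {x : ℕ} (hx : NS ≤ x) : regS x ∉ regS '' Set.Iio NS := by
  rintro ⟨y, hy, h⟩; rw [regS_injective h] at hy; exact absurd hy (by simp; omega)

theorem regM_notMem {x : ℕ} (hx : N' ≤ x) : regM x ∉ regM '' Set.Iio N' := by
  rintro ⟨y, hy, h⟩; rw [regM_injective h] at hy; exact absurd hy (by simp; omega)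

theorem notMem_regS {x : ℕ} (hx : x < 100) (s : Set ℕ) : x ∉ regS '' s := by
  rintro ⟨y, _, rfl⟩; simp only [regS] at hx; omega

/-- The sampler and the inverter are restarted from clean memory, so every attempt fails with the
same averaged probability, whatever happened before. This factor multiplies the value `2⁻¹ ^ L + x`
of an attempt without a correct candidate. -/
theorem ex_attempt {W l L m τ τS : ℕ} {v : ℕ → ℕ} {a : ℕ → List ℕ} {A : Matrix.GeneralLinearGroup (Fin n) F}
    {x : ℝ≥0∞} (hx : x ≠ ⊤) (hS : NamesBelow NS S) (hS0 : 2 < NS)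
    (hM : NamesBelow N' (M.clk N)) (hN0 : 1 ≤ N) (hN : N < N')
    (hB : Base code A.1 L v a) (hW : Nat.size W ≤ l) (hLW : L ≤ W)
    (hmW : 2 * (n * n) + 2 * n + 3 * m + Fintype.card F + 10 ≤ W)
    (hdW : (n + 2) ^ d + (n + 2) ^ d + n + 2 ≤ W)
    (hcS : Clean regS NS v a) (hcM : Clean regM N' v a)
    (hsam : Ens S (fun u => u.time ≤ τS ∧ GoodSample code n m u) (input n [] []))
    (hclk : ∀ R : Matrix (Fin n) (Fin n) F, Ens (M.clk N) (fun u => u.time ≤ τ ∧ u.var N ≤ (n + 2) ^ d ∧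
      (u.var N = 0 → fbCost (Fintype.card F) n ≤ τ)) (clkInput N n (encMatrix code R) ((n + 2) ^ d))) :
    Ex (attempt code S M NS N N' d) (attemptCost NS N' d (Fintype.card F) n m l L τ τS) v a (outcome code A x)
      ((2⁻¹ ^ L + x) * E S (sampleFail code M N ((n + 2) ^ d) A) (input n [] [])) := by
  classical
  have sn : Nat.size n ≤ l := size_le_of_le hW (by omega)
  refine Ex.mono ((tr_resetRegion regS regS_injective NS v a).exSeq (c₂ := l + 3 + (τS + (applyCost (Fintype.card F) n m l +
    (callCost (Fintype.card F) N' d n l τ + verifyCost (Fintype.card F) n m l L)))) fun v1 a1 ⟨f1, hF1⟩ => ?_)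
    (by rw [attemptCost]; omega) (fun _ _ => le_rfl) le_rfl
  have hB1 : Base code A.1 L v1 a1 := hB.fr code hF1 (notMem_regS (by simp) _) (notMem_regS (by simp) _)
    (notMem_regS (by simp) _) (notMem_regS (by simp) _)
  have cS1 : ∀ x, v1 (regS x) = 0 ∧ a1 (regS x) = [] := by
    intro x
    by_cases hx : x < NS
    · exact f1 x hx
    · rw [hF1.1 _ (regS_notMem (by omega)), hF1.2 _ (regS_notMem (by omega))]
      exact hcS x (by omega)
  have cM1 : Clean regM N' v1 a1 := hcM.fr hF1 (fun _ _ => regM_notMem_regS _ _) (fun _ _ => regM_notMem_regS _ _)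
  refine (tr_getDim (n := n) hB1.1 sn (by simp)).exSeq fun v2 a2 ⟨f2, hF2⟩ => ?_
  have hB2 : Base code A.1 L v2 a2 := hB1.fr code hF2 (by simp) (by simp) (by simp) (by simp)
  have cM2 : Clean regM N' v2 a2 := cM1.fr hF2 (fun _ _ => by simp [regM]; omega) (fun _ _ => by simp)
  have hv2 : ∀ x, v2 (regS x) = (input n [] []).var x := by
    intro x
    by_cases hx : x = 0
    · subst hx
      exact f2
    · rw [hF2.1 _ (by simp [regS]; omega), (cS1 x).1]
      simp [input, hx]
  have ha2 : ∀ x, a2 (regS x) = (input n [] []).arr x := by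
    intro x
    rw [hF2.2 _ (by simp), (cS1 x).2]
    simp [input]
  set p : ℝ≥0∞ := 2⁻¹ ^ L + x with hp
  have hpt : p ≠ ⊤ := ENNReal.add_ne_top.2 ⟨ENNReal.pow_ne_top (by simp), hx⟩
  have hp0 : p ≠ 0 := by simp [hp]
  rw [← E_mul_le S hpt hp0]
  -- Of the sampler's final configuration only its arrays `0`, `1` and `2` matter, which are the
  -- arrays `100`, `102` and `104` of the full memory.
  obtain ⟨Cond, hCond⟩ : ∃ Cond : (ℕ → ℕ) → (ℕ → List ℕ) → Prop, Cond = fun v' a' =>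
    ∃ u, GoodSample code n m u ∧ a' 100 = u.arr 0 ∧ a' 102 = u.arr 1 ∧ a' 104 = u.arr 2 ∧
      Base code A.1 L v' a' ∧ Clean regM N' v' a' := ⟨_, rfl⟩
  obtain ⟨Φ₁, hΦ₁⟩ : ∃ Φ₁ : (ℕ → ℕ) → (ℕ → List ℕ) → ℝ≥0∞, Φ₁ = fun v' a' =>
    if Cond v' a' then p * failProb code M N ((n + 2) ^ d) (A.1.transpose * sanMatrix code n (a' 100)) else ⊤ :=
    ⟨_, rfl⟩
  have hreg : Ex (S.rename regS) τS v2 a2 Φ₁ (E S (fun u => p * sampleFail code M N ((n + 2) ^ d) A u) (input n [] [])) := by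
    refine Ex.region regS_injective hS rfl hv2 ha2 hsam fun u v' a' hu hv' ha' hF => ?_
    rw [hΦ₁]
    simp only
    have h0 : a' 100 = u.arr 0 := ha' 0
    rw [if_pos, sampleFail, h0]
    rw [hCond]
    exact ⟨u, hu, h0, ha' 1, ha' 2, hB2.fr code hF (notMem_regS (by simp) _) (notMem_regS (by simp) _)
      (notMem_regS (by simp) _) (notMem_regS (by simp) _),
      cM2.fr hF (fun _ _ => regM_notMem_regS _ _) (fun _ _ => regM_notMem_regS _ _)⟩
  refine hreg.seq fun v3 a3 hne => ?_
  have hc : Cond v3 a3 := by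
    by_contra hc
    exact hne (by rw [hΦ₁]; exact if_neg hc)
  rw [hΦ₁]
  simp only
  rw [if_pos hc]
  rw [hCond] at hc
  obtain ⟨u, ⟨R, C, C', u0, u1, u2, hCR, hCR', hCm, hCm'⟩, x0, x1, x2, hB3, cM3⟩ := hc
  rw [x0, u0, sanMatrix_encMatrix]
  exact ex_solve code hx hM hN0 hN hB3 hW hLW hmW hdW (x1.trans u1) (x2.trans u2) hCR hCR' hCm hCm' cM3 (hclk _)

end field

/-! ### Computing the number of rounds -/

theorem size_half {m : ℕ} (hm : m ≠ 0) : Nat.size m = Nat.size (m / 2) + 1 := by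
  have h := Nat.bit_bodd_div2 m
  rw [Nat.div2_val] at h
  conv_lhs => rw [← h]
  exact Nat.size_bit (by rwa [h])

/-- Add the number of digits of variable `64` times variable `65` to variable `63`. -/
def addDigits : Prog := .whileNZ 64 (.plus 63 63 65 ;; .half 64 64)

/-- Halving until zero counts binary digits, which gives a number of rounds logarithmic in `n`. -/
theorem tr_addDigits {W l : ℕ} (hW : Nat.size W ≤ l) (m : ℕ) : ∀ (v : ℕ → ℕ) (a : ℕ → List ℕ), v 64 = m →
    v 63 + v 65 * Nat.size m ≤ W → m ≤ W → v 65 ≤ W →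
    Tr addDigits (Nat.size m * (4 * l + 3) + 1) v a fun v' a' => v' 63 = v 63 + v 65 * Nat.size m ∧
      Fr {63, 64} ∅ v a v' a' := by
  suffices H : ∀ s m, Nat.size m = s → ∀ (v : ℕ → ℕ) (a : ℕ → List ℕ), v 64 = m →
      v 63 + v 65 * s ≤ W → m ≤ W → v 65 ≤ W →
      Tr addDigits (s * (4 * l + 3) + 1) v a fun v' a' => v' 63 = v 63 + v 65 * s by
    intro v a hm h1 h2 h3
    exact (H _ m rfl v a hm h1 h2 h3).frame (by simp [addDigits, WritesIn])
  intro s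
  induction s with
  | zero =>
    intro m hs v a hm h1 h2 h3 τ
    have h0 : m = 0 := Nat.size_eq_zero.1 hs
    rw [addDigits, Ens_whileNZ, if_pos (by show v 64 = 0; rw [hm, h0])]
    simp [State.tick, hm, h0]
  | succ s ih =>
    intro m hs v a hm h1 h2 h3 τ
    have h0 : m ≠ 0 := by rintro rfl; simp at hs
    have sm : Nat.size m ≤ l := size_le_of_le hW h2
    rw [mul_add, mul_one] at h1
    rw [addDigits, Ens_whileNZ, if_neg (by show ¬ v 64 = 0; rw [hm]; exact h0)]
    show Ens _ (Ens addDigits _) ⟨v, a, τ + (1 + Nat.size (v 64))⟩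
    rw [hm]
    simp only [Ens_seq, Ens_plus, Ens_half]
    set v1 := Function.update (Function.update v 63 (v 63 + v 65)) 64 (m / 2) with hv1
    have hs' : Nat.size (m / 2) = s := by have := size_half h0; omega
    have h64 : v1 64 = m / 2 := by simp [hv1]
    have h63 : v1 63 = v 63 + v 65 := by simp [hv1]
    have h65 : v1 65 = v 65 := by simp [hv1]
    have s63 : Nat.size (v 63) ≤ l := size_le_of_le hW (by omega)
    have s65 : Nat.size (v 65) ≤ l := size_le_of_le hW h3
    have e : Function.update (Function.update v 63 (v 63 + v 65)) 64
        (Function.update v 63 (v 63 + v 65) 64 / 2) = v1 := by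
      rw [hv1, Function.update_of_ne (by simp), hm]
    rw [e, Function.update_of_ne (by simp), hm]
    refine (ih (m / 2) hs' v1 a h64 (by rw [h63, h65]; omega) (by omega) (by rw [h65]; exact h3)).step
      fun v2 a2 t2 ht2 h => ⟨?_, ?_⟩
    · show t2 ≤ _
      have : (s + 1) * (4 * l + 3) = s * (4 * l + 3) + (4 * l + 3) := by ring
      omega
    · show v2 63 = _
      rw [h, h63, h65]; ring

/-- Put the number of rounds into the variables `61` and `63`. -/
def prepare (K : ℕ) : Prog :=
  .const 63 0 ;; .const 1 0 ;; .plus 64 0 1 ;; .const 65 K ;; addDigits ;; .plus 61 63 1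

theorem tr_prepare {K W l n : ℕ} {v : ℕ → ℕ} {a : ℕ → List ℕ} (hW : Nat.size W ≤ l) (hn : v 0 = n)
    (hnW : n ≤ W) (hKW : K ≤ W) (hLW : K * Nat.size n ≤ W) :
    Tr (prepare K) (l * (4 * l + 3) + 3 * l + 10) v a fun v' a' => v' 61 = K * Nat.size n ∧
      v' 63 = K * Nat.size n ∧ Fr {1, 61, 63, 64, 65} ∅ v a v' a' := by
  refine Tr.mono (Tr.frame (Q := fun v' a' => v' 61 = K * Nat.size n ∧ v' 63 = K * Nat.size n) ?_
    (by simp [prepare, addDigits, WritesIn] : WritesIn {1, 61, 63, 64, 65} ∅ (prepare K))) le_rfl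
    fun v' a' h => ⟨h.1.1, h.1.2, h.2⟩
  intro τ
  have sn : Nat.size n ≤ l := size_le_of_le hW hnW
  have sK : Nat.size K ≤ l := size_le_of_le hW hKW
  have sL : Nat.size (K * Nat.size n) ≤ l := size_le_of_le hW hLW
  rw [prepare]
  simp only [Ens_seq, Ens_const, Ens_plus]
  simp only [Function.update_apply, Nat.reduceEqDiff, if_true, if_false, add_zero, hn, zero_ne_one, Nat.size_zero,
    OfNat.zero_ne_ofNat]
  refine (tr_addDigits hW n _ a (by simp) (by simpa using hLW) hnW (by simpa using hKW)).step
    fun v1 a1 t1 ht1 ⟨h1, hF1⟩ => ?_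
  rw [Function.update_of_ne (by simp), Function.update_of_ne (by simp), Function.update_of_ne (by simp),
    Function.update_self, Function.update_self, zero_add] at h1
  have h11 : v1 1 = 0 := by rw [hF1.1 1 (by simp)]; simp
  have : Nat.size n * (4 * l + 3) ≤ l * (4 * l + 3) := Nat.mul_le_mul_right _ sn
  rw [Ens_plus]
  refine ⟨?_, by simp [h1, h11], by simp [h1]⟩
  simp only [h1, h11, Nat.size_zero]
  omega

/-! ### Repeating the attempts -/

section field

variable {F : Type*} [Field F] [Fintype F] (code : F ≃ Fin (Fintype.card F)) {n : ℕ}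

/-- The algorithm that inverts every matrix with high probability. -/
def solver (S M : Prog) (NS N N' d K : ℕ) : Prog :=
  prepare K ;; .forN 61 (.ifNZ 60 .skip (attempt code S M NS N N' d))

/-- A bound for the running time of `solver`. -/
def solverCost (NS N' d K q n m l τ τS : ℕ) : ℕ :=
  l * (4 * l + 3) + 3 * l + 10 +
    (K * Nat.size n * (attemptCost NS N' d q n m l (K * Nat.size n) τ τS + 2 + 2 * l + 5) + 1)

/-- A bound for the probability that `k` attempts fail, where `ρ` bounds the probability that an
attempt yields no correct candidate and `η` the probability that a wrong candidate is accepted. -/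
noncomputable def failBound (η ρ : ℝ≥0∞) : ℕ → ℝ≥0∞
  | 0 => 1
  | k + 1 => (η + failBound η ρ k) * ρ

theorem failBound_ne_top {η ρ : ℝ≥0∞} (hη : η ≠ ⊤) (hρ : ρ ≠ ⊤) (k : ℕ) : failBound η ρ k ≠ ⊤ := by
  induction k with
  | zero => simp [failBound]
  | succ k ih => exact ENNReal.mul_ne_top (ENNReal.add_ne_top.2 ⟨hη, ih⟩) hρ

/-- Either all `k` attempts lack a correct candidate, or one of them accepts a wrong one; the latter
contributes at most `η` for each attempt. -/
theorem failBound_le {η ρ δ : ℝ≥0∞} (hρ : ρ ≤ δ) (hδ : δ ≤ 1) (k : ℕ) : failBound η ρ k ≤ δ ^ k + k * η := by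
  induction k with
  | zero => simp [failBound]
  | succ k ih =>
    calc (η + failBound η ρ k) * ρ ≤ (η + (δ ^ k + k * η)) * δ := by gcongr
      _ = δ ^ (k + 1) + (k + 1) * η * δ := by ring
      _ ≤ δ ^ (k + 1) + (k + 1) * η * 1 := by gcongr
      _ = _ := by push_cast; ring

variable {S M : Prog} {NS N N' d : ℕ}

/-- While no answer has been recorded, the potential is the failure bound for the remaining
attempts; once variable `60` is set, it is `0` or `1` according to the answer, and later rounds are
skipped. The recursion of `failBound` is exactly the bound for one attempt. -/
theorem ex_solver {K W l m τ τS : ℕ} {A : Matrix.GeneralLinearGroup (Fin n) F}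
    (hS : NamesBelow NS S) (hS0 : 2 < NS)
    (hM : NamesBelow N' (M.clk N)) (hN0 : 1 ≤ N) (hN : N < N')
    (hW : Nat.size W ≤ l) (hLW : K * Nat.size n ≤ W) (hKW : K ≤ W)
    (hmW : 2 * (n * n) + 2 * n + 3 * m + Fintype.card F + 10 ≤ W)
    (hdW : (n + 2) ^ d + (n + 2) ^ d + n + 2 ≤ W)
    (hsam : Ens S (fun u => u.time ≤ τS ∧ GoodSample code n m u) (input n [] []))
    (hclk : ∀ R : Matrix (Fin n) (Fin n) F, Ens (M.clk N) (fun u => u.time ≤ τ ∧ u.var N ≤ (n + 2) ^ d ∧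
      (u.var N = 0 → fbCost (Fintype.card F) n ≤ τ)) (clkInput N n (encMatrix code R) ((n + 2) ^ d)))
    (hρ : E S (sampleFail code M N ((n + 2) ^ d) A) (input n [] []) ≠ ⊤) :
    Ex (solver code S M NS N N' d K) (solverCost NS N' d K (Fintype.card F) n m l τ τS)
      (input n (encMatrix code A.1) []).var (input n (encMatrix code A.1) []).arr
      (fun _ a' => if a' 1 = encMatrix code A⁻¹.1 then 0 else 1)
      (failBound (2⁻¹ ^ (K * Nat.size n)) (E S (sampleFail code M N ((n + 2) ^ d) A) (input n [] []))
        (K * Nat.size n)) := by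
  classical
  generalize hL : K * Nat.size n = L at hLW ⊢
  set ρ := E S (sampleFail code M N ((n + 2) ^ d) A) (input n [] []) with hρ'
  have hη : (2⁻¹ ^ L : ℝ≥0∞) ≠ ⊤ := ENNReal.pow_ne_top (by simp)
  have sL : Nat.size L ≤ l := size_le_of_le hW hLW
  refine Ex.mono ((tr_prepare (K := K) (n := n) hW (by simp [input]) (by omega) hKW (by omega)).exSeq
    (c₂ := L * (attemptCost NS N' d (Fintype.card F) n m l L τ τS + 2 + 2 * l + 5) + 1)
    fun v1 a1 ⟨h61, h63, hF1⟩ => ?_) (by rw [solverCost, hL]) (fun _ _ => le_rfl) le_rfl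
  rw [hL] at h61 h63
  obtain ⟨Cond, hCond⟩ : ∃ Cond : (ℕ → ℕ) → (ℕ → List ℕ) → Prop, Cond = fun v' a' =>
    v' 0 = n ∧ a' 0 = encMatrix code A.1 ∧ v' 63 = L ∧ Clean regS NS v' a' ∧ Clean regM N' v' a' := ⟨_, rfl⟩
  have hCond1 : Cond v1 a1 := by
    rw [hCond]
    refine ⟨?_, ?_, h63, fun x hx => ?_, fun x hx => ?_⟩
    · rw [hF1.1 0 (by simp)]; simp [input]
    · rw [hF1.2 0 (by simp)]; simp [input]
    · rw [hF1.1 _ (by simp [regS]; omega), hF1.2 _ (by simp)]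
      simp [input, regS]
    · rw [hF1.1 _ (by simp [regM]; omega), hF1.2 _ (by simp)]
      simp [input, regM]
  have h60 : v1 60 = 0 := by rw [hF1.1 60 (by simp)]; simp [input]
  have hCfr : ∀ v a v' a', Cond v a → Fr (attemptVars NS N') (attemptArrs NS N') v a v' a' →
      Cond (Function.update (Function.update v' 1 1) 61 (v 61 - 1)) a' := by
    rw [hCond]
    rintro v a v' a' ⟨c0, c1, c2, c3, c4⟩ hF
    have nv : ∀ x, x = 0 ∨ x = 63 ∨ x = 61 → x ∉ attemptVars NS N' := by
      rintro x hx (((h | h) | h) | h)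
      · simp [low] at h; omega
      · simp at h; omega
      · exact notMem_regS (by omega) _ h
      · exact notMem_regM (by omega) _ h
    have b0 : 0 ∉ attemptArrs NS N' := by
      rintro ((h | h) | h)
      · simp at h
      · exact notMem_regS (by omega) _ h
      · exact notMem_regM (by omega) _ h
    refine ⟨?_, by rw [hF.2 0 b0, c1], ?_, ?_, ?_⟩
    · rw [Function.update_of_ne (by simp), Function.update_of_ne (by simp), hF.1 _ (nv _ (by simp)), c0]
    · rw [Function.update_of_ne (by simp), Function.update_of_ne (by simp), hF.1 _ (nv _ (by simp)), c2]
    · intro x hx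
      have nx : regS x ∉ attemptVars NS N' := by
        rintro (((h | h) | h) | h)
        · simp [low, regS] at h; omega
        · simp [regS] at h; omega
        · exact regS_notMem hx h
        · exact regS_notMem_regM _ _ h
      have na : regS x ∉ attemptArrs NS N' := by
        rintro ((h | h) | h)
        · simp [regS] at h; omega
        · exact regS_notMem hx h
        · exact regS_notMem_regM _ _ h
      rw [Function.update_of_ne (by simp [regS]; omega), Function.update_of_ne (by simp [regS]; omega),
        hF.1 _ nx, hF.2 _ na]
      exact c3 x hx
    · intro x hx
      have nx : regM x ∉ attemptVars NS N' := by
        rintro (((h | h) | h) | h)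
        · simp [low, regM] at h; omega
        · simp [regM] at h; omega
        · exact regM_notMem_regS _ _ h
        · exact regM_notMem hx h
      have na : regM x ∉ attemptArrs NS N' := by
        rintro ((h | h) | h)
        · simp [regM] at h; omega
        · exact regM_notMem_regS _ _ h
        · exact regM_notMem hx h
      rw [Function.update_of_ne (by simp [regM]; omega), Function.update_of_ne (by simp [regM]; omega),
        hF.1 _ nx, hF.2 _ na]
      exact c4 x hx
  obtain ⟨Φ, hΦ⟩ : ∃ Φ : ℕ → (ℕ → ℕ) → (ℕ → List ℕ) → ℝ≥0∞, Φ = fun j v' a' =>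
    if Cond v' a' then outcome code A (failBound (2⁻¹ ^ L) ρ (L - j)) v' a' else ⊤ := ⟨_, rfl⟩
  have hr : Φ 0 v1 a1 = failBound (2⁻¹ ^ L) ρ L := by
    rw [hΦ]; simp only; rw [if_pos hCond1, outcome, if_pos h60, Nat.sub_zero]
  rw [← hr]
  refine Ex.mono (Ex.forN (N := L) (l := l) (c := attemptCost NS N' d (Fintype.card F) n m l L τ τS + 2) (Φ := Φ)
    sL h61 (by simp) ?_) (by omega) ?_ le_rfl
  · intro j hj v a h61 hne
    have hc : Cond v a := by
      by_contra hc
      exact hne (by rw [hΦ]; exact if_neg hc)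
    have hstep : ∀ v' a', Fr (attemptVars NS N') (attemptArrs NS N') v a v' a' →
        (if v' 61 = L - j then Φ (j + 1) (Function.update (Function.update v' 1 1) 61 (L - (j + 1))) a' else ⊤) =
          outcome code A (failBound (2⁻¹ ^ L) ρ (L - (j + 1))) v' a' := by
      intro v' a' hF
      have n61 : 61 ∉ attemptVars NS N' := by
        rintro (((h | h) | h) | h)
        · simp [low] at h
        · simp at h
        · exact notMem_regS (by omega) _ h
        · exact notMem_regM (by omega) _ h
      rw [if_pos (by rw [hF.1 61 n61, h61]), hΦ]
      have := hCfr v a v' a' hc hF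
      rw [h61] at this
      simp only
      rw [Nat.sub_sub] at this
      rw [if_pos this, outcome, outcome]
      simp
    have hΦj : Φ j v a = outcome code A (failBound (2⁻¹ ^ L) ρ (L - j)) v a := by
      rw [hΦ]; exact if_pos hc
    rw [hΦj] at hne ⊢
    have h1 : v 60 ≤ 1 := by
      rw [outcome] at hne
      by_contra h
      rw [if_neg (by omega), if_neg (by omega)] at hne
      exact hne rfl
    have s60 : Nat.size (v 60) ≤ 1 := (Nat.size_le_size h1).trans Nat.size_one.le
    refine Ex.mono (Ex.ifNZ (c := attemptCost NS N' d (Fintype.card F) n m l L τ τS) (fun hx => ?_) (fun hx => ?_))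
      (by omega) (fun _ _ => le_rfl) le_rfl
    · refine Ex.mono ((Tr.skip (Q := fun v' a' => v' = v ∧ a' = a) ⟨rfl, rfl⟩).ex ?_)
        (by rw [attemptCost]; omega) (fun _ _ => le_rfl) le_rfl
      rintro v' a' ⟨rfl, rfl⟩
      rw [hstep v' a' (Fr.refl _ _), outcome, outcome, if_neg hx, if_neg hx]
    · rw [outcome, if_pos hx]
      have e : failBound (2⁻¹ ^ L) ρ (L - j) = (2⁻¹ ^ L + failBound (2⁻¹ ^ L) ρ (L - (j + 1))) * ρ := by
        conv_lhs => rw [show L - j = (L - (j + 1)) + 1 by omega]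
        rfl
      rw [e]
      rw [hCond] at hc
      exact (ex_attempt code (failBound_ne_top hη hρ _) hS hS0 hM hN0 hN ⟨hc.1, hc.2.1, hc.2.2.1, hx⟩ hW hLW hmW hdW
        hc.2.2.2.1 hc.2.2.2.2 hsam hclk).frame (writesIn_attempt code hS hS0 hM hN0 hN)
        fun v' a' hF => (hstep v' a' hF).le
  · intro v' a'
    split_ifs with h h'
    · exact zero_le
    · exact zero_le
    · rw [hΦ]
      simp only
      split_ifs with hc
      · rw [outcome]
        -- Ending without an answer counts as an error.
        have : failBound (2⁻¹ ^ L) ρ (L - L) = 1 := by rw [Nat.sub_self]; rfl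
        rw [this]
        split_ifs <;> simp
      · exact le_top
    · exact le_top

end field

/-! ### Asymptotic bounds -/

theorem eventually_one_le_log : ∀ᶠ n in Filter.atTop, 1 ≤ Nat.log 2 n := by
  filter_upwards [Filter.eventually_ge_atTop 2] with n hn
  exact Nat.log_pos (by simp) hn

namespace SoftO

variable {f f' g g' p : ℕ → ℕ}

theorem mono (h : SoftO f g) (hf : ∀ᶠ n in Filter.atTop, f' n ≤ f n) (hg : ∀ᶠ n in Filter.atTop, g n ≤ g' n) :
    SoftO f' g' := by
  obtain ⟨C, k, hC⟩ := h
  refine ⟨C, k, ?_⟩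
  filter_upwards [hC, hf, hg] with n h1 h2 h3
  exact h2.trans (h1.trans (by gcongr))

theorem refl (f : ℕ → ℕ) : SoftO f f := ⟨1, 0, Filter.Eventually.of_forall fun n => by simp⟩

theorem add (h : SoftO f g) (h' : SoftO f' g) : SoftO (fun n => f n + f' n) g := by
  obtain ⟨C, k, hC⟩ := h
  obtain ⟨C', k', hC'⟩ := h'
  refine ⟨C + C', k + k', ?_⟩
  filter_upwards [hC, hC', eventually_one_le_log] with n h1 h2 h3
  have e1 : Nat.log 2 n ^ k ≤ Nat.log 2 n ^ (k + k') := Nat.pow_le_pow_right h3 (by omega)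
  have e2 : Nat.log 2 n ^ k' ≤ Nat.log 2 n ^ (k + k') := Nat.pow_le_pow_right h3 (by omega)
  calc f n + f' n ≤ C * g n * Nat.log 2 n ^ (k + k') + C' * g n * Nat.log 2 n ^ (k + k') :=
        Nat.add_le_add (h1.trans (by gcongr)) (h2.trans (by gcongr))
    _ = _ := by ring

theorem mul (h : SoftO f g) (h' : SoftO f' g') : SoftO (fun n => f n * f' n) (fun n => g n * g' n) := by
  obtain ⟨C, k, hC⟩ := h
  obtain ⟨C', k', hC'⟩ := h'
  refine ⟨C * C', k + k', ?_⟩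
  filter_upwards [hC, hC'] with n h1 h2
  calc f n * f' n ≤ (C * g n * Nat.log 2 n ^ k) * (C' * g' n * Nat.log 2 n ^ k') := Nat.mul_le_mul h1 h2
    _ = _ := by ring

theorem const (c : ℕ) : SoftO (fun _ => c) (fun _ => 1) :=
  ⟨c, 0, Filter.Eventually.of_forall fun n => by simp⟩

theorem mul_polylog (h : SoftO f g) (hp : SoftO p fun _ => 1) : SoftO (fun n => f n * p n) g := by
  simpa using h.mul hp

theorem polylog_mul (hp : SoftO p fun _ => 1) (h : SoftO f g) : SoftO (fun n => p n * f n) g := by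
  simpa using hp.mul h

theorem polylog_mul_polylog (hp : SoftO p fun _ => 1) (h : SoftO f fun _ => 1) :
    SoftO (fun n => p n * f n) fun _ => 1 := polylog_mul hp h

theorem id_mul (h : SoftO f fun n => n) : SoftO (fun n => n * f n) fun n => n ^ 2 := by
  simpa [sq] using (refl fun n => n).mul h

theorem of_polylog (hp : SoftO p fun _ => 1) (hg : ∀ᶠ n in Filter.atTop, 1 ≤ g n) : SoftO p g :=
  hp.mono (Filter.Eventually.of_forall fun _ => le_rfl) hg

theorem lin (hp : SoftO p fun _ => 1) : SoftO p fun n => n :=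
  hp.of_polylog (Filter.eventually_ge_atTop 1)

theorem lin_sq (h : SoftO f fun n => n) : SoftO f fun n => n ^ 2 :=
  h.mono (Filter.Eventually.of_forall fun _ => le_rfl)
    (Filter.Eventually.of_forall fun n => Nat.le_self_pow (by simp) n)

theorem square (hp : SoftO p fun _ => 1) : SoftO p fun n => n ^ 2 := hp.lin.lin_sq

theorem trans (h : SoftO f g) (h' : SoftO g g') : SoftO f g' := by
  obtain ⟨C, k, hC⟩ := h
  obtain ⟨C', k', hC'⟩ := h'
  refine ⟨C * C', k' + k, ?_⟩
  filter_upwards [hC, hC'] with n h1 h2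
  calc f n ≤ C * g n * Nat.log 2 n ^ k := h1
    _ ≤ C * (C' * g' n * Nat.log 2 n ^ k') * Nat.log 2 n ^ k := by gcongr
    _ = _ := by ring

/-- A function in `Õ(n)` is eventually bounded by a polynomial. -/
theorem exists_le_pow (h : SoftO f fun n => n) : ∃ e, ∀ᶠ n in Filter.atTop, f n ≤ (n + 2) ^ e := by
  obtain ⟨C, k, hC⟩ := h
  obtain ⟨e, he⟩ := (((PolyB.const C).mul PolyB.id).mul (PolyB.id.pow k))
  refine ⟨e, ?_⟩
  filter_upwards [hC] with n h1
  have : Nat.log 2 n ≤ n := Nat.log_le_self 2 n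
  exact h1.trans ((by gcongr : C * n * Nat.log 2 n ^ k ≤ C * n * n ^ k).trans (he n))

theorem size_id : SoftO Nat.size fun _ => 1 := by
  refine ⟨2, 1, ?_⟩
  filter_upwards [Filter.eventually_ge_atTop 2] with n hn
  have h1 : 1 ≤ Nat.log 2 n := Nat.log_pos (by simp) hn
  have h2 : Nat.size n ≤ Nat.log 2 n + 1 := by
    rw [Nat.size_le]; exact Nat.lt_pow_succ_log_self (by simp) n
  rw [pow_one]
  omega

/-- Numbers of polynomial size have logarithmically many bits; this is why the logarithmic cost of
instructions disappears in the soft-O notation. -/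
theorem size_pow {W : ℕ → ℕ} {e : ℕ} (hW : ∀ᶠ n in Filter.atTop, W n ≤ (n + 2) ^ e) :
    SoftO (fun n => Nat.size (W n)) fun _ => 1 := by
  refine (((const e).polylog_mul (size_id.add (const 2))).add (const 1)).mono ?_
    (Filter.Eventually.of_forall fun _ => le_rfl)
  filter_upwards [hW] with n h
  refine (Nat.size_le_size h).trans ((size_pow_le _ _).trans ?_)
  have : Nat.size (n + 2) ≤ Nat.size n + 2 := by
    rw [Nat.size_le, pow_add]
    have := Nat.lt_size_self n
    omega
  gcongr

end SoftO

/-! ### Soft-O bounds for the running times -/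

section costs

variable {l m τ τS L : ℕ → ℕ} (q d : ℕ)

theorem softO_dotCost (hl : SoftO l fun _ => 1) : SoftO (fun n => dotCost q n (l n)) fun n => n := by
  have h : SoftO (fun n => 2 * fopCost q + 2 * q + 8 * l n + 20) fun _ => 1 :=
    ((SoftO.const _).add ((SoftO.const 8).polylog_mul hl)).add (SoftO.const 20)
  exact ((((SoftO.refl fun n => n).mul_polylog h).add hl.lin).add (SoftO.const q).lin).add (SoftO.const 10).lin

theorem softO_matmulCost (hl : SoftO l fun _ => 1) : SoftO (fun n => matmulCost q n 1 (l n)) fun n => n ^ 2 := by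
  have hmul : ∀ c, SoftO (fun n => c * l n) fun n => n := fun c => ((SoftO.const c).polylog_mul hl).lin
  have hrow : SoftO (fun n => matmulRowCost q n 1 (l n)) fun n => n :=
    (((SoftO.const 1).polylog_mul ((((softO_dotCost q hl).add (hmul 10)).add (SoftO.const q).lin).add
      (SoftO.const 20).lin)).add (hmul 5)).add (SoftO.const 10).lin
  exact ((((hrow.add (hmul 2)).add (SoftO.const 5).lin).id_mul).add hl.square).add (SoftO.const 10).square

theorem softO_squareCost (hl : SoftO l fun _ => 1) : SoftO (fun n => squareCost n (l n)) fun n => n := by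
  have h : SoftO (fun n => 4 * l n + 6) fun _ => 1 := ((SoftO.const 4).polylog_mul hl).add (SoftO.const 6)
  exact (((SoftO.refl fun n => n).mul_polylog h).add hl.lin).add (SoftO.const 8).lin

theorem softO_copySqCost {w g : ℕ → ℕ} (hl : SoftO l fun _ => 1) (hw : SoftO w g)
    (hg : SoftO (fun n => n ^ 2) g) : SoftO (fun n => copySqCost q n (l n) (w n)) g := by
  have h : SoftO (fun n => 4 * q + 5 * l n + 25) fun _ => 1 :=
    ((SoftO.const _).add ((SoftO.const 5).polylog_mul hl)).add (SoftO.const 25)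
  have hsq : SoftO (fun n => n * n * (4 * q + 5 * l n + 25)) fun n => n ^ 2 :=
    SoftO.mul_polylog (SoftO.id_mul (SoftO.refl fun n => n)) h
  exact ((((SoftO.const 2).polylog_mul hw).add (hsq.trans hg)).add ((SoftO.const 10).square.trans hg)).add
    ((softO_squareCost hl).lin_sq.trans hg)

theorem softO_copyEncCost (hl : SoftO l fun _ => 1) : SoftO (fun n => copyEncCost q n (l n)) fun n => n ^ 2 :=
  softO_copySqCost q hl (SoftO.mul_polylog (SoftO.id_mul (SoftO.refl fun n => n)) (SoftO.const (q + 1)))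
    (SoftO.refl _)

theorem softO_mulDimCost (hl : SoftO l fun _ => 1) : SoftO (fun n => mulDimCost n (l n)) fun n => n := by
  have h : SoftO (fun n => 4 * l n + 6) fun _ => 1 := ((SoftO.const 4).polylog_mul hl).add (SoftO.const 6)
  have h1 : SoftO (fun n => n + 2) fun n => n := (SoftO.refl fun n => n).add (SoftO.const 2).lin
  exact ((h1.mul_polylog h).add ((SoftO.const 2).polylog_mul hl).lin).add (SoftO.const 12).lin

theorem softO_applyCost (hl : SoftO l fun _ => 1) (hm : SoftO m fun n => n) :
    SoftO (fun n => applyCost q n (m n) (l n)) fun n => n ^ 2 := by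
  have hmul : ∀ c, SoftO (fun n => c * l n) fun _ => 1 := fun c => (SoftO.const c).polylog_mul hl
  have h : SoftO (fun n => stepCost q (l n) + 2 * l n + 5) fun _ => 1 :=
    ((((SoftO.const (fopCost q + 4 * q)).add (hmul 20)).add (SoftO.const 60)).add (hmul 2)).add (SoftO.const 5)
  have h1 : SoftO (fun n => 2 * n + m n + 1) fun n => n :=
    (((SoftO.const 2).polylog_mul (SoftO.refl fun n => n)).add hm).add (SoftO.const 1).lin
  exact (((((h1.mul_polylog h).add (hmul 4).lin).add (SoftO.const 15).lin).id_mul).add hl.square).add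
    (SoftO.const 10).square

theorem softO_freivCost (hl : SoftO l fun _ => 1) : SoftO (fun n => freivCost q n (l n)) fun n => n ^ 2 := by
  have hmul : ∀ c, SoftO (fun n => c * l n) fun _ => 1 := fun c => (SoftO.const c).polylog_mul hl
  have h1 : SoftO (fun n => randCost q n (l n)) fun n => n :=
    (((SoftO.refl fun n => n).mul_polylog (((SoftO.const (2 * q)).add (hmul 3)).add (SoftO.const 11))).add
      hl.lin).add (SoftO.const 5).lin
  have h2 : SoftO (fun n => eqCost q n (l n)) fun n => n :=
    ((SoftO.refl fun n => n).mul_polylog (((SoftO.const (12 * q)).add (hmul 6)).add (SoftO.const 35))).add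
      (SoftO.const 10).lin
  exact (((h1.lin_sq.add ((SoftO.const 2).polylog_mul (softO_matmulCost q hl))).add h2.lin_sq).add hl.square).add
    (SoftO.const 10).square

theorem softO_verifyCost (hl : SoftO l fun _ => 1) (hm : SoftO m fun n => n) (hL : SoftO L fun _ => 1) :
    SoftO (fun n => verifyCost q n (m n) (l n) (L n)) fun n => n ^ 2 := by
  have hmul : ∀ c, SoftO (fun n => c * l n) fun n => n ^ 2 := fun c => ((SoftO.const c).polylog_mul hl).square
  exact (((softO_applyCost q hl hm).add (((hL.polylog_mul (((softO_freivCost q hl).add (hmul 2)).add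
    (SoftO.const 5).square)).add (hmul 2)).add (SoftO.const 10).square)).add (softO_copyEncCost q hl)).add
    (SoftO.const 10).square

/-- There are logarithmically many attempts, and each costs `Õ(n²)` plus a polylogarithmic multiple
of the time of the inverter; `hT` absorbs the former into the latter. -/
theorem softO_solverCost {T : ℕ → ℕ} (NS N' K : ℕ) (hl : SoftO l fun _ => 1) (hm : SoftO m fun n => n)
    (hτ : SoftO τ T) (hτS : SoftO τS fun n => n ^ 2) (hT : SoftO (fun n => n ^ 2) T) :
    SoftO (fun n => solverCost NS N' d K q n (m n) (l n) (τ n) (τS n)) T := by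
  have hmul : ∀ c, SoftO (fun n => c * l n) fun _ => 1 := fun c => (SoftO.const c).polylog_mul hl
  have hL : SoftO (fun n => K * Nat.size n) fun _ => 1 := (SoftO.const K).polylog_mul SoftO.size_id
  have hpl : ∀ {p : ℕ → ℕ}, SoftO p (fun _ => 1) → SoftO p T := fun hp => hp.square.trans hT
  have hcall : SoftO (fun n => callCost q N' d n (l n) (τ n)) T :=
    ((((((hpl (SoftO.const (2 * N'))).add ((softO_copyEncCost q hl).trans hT)).add
      ((SoftO.const d).polylog_mul ((softO_mulDimCost hl).lin_sq.trans hT))).add hτ).add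
      (softO_copySqCost q hl hτ hT)).add hτ).add (hpl (hmul 3)) |>.add (hpl (SoftO.const 20))
  have hatt : SoftO (fun n => attemptCost NS N' d q n (m n) (l n) (K * Nat.size n) (τ n) (τS n)) T :=
    (((((hpl (SoftO.const (2 * NS + 1))).add (hpl (hl.add (SoftO.const 3)))).add (hτS.trans hT)).add
      ((softO_applyCost q hl hm).trans hT)).add hcall).add ((softO_verifyCost q hl hm hL).trans hT)
  exact ((hpl (hl.polylog_mul_polylog ((hmul 4).add (SoftO.const 3)))).add (hpl (hmul 3))).add
    (hpl (SoftO.const 10)) |>.add ((hL.polylog_mul (((hatt.add (hpl (SoftO.const 2))).add (hpl (hmul 2))).add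
      (hpl (SoftO.const 5)))).add (hpl (SoftO.const 1)))

end costs

/-! ### Averaging over the sampler, and the choice of parameters -/

section field

variable {F : Type*} [Field F] [Fintype F] (code : F ≃ Fin (Fintype.card F)) {n : ℕ}

theorem Ens.E_mul {P : Prog} {Q : State → Prop} {s : State} (h : Ens P Q s) {c : ℝ≥0∞} (hc : c ≠ ⊤)
    (g : State → ℝ≥0∞) : E P (fun s => g s * c) s = E P g s * c := by
  by_cases h0 : c = 0
  · subst h0; simp only [mul_zero]; exact h.E_const 0
  · simp only [mul_comm _ c]; exact E_mul_le P hc h0 g s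

theorem Ens.E_sum {P : Prog} {Q : State → Prop} {s : State} (h : Ens P Q s) {ι : Type*} (I : Finset ι)
    (g : ι → State → ℝ≥0∞) : E P (fun s => ∑ i ∈ I, g i s) s = ∑ i ∈ I, E P (g i) s := by
  classical
  induction I using Finset.induction_on with
  | empty => simpa using h.E_const 0
  | insert i I hi ih => simp only [Finset.sum_insert hi, E_add, ih]

variable {S M : Prog} {N : ℕ} {T : ℕ → ℕ}

theorem failProb_le_one {T c₀ : ℕ} {B : Matrix (Fin n) (Fin n) F} (hM : NamesBelow N M)
    (hT : HaltsWithin M (input n (encMatrix code B) []) T) : failProb code M N c₀ B ≤ 1 := by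
  rw [← succProb_add_failProb code (c₀ := c₀) hM hT]; exact le_add_self

theorem E_sampleFail_le_one {T m t c₀ : ℕ} {A : Matrix.GeneralLinearGroup (Fin n) F} (hM : NamesBelow N M)
    (hT : ∀ R : Matrix (Fin n) (Fin n) F, HaltsWithin M (input n (encMatrix code R) []) T)
    (hsam : Ens S (fun u => u.time ≤ t ∧ GoodSample code n m u) (input n [] [])) :
    E S (sampleFail code M N c₀ A) (input n [] []) ≤ 1 :=
  hsam.E_le fun _ _ => failProb_le_one code hM (hT _)

/-- The probability that an attempt fails, in terms of the probability that the inverter succeeds. -/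
theorem E_sampleFail_add {T m t c₀ : ℕ} {A : Matrix.GeneralLinearGroup (Fin n) F} (hM : NamesBelow N M)
    (hT : ∀ R : Matrix (Fin n) (Fin n) F, HaltsWithin M (input n (encMatrix code R) []) T)
    (hsam : Ens S (fun u => u.time ≤ t ∧ GoodSample code n m u) (input n [] [])) :
    E S (sampleFail code M N c₀ A) (input n [] []) +
      ENNReal.ofReal (∑ R : Matrix (Fin n) (Fin n) F, prob S (input n [] []) (fun s => s.arr 0 = encMatrix code R) *
        (succProb code M N c₀ (A.1.transpose * R)).toReal) ≤ 1 := by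
  classical
  set p : Matrix (Fin n) (Fin n) F → ℝ≥0∞ := fun R => E S (ind fun s => s.arr 0 = encMatrix code R) (input n [] [])
    with hp
  have hp1 : ∀ R, p R ≤ 1 := fun R => hsam.E_ind_le_one _
  have hadd : ∀ R, succProb code M N c₀ R + failProb code M N c₀ R = 1 := fun R => succProb_add_failProb code hM (hT R)
  have hs1 : ∀ R, succProb code M N c₀ R ≤ 1 := fun R => (hadd R).symm ▸ le_self_add
  have hsum : ∀ g : Matrix (Fin n) (Fin n) F → ℝ≥0∞, (∀ R, g R ≠ ⊤) →
      E S (fun s => ∑ R, ind (fun s => s.arr 0 = encMatrix code R) s * g R) (input n [] []) = ∑ R, p R * g R := by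
    intro g hg
    rw [hsam.E_sum]
    exact Finset.sum_congr rfl fun R _ => hsam.E_mul (hg R) _
  have hind : ∀ (g : Matrix (Fin n) (Fin n) F → ℝ≥0∞) (R : Matrix (Fin n) (Fin n) F) (s : State),
      s.arr 0 = encMatrix code R → ∑ R, ind (fun s => s.arr 0 = encMatrix code R) s * g R = g R := by
    intro g R s hs
    rw [Finset.sum_eq_single R]
    · simp [ind, hs]
    · intro R' _ hR'
      have : ¬ s.arr 0 = encMatrix code R' := fun h => hR' (encMatrix_injective code (h.symm.trans hs))
      simp [ind, this]
    · simp
  have h1 : E S (sampleFail code M N c₀ A) (input n [] []) ≤ ∑ R, p R * failProb code M N c₀ (A.1.transpose * R) := by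
    rw [← hsum _ fun R => ((failProb_le_one code hM (hT _)).trans_lt ENNReal.one_lt_top).ne]
    refine hsam.E_le_E fun s hs => ?_
    obtain ⟨R, -, -, hR, -⟩ := hs.2
    rw [hind _ R s hR, sampleFail, hR, sanMatrix_encMatrix]
  have h2 : ENNReal.ofReal (∑ R : Matrix (Fin n) (Fin n) F, prob S (input n [] []) (fun s => s.arr 0 = encMatrix code R) *
      (succProb code M N c₀ (A.1.transpose * R)).toReal) = ∑ R, p R * succProb code M N c₀ (A.1.transpose * R) := by
    have : ∀ R, prob S (input n [] []) (fun s => s.arr 0 = encMatrix code R) = (p R).toReal := fun R =>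
      prob_eq_E hsam _
    simp only [this, ← ENNReal.toReal_mul]
    rw [← ENNReal.toReal_sum, ENNReal.ofReal_toReal]
    · refine ENNReal.sum_ne_top.2 fun R _ => ENNReal.mul_ne_top ((hp1 R).trans_lt ENNReal.one_lt_top).ne
        ((hs1 _).trans_lt ENNReal.one_lt_top).ne
    · exact fun R _ => ENNReal.mul_ne_top ((hp1 R).trans_lt ENNReal.one_lt_top).ne
        ((hs1 _).trans_lt ENNReal.one_lt_top).ne
  calc _ ≤ ∑ R, p R * failProb code M N c₀ (A.1.transpose * R) + ∑ R, p R * succProb code M N c₀ (A.1.transpose * R) := by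
        rw [h2]; gcongr
    _ = ∑ R, p R * 1 := by
        rw [← Finset.sum_add_distrib]
        refine Finset.sum_congr rfl fun R _ => ?_
        rw [← mul_add, add_comm, hadd]
    _ ≤ 1 := by
        rw [← hsum (fun _ => 1) (by simp)]
        refine hsam.E_le fun s hs => ?_
        obtain ⟨R, -, -, hR, -⟩ := hs.2
        rw [hind _ R s hR]

theorem IsTrapdooredFamily.exists_ens [DecidableEq F] (hS : IsTrapdooredFamily code S) : ∃ t b : ℕ → ℕ,
    SoftO t (fun n => n ^ 2) ∧ SoftO b (fun n => n) ∧
      ∀ n, Ens S (fun u => u.time ≤ t n ∧ GoodSample code n (b n) u) (input n [] []) := by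
  obtain ⟨t, ht, hSt⟩ := hS.samplable
  obtain ⟨b, hb, hSb⟩ := hS.correct
  exact ⟨t, b, ht, hb, fun n => (ens_of_haltsWithin (hSt n)).mono fun s hs => ⟨hs.1, hSb n s hs.2⟩⟩

/-- An inverter that succeeds with noticeable probability has to write down the inverse. -/
theorem eventually_sq_le [DecidableEq F] {ε : ℝ} (hε : 0 < ε)
    (hT : ∀ (n : ℕ) (A : Matrix (Fin n) (Fin n) F), HaltsWithin M (input n (encMatrix code A) []) (T n))
    (hinv : ∀ᶠ n : ℕ in Filter.atTop, ε ≤ (∑ A : Matrix.GeneralLinearGroup (Fin n) F, probInverts code M A) /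
        Fintype.card (Matrix.GeneralLinearGroup (Fin n) F)) :
    ∀ᶠ n in Filter.atTop, n ^ 2 ≤ T n := by
  filter_upwards [hinv] with n h
  by_contra hn
  have h0 : ∀ A : Matrix.GeneralLinearGroup (Fin n) F, probInverts code M A = 0 := by
    intro A
    have hE := ens_of_haltsWithin (hT n A.1)
    rw [probInverts, prob_eq_E hE]
    have : E M (ind fun s => s.arr 1 = encMatrix code A⁻¹.1) (input n (encMatrix code A.1) []) ≤ 0 := by
      -- The output array starts empty, so its length is at most the elapsed time. If `T n < n²`,
      -- then the array cannot hold an `n × n` matrix.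
      refine hE.weight.E_le fun s hs => ?_
      have h1 := hs.2 1
      have h2 := hs.1.1
      have h3 := length_le_weight (s.arr 1)
      have h4 : (input n (encMatrix code A.1) []).time = 0 := rfl
      have h5 : weight ((input n (encMatrix code A.1) []).arr 1) = 0 := rfl
      have : ¬ s.arr 1 = encMatrix code A⁻¹.1 := by
        intro h
        rw [h, length_encMatrix] at h3
        rw [sq] at hn
        rw [h] at h1
        omega
      rw [ind, if_neg this]
    rw [le_antisymm this zero_le, ENNReal.toReal_zero]
  simp [h0] at h
  linarith

/-- Take `K ≥ c + 2` with `δ ^ K ≤ 2⁻¹ ^ (c + 1)`, and put `y = 2⁻¹ ^ Nat.size n ≤ 1 / n`. The first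
term is at most `y ^ (c + 1)`. The second is at most `K * y ^ (c + 1)`, where one factor `y` has
cancelled `Nat.size n`. The remaining factor `K + 1` is absorbed by one more `y` as soon as `n ≥ K +
1`. -/
theorem amplification {δ : ℝ≥0∞} (hδ : δ < 1) (c : ℕ) : ∃ K : ℕ, ∀ᶠ n : ℕ in Filter.atTop,
    δ ^ (K * Nat.size n) + (K * Nat.size n : ℕ) * (2⁻¹ : ℝ≥0∞) ^ (K * Nat.size n) ≤ ((n : ℝ≥0∞)⁻¹) ^ c := by
  have h1 := (ENNReal.tendsto_pow_atTop_nhds_zero_of_lt_one hδ).eventually_le_const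
    (show 0 < (2⁻¹ : ℝ≥0∞) ^ (c + 1) from ENNReal.pow_pos (by simp) _)
  obtain ⟨K, hK, hKc⟩ := (h1.and (Filter.eventually_ge_atTop (c + 2))).exists
  refine ⟨K, ?_⟩
  filter_upwards [Filter.eventually_ge_atTop (K + 1)] with n hn
  set y : ℝ≥0∞ := 2⁻¹ ^ Nat.size n with hy
  have hyn : y ≤ (n : ℝ≥0∞)⁻¹ := by
    rw [hy, ← ENNReal.inv_pow]
    refine ENNReal.inv_le_inv.2 ?_
    exact_mod_cast (Nat.lt_size_self n).le
  have hy1 : y ≤ 1 := pow_le_one₀ (by simp) (by simp)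
  have e1 : δ ^ (K * Nat.size n) ≤ y ^ (c + 1) := by
    rw [pow_mul, hy, pow_right_comm (2⁻¹ : ℝ≥0∞)]
    exact pow_le_pow_left₀ zero_le hK _
  have hsy : (Nat.size n : ℝ≥0∞) * y ≤ 1 := by
    rw [hy, ← ENNReal.inv_pow, ← div_eq_mul_inv]
    refine ENNReal.div_le_of_le_mul ?_
    rw [one_mul]
    exact_mod_cast (Nat.lt_two_pow_self).le
  have e2 : ((K * Nat.size n : ℕ) : ℝ≥0∞) * (2⁻¹ : ℝ≥0∞) ^ (K * Nat.size n) ≤ K * y ^ (c + 1) := by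
    calc ((K * Nat.size n : ℕ) : ℝ≥0∞) * (2⁻¹ : ℝ≥0∞) ^ (K * Nat.size n) = K * Nat.size n * y ^ K := by
          rw [hy, ← pow_mul, mul_comm (Nat.size n)]; push_cast; ring
      _ ≤ K * Nat.size n * y ^ (c + 2) := by gcongr K * Nat.size n * ?_; exact pow_le_pow_of_le_one zero_le hy1 hKc
      _ = K * (Nat.size n * y) * y ^ (c + 1) := by ring
      _ ≤ K * 1 * y ^ (c + 1) := by gcongr
      _ = _ := by ring
  have hn0 : (n : ℝ≥0∞) ≠ 0 := by simp; omega
  calc _ ≤ y ^ (c + 1) + K * y ^ (c + 1) := add_le_add e1 e2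
    _ = (K + 1) * y * y ^ c := by ring
    _ ≤ n * (n : ℝ≥0∞)⁻¹ * (n : ℝ≥0∞)⁻¹ ^ c := by
        gcongr
        exact_mod_cast hn
    _ = _ := by rw [ENNReal.mul_inv_cancel hn0 (by simp), one_mul]

end field

section field

variable {F : Type*} [Field F] [Fintype F] (code : F ≃ Fin (Fintype.card F)) {n : ℕ}
  {S M : Prog} {NS N N' d K W l m τ τS : ℕ}

/-- The properties of `solver` for one matrix. -/
theorem solver_spec [DecidableEq F] {T : ℕ} {δ : ℝ≥0∞} {A : Matrix.GeneralLinearGroup (Fin n) F}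
    (hS : NamesBelow NS S) (hS0 : 2 < NS) (hM : NamesBelow N M)
    (hM' : NamesBelow N' (M.clk N)) (hN0 : 1 ≤ N) (hN : N < N')
    (hW : Nat.size W ≤ l) (hLW : K * Nat.size n ≤ W) (hKW : K ≤ W)
    (hmW : 2 * (n * n) + 2 * n + 3 * m + Fintype.card F + 10 ≤ W)
    (hdW : (n + 2) ^ d + (n + 2) ^ d + n + 2 ≤ W) (hfb : fbCost (Fintype.card F) n ≤ (n + 2) ^ d)
    (hT : ∀ R : Matrix (Fin n) (Fin n) F, HaltsWithin M (input n (encMatrix code R) []) T)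
    (hsam : Ens S (fun u => u.time ≤ τS ∧ GoodSample code n m u) (input n [] [])) :
    HaltsWithin (solver code S M NS N N' d K) (input n (encMatrix code A.1) [])
        (solverCost NS N' d K (Fintype.card F) n m l ((2 * Nat.size ((n + 2) ^ d) + 11) * T) τS) ∧
      (E S (sampleFail code M N ((n + 2) ^ d) A) (input n [] []) ≤ δ → δ ≤ 1 →
        1 - (δ ^ (K * Nat.size n) + (K * Nat.size n : ℕ) * (2⁻¹ : ℝ≥0∞) ^ (K * Nat.size n)).toReal ≤
          probInverts code (solver code S M NS N N' d K) A) := by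
  set ρ := E S (sampleFail code M N ((n + 2) ^ d) A) (input n [] []) with hρ
  have hρ1 : ρ ≤ 1 := E_sampleFail_le_one code hM hT hsam
  have hρt : ρ ≠ ⊤ := (hρ1.trans_lt ENNReal.one_lt_top).ne
  have hη : (2⁻¹ ^ (K * Nat.size n) : ℝ≥0∞) ≠ ⊤ := ENNReal.pow_ne_top (by simp)
  -- If the clock has run out, then the cost of powering is at most `(n + 2) ^ d ≤ T` by `hfb` and
  -- `ens_clk`, so it fits into the same multiple of `T`.
  have hclk : ∀ R : Matrix (Fin n) (Fin n) F, Ens (M.clk N) (fun u => u.time ≤ (2 * Nat.size ((n + 2) ^ d) + 11) * T ∧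
      u.var N ≤ (n + 2) ^ d ∧ (u.var N = 0 → fbCost (Fintype.card F) n ≤ (2 * Nat.size ((n + 2) ^ d) + 11) * T))
      (clkInput N n (encMatrix code R) ((n + 2) ^ d)) := fun R =>
    (ens_clk hM (hT R)).mono fun u hu => ⟨hu.1.trans (Nat.mul_le_mul_right _ (by omega)), hu.2.1, fun h0 =>
      (hfb.trans (hu.2.2 h0)).trans (Nat.le_mul_of_pos_left _ (by omega))⟩
  have h := ex_solver code (A := A) hS hS0 hM' hN0 hN hW hLW hKW hmW hdW hsam hclk hρt
  set t := solverCost NS N' d K (Fintype.card F) n m l ((2 * Nat.size ((n + 2) ^ d) + 11) * T) τS with ht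
  have hens : Ens (solver code S M NS N N' d K) (fun s => s.time ≤ 0 + t ∧ True) (input n (encMatrix code A.1) []) :=
    h.tr (Q := fun _ _ => True) (failBound_ne_top hη hρt _) (fun _ _ _ => trivial) 0
  refine ⟨haltsWithin_of_ens (hens.mono fun s hs => by have := hs.1; omega), fun hδ hδ1 => ?_⟩
  rw [probInverts, prob_eq_E hens]
  have hadd := hens.E_ind_add fun s => s.arr 1 = encMatrix code A⁻¹.1
  have hle : E (solver code S M NS N N' d K) (ind fun s => ¬ s.arr 1 = encMatrix code A⁻¹.1)
      (input n (encMatrix code A.1) []) ≤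
      δ ^ (K * Nat.size n) + (K * Nat.size n : ℕ) * (2⁻¹ : ℝ≥0∞) ^ (K * Nat.size n) := by
    refine (h 0 _ fun v' a' t' _ => ?_).trans (failBound_le hδ hδ1 _)
    rw [ind]
    simp only
    split_ifs <;> simp
  have h1 := hens.E_ind_le_one fun s => s.arr 1 = encMatrix code A⁻¹.1
  have h2 := hens.E_ind_le_one fun s => ¬ s.arr 1 = encMatrix code A⁻¹.1
  have hr := congrArg ENNReal.toReal hadd
  rw [ENNReal.toReal_add (h1.trans_lt ENNReal.one_lt_top).ne (h2.trans_lt ENNReal.one_lt_top).ne,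
    ENNReal.toReal_one] at hr
  have hle' := ENNReal.toReal_mono (ENNReal.add_ne_top.2 ⟨ENNReal.pow_ne_top
    (hδ1.trans_lt ENNReal.one_lt_top).ne, ENNReal.mul_ne_top (ENNReal.natCast_ne_top _) hη⟩) hle
  linarith

theorem exists_solver [DecidableEq F] {ε : ℝ} (hε : 0 < ε) {S M : Prog} {T : ℕ → ℕ}
    (hS : IsTrapdooredFamily code S)
    (hT : ∀ (n : ℕ) (A : Matrix (Fin n) (Fin n) F), HaltsWithin M (input n (encMatrix code A) []) (T n))
    (hM : ∀ᶠ n : ℕ in Filter.atTop, ε ≤ (∑ A : Matrix.GeneralLinearGroup (Fin n) F, probInverts code M A) /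
        Fintype.card (Matrix.GeneralLinearGroup (Fin n) F)) (c : ℕ) :
    ∃ (P : Prog) (t : ℕ → ℕ), SoftO t T ∧
      (∀ (n : ℕ) (A : Matrix.GeneralLinearGroup (Fin n) F),
        HaltsWithin P (input n (encMatrix code (A : Matrix (Fin n) (Fin n) F)) []) (t n)) ∧
      ∀ᶠ n : ℕ in Filter.atTop, ∀ A : Matrix.GeneralLinearGroup (Fin n) F,
        1 - 1 / (n : ℝ) ^ c ≤ probInverts code P A := by
  obtain ⟨NS₀, hNS₀⟩ := exists_namesBelow S
  obtain ⟨N₀, hN₀⟩ := exists_namesBelow M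
  -- The name of the clock exceeds all names in `M` and also `1`, so the output array `1` is among
  -- those on which the simulation agrees.
  have hNM : NamesBelow (N₀ + 2) M := hN₀.mono (by omega)
  generalize hN : N₀ + 2 = N at hNM
  obtain ⟨N'₀, hN'₀⟩ := exists_namesBelow (M.clk N)
  have hN' : NamesBelow (N'₀ + N + 1) (M.clk N) := hN'₀.mono (by omega)
  generalize hNN : N'₀ + N + 1 = N' at hN'
  have hNS : NamesBelow (NS₀ + 3) S := hNS₀.mono (by omega)
  generalize hNSS : NS₀ + 3 = NS at hNS
  -- The clock exponent depends only on the field: the clock starts no lower than the cost of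
  -- inversion by powering.
  obtain ⟨d, hd⟩ := polyB_fbCost (Fintype.card F)
  obtain ⟨tS, b, htS, hb, hsam⟩ := hS.exists_ens
  -- This will bound the failure probability of one attempt for every `A`, by `eventually_succProb`.
  set δ : ℝ≥0∞ := 1 - ENNReal.ofReal (ε / 8) with hδ
  have hδ1 : δ < 1 := ENNReal.sub_lt_self ENNReal.one_ne_top one_ne_zero (by simp; linarith)
  obtain ⟨K, hK⟩ := amplification hδ1 c
  -- This is the sum of all lower bounds that the components demand of `W`; it is eventually
  -- polynomial because the circuit size `b` is `Õ(n)`.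
  obtain ⟨W, hW⟩ : ∃ W : ℕ → ℕ, W = fun n => (2 * (n * n) + 2 * n + 3 * b n + Fintype.card F + 10) +
    ((n + 2) ^ d + (n + 2) ^ d + n + 2) + (K * n + K) := ⟨_, rfl⟩
  have hWn : ∀ n, W n = (2 * (n * n) + 2 * n + 3 * b n + Fintype.card F + 10) +
    ((n + 2) ^ d + (n + 2) ^ d + n + 2) + (K * n + K) := fun n => by rw [hW]
  have hspec := fun n (A : Matrix.GeneralLinearGroup (Fin n) F) => solver_spec code (S := S) (M := M) (NS := NS) (N := N) (N' := N')
    (d := d) (K := K) (W := W n) (l := Nat.size (W n)) (m := b n) (τS := tS n) (T := T n) (δ := δ) (A := A)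
    hNS (by omega) hNM hN' (by omega) (by omega) le_rfl
    (by have := Nat.mul_le_mul_left K (size_le_self n); rw [hWn]; omega) (by rw [hWn]; omega) (by rw [hWn]; omega)
    (by rw [hWn]; omega) (hd n) (hT n) (hsam n)
  refine ⟨solver code S M NS N N' d K, fun n => solverCost NS N' d K (Fintype.card F) n (b n) (Nat.size (W n))
    ((2 * Nat.size ((n + 2) ^ d) + 11) * T n) (tS n), ?_, fun n A => (hspec n A).1, ?_⟩
  · obtain ⟨e, he⟩ := hb.exists_le_pow
    obtain ⟨e', he'⟩ : PolyB fun n => (2 * (n * n) + 2 * n + 3 * (n + 2) ^ e + Fintype.card F + 10) +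
        ((n + 2) ^ d + (n + 2) ^ d + n + 2) + (K * n + K) := by
      have h2 : ∀ e, PolyB fun n => (n + 2) ^ e := fun e => ⟨e, fun n => le_rfl⟩
      exact ((((((PolyB.const 2).mul (PolyB.id.mul PolyB.id)).add ((PolyB.const 2).mul PolyB.id)).add
        ((PolyB.const 3).mul (h2 e))).add (PolyB.const _)).add (PolyB.const 10)).add
        ((((h2 d).add (h2 d)).add PolyB.id).add (PolyB.const 2)) |>.add
        (((PolyB.const K).mul PolyB.id).add (PolyB.const K))
    have hl : SoftO (fun n => Nat.size (W n)) fun _ => 1 := by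
      refine SoftO.size_pow (e := e') ?_
      filter_upwards [he] with n hn
      exact le_trans (by rw [hWn]; beta_reduce; omega) (he' n)
    have hτ : SoftO (fun n => (2 * Nat.size ((n + 2) ^ d) + 11) * T n) T :=
      SoftO.polylog_mul (((SoftO.const 2).polylog_mul (SoftO.size_pow (e := d) (Filter.Eventually.of_forall
        fun n => le_rfl))).add (SoftO.const 11)) (SoftO.refl T)
    -- The success assumption enters a second time here: it forces `T` to be at least quadratic.
    have hsq : SoftO (fun n => n ^ 2) T := (SoftO.refl T).mono (eventually_sq_le code hε hT hM)
      (Filter.Eventually.of_forall fun _ => le_rfl)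
    exact softO_solverCost _ _ _ _ _ hl hb hτ htS hsq
  · have hsucc := eventually_succProb code (d := d) hε hS.indistinguishable hNM hN' (by omega) (by omega) hT hM
    filter_upwards [hsucc, hK, Filter.eventually_ge_atTop 1] with n hn hKn hn1 A
    refine le_trans ?_ ((hspec n A).2 ?_ hδ1.le)
    · have h1 : ((n : ℝ≥0∞)⁻¹ ^ c).toReal = 1 / (n : ℝ) ^ c := by simp
      rw [← h1]
      gcongr
      refine ENNReal.pow_ne_top ?_
      simp; omega
    · have h1 := E_sampleFail_add code (A := A) (c₀ := (n + 2) ^ d) hNM (hT n) (hsam n)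
      refine ENNReal.le_sub_of_add_le_right ENNReal.ofReal_ne_top (le_trans ?_ h1)
      gcongr
      exact hn A

end field

end TrapdooredMatrix

theorem mainTheorem6 {F : Type*} [Field F] [Fintype F] [DecidableEq F]
    (code : F ≃ Fin (Fintype.card F))
    (hfam : ∃ S : TrapdooredMatrix.Prog, TrapdooredMatrix.IsTrapdooredFamily code S)
    (ε : ℝ) (hε : 0 < ε)
    (M : TrapdooredMatrix.Prog) (T : ℕ → ℕ)
    (hT : ∀ (n : ℕ) (A : Matrix (Fin n) (Fin n) F),
      TrapdooredMatrix.HaltsWithin M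
        (TrapdooredMatrix.input n (TrapdooredMatrix.encMatrix code A) []) (T n))
    (hM : ∀ᶠ n : ℕ in Filter.atTop,
      ε ≤ (∑ A : Matrix.GeneralLinearGroup (Fin n) F, TrapdooredMatrix.probInverts code M A) /
        Fintype.card (Matrix.GeneralLinearGroup (Fin n) F))
    (c : ℕ) :
    ∃ (P : TrapdooredMatrix.Prog) (t : ℕ → ℕ),
      TrapdooredMatrix.SoftO t T ∧
      (∀ (n : ℕ) (A : Matrix.GeneralLinearGroup (Fin n) F),
        TrapdooredMatrix.HaltsWithin P
          (TrapdooredMatrix.input n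
            (TrapdooredMatrix.encMatrix code (A : Matrix (Fin n) (Fin n) F)) []) (t n)) ∧
      ∀ᶠ n : ℕ in Filter.atTop, ∀ A : Matrix.GeneralLinearGroup (Fin n) F,
        1 - 1 / (n : ℝ) ^ c ≤ TrapdooredMatrix.probInverts code P A := by
  obtain ⟨S, hS⟩ := hfam
  exact TrapdooredMatrix.exists_solver code hε hS hT hM c
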